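/- **Setting.** Let $\mathcal O=\mathbb C[\![t]\!]$ and $\mathcal K=\mathbb C(\!(t)\!)$, let $n\ge 0$, and fix a perfect symmetric pairing $J$ on $\mathcal O^{2n+1}$. Write $\mathfrak{so}_{2n+1}$, $\mathrm{SO}_{2n+1}$ for the Lie algebra and group of $J$, $L\mathfrak{so}_{2n+1}=\mathfrak{so}_{2n+1}(\mathcal K)$, $L^+\mathfrak{so}_{2n+1}=\mathfrak{so}_{2n+1}(\mathcal O)$, $L\mathrm{SO}_{2n+1}=\mathrm{SO}_{2n+1}(\mathcal K)$. Let $L^\heartsuit\mathfrak{so}_{2n+1}\subset L\mathfrak{so}_{2n+1}$ be the set of topologically nilpotent regular semisimple elements (regular semisimple means here that $\det(\lambda-\gamma)$ has no multiple root). For $\gamma\in L^\heartsuit\mathfrak{so}_{2n+1}$ put $\chi_\gamma(\lambda)=\det(\lambda-\gamma)/\lambda\in\mathcal O[\lambda]$. Suppose that $\chi_\gamma=\prod_{i=1}^s f_i$ with monic $f_i\in\mathcal O[\lambda]$ of degree $N_i>0$, $f_i(0)\neq 0$ of $t$-order $m_i$, such that the Newton polygon of $f_i$ is a single segment (the coefficient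 of $\lambda^{N_i-j}$ has order $\ge jm_i/N_i$ for $0\le j\le N_i$), and $N_1/m_1>N_2/m_2>\cdots$. Write $N_i=m_ik_i+l_i$ with $0\le l_i<m_i$, let $\mathbf d_i=[(k_i+1)^{l_i},k_i^{m_i-l_i}]$ ($a^b$ means $b$ copies of $a$), and let $\mathbf d_A$ be the multiset union of all $\mathbf d_i$ and $[1]$. For a partition $\mathbf d$, a part $k$ of multiplicity $j$, and a monic polynomial $f=\sum_i a_i\lambda^{\deg f-i}$ over $\mathcal O$, let $p$ and $s$ be the number and the sum of the parts of $\mathbf d$ larger than $k$ and put $$\operatorname{gr}_{\mathbf d,k}(f)=\sum_{\alpha=0}^{j}(a_{s+\alpha k})_{p+\alpha}X^{j-\alpha}\in\mathbb C[X],$$ where $(a)_i$ is the coefficient of $t^i$ in $a$. **The partition $\mathbf d_B$.** The type D rules modify a list $(\mathbf d_1,\mathbf d_2,\dots)$ with $\sum m_i$ even, from the left, as follows. * (D1) If $m_1$ is even, $\mathbf d_1$ is kept, unless $l_1=0$, $k_1$ is even and $\operatorname{gr}_{\mathbf d_A,k_1}(\chi_\gamma)$ is not a square in $\mathbb C[X]$;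 in that case it is replaced by $[k_1+1,k_1^{m_1-2},k_1-1]$. Continue with $(\mathbf d_2,\mathbf d_3,\dots)$. * (D2) If $m_1$ is odd, let $r\ge2$ be minimal with $m_r$ odd. Replace $\mathbf d_1$ by $[(k_1+1)^{l_1+1},k_1^{m_1-l_1-1}]$, keep $\mathbf d_2,\dots,\mathbf d_{r-1}$, and replace $\mathbf d_r$ by $[(k_r+1)^{l_r-1},k_r^{m_r-l_r+1}]$ if $l_r\ne0$ and by $[k_r^{m_r-1},k_r-1]$ if $l_r=0$. Continue with $(\mathbf d_{r+1},\dots)$. Let $m=\sum_i m_i$ be the order of $\chi_\gamma(0)$. * (B1) If $m$ is even, $\mathbf d_B$ is the union of $[1]$ and of the result of the type D rules applied to $(\mathbf d_1,\mathbf d_2,\dots)$. * (B2) If $m$ is odd, let $r\ge 1$ be the largest index with $m_r$ odd. Then $\mathbf d_B$ is the union of the result of the type D rules applied to $(\mathbf d_1,\dots,\mathbf d_{r-1})$ (with the same $\mathbf d_A$ and $\chi_\gamma$), of $[(k_r+1)^{l_r+1},k_r^{m_r-l_r-1}]$, and of $\mathbf d_{r+1},\mathbf d_{r+2},\dots$.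 Zero parts are discarded. **Proposition.** $\gamma$ admits a reduction with partition $\mathbf d_B$: there is $g\in L\mathrm{SO}_{2n+1}$ with $g^{-1}\gamma g\in L^+\mathfrak{so}_{2n+1}$ such that $g^{-1}\gamma g \bmod t$ is nilpotent with Jordan blocks of sizes $\mathbf d_B$. The same holds if in (D1) the polynomial $\operatorname{gr}_{\mathbf d_A,k_i}(\chi_\gamma)$ is replaced by $\operatorname{gr}_{\mathbf d_i,k_i}(f_i)$. -/

import Mathlib

open Polynomial

noncomputable section

namespace SOOdd

/-- The ring of integers `𝒪 = ℂ⟦t⟧`. -/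
abbrev O : Type := PowerSeries ℂ

/-- The field of Laurent series `𝒦 = ℂ((t))`. -/
abbrev K : Type := LaurentSeries ℂ

/-- Extension of scalars of a matrix from `𝒪` to `𝒦`. -/
def toK {N : ℕ} (A : Matrix (Fin N) (Fin N) O) : Matrix (Fin N) (Fin N) K :=
  A.map (algebraMap O K)

/-- Reduction modulo `t` of a matrix over `𝒪`. -/
def modT {N : ℕ} (A : Matrix (Fin N) (Fin N) O) : Matrix (Fin N) (Fin N) ℂ :=
  A.map (PowerSeries.constantCoeff (R := ℂ))

/-- `J` is the Gram matrix of a non-degenerate (perfect) symmetric pairing on `𝒪^N`. -/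
def IsPerfectSymm {N : ℕ} (J : Matrix (Fin N) (Fin N) O) : Prop :=
  J.IsSymm ∧ IsUnit J.det

/-- `γ` is topologically nilpotent: `γ ^ k → 0` in the `t`-adic topology. -/
def IsTopNilpotent {N : ℕ} (γ : Matrix (Fin N) (Fin N) K) : Prop :=
  ∀ e : ℕ, ∃ k₀ : ℕ, ∀ k ≥ k₀, ∃ A : Matrix (Fin N) (Fin N) O,
    γ ^ k = toK ((PowerSeries.X ^ e : O) • A)

/-- The set `L^♥ 𝔰𝔬_N` of topologically nilpotent regular semisimple elements of the loop
algebra of the odd orthogonal Lie algebra of the pairing `J`.  For `N = 2n+1` the eigenvalues are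
`0, ±x₁, …, ±xₙ` and the roots are `±xᵢ`, `±xᵢ ± xⱼ`, so that regular semisimple (no root vanishes
on `γ`) means that the characteristic polynomial has no multiple root. -/
def LHeart {n : ℕ} (J : Matrix (Fin (2 * n + 1)) (Fin (2 * n + 1)) O) :
    Set (Matrix (Fin (2 * n + 1)) (Fin (2 * n + 1)) K) :=
  {γ | γ ∈ skewAdjointMatricesLieSubalgebra (toK J) ∧ IsTopNilpotent γ ∧ γ.charpoly.Separable}

/-- `g` lies in `LSO_N = SO(J)(𝒦)`. -/
def InLSO {N : ℕ} (J : Matrix (Fin N) (Fin N) O) (g : Matrix (Fin N) (Fin N) K) : Prop :=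
  g.transpose * toK J * g = toK J ∧ g.det = 1

/-- `A` is nilpotent and the sizes of its Jordan blocks are the members of `d`: there is a basis
made of chains `b (i, s i - 1) ↦ ⋯ ↦ b (i, 1) ↦ b (i, 0) ↦ 0` with lengths `s i`. -/
def HasJordanType {N : ℕ} (A : Matrix (Fin N) (Fin N) ℂ) (d : Multiset ℕ) : Prop :=
  ∃ (r : ℕ) (s : Fin r → ℕ) (b : Module.Basis (Σ i : Fin r, Fin (s i)) ℂ (Fin N → ℂ)),
    (∀ i, 0 < s i) ∧ d = Finset.univ.val.map s ∧
    (∀ (i : Fin r) (h : 0 < s i), A.mulVec (b ⟨i, ⟨0, h⟩⟩) = 0) ∧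
    (∀ (i : Fin r) (j : ℕ) (h : j + 1 < s i),
      A.mulVec (b ⟨i, ⟨j + 1, h⟩⟩) = b ⟨i, ⟨j, Nat.lt_of_succ_lt h⟩⟩)

/-- `γ` admits a reduction with partition `d`: some point `g L⁺SO` of the affine Grassmannian
satisfies `g⁻¹ γ g ∈ L⁺𝔰𝔬`, and `g⁻¹ γ g mod t` has Jordan type `d`. -/
def HasReduction {N : ℕ} (J : Matrix (Fin N) (Fin N) O) (γ : Matrix (Fin N) (Fin N) K)
    (d : Multiset ℕ) : Prop :=
  ∃ g : Matrix (Fin N) (Fin N) K, InLSO J g ∧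
    ∃ A : Matrix (Fin N) (Fin N) O,
      A ∈ skewAdjointMatricesLieSubalgebra J ∧ g⁻¹ * γ * g = toK A ∧ HasJordanType (modT A) d

/-- The order in `t` of the constant term of `f`. -/
def ordConst (f : O[X]) : ℕ := (f.coeff 0).order.toNat

/-- `f` is monic of positive degree `N`, its constant term is non-zero, of order `m`, and its
Newton polygon is a single segment: the order of the coefficient of `λ^(N-i)` is at least
`i * m / N`. -/
def IsSingleSlope (f : O[X]) : Prop :=
  f.Monic ∧ 0 < f.natDegree ∧ f.coeff 0 ≠ 0 ∧
    ∀ i ≤ f.natDegree,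
      ((i * ordConst f : ℕ) : ℕ∞) ≤ (f.natDegree : ℕ∞) * (f.coeff (f.natDegree - i)).order

/-- `f₁, f₂, …` is the factorization of `χ_γ = det(λ - γ) / λ` by the slopes of its Newton polygon,
in the order in which the (absolute) slope `deg fᵢ / ord fᵢ(0)` strictly decreases. -/
def IsSlopeFactorization {N : ℕ} (γ : Matrix (Fin N) (Fin N) K) (f : List O[X]) : Prop :=
  γ.charpoly = X * f.prod.map (algebraMap O K) ∧
  (∀ p ∈ f, IsSingleSlope p) ∧
  f.Pairwise fun p q => q.natDegree * ordConst p < p.natDegree * ordConst q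

/-- The `m`-balanced partition `[(k+1)^l, k^(m-l)]` of `N = m k + l`. -/
def balanced (N m : ℕ) : Multiset ℕ :=
  Multiset.replicate (N % m) (N / m + 1) + Multiset.replicate (m - N % m) (N / m)

/-- The collection of the balanced partitions of all factors, together with the part `1`. -/
def dA (f : List O[X]) : Multiset ℕ :=
  (f.map fun p => balanced p.natDegree (ordConst p)).sum + {1}

/-- The associated graded polynomial `gr_{d,k}(χ)`.  If `k` has multiplicity `j` in `d`, and `p` is
the number and `s` the sum of the parts larger than `k`, then it is
`∑_{α=0}^{j} (a_{s + α k})_{p + α} X^(j-α)`, where `a_i` is the coefficient of `λ^(deg χ - i)` in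
`χ` and `(a)_i` the coefficient of `t^i` in `a`. -/
def gr (d : Multiset ℕ) (k : ℕ) (χ : O[X]) : ℂ[X] :=
  ∑ α ∈ Finset.range (d.count k + 1),
    C (PowerSeries.coeff ((d.filter (k < ·)).card + α)
        (χ.coeff (χ.natDegree - ((d.filter (k < ·)).sum + α * k)))) * X ^ (d.count k - α)

/-- The test in the rule for even `m`, with the graded polynomial of the whole collection `d_A`: is
`gr_{d_A,k}(χ)` a square, where `χ` is the product of all factors and `k = deg p / ord p(0)`? -/
def squareWhole (f : List O[X]) (p : O[X]) : Prop :=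
  IsSquare (gr (dA f) (p.natDegree / ordConst p) f.prod)

/-- The same test with the graded polynomial of the factor `p` itself. -/
def squareOwn (p : O[X]) : Prop :=
  IsSquare (gr (balanced p.natDegree (ordConst p)) (p.natDegree / ordConst p) p)

open Classical in
/-- The partition that replaces `d_i = balanced N m` when `m` is even and no block is waiting for a
partner.  It is `d_i`, except that `[k^m]` with `k` even becomes `[k+1, k^(m-2), k-1]` if the graded
polynomial is not a square (`sq` says that it is one). -/
def evenBlock (sq : Prop) (N m : ℕ) : Multiset ℕ :=
  if N % m = 0 ∧ Even (N / m) ∧ ¬ sq then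
    {N / m + 1} + Multiset.replicate (m - 2) (N / m) + {N / m - 1}
  else balanced N m

/-- The first block of an odd pair: `[(k+1)^(l+1), k^(m-l-1)]`. -/
def raised (N m : ℕ) : Multiset ℕ :=
  Multiset.replicate (N % m + 1) (N / m + 1) + Multiset.replicate (m - N % m - 1) (N / m)

/-- The second block of an odd pair: `[(k+1)^(l-1), k^(m-l+1)]`, or `[k^(m-1), k-1]` if `l = 0`. -/
def lowered (N m : ℕ) : Multiset ℕ :=
  if N % m = 0 then Multiset.replicate (m - 1) (N / m) + {N / m - 1}
  else Multiset.replicate (N % m - 1) (N / m + 1) + Multiset.replicate (m - N % m + 1) (N / m)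

/-- The modification rules, run through the list of factors; `N_i = deg f_i`, `m_i = ord f_i(0)`.
The Boolean argument says whether an earlier block with odd `m` is waiting for its partner.
* Not waiting: a block with even `m` becomes `evenBlock`; a block with odd `m` is raised, and waits.
* Waiting: blocks with even `m` are unchanged, and the next block with odd `m` is the partner and
  is lowered. -/
def modify (sq : O[X] → Prop) : Bool → List O[X] → Multiset ℕ
  | _, [] => 0
  | false, p :: L =>
      if Even (ordConst p) then evenBlock (sq p) p.natDegree (ordConst p) + modify sq false L
      else raised p.natDegree (ordConst p) + modify sq true L
  | true, p :: L =>
      if Even (ordConst p) then balanced p.natDegree (ordConst p) + modify sq true L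
      else lowered p.natDegree (ordConst p) + modify sq false L

/-- The partition `d_B`.  If the order `m` of the constant term of `χ` is even, then the blocks with
odd `m_i` pair off, and the part `1` is added to the partition obtained by the type D rules.  If `m`
is odd, then the last block `r` with odd `m_r` is raised, the blocks after it are unchanged, those
before it follow the type D rules, and the part `1` is dropped: this is what `modify` returns when
the last odd block finds no partner.  Zero parts are discarded. -/
def dB (sq : O[X] → Prop) (f : List O[X]) : Multiset ℕ :=
  (if Even (ordConst f.prod) then modify sq false f + {1} else modify sq false f).filter (0 < ·)

end SOOdd

end

set_option linter.unusedSectionVars false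

open Polynomial

noncomputable section

/-! A coset `g L⁺SO` is a self-dual lattice `Λ` in `V = K^(2n+1)`. The Jordan type of `γ` on `Λ /
tΛ` is determined by the ranks of the powers of `γ`, that is, by the lengths of `(γ^j Λ + tΛ) / tΛ`.
For the type `d` these must equal `partSum d j`. So a `γ`-stable self-dual lattice with prescribed
lengths is wanted (`IsClosedLat`). `exists_reduction` turns it into a group element: a symmetric
unimodular matrix over `𝒪` has the form `wᵀ w`, so `Λ` has a basis with Gram matrix `J`, and a sign
corrects the determinant because the dimension is odd. `hasJordanType_of_finrank` recovers the
partition.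

Since the characteristic polynomial is separable, `γ` has a cyclic vector, and since factors of
different slopes are coprime, `V` is the orthogonal sum of the kernels of the `f_i(γ)` and of the
line `ker γ`. On a block of dimension `N`, with constant term of order `m`, give `γ` the weight `m`
and `t` the weight `N`. The Newton polygon provides lattices stable under all monomials `t^b γ^a` of
non-negative weight (`exists_adapted_lattice`), and the index of a monomial on such a lattice is its
weight. If `M` is maximal among the integral ones, monomials of positive weight map `M^∨` into `M`
(`shift_dualIn_le`).

If `N / m` is not an integer, `t` and `γ^j` never have equal weight, and the ranks on a lattice
between `M` and `M^∨` depend only on lengths. A maximal integral lattice `P` has `P^∨ / P` of length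
at most one, with the parity of `m`, because `B(γ x, y)` is alternating. If `N = m k`, the operator
`ζ = γ^k / t` has weight zero. For `k` odd it is skew and `M` is already self-dual
(`IsBlock.of_odd`). For `k` even it is self-adjoint. A generator `v` can then be normalized so that
`B(ζ^i v, ζ^j v)`, which depends only on `i + j`, is integral for `p < i + j < p + m` and not for `i
+ j = p + m` (`IsBlock.exists_isModel`). Lattices spanned by consecutive `ζ^i v` over the vectors of
positive weight give the raised, lowered and exceptional partitions. If the graded polynomial is
`s²`, then `s(ζ)` gives a `ζ`-stable self-dual lattice and the balanced partition. The normalization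
rests on the fact that units are squares in a finite extension of `K`'s valuation ring, so that norm
forms `x² - μ y²` are universal and every even polynomial is congruent to some `u(X) u(-X)`.

A block with `m` odd has no stable self-dual lattice, only an open one, of index one in its dual.
Two of them, or one and the line `ker γ`, are glued along `e + c y` with `c` chosen to make the norm
integral (`IsOpenLat.glue`). The ranks add up (`relLen_glue_aux`) because the slopes decrease.
Blocks with even `m` lying in between are either summed orthogonally or pass the defect on. Whether
`ker γ` is glued or summed is decided by the parity of the length of `A^∨ / A`, which is even for
every integral lattice since the standard lattice is self-dual.

The two versions of the test are related by `gr_{d_A,k}(χ) = c X^e gr_{d_i,k}(f_i)`. Only the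
implication from the test to `squareOwn` matters, since the exceptional lattice exists whether or
not the polynomial is a square. -/

namespace SOOdd

/-! ### Relative lengths of submodules. -/

section RelLen

variable {R V W : Type*} [CommRing R] [AddCommGroup V] [Module R V] [AddCommGroup W] [Module R W]

/-- The length of `B / A`, for submodules `A ≤ B`. -/
def relLen (A B : Submodule R V) : ℕ∞ := Module.length R (B ⧸ A.submoduleOf B)

/-- The submodules of `B / A` are the submodules between `A` and `B`. -/
def quotientIccIso {A B : Submodule R V} (h : A ≤ B) :
    Submodule R (B ⧸ A.submoduleOf B) ≃o Set.Icc A B where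
  toFun N := ⟨(N.comap (A.submoduleOf B).mkQ).map B.subtype, by
    constructor
    · intro x hx
      refine ⟨⟨x, h hx⟩, ?_, rfl⟩
      have : (A.submoduleOf B).mkQ ⟨x, h hx⟩ = 0 := by
        rw [Submodule.mkQ_apply, Submodule.Quotient.mk_eq_zero, Submodule.submoduleOf,
        Submodule.mem_comap]; exact hx
      simp [this]
    · rintro _ ⟨x, -, rfl⟩; exact x.2⟩
  invFun C := (C.1.comap B.subtype).map (A.submoduleOf B).mkQ
  left_inv N := by
    simp only
    rw [Submodule.comap_map_eq_of_injective B.injective_subtype,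
      Submodule.map_comap_eq_of_surjective (Submodule.mkQ_surjective _)]
  right_inv C := by
    obtain ⟨C, hA, hB⟩ := C
    ext1
    simp only
    rw [Submodule.comap_map_mkQ, sup_eq_right.2, Submodule.map_comap_subtype]
    · exact inf_eq_right.2 hB
    · intro x hx; exact hA hx
  map_rel_iff' {N N'} := by
    change Submodule.map _ _ ≤ Submodule.map _ _ ↔ _
    rw [Submodule.map_le_map_iff_of_injective B.injective_subtype]
    constructor
    · intro H
      have := Submodule.map_mono (f := (A.submoduleOf B).mkQ) H
      rwa [Submodule.map_comap_eq_of_surjective (Submodule.mkQ_surjective _),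
        Submodule.map_comap_eq_of_surjective (Submodule.mkQ_surjective _)] at this
    · exact fun H => Submodule.comap_mono H

/-- Length is the Krull dimension of the lattice of submodules, so it depends only on the ordered
set of intermediate modules. This is what lets an order-reversing bijection such as duality preserve
it. -/
theorem coe_relLen {A B : Submodule R V} (h : A ≤ B) :
    (relLen A B : WithBot ℕ∞) = Order.krullDim (Set.Icc A B) := by
  rw [relLen, Module.coe_length]
  exact Order.krullDim_eq_of_orderIso (quotientIccIso h)

theorem relLen_add {A B C : Submodule R V} (h : A ≤ B) (h' : B ≤ C) :
    relLen A C = relLen A B + relLen B C := by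
  have hf : A.submoduleOf B ≤ (A.submoduleOf C).comap (Submodule.inclusion h') :=
    fun x hx => hx
  have hg : A.submoduleOf C ≤ (B.submoduleOf C).comap LinearMap.id := fun x hx => h hx
  refine Module.length_eq_add_of_exact
    (Submodule.mapQ _ _ (Submodule.inclusion h') hf)
    (Submodule.mapQ _ _ LinearMap.id hg) ?_ ?_ ?_
  · rw [← LinearMap.ker_eq_bot, LinearMap.ker_eq_bot']
    intro m hm
    induction m using Submodule.Quotient.induction_on with
    | _ x =>
      rw [Submodule.mapQ_apply, Submodule.Quotient.mk_eq_zero] at hm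
      rw [Submodule.Quotient.mk_eq_zero]; exact hm
  · intro m
    induction m using Submodule.Quotient.induction_on with
    | _ x => exact ⟨Submodule.Quotient.mk x, by simp⟩
  · intro m
    induction m using Submodule.Quotient.induction_on with
    | _ x =>
      rw [Submodule.mapQ_apply]
      constructor
      · intro hx
        rw [Submodule.Quotient.mk_eq_zero] at hx
        exact ⟨Submodule.Quotient.mk ⟨x.1, hx⟩, by simp [Submodule.mapQ_apply]; rfl⟩
      · rintro ⟨y, hy⟩
        induction y using Submodule.Quotient.induction_on with
        | _ y =>
          rw [Submodule.mapQ_apply, Submodule.Quotient.eq] at hy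
          have h1 : (y : V) - x ∈ A := hy
          have := B.sub_mem y.2 (h h1)
          rw [sub_sub_cancel] at this
          exact (Submodule.Quotient.mk_eq_zero _).2 this

theorem relLen_self (A : Submodule R V) : relLen A A = 0 := by
  rw [relLen, Module.length_eq_zero_iff, Submodule.Quotient.subsingleton_iff,
    Submodule.submoduleOf_self]

theorem relLen_eq_zero_iff {A B : Submodule R V} : relLen A B = 0 ↔ B ≤ A := by
  rw [relLen, Module.length_eq_zero_iff, Submodule.Quotient.subsingleton_iff,
    Submodule.submoduleOf, Submodule.comap_subtype_eq_top]

theorem relLen_anti {A B C : Submodule R V} (h : A ≤ B) (h' : B ≤ C) :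
    relLen B C ≤ relLen A C := by
  rw [relLen_add h h']; exact le_add_self

/-- Injectivity on `B` suffices; this generality is needed because `γ` has a kernel on the whole
space and is injective only on the sum of the blocks. -/
theorem relLen_map {A B : Submodule R V} (f : V →ₗ[R] W) (hf : Set.InjOn f B) (h : A ≤ B) :
    relLen (A.map f) (B.map f) = relLen A B := by
  have hi : Function.Injective (f.submoduleMap B) := by
    intro x y hxy
    exact Subtype.ext (hf x.2 y.2 (congrArg Subtype.val hxy))
  let e : B ≃ₗ[R] B.map f := LinearEquiv.ofBijective (f.submoduleMap B)
    ⟨hi, f.submoduleMap_surjective B⟩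
  refine (LinearEquiv.length_eq (Submodule.Quotient.equiv _ _ e ?_)).symm
  ext x
  constructor
  · rintro ⟨y, hy, rfl⟩; exact ⟨y, hy, rfl⟩
  · rintro ⟨y, hy, hxy⟩; exact ⟨⟨y, h hy⟩, hy, Subtype.ext hxy⟩

theorem relLen_sup (A B : Submodule R V) : relLen B (A ⊔ B) = relLen (A ⊓ B) A := by
  refine (LinearEquiv.length_eq ((LinearMap.quotientInfEquivSupQuotient A B))).symm.trans ?_
  have : B.submoduleOf A = (A ⊓ B).submoduleOf A := by
    ext x; simp [Submodule.submoduleOf]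
  rw [relLen]
  exact LinearEquiv.length_eq (Submodule.quotEquivOfEq _ _ (by ext; simp [Submodule.submoduleOf]))

theorem relLen_sup_of_inf {A B C : Submodule R V} (h : A ⊓ B = C) :
    relLen B (A ⊔ B) = relLen C A := by rw [relLen_sup, h]

/-- Lengths add up over independent submodules. -/
theorem relLen_sup_sup {A₁ A₂ B₁ B₂ U₁ U₂ : Submodule R V} (hU : Disjoint U₁ U₂)
    (h₁ : A₁ ≤ B₁) (h₂ : A₂ ≤ B₂) (hB₁ : B₁ ≤ U₁) (hB₂ : B₂ ≤ U₂) :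
    relLen (A₁ ⊔ A₂) (B₁ ⊔ B₂) = relLen A₁ B₁ + relLen A₂ B₂ := by
  have key : ∀ {A B C U U' : Submodule R V}, Disjoint U U' → A ≤ B → B ≤ U → C ≤ U' →
      relLen (A ⊔ C) (B ⊔ C) = relLen A B := by
    intro A B C U U' hU hAB hB hC
    have : B ⊔ C = B ⊔ (A ⊔ C) := by rw [← sup_assoc, sup_eq_left.2 hAB]
    rw [this]
    -- The modular law in a direct sum: a vector of `B ∩ (A + C)` has its `C`-component in both `U`
    -- and `U'`, hence zero.
    apply relLen_sup_of_inf
    apply le_antisymm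
    · rintro x ⟨hx, hx'⟩
      obtain ⟨a, ha, c, hc, rfl⟩ := Submodule.mem_sup.1 hx'
      have hcU : c ∈ U := by
        have := U.sub_mem (hB hx) (hB (hAB ha))
        simpa using this
      have := (Submodule.disjoint_def.1 hU) c hcU (hC hc)
      simpa [this] using ha
    · exact le_inf hAB le_sup_left
  rw [relLen_add (sup_le_sup_right h₁ A₂) (sup_le_sup_left h₂ B₁), key hU h₁ hB₁ (h₂.trans hB₂)]
  congr 1
  rw [sup_comm B₁ A₂, sup_comm B₁ B₂]
  exact key hU.symm h₂ hB₂ hB₁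

/-- An order-reversing involution between two intervals preserves lengths. -/
theorem relLen_eq_of_dual {X Y X' Y' : Submodule R V} (h : X ≤ Y) (h' : X' ≤ Y')
    (d : Submodule R V → Submodule R V) (hd : Antitone d)
    (hX : d X = Y') (hY : d Y = X') (hX' : d X' = Y) (hY' : d Y' = X)
    (h1 : ∀ N, X ≤ N → N ≤ Y → d (d N) = N) (h2 : ∀ N, X' ≤ N → N ≤ Y' → d (d N) = N) :
    relLen X' Y' = relLen X Y := by
  let e : Set.Icc X Y ≃o (Set.Icc X' Y')ᵒᵈ :=
    { toFun := fun N => OrderDual.toDual ⟨d N.1, hY ▸ hd N.2.2, hX ▸ hd N.2.1⟩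
      invFun := fun N => ⟨d N.ofDual.1, hY' ▸ hd N.ofDual.2.2, hX' ▸ hd N.ofDual.2.1⟩
      left_inv := fun N => Subtype.ext (h1 _ N.2.1 N.2.2)
      right_inv := fun N => Subtype.ext (h2 _ N.ofDual.2.1 N.ofDual.2.2)
      map_rel_iff' := by
        intro a b
        constructor
        · intro hab
          have : d b.1 ≤ d a.1 := hab
          have := hd this
          rwa [h1 _ a.2.1 a.2.2, h1 _ b.2.1 b.2.2] at this
        · intro hab; exact hd hab }
  have := Order.krullDim_eq_of_orderIso e
  rw [Order.krullDim_orderDual, ← coe_relLen h, ← coe_relLen h'] at this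
  exact_mod_cast this.symm

end RelLen

set_option linter.style.haveILetI false

/-! ### Lattices over `𝒪` in an `F`-space: bases, indices, commensurability. -/

section Lattice


variable {F : Type*} [Field F] [Algebra O F] [IsFractionRing O F]

variable (F) in
/-- The uniformizer `t` of the field of fractions of `𝒪`. -/
def τ : F := algebraMap O F PowerSeries.X

theorem τ_ne_zero : τ F ≠ 0 := by
  rw [τ, Ne, map_eq_zero_iff _ (IsFractionRing.injective O F)]
  exact PowerSeries.X_ne_zero

/-- Over `𝒪 = ℂ⟦t⟧` a scalar is a constant modulo `t`. -/
theorem exists_const (a : O) : ∃ (c : ℂ) (b : O), a = PowerSeries.C c + b * PowerSeries.X := by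
  obtain ⟨b, hb⟩ := (PowerSeries.X_dvd_iff (φ := a - PowerSeries.C a.constantCoeff)).2 (by simp)
  exact ⟨a.constantCoeff, b, by rw [mul_comm b, ← hb]; ring⟩

instance isMaximal_span_X : (Ideal.span {(PowerSeries.X : O)}).IsMaximal := by
  have : Ideal.span {(PowerSeries.X : O)} = RingHom.ker (PowerSeries.constantCoeff (R := ℂ)) := by
    ext x; rw [Ideal.mem_span_singleton, PowerSeries.X_dvd_iff, RingHom.mem_ker]
  rw [this]
  exact RingHom.ker_isMaximal_of_surjective _ PowerSeries.constantCoeff_surj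

theorem length_residue : Module.length O (O ⧸ Ideal.span {(PowerSeries.X : O)}) = 1 := by
  rw [Module.length_eq_one_iff]
  exact isSimpleModule_iff_isCoatom.2 (Ideal.isMaximal_def.1 isMaximal_span_X)

theorem relLen_X_pi (n : ℕ) :
    relLen ((⊤ : Submodule O (Fin n → O)).map (LinearMap.lsmul O (Fin n → O) PowerSeries.X)) ⊤
      = n := by
  let f : (Fin n → O) →ₗ[O] (Fin n → (O ⧸ Ideal.span {(PowerSeries.X : O)})) :=
    LinearMap.pi fun i => (Submodule.mkQ _).comp (LinearMap.proj i)
  have hf : Function.Surjective f := by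
    intro y
    choose z hz using fun i => Submodule.mkQ_surjective _ (y i)
    exact ⟨z, funext hz⟩
  have hk : LinearMap.ker f =
      (⊤ : Submodule O (Fin n → O)).map (LinearMap.lsmul O (Fin n → O) PowerSeries.X) := by
    ext x
    rw [LinearMap.mem_ker]
    constructor
    · intro hx
      have h1 : ∀ i, ∃ a, x i = PowerSeries.X * a := by
        intro i
        have : (Submodule.mkQ (Ideal.span {(PowerSeries.X : O)})) (x i) = 0 := congrFun hx i
        rw [Submodule.mkQ_apply, Submodule.Quotient.mk_eq_zero] at this
        exact Ideal.mem_span_singleton.1 this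
      choose a ha using h1
      exact ⟨a, trivial, funext fun i => (ha i).symm⟩
    · rintro ⟨y, -, rfl⟩
      ext i
      change (Submodule.mkQ (Ideal.span {(PowerSeries.X : O)})) (PowerSeries.X * y i) = 0
      rw [Submodule.mkQ_apply, Submodule.Quotient.mk_eq_zero]
      exact Ideal.mul_mem_right _ _ (Ideal.mem_span_singleton_self _)
  have h1 : Module.length O ((Fin n → O) ⧸ LinearMap.ker f) = n := by
    rw [LinearEquiv.length_eq (f.quotKerEquivOfSurjective hf), Module.length_pi_of_fintype]
    simp [length_residue]
  rw [← hk, ← h1]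
  refine (LinearEquiv.length_eq (Submodule.Quotient.equiv _ _ (Submodule.topEquiv) ?_))
  ext x
  constructor
  · rintro ⟨y, hy, rfl⟩; exact hy
  · intro hx; exact ⟨⟨x, trivial⟩, hx, rfl⟩

/-- Every element of `F` becomes integral after multiplication by a power of `t`. -/
theorem exists_pow_mul_mem (x : F) : ∃ (e : ℕ) (a : O), τ F ^ e * x = algebraMap O F a := by
  obtain ⟨a, b, hb, rfl⟩ := IsFractionRing.div_surjective (A := O) x
  have hb0 : b ≠ 0 := nonZeroDivisors.ne_zero hb
  obtain ⟨e, u, hu⟩ := IsDiscreteValuationRing.eq_unit_mul_pow_irreducible hb0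
    (PowerSeries.X_prime (R := ℂ)).irreducible
  refine ⟨e, a * ↑u⁻¹, ?_⟩
  have h1 : algebraMap O F b ≠ 0 := by
    rwa [Ne, map_eq_zero_iff _ (IsFractionRing.injective O F)]
  rw [mul_div_assoc', div_eq_iff h1, τ, ← map_pow, ← map_mul, ← map_mul]
  congr 1
  rw [hu]
  calc PowerSeries.X ^ e * a = PowerSeries.X ^ e * a * (↑u⁻¹ * ↑u : O) := by simp
    _ = _ := by ring

theorem isTorsionFree_of_tower (F V : Type*) [Field F] [Algebra O F] [IsFractionRing O F]
    [AddCommGroup V] [Module F V] [Module O V] [IsScalarTower O F V] : Module.IsTorsionFree O V := by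
  refine Module.IsTorsionFree.of_smul_eq_zero fun r m h => ?_
  by_cases hr : r = 0
  · exact Or.inl hr
  · right
    rw [← algebraMap_smul F r m] at h
    exact (smul_eq_zero.1 h).resolve_left
      (fun h => hr ((map_eq_zero_iff _ (IsFractionRing.injective O F)).1 h))

variable {V : Type*} [AddCommGroup V] [Module F V] [Module O V] [IsScalarTower O F V]

theorem τ_smul (x : V) : τ F • x = (PowerSeries.X : O) • x := algebraMap_smul F _ x

/-- Multiplication by `t`. -/
def tEnd (F V : Type*) [Field F] [Algebra O F] [AddCommGroup V] [Module F V] : Module.End F V := algebraMap F _ (τ F)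

@[simp] theorem tEnd_apply (x : V) : tEnd F V x = τ F • x := by
  simp [tEnd, Module.algebraMap_end_apply]

theorem commute_tEnd (φ : Module.End F V) : Commute (tEnd F V) φ := Algebra.commutes _ _

theorem tEnd_pow_apply (n : ℕ) (x : V) : (tEnd F V ^ n) x = τ F ^ n • x := by
  rw [tEnd, ← map_pow, Module.algebraMap_end_apply]

theorem tEnd_injective : Function.Injective (tEnd F V) := by
  intro x y h
  simpa [tEnd_apply, τ_ne_zero] using h

/-- The image of an `𝒪`-submodule under a `F`-linear endomorphism. -/
def act (φ : Module.End F V) (A : Submodule O V) : Submodule O V :=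
  A.map (φ.restrictScalars O)

theorem mem_act_of_mem {φ : Module.End F V} {A : Submodule O V} {x : V} (h : x ∈ A) :
    φ x ∈ act φ A := ⟨x, h, rfl⟩

theorem act_le {φ : Module.End F V} {A B : Submodule O V} :
    act φ A ≤ B ↔ ∀ x ∈ A, φ x ∈ B := Submodule.map_le_iff_le_comap

theorem act_mono {φ : Module.End F V} {A B : Submodule O V} (h : A ≤ B) : act φ A ≤ act φ B :=
  Submodule.map_mono h

theorem act_mul (φ ψ : Module.End F V) (A : Submodule O V) :
    act (φ * ψ) A = act φ (act ψ A) := by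
  rw [act, act, act, ← Submodule.map_comp]; rfl

@[simp] theorem act_one (A : Submodule O V) : act (1 : Module.End F V) A = A := Submodule.map_id A

theorem act_sup (φ : Module.End F V) (A B : Submodule O V) :
    act φ (A ⊔ B) = act φ A ⊔ act φ B := Submodule.map_sup _ _ _

theorem act_span_singleton (φ : Module.End F V) (x : V) :
    act φ (Submodule.span O {x}) = Submodule.span O {φ x} := by
  rw [act, Submodule.map_span, Set.image_singleton]; rfl

theorem act_comm {φ ψ : Module.End F V} (h : Commute φ ψ) (A : Submodule O V) :
    act φ (act ψ A) = act ψ (act φ A) := by rw [← act_mul, h.eq, act_mul]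

theorem relLen_act {φ : Module.End F V} {A B : Submodule O V} (hφ : Set.InjOn φ B) (h : A ≤ B) :
    relLen (act φ A) (act φ B) = relLen A B := relLen_map _ hφ h

variable (F) in
/-- `t A`. -/
abbrev tS (A : Submodule O V) : Submodule O V := act (tEnd F V) A

theorem tS_le (A : Submodule O V) : tS F A ≤ A := by
  rw [act_le]; intro x hx; rw [tEnd_apply, τ_smul]; exact A.smul_mem _ hx

theorem tS_pow_le (A : Submodule O V) (e : ℕ) : act (tEnd F V ^ e) A ≤ A := by
  rw [act_le]; intro x hx
  rw [tEnd_pow_apply, τ, ← map_pow, algebraMap_smul]; exact A.smul_mem _ hx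

theorem relLen_tS {A B : Submodule O V} (h : A ≤ B) : relLen (tS F A) (tS F B) = relLen A B :=
  relLen_act tEnd_injective.injOn h

/-- Adding to `A` a vector `v ∉ A` with `t v ∈ A` gives a module of relative length `1`. -/
theorem relLen_sup_span {A : Submodule O V} {v : V} (hv : v ∉ A) (ht : τ F • v ∈ A) :
    relLen A (A ⊔ Submodule.span O {v}) = 1 := by
  rw [sup_comm, relLen_sup, ← length_residue, relLen]
  let f : O →ₗ[O] (Submodule.span O {v} ⧸
      ((Submodule.span O {v} ⊓ A).submoduleOf (Submodule.span O {v}))) :=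
    (Submodule.mkQ _).comp (LinearMap.toSpanSingleton O (Submodule.span O {v})
      ⟨v, Submodule.mem_span_singleton_self v⟩)
  have hf : Function.Surjective f := by
    refine (Submodule.mkQ_surjective _).comp ?_
    rintro ⟨x, hx⟩
    obtain ⟨a, rfl⟩ := Submodule.mem_span_singleton.1 hx
    exact ⟨a, rfl⟩
  have hk : LinearMap.ker f = Ideal.span {(PowerSeries.X : O)} := by
    have h0 : ∀ a : O, a ∈ LinearMap.ker f ↔ a • v ∈ A := by
      intro a
      rw [LinearMap.mem_ker]
      change Submodule.Quotient.mk _ = _ ↔ _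
      rw [Submodule.Quotient.mk_eq_zero]
      change a • v ∈ _ ⊓ A ↔ _
      rw [Submodule.mem_inf]
      exact and_iff_right (Submodule.smul_mem _ _ (Submodule.mem_span_singleton_self v))
    -- The annihilator of the class of `v` is proper and contains the maximal ideal generated by
    -- `t`.
    refine (Ideal.IsMaximal.eq_of_le isMaximal_span_X ?_ ?_).symm
    · rw [Ideal.ne_top_iff_one]
      intro h1
      exact hv (by simpa using (h0 1).1 h1)
    · rw [Ideal.span_le, Set.singleton_subset_iff]
      exact (h0 _).2 (by rwa [← τ_smul (F := F)])
  rw [← hk]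
  exact (LinearEquiv.length_eq (f.quotKerEquivOfSurjective hf)).symm

theorem relLen_sup_span_le {A : Submodule O V} {v : V} (ht : τ F • v ∈ A) :
    relLen A (A ⊔ Submodule.span O {v}) ≤ 1 := by
  by_cases hv : v ∈ A
  · rw [sup_eq_left.2 ((Submodule.span_singleton_le_iff_mem _ _).2 hv), relLen_self]; simp
  · exact (relLen_sup_span hv ht).le

/-- `A` is an `𝒪`-lattice in the subspace `U`. -/
structure IsLat (U : Submodule F V) (A : Submodule O V) : Prop where
  fg : A.FG
  span_eq : Submodule.span F (A : Set V) = U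

theorem IsLat.le {U : Submodule F V} {A : Submodule O V} (h : IsLat U A) :
    A ≤ U.restrictScalars O := fun x hx => by
  have : x ∈ Submodule.span F (A : Set V) := Submodule.subset_span hx
  rwa [h.span_eq] at this

/-- A lattice has an `𝒪`-basis which is a `F`-basis of the ambient space. -/
theorem IsLat.exists_basis {U : Submodule F V} {A : Submodule O V} (h : IsLat U A) :
    ∃ (n : ℕ) (b : Module.Basis (Fin n) F U),
      A = (Submodule.span O (Set.range b)).map (U.subtype.restrictScalars O) := by
  have : Module.Finite O A := Module.Finite.iff_fg.2 h.fg
  have : Module.IsTorsionFree O V := isTorsionFree_of_tower F V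
  -- A finite torsion-free module over a principal ideal domain is free, and independence over `𝒪`
  -- is independence over its fraction field.
  let c := Module.finBasis O A
  have hli : LinearIndependent O (fun i => (c i : V)) :=
    c.linearIndependent.map' A.subtype (Submodule.ker_subtype A)
  have hK : LinearIndependent F (fun i => (c i : V)) :=
    (LinearIndependent.iff_fractionRing O F).1 hli
  have hspanO : Submodule.span O (Set.range fun i => (c i : V)) = A := by
    have := congrArg (Submodule.map A.subtype) c.span_eq
    rw [Submodule.map_span, ← Set.range_comp, Submodule.map_top, Submodule.range_subtype] at this
    exact this
  have hmem : ∀ i, (c i : V) ∈ U := fun i => h.le (c i).2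
  let v : Fin (Module.finrank O A) → U := fun i => ⟨c i, hmem i⟩
  have hvli : LinearIndependent F v := LinearIndependent.of_comp U.subtype hK
  have hvsp : ⊤ ≤ Submodule.span F (Set.range v) := by
    rintro ⟨x, hx⟩ -
    have hx' : x ∈ (Submodule.span F (Set.range v)).map U.subtype := by
      rw [Submodule.map_span, ← Set.range_comp]
      change x ∈ Submodule.span F (Set.range fun i => (c i : V))
      rw [← Submodule.span_span_of_tower O, hspanO, h.span_eq]
      exact hx
    obtain ⟨y, hy, hyx⟩ := hx'
    rwa [show (⟨x, hx⟩ : U) = y from Subtype.ext hyx.symm]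
  refine ⟨_, Module.Basis.mk hvli hvsp, ?_⟩
  rw [Module.Basis.coe_mk, Submodule.map_span, ← Set.range_comp]
  exact hspanO.symm

theorem isLat_of_basis {U : Submodule F V} {ι : Type*} [Finite ι] (b : Module.Basis ι F U) :
    IsLat U ((Submodule.span O (Set.range b)).map (U.subtype.restrictScalars O)) := by
  refine ⟨(Submodule.fg_span (Set.finite_range b)).map _, ?_⟩
  rw [Submodule.map_span, Submodule.span_span_of_tower]
  have := congrArg (Submodule.map U.subtype) b.span_eq
  rwa [Submodule.map_span, Submodule.map_top, Submodule.range_subtype] at this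

theorem IsLat.relLen_tS {U : Submodule F V} {A : Submodule O V} (h : IsLat U A) :
    relLen (tS F A) A = Module.finrank F U := by
  obtain ⟨n, b, rfl⟩ := h.exists_basis
  rw [Module.finrank_eq_card_basis b, Fintype.card_fin]
  have hK : LinearIndependent F (fun i => (b i : V)) :=
    LinearIndependent.map' (v := b) b.linearIndependent U.subtype (Submodule.ker_subtype U)
  have hli : LinearIndependent O (fun i => (b i : V)) :=
    (LinearIndependent.iff_fractionRing O F).2 hK
  let g : (Fin n → O) →ₗ[O] V := Fintype.linearCombination O (fun i => (b i : V))
  have hg : Function.Injective g := linearIndependent_iff_injective_fintypeLinearCombination.1 hli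
  have h1 : (Submodule.span O (Set.range b)).map (U.subtype.restrictScalars O)
      = (⊤ : Submodule O (Fin n → O)).map g := by
    rw [Submodule.map_top, Fintype.range_linearCombination, Submodule.map_span, ← Set.range_comp]
    rfl
  have h2 : tS F ((Submodule.span O (Set.range b)).map (U.subtype.restrictScalars O)) =
      ((⊤ : Submodule O (Fin n → O)).map
      (LinearMap.lsmul O (Fin n → O) PowerSeries.X)).map g := by
    rw [h1]
    ext x
    constructor
    · rintro ⟨_, ⟨y, -, rfl⟩, rfl⟩
      refine ⟨_, ⟨y, trivial, rfl⟩, ?_⟩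
      change g ((PowerSeries.X : O) • y) = tEnd F V (g y)
      rw [map_smul, tEnd_apply, τ_smul]
    · rintro ⟨_, ⟨y, -, rfl⟩, rfl⟩
      refine ⟨_, ⟨y, trivial, rfl⟩, ?_⟩
      change tEnd F V (g y) = g ((PowerSeries.X : O) • y)
      rw [map_smul, tEnd_apply, τ_smul]
  rw [h2, h1, relLen_map _ hg.injOn le_top, relLen_X_pi]

theorem exists_pow_smul_mem {A : Submodule O V} {x : V} (hx : x ∈ Submodule.span F (A : Set V)) :
    ∃ e : ℕ, τ F ^ e • x ∈ A := by
  have hmono : ∀ (e f : ℕ) (y : V), τ F ^ e • y ∈ A → τ F ^ (f + e) • y ∈ A := by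
    intro e f y h
    rw [pow_add, mul_smul, τ, ← map_pow, algebraMap_smul]
    exact A.smul_mem _ h
  induction hx using Submodule.span_induction with
  | mem x h => exact ⟨0, by simpa using h⟩
  | zero => exact ⟨0, by simp⟩
  | add x y _ _ hx hy =>
    obtain ⟨e, he⟩ := hx
    obtain ⟨f, hf⟩ := hy
    refine ⟨e + f, ?_⟩
    rw [smul_add]
    refine A.add_mem ?_ (hmono f e y hf)
    rw [add_comm]; exact hmono e f x he
  | smul a x _ hx =>
    obtain ⟨e, he⟩ := hx
    obtain ⟨f, b, hb⟩ := exists_pow_mul_mem a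
    refine ⟨f + e, ?_⟩
    rw [smul_smul, pow_add, mul_right_comm, mul_smul, hb, algebraMap_smul]
    exact A.smul_mem _ he

/-- One power of `t` clears the denominators of finitely many generators. Hence two lattices in the
same subspace are commensurable, and all indices between them are finite. -/
theorem exists_tS_pow_le {A D : Submodule O V} (hD : D.FG)
    (h : ∀ x ∈ D, x ∈ Submodule.span F (A : Set V)) : ∃ e : ℕ, act (tEnd F V ^ e) D ≤ A := by
  obtain ⟨s, rfl⟩ := hD
  choose e he using fun x : s => exists_pow_smul_mem (h x.1 (Submodule.subset_span x.2))
  refine ⟨s.attach.sup e, ?_⟩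
  rw [act, Submodule.map_span_le]
  intro x hx
  change (tEnd F V ^ _) x ∈ A
  rw [tEnd_pow_apply]
  obtain ⟨d, hd⟩ := Nat.exists_eq_add_of_le (Finset.le_sup (f := e) (s.mem_attach ⟨x, hx⟩))
  rw [hd, add_comm, pow_add, mul_smul, τ, ← map_pow, algebraMap_smul]
  exact A.smul_mem _ (he ⟨x, hx⟩)

theorem IsLat.exists_tS_pow_le {U : Submodule F V} {A D : Submodule O V} (hA : IsLat U A)
    (hD : D.FG) (h : D ≤ U.restrictScalars O) : ∃ e : ℕ, act (tEnd F V ^ e) D ≤ A :=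
  SOOdd.exists_tS_pow_le hD fun x hx => by rw [hA.span_eq]; exact h hx

theorem IsLat.of_le_of_le {U : Submodule F V} {A B C : Submodule O V} (hA : IsLat U A)
    (hC : IsLat U C) (h : A ≤ B) (h' : B ≤ C) : IsLat U B where
  fg := by
    have : IsNoetherian O C := isNoetherian_of_fg_of_noetherian C hC.fg
    have h1 : (B.comap C.subtype).FG := IsNoetherian.noetherian _
    have := h1.map C.subtype
    rwa [Submodule.map_comap_subtype, inf_eq_right.2 h'] at this
  span_eq := le_antisymm (by rw [← hC.span_eq]; exact Submodule.span_mono h')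
    (by rw [← hA.span_eq]; exact Submodule.span_mono h)

theorem IsLat.sup {U₁ U₂ : Submodule F V} {A B : Submodule O V} (hA : IsLat U₁ A)
    (hB : IsLat U₂ B) : IsLat (U₁ ⊔ U₂) (A ⊔ B) where
  fg := hA.fg.sup hB.fg
  span_eq := by
    rw [← hA.span_eq, ← hB.span_eq]
    apply le_antisymm
    · rw [Submodule.span_le]
      intro x hx
      obtain ⟨a, ha, b, hb, rfl⟩ := Submodule.mem_sup.1 hx
      exact Submodule.add_mem_sup (Submodule.subset_span ha) (Submodule.subset_span hb)
    · exact sup_le (Submodule.span_mono fun x hx => Submodule.mem_sup_left hx)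
        (Submodule.span_mono fun x hx => Submodule.mem_sup_right hx)

theorem IsLat.sup_span {U : Submodule F V} {A : Submodule O V} (hA : IsLat U A) {x : V}
    (hx : x ∈ U) : IsLat U (A ⊔ Submodule.span O {x}) where
  fg := hA.fg.sup (Submodule.fg_span_singleton x)
  span_eq := by
    apply le_antisymm
    · rw [Submodule.span_le]
      intro y hy
      have : A ⊔ Submodule.span O {x} ≤ U.restrictScalars O :=
        sup_le hA.le ((Submodule.span_singleton_le_iff_mem _ _).2 hx)
      exact this hy
    · rw [← hA.span_eq]; exact Submodule.span_mono fun x hx => Submodule.mem_sup_left hx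

theorem IsLat.act {U : Submodule F V} {A : Submodule O V} (hA : IsLat U A) (φ : Module.End F V) :
    IsLat (U.map φ) (act φ A) where
  fg := hA.fg.map _
  span_eq := by
    rw [← hA.span_eq, Submodule.map_span]; rfl

theorem IsLat.tS_pow {U : Submodule F V} {A : Submodule O V} (hA : IsLat U A) (e : ℕ) :
    IsLat U (SOOdd.act (tEnd F V ^ e) A) := by
  have := hA.act (tEnd F V ^ e)
  rwa [show U.map (tEnd F V ^ e) = U from ?_] at this
  apply le_antisymm
  · rw [Submodule.map_le_iff_le_comap]
    intro x hx
    rw [Submodule.mem_comap, tEnd_pow_apply]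
    exact U.smul_mem _ hx
  · intro x hx
    refine ⟨(τ F ^ e)⁻¹ • x, U.smul_mem _ hx, ?_⟩
    rw [tEnd_pow_apply, smul_smul, mul_inv_cancel₀ (pow_ne_zero _ τ_ne_zero), one_smul]

theorem tS_pow_succ (A : Submodule O V) (e : ℕ) :
    act (tEnd F V ^ (e + 1)) A = act (tEnd F V ^ e) (tS F A) := by rw [pow_succ, act_mul]

theorem tEnd_pow_injective (e : ℕ) : Function.Injective (tEnd F V ^ e) := by
  rw [Module.End.coe_pow]; exact tEnd_injective.iterate e

theorem IsLat.relLen_tS_pow {U : Submodule F V} {A : Submodule O V} (h : IsLat U A) (e : ℕ) :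
    relLen (SOOdd.act (tEnd F V ^ e) A) A = (e * Module.finrank F U : ℕ) := by
  induction e with
  | zero => simp [relLen_self]
  | succ e ih =>
    have h1 : SOOdd.act (tEnd F V ^ (e + 1)) A ≤ SOOdd.act (tEnd F V ^ e) A := by
      rw [tS_pow_succ]; exact act_mono (tS_le A)
    rw [relLen_add h1 (tS_pow_le A e), ih, tS_pow_succ,
      relLen_act (tEnd_pow_injective e).injOn (tS_le A), h.relLen_tS]
    push_cast; ring

theorem IsLat.relLen_ne_top {U : Submodule F V} {A B : Submodule O V} (hA : IsLat U A)
    (hB : IsLat U B) (h : A ≤ B) : relLen A B ≠ ⊤ := by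
  obtain ⟨e, he⟩ := hA.exists_tS_pow_le hB.fg hB.le
  have := relLen_anti he h
  rw [hB.relLen_tS_pow] at this
  exact ne_top_of_le_ne_top (ENat.natCast_ne_top _) this

/-- The length of `A / φ A` does not depend on the lattice `A`. -/
theorem IsLat.relLen_act_eq {U : Submodule F V} {A B : Submodule O V} (hA : IsLat U A)
    (hB : IsLat U B) {φ : Module.End F V} (hφ : Set.InjOn φ U) (hφA : SOOdd.act φ A ≤ A)
    (hφB : SOOdd.act φ B ≤ B) : relLen (SOOdd.act φ A) A = relLen (SOOdd.act φ B) B := by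
  obtain ⟨e, he⟩ := hA.exists_tS_pow_le hB.fg hB.le
  set B' := SOOdd.act (tEnd F V ^ e) B with hB'
  have hcomm : Commute φ (tEnd F V ^ e) := ((commute_tEnd φ).pow_left e).symm
  have hφB' : SOOdd.act φ B' ≤ B' := by rw [hB', act_comm hcomm]; exact act_mono hφB
  have hLB' : IsLat U B' := hB.tS_pow e
  have h1 : relLen (SOOdd.act φ B') B' = relLen (SOOdd.act φ B) B := by
    rw [hB', act_comm hcomm, relLen_act (tEnd_pow_injective e).injOn hφB]
  have h2 : relLen (SOOdd.act φ B') (SOOdd.act φ A) = relLen B' A :=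
    relLen_act (hφ.mono hA.le) he
  -- The length of `A / φ B'` is computed through `φ A` and through `B'`; the pieces `φ A / φ B'`
  -- and `A / B'` have equal finite length and cancel.
  have h3 := relLen_add (act_mono (φ := φ) he) hφA
  have h4 := relLen_add hφB' he
  rw [h3, h2, h1, add_comm] at h4
  exact (ENat.add_left_injective_of_ne_top (hLB'.relLen_ne_top hA he)) h4

/-- Existence of maximal modules with a property inside a finitely generated one. -/
theorem exists_maximal_of_fg {D : Submodule O V} (hD : D.FG) (P : Submodule O V → Prop)
    (hP : ∀ X, P X → X ≤ D) {A : Submodule O V} (hA : P A) :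
    ∃ M, A ≤ M ∧ P M ∧ ∀ X, P X → M ≤ X → X = M := by
  have : IsNoetherian O D := isNoetherian_of_fg_of_noetherian D hD
  let S : Set (Submodule O D) := {N | P (N.map D.subtype) ∧ A ≤ N.map D.subtype}
  have hS : S.Nonempty := ⟨A.comap D.subtype, by
    change P _ ∧ A ≤ _
    rw [Submodule.map_comap_subtype, inf_eq_right.2 (hP A hA)]
    exact ⟨hA, le_rfl⟩⟩
  obtain ⟨N, hN, hmax⟩ := set_has_maximal_iff_noetherian.2 this S hS
  refine ⟨N.map D.subtype, hN.2, hN.1, fun X hX hle => ?_⟩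
  have hXD : (X.comap D.subtype).map D.subtype = X := by
    rw [Submodule.map_comap_subtype, inf_eq_right.2 (hP X hX)]
  have h1 : X.comap D.subtype ∈ S := by
    change P _ ∧ A ≤ _
    rw [hXD]; exact ⟨hX, hN.2.trans hle⟩
  have h2 := hmax _ h1
  have h3 : N ≤ X.comap D.subtype := Submodule.map_le_iff_le_comap.1 hle
  have h4 : N = X.comap D.subtype := by
    by_contra hne
    exact h2 (lt_of_le_of_ne h3 hne)
  rw [h4, hXD]

end Lattice

/-! ### Integrality and residues for elements of `t⁻¹ 𝒪`. -/

section Integral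

variable {F : Type*} [Field F] [Algebra O F] [IsFractionRing O F]

theorem charZero_of_fraction (F : Type*) [Field F] [Algebra O F] [IsFractionRing O F] :
    CharZero F := 
  charZero_of_injective_ringHom (f := (algebraMap O F).comp PowerSeries.C)
    ((algebraMap O F).comp PowerSeries.C).injective

theorem eq_zero_of_eq_neg {x : F} (h : x = -x) : x = 0 := by
  have := charZero_of_fraction F
  linear_combination (1 / 2 : F) * h

theorem algebraMap_mem_one (a : O) : algebraMap O F a ∈ (1 : Submodule O F) :=
  Submodule.mem_one.2 ⟨a, rfl⟩

theorem mul_mem_one {x y : F} (hx : x ∈ (1 : Submodule O F)) (hy : y ∈ (1 : Submodule O F)) :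
    x * y ∈ (1 : Submodule O F) := by
  obtain ⟨a, rfl⟩ := Submodule.mem_one.1 hx
  obtain ⟨b, rfl⟩ := Submodule.mem_one.1 hy
  rw [← map_mul]; exact algebraMap_mem_one _

variable (F) in
/-- The constant `c` as an element of `F`. -/
def cst (c : ℂ) : F := algebraMap O F (PowerSeries.C c)

theorem cst_mem_one (c : ℂ) : cst F c ∈ (1 : Submodule O F) := algebraMap_mem_one _

theorem cst_add (c d : ℂ) : cst F (c + d) = cst F c + cst F d := by simp [cst]
theorem cst_mul (c d : ℂ) : cst F (c * d) = cst F c * cst F d := by simp [cst]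
theorem cst_neg (c : ℂ) : cst F (-c) = -cst F c := by simp [cst]
theorem cst_one : cst F 1 = 1 := by simp [cst]
theorem cst_zero : cst F 0 = 0 := by simp [cst]

/-- An element of `t⁻¹𝒪` has a residue. -/
theorem exists_residue {x : F} (hx : τ F * x ∈ (1 : Submodule O F)) :
    ∃ c : ℂ, x - cst F c / τ F ∈ (1 : Submodule O F) := by
  obtain ⟨a, ha⟩ := Submodule.mem_one.1 hx
  obtain ⟨c, b, rfl⟩ := exists_const a
  refine ⟨c, ?_⟩
  have : x - cst F c / τ F = algebraMap O F b := by
    have h0 := τ_ne_zero (F := F)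
    rw [map_add, map_mul] at ha
    change cst F c + algebraMap O F b * τ F = _ at ha
    field_simp
    linear_combination -ha
  rw [this]; exact algebraMap_mem_one b

theorem cst_div_mem_one_iff {c : ℂ} : cst F c / τ F ∈ (1 : Submodule O F) ↔ c = 0 := by
  constructor
  · intro h
    obtain ⟨a, ha⟩ := Submodule.mem_one.1 h
    have h0 := τ_ne_zero (F := F)
    rw [eq_div_iff h0, τ, cst, ← map_mul] at ha
    have := IsFractionRing.injective O F ha
    simpa using (congrArg PowerSeries.constantCoeff this).symm
  · rintro rfl; rw [cst_zero, zero_div]; exact zero_mem _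

theorem residue_ne_zero {x : F} (hx : x ∉ (1 : Submodule O F)) {c : ℂ}
    (hc : x - cst F c / τ F ∈ (1 : Submodule O F)) : c ≠ 0 := by
  rintro rfl
  rw [cst_zero, zero_div, sub_zero] at hc
  exact hx hc

/-- A quadratic polynomial with coefficients in `t⁻¹𝒪`, the leading one not in `𝒪`, has
an integral value. -/
theorem exists_quadratic_mem {a b d : F} (ha : τ F * a ∈ (1 : Submodule O F))
    (hb : τ F * b ∈ (1 : Submodule O F)) (hd : τ F * d ∈ (1 : Submodule O F))
    (hd' : d ∉ (1 : Submodule O F)) :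
    ∃ c : ℂ, a + cst F c * b + cst F c ^ 2 * d ∈ (1 : Submodule O F) := by
  obtain ⟨a₀, ha₀⟩ := exists_residue ha
  obtain ⟨b₀, hb₀⟩ := exists_residue hb
  obtain ⟨d₀, hd₀⟩ := exists_residue hd
  have hd0 := residue_ne_zero hd' hd₀
  -- Only the residues obstruct integrality. They give a genuine quadratic equation over `ℂ`, since
  -- the leading residue is non-zero.
  obtain ⟨c, hc⟩ : ∃ c : ℂ, d₀ * (c * c) + b₀ * c + a₀ = 0 := by
    obtain ⟨s, hs⟩ := IsAlgClosed.exists_eq_mul_self (discrim d₀ b₀ a₀)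
    exact exists_quadratic_eq_zero hd0 ⟨s, hs⟩
  refine ⟨c, ?_⟩
  have key : a + cst F c * b + cst F c ^ 2 * d = (a - cst F a₀ / τ F)
      + cst F c * (b - cst F b₀ / τ F) + (cst F c * cst F c) * (d - cst F d₀ / τ F) := by
    have h1 : cst F (d₀ * (c * c) + b₀ * c + a₀) = 0 := by rw [hc, cst_zero]
    simp only [cst_add, cst_mul] at h1
    have h0 := τ_ne_zero (F := F)
    field_simp
    linear_combination h1
  rw [key]
  exact add_mem (add_mem ha₀ (mul_mem_one (cst_mem_one c) hb₀))
    (mul_mem_one (mul_mem_one (cst_mem_one c) (cst_mem_one c)) hd₀)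

end Integral

/-! ### Dual lattices, and two parity statements for the length of `A^∨ / A`. -/

section Dual

variable {F : Type*} [Field F] [Algebra O F] [IsFractionRing O F]
variable {V : Type*} [AddCommGroup V] [Module F V] [Module O V] [IsScalarTower O F V]
variable (B : LinearMap.BilinForm F V)

/-- The dual of `A` inside the subspace `U`. -/
def dualIn (U : Submodule F V) (A : Submodule O V) : Submodule O V :=
  B.dualSubmodule A ⊓ U.restrictScalars O

/-- `B` is non-degenerate on `U`. -/
def NondegOn (U : Submodule F V) : Prop := ∀ x ∈ U, (∀ y ∈ U, B x y = 0) → x = 0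

variable {B}

theorem mem_dualIn {U : Submodule F V} {A : Submodule O V} {x : V} :
    x ∈ dualIn B U A ↔ (∀ y ∈ A, B x y ∈ (1 : Submodule O F)) ∧ x ∈ U := Iff.rfl

theorem dualIn_anti (U : Submodule F V) : Antitone (dualIn B U) := by
  exact fun A A' h x hx => ⟨fun y hy => hx.1 y (h hy), hx.2⟩

theorem dualIn_le (U : Submodule F V) (A : Submodule O V) :
    dualIn B U A ≤ U.restrictScalars O := inf_le_right

theorem nondegenerate_restrict (hs : B.IsSymm) {U : Submodule F V} (hU : NondegOn B U) :
    (B.restrict U).Nondegenerate := by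
  refine ⟨fun x hx => Subtype.ext (hU x x.2 fun y hy => hx ⟨y, hy⟩),
    fun x hx => Subtype.ext (hU x x.2 fun y hy => ?_)⟩
  rw [hs.eq]; exact hx ⟨y, hy⟩

theorem dualIn_map_subtype {U : Submodule F V} (A : Submodule O U) :
    dualIn B U (A.map (U.subtype.restrictScalars O)) =
      ((B.restrict U).dualSubmodule A).map (U.subtype.restrictScalars O) := by
  ext x
  constructor
  · rintro ⟨h, hx⟩
    exact ⟨⟨x, hx⟩, fun y hy => h y ⟨y, hy, rfl⟩, rfl⟩
  · rintro ⟨y, hy, rfl⟩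
    refine ⟨?_, y.2⟩
    rintro _ ⟨z, hz, rfl⟩
    exact hy z hz

theorem restrict_isSymm (hs : B.IsSymm) (U : Submodule F V) : (B.restrict U).IsSymm :=
  ⟨fun x y => hs.eq x y⟩

theorem IsLat.dualIn (hs : B.IsSymm) {U : Submodule F V} (hU : NondegOn B U) {A : Submodule O V}
    (hA : IsLat U A) : IsLat U (dualIn B U A) := by
  obtain ⟨n, b, rfl⟩ := hA.exists_basis
  rw [dualIn_map_subtype,
    LinearMap.BilinForm.dualSubmodule_span_of_basis _ (nondegenerate_restrict hs hU)]
  exact isLat_of_basis _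

theorem IsLat.dualIn_dualIn (hs : B.IsSymm) {U : Submodule F V} (hU : NondegOn B U)
    {A : Submodule O V} (hA : IsLat U A) : SOOdd.dualIn B U (SOOdd.dualIn B U A) = A := by
  obtain ⟨n, b, rfl⟩ := hA.exists_basis
  rw [dualIn_map_subtype, dualIn_map_subtype,
    LinearMap.BilinForm.dualSubmodule_dualSubmodule_of_basis _ (nondegenerate_restrict hs hU)
      (restrict_isSymm hs U)]

theorem le_dualIn_comm (hs : B.IsSymm) {U : Submodule F V} {A A' : Submodule O V}
    (hA : A ≤ U.restrictScalars O) (h : A' ≤ dualIn B U A) : A ≤ dualIn B U A' :=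
  fun x hx => ⟨fun y hy => by rw [hs.eq]; exact (h hy).1 x hx, hA hx⟩

/-- Taking duals is an inclusion-reversing involution from the lattices between `X` and `Y` to those
between `Y^∨` and `X^∨`. -/
theorem relLen_dualIn (hs : B.IsSymm) {U : Submodule F V} (hU : NondegOn B U)
    {X Y : Submodule O V} (hX : IsLat U X) (hY : IsLat U Y) (h : X ≤ Y) :
    relLen (dualIn B U Y) (dualIn B U X) = relLen X Y := by
  have hX' := hX.dualIn hs hU
  have hY' := hY.dualIn hs hU
  exact relLen_eq_of_dual h (dualIn_anti U h) (dualIn B U) (dualIn_anti U) rfl rfl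
    (hY.dualIn_dualIn hs hU) (hX.dualIn_dualIn hs hU)
    (fun N h1 h2 => (hX.of_le_of_le hY h1 h2).dualIn_dualIn hs hU)
    (fun N h1 h2 => (hY'.of_le_of_le hX' h1 h2).dualIn_dualIn hs hU)

theorem exists_last_pow {A : Submodule O V} {y : V} (hy : y ∈ Submodule.span F (A : Set V))
    (hyA : y ∉ A) : ∃ e : ℕ, τ F ^ e • y ∉ A ∧ τ F ^ (e + 1) • y ∈ A := by
  classical
  have h := exists_pow_smul_mem hy
  have h0 : Nat.find h ≠ 0 := by
    intro h0
    have := Nat.find_spec h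
    rw [h0, pow_zero, one_smul] at this
    exact hyA this
  obtain ⟨e, he⟩ := Nat.exists_eq_succ_of_ne_zero h0
  refine ⟨e, Nat.find_min h (by omega), ?_⟩
  have := Nat.find_spec h
  rwa [he] at this

/-- The length of `A^∨ / A` is even if there is a self-dual lattice. -/
theorem even_relLen_dualIn (hs : B.IsSymm) {U : Submodule F V} (hU : NondegOn B U)
    {A L : Submodule O V} (hA : IsLat U A) (hL : IsLat U L) (hLd : dualIn B U L = L)
    (hAd : A ≤ dualIn B U A) : ∃ n : ℕ, relLen A (dualIn B U A) = (2 * n : ℕ) := by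
  obtain ⟨e, he⟩ := hL.exists_tS_pow_le hA.fg hA.le
  have hA' : IsLat U (act (tEnd F V ^ e) A) := hA.tS_pow e
  have hAA' := tS_pow_le (F := F) A e
  -- For an integral `X` containing `t^e A`, the chain `t^e A ≤ X ≤ X^∨ ≤ (t^e A)^∨` has outer steps
  -- of equal length. So the length of `X^∨ / X` has the same parity for every such `X`, in
  -- particular for `A` and for the self-dual `L`.
  have key : ∀ {X : Submodule O V}, IsLat U X → act (tEnd F V ^ e) A ≤ X → X ≤ dualIn B U X →
      relLen (act (tEnd F V ^ e) A) (dualIn B U (act (tEnd F V ^ e) A)) =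
      relLen X (dualIn B U X) + 2 * relLen (act (tEnd F V ^ e) A) X := by
    intro X hX h1 h2
    rw [relLen_add (h1.trans h2) (dualIn_anti U h1), relLen_add h1 h2,
      relLen_dualIn hs hU hA' hX h1]
    ring
  have h1 := key hA hAA' hAd
  have h2 := key hL he hLd.ge
  rw [h1, hLd, relLen_self, zero_add] at h2
  have hn1 := hA'.relLen_ne_top hA hAA'
  have hn2 := hA'.relLen_ne_top hL he
  have hn3 := hA.relLen_ne_top (hA.dualIn hs hU) hAd
  lift relLen (act (tEnd F V ^ e) A) A to ℕ using hn1 with a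
  lift relLen (act (tEnd F V ^ e) A) L to ℕ using hn2 with b
  lift relLen A (dualIn B U A) to ℕ using hn3 with c
  refine ⟨b - a, ?_⟩
  norm_cast at h2 ⊢
  omega

/-- Parity of the length of `P^∨ / P`, for a lattice stable under a skew automorphism. -/
theorem even_relLen_dualIn_add (hs : B.IsSymm) {U : Submodule F V} (hU : NondegOn B U)
    {γ : Module.End F V} (hγ : Set.InjOn γ U) (hγU : U.map γ = U)
    (hskew : ∀ x y, B (γ x) y = -B x (γ y))
    {P : Submodule O V} (hP : IsLat U P) (hPd : P ≤ dualIn B U P) (hγP : act γ P ≤ P) :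
    ∃ n : ℕ, relLen P (dualIn B U P) + relLen (act γ P) P = (2 * n : ℕ) := by
  have hLd := hP.dualIn hs hU
  -- A finitely generated module that contains every candidate `X` below, so that a maximal one
  -- exists.
  let D : Submodule O V := (dualIn B U P).comap (γ.restrictScalars O) ⊓ U.restrictScalars O
  have hDU : D ≤ U.restrictScalars O := inf_le_right
  have hD : D.FG := by
    have : IsNoetherian O (dualIn B U P) := isNoetherian_of_fg_of_noetherian _ hLd.fg
    let f : D →ₗ[O] dualIn B U P :=
      (γ.restrictScalars O).restrict (p := D) (q := dualIn B U P) (fun x hx => hx.1)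
    have hf : Function.Injective f := fun x y hxy =>
      Subtype.ext (hγ x.2.2 y.2.2 (congrArg Subtype.val hxy))
    have := isNoetherian_of_injective f hf
    exact Module.Finite.iff_fg.1 (inferInstance : Module.Finite O D)
  -- The form `B (γ x) y` is alternating, because `B` is symmetric and `γ` is skew. A maximal
  -- lattice `Q ≥ P` on which it is integral is therefore self-dual for it, which means `Q^∨ = γ Q`.
  obtain ⟨Q, hPQ, ⟨hPQ', hQU, hQγ⟩, hmax⟩ := exists_maximal_of_fg hD
    (fun X => P ≤ X ∧ X ≤ U.restrictScalars O ∧ ∀ x ∈ X, ∀ y ∈ X, B (γ x) y ∈ (1 : Submodule O F))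
    (fun X hX x hx => ⟨⟨fun y hy => hX.2.2 x hx y (hX.1 hy), by
      rw [← hγU]; exact ⟨x, hX.2.1 hx, rfl⟩⟩, hX.2.1 hx⟩)
    (A := P) ⟨le_rfl, hP.le, fun x hx y hy => (hPd (hγP ⟨x, hx, rfl⟩)).1 y hy⟩
  have hLQ : IsLat U Q := by
    obtain ⟨e, he⟩ := hP.exists_tS_pow_le hD hDU
    refine ⟨?_, le_antisymm (Submodule.span_le.2 hQU) ?_⟩
    · have : IsNoetherian O D := isNoetherian_of_fg_of_noetherian D hD
      have hQD : Q ≤ D := fun x hx => ⟨⟨fun y hy => hQγ x hx y (hPQ hy), by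
        have : γ x ∈ U.map γ := ⟨x, hQU hx, rfl⟩
        rwa [hγU] at this⟩, hQU hx⟩
      have := (IsNoetherian.noetherian (Q.comap D.subtype)).map D.subtype
      rwa [Submodule.map_comap_subtype, inf_eq_right.2 hQD] at this
    · rw [← hP.span_eq]; exact Submodule.span_mono hPQ
  have hdual : dualIn B U Q = act γ Q := by
    apply le_antisymm
    · intro z hz
      have hzU : z ∈ U.map γ := by rw [hγU]; exact hz.2
      obtain ⟨y, hyU, rfl⟩ := hzU
      refine mem_act_of_mem ?_
      by_contra hy
      obtain ⟨e, he1, he2⟩ := exists_last_pow (F := F) (by rw [hLQ.span_eq]; exact hyU) hy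
      set y' := τ F ^ e • y with hy'
      have hy'd : ∀ x ∈ Q, B (γ y') x ∈ (1 : Submodule O F) := by
        intro x hx
        rw [hy', map_smul, map_smul, LinearMap.smul_apply, smul_eq_mul]
        refine mul_mem_one ?_ (hz.1 x hx)
        rw [τ, ← map_pow]; exact algebraMap_mem_one _
      -- A vector pairing integrally with `Q` has norm zero for the alternating form, so nothing
      -- prevents adding it to `Q`.
      have h0 : B (γ y') y' = 0 := by
        have h1 := hskew y' y'
        rw [hs.eq y' (γ y')] at h1
        exact eq_zero_of_eq_neg h1
      have hX := hmax (Q ⊔ Submodule.span O {y'}) ⟨hPQ.trans le_sup_left,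
        sup_le hQU ((Submodule.span_singleton_le_iff_mem _ _).2 (U.smul_mem _ hyU)), ?_⟩
        le_sup_left
      · apply he1
        rw [← hX]; exact Submodule.mem_sup_right (Submodule.mem_span_singleton_self _)
      · intro u hu v hv
        obtain ⟨q, hq, r, hr, rfl⟩ := Submodule.mem_sup.1 hu
        obtain ⟨q', hq', r', hr', rfl⟩ := Submodule.mem_sup.1 hv
        obtain ⟨a, rfl⟩ := Submodule.mem_span_singleton.1 hr
        obtain ⟨a', rfl⟩ := Submodule.mem_span_singleton.1 hr'
        have e1 : B (γ (q + a • y')) (q' + a' • y') = B (γ q) q' +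
            algebraMap O F a * B (γ y') q' - algebraMap O F a' * B (γ y') q := by
          rw [← algebraMap_smul F a, ← algebraMap_smul F a']
          simp only [map_add, map_smul, LinearMap.add_apply, LinearMap.smul_apply, smul_eq_mul, h0]
          rw [hskew q y', hs.eq q (γ y')]
          ring
        rw [e1]
        exact sub_mem (add_mem (hQγ q hq q' hq') (mul_mem_one (algebraMap_mem_one _)
          (hy'd q' hq'))) (mul_mem_one (algebraMap_mem_one _) (hy'd q hq))
    · rw [act_le]
      intro x hx
      refine ⟨fun y hy => hQγ x hx y hy, ?_⟩
      have : γ x ∈ U.map γ := ⟨x, hQU hx, rfl⟩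
      rwa [hγU] at this
  -- The length of `P^∨ / γ P` is the sum in question when computed through `P`, and twice the
  -- length of `Q / P` when computed through `γ Q = Q^∨`.
  have h1 : relLen (act γ P) (dualIn B U P) =
      relLen (act γ P) P + relLen P (dualIn B U P) := relLen_add hγP hPd
  have h2 : relLen (act γ P) (dualIn B U P) =
      relLen (act γ P) (act γ Q) + relLen (act γ Q) (dualIn B U P) := by
    refine relLen_add (act_mono hPQ) ?_
    rw [← hdual]; exact dualIn_anti U hPQ
  rw [relLen_act (hγ.mono hQU) hPQ, ← hdual, relLen_dualIn hs hU hP hLQ hPQ] at h2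
  have hn := hP.relLen_ne_top hLQ hPQ
  lift relLen P Q to ℕ using hn with n
  refine ⟨n, ?_⟩
  rw [add_comm, ← h1, h2]; push_cast; ring

end Dual

/-! ### Gluing modules in independent subspaces along a vector `e + y`. -/

section Glue

variable {F : Type*} [Field F] [Algebra O F] [IsFractionRing O F]
variable {V : Type*} [AddCommGroup V] [Module F V] [Module O V] [IsScalarTower O F V]

/-- The `𝒪`-submodule generated by `v`. -/
local notation "⟪" v "⟫" => Submodule.span O {v}

theorem disjoint_restrictScalars {U₁ U₂ : Submodule F V} (h : Disjoint U₁ U₂) :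
    Disjoint (U₁.restrictScalars O) (U₂.restrictScalars O) :=
  Submodule.disjoint_def.2 fun x hx hx' => Submodule.disjoint_def.1 h x hx hx'

theorem span_le_restrict {U : Submodule F V} {v : V} (h : v ∈ U) :
    ⟪v⟫ ≤ U.restrictScalars O := (Submodule.span_singleton_le_iff_mem _ _).2 h

theorem mem_sup_span {A : Submodule O V} {v x : V} :
    x ∈ A ⊔ ⟪v⟫ ↔ ∃ c ∈ A, ∃ a : O, c + a • v = x := by
  simp [Submodule.mem_sup, Submodule.mem_span_singleton]

theorem mem_sup_span_self (A : Submodule O V) (v : V) : v ∈ A ⊔ ⟪v⟫ :=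
  Submodule.mem_sup_right (Submodule.mem_span_singleton_self v)

/-- If `a v ∈ C` and `v ∉ C`, then `a` is divisible by `t`. -/
theorem exists_eq_mul_X {C : Submodule O V} {v : V} (hv : v ∉ C) (hτ : τ F • v ∈ C) {a : O}
    (ha : a • v ∈ C) : ∃ b, a = b * PowerSeries.X := by
  obtain ⟨c, b, rfl⟩ := exists_const a
  have hc : c = 0 := by
    by_contra hc
    rw [add_smul, mul_smul, ← τ_smul (F := F)] at ha
    have h1 := (C.add_mem_iff_left (C.smul_mem b hτ)).1 ha
    apply hv
    have := C.smul_mem (PowerSeries.C c⁻¹) h1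
    rwa [smul_smul, ← map_mul, inv_mul_cancel₀ hc, map_one, one_smul] at this
  exact ⟨b, by rw [hc]; simp⟩

theorem mem_of_add_mem_sup {U₁ U₂ : Submodule F V} (hU : Disjoint U₁ U₂) {A₁ A₂ : Submodule O V}
    (h₁ : A₁ ≤ U₁.restrictScalars O) (h₂ : A₂ ≤ U₂.restrictScalars O) {x₁ x₂ : V}
    (hx₁ : x₁ ∈ U₁) (hx₂ : x₂ ∈ U₂) (h : x₁ + x₂ ∈ A₁ ⊔ A₂) : x₁ ∈ A₁ ∧ x₂ ∈ A₂ := by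
  obtain ⟨a₁, ha₁, a₂, ha₂, he⟩ := Submodule.mem_sup.1 h
  have e1 : x₁ - a₁ = a₂ - x₂ := by
    rw [sub_eq_sub_iff_add_eq_add, ← he]; exact add_comm _ _
  have h0 : x₁ - a₁ = 0 := Submodule.disjoint_def.1 hU _ (U₁.sub_mem hx₁ (h₁ ha₁))
    (e1 ▸ U₂.sub_mem (h₂ ha₂) hx₂)
  rw [h0] at e1
  rw [sub_eq_zero.1 h0, ← sub_eq_zero.1 e1.symm]
  exact ⟨ha₁, ha₂⟩

/-- A glued module meets the first summand in the expected way. -/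
theorem mem_of_mem_glue {U₁ U₂ : Submodule F V} (hU : Disjoint U₁ U₂) {C₁ C₂ : Submodule O V}
    (h₁ : C₁ ≤ U₁.restrictScalars O) (h₂ : C₂ ≤ U₂.restrictScalars O) {e y : V}
    (he : e ∈ U₁) (hy : y ∈ U₂) (hτe : τ F • e ∈ C₁) (hyC : y ∉ C₂) (hτy : τ F • y ∈ C₂)
    {x : V} (hx : x ∈ U₁) (h : x ∈ C₁ ⊔ C₂ ⊔ ⟪e + y⟫) : x ∈ C₁ := by
  obtain ⟨c, hc, a, rfl⟩ := mem_sup_span.1 h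
  obtain ⟨c₁, hc₁, c₂, hc₂, rfl⟩ := Submodule.mem_sup.1 hc
  have h0 : c₂ + a • y = 0 := by
    refine Submodule.disjoint_def.1 hU _ ?_ ?_
    · have : c₂ + a • y = (c₁ + c₂ + a • (e + y)) - c₁ - a • e := by rw [smul_add]; abel
      rw [this]
      exact U₁.sub_mem (U₁.sub_mem hx (h₁ hc₁)) ((U₁.restrictScalars O).smul_mem a he)
    · exact U₂.add_mem (h₂ hc₂) ((U₂.restrictScalars O).smul_mem a hy)
  have h1 : a • y ∈ C₂ := by
    rw [eq_neg_of_add_eq_zero_right h0]; exact C₂.neg_mem hc₂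
  obtain ⟨b, rfl⟩ := exists_eq_mul_X (F := F) hyC hτy h1
  have h2 : c₁ + c₂ + (b * PowerSeries.X) • (e + y) = c₁ + b • τ F • e := by
    rw [smul_add, add_add_add_comm, h0, add_zero, mul_smul, τ_smul]
  rw [h2]
  exact C₁.add_mem hc₁ (C₁.smul_mem b hτe)

theorem smul_mem_tS {A : Submodule O V} {x : V} (h : x ∈ A) : τ F • x ∈ tS F A :=
  ⟨x, h, tEnd_apply x⟩

theorem of_smul_mem_tS {A : Submodule O V} {x : V} (h : τ F • x ∈ tS F A) : x ∈ A := by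
  obtain ⟨y, hy, hxy⟩ := h
  change tEnd F V y = _ at hxy
  rw [← tEnd_apply] at hxy
  rwa [← tEnd_injective hxy]

theorem tS_sup (A B : Submodule O V) : tS F (A ⊔ B) = tS F A ⊔ tS F B := act_sup _ _ _

theorem tS_span_singleton (v : V) : tS F ⟪v⟫ = ⟪tEnd F V v⟫ := act_span_singleton _ _

/-- The glued module sees `e` and `y` only through `e + y`, so additivity of the ranks is not
automatic. It holds when one side makes the coupling invisible. Either `φ C₁` absorbs `t (C₁ + 𝒪
e)`, in which case `t e` and hence `t y` can be adjoined separately, or `φ` sends `B₂` and `y` into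
`t C₂`, in which case `φ (e + y)` acts as `φ e` and the second side contributes nothing. -/
theorem relLen_glue_aux {U₁ U₂ : Submodule F V} (hU : Disjoint U₁ U₂)
    {C₁ C₂ B₂ : Submodule O V} (h₁ : C₁ ≤ U₁.restrictScalars O) (hCB : C₂ ≤ B₂)
    (h₂ : B₂ ≤ U₂.restrictScalars O) {e y : V}
    (he : e ∈ U₁) (heC : e ∉ C₁) (hτe : τ F • e ∈ C₁)
    (hy : y ∈ U₂) (hyC : y ∉ C₂) (hτy : τ F • y ∈ C₂)
    {φ : Module.End F V} (hφ₁ : ∀ x ∈ U₁, φ x ∈ U₁) (hφ₂ : ∀ x ∈ U₂, φ x ∈ U₂)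
    (hinj : Set.InjOn φ U₁)
    (h : tS F (C₁ ⊔ ⟪e⟫) ≤ act φ C₁ ∨ act φ (B₂ ⊔ ⟪y⟫) ≤ tS F C₂) :
    relLen (tS F (C₁ ⊔ C₂ ⊔ ⟪e + y⟫))
      (act φ (C₁ ⊔ B₂ ⊔ ⟪e + y⟫) ⊔ tS F (C₁ ⊔ C₂ ⊔ ⟪e + y⟫)) =
    relLen (tS F C₁) (act φ (C₁ ⊔ ⟪e⟫) ⊔ tS F C₁) +
      relLen (tS F (C₂ ⊔ ⟪y⟫)) (act φ B₂ ⊔ tS F (C₂ ⊔ ⟪y⟫)) := by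
  have hC₂ : C₂ ≤ U₂.restrictScalars O := hCB.trans h₂
  set A := C₁ ⊔ C₂ ⊔ ⟪e + y⟫ with hA
  have hC₁A : C₁ ≤ A := le_sup_left.trans le_sup_left
  have hC₂A : C₂ ≤ A := le_sup_right.trans le_sup_left
  have hwA : e + y ∈ A := mem_sup_span_self _ _
  have hφU₁ : act φ (C₁ ⊔ ⟪e⟫) ≤ U₁.restrictScalars O :=
    act_le.2 fun x hx => hφ₁ x (sup_le h₁ (span_le_restrict he) hx)
  have hφB₂ : act φ B₂ ≤ U₂.restrictScalars O := act_le.2 fun x hx => hφ₂ x (h₂ hx)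
  rcases h with h | h
  · set A₂ := C₂ ⊔ ⟪y⟫ with hA₂
    have hA₂U : A₂ ≤ U₂.restrictScalars O := sup_le hC₂ (span_le_restrict hy)
    set X₀ := act φ C₁ ⊔ (act φ B₂ ⊔ tS F A₂) with hX₀
    set D := tS F (C₁ ⊔ ⟪e⟫) ⊔ tS F A₂ with hD
    have hX : act φ (C₁ ⊔ B₂ ⊔ ⟪e + y⟫) ⊔ tS F A = X₀ ⊔ ⟪φ (e + y)⟫ := by
      apply le_antisymm
      · refine sup_le ?_ ?_
        · rw [act_sup, act_sup, act_span_singleton]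
          exact sup_le_sup_right (sup_le_sup_left le_sup_left _) _
        · rw [hA, tS_sup, tS_sup, tS_span_singleton]
          refine le_sup_of_le_left (sup_le (sup_le ?_ ?_) ?_)
          · exact le_sup_of_le_left ((act_mono le_sup_left).trans h)
          · exact le_sup_of_le_right (le_sup_of_le_right (act_mono le_sup_left))
          · rw [Submodule.span_singleton_le_iff_mem, map_add]
            exact Submodule.add_mem_sup (h (mem_act_of_mem (mem_sup_span_self _ _)))
              (Submodule.mem_sup_right (mem_act_of_mem (mem_sup_span_self _ _)))
      · refine sup_le (sup_le (le_sup_of_le_left (act_mono (le_sup_left.trans le_sup_left)))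
          (sup_le (le_sup_of_le_left (act_mono (le_sup_right.trans le_sup_left))) ?_)) ?_
        · rw [hA₂, tS_sup, tS_span_singleton]
          refine sup_le (le_sup_of_le_right (act_mono hC₂A)) ?_
          rw [Submodule.span_singleton_le_iff_mem]
          have : tEnd F V y = tEnd F V (e + y) - tEnd F V e := by rw [map_add]; abel
          rw [this]
          refine Submodule.sub_mem _ (Submodule.mem_sup_right (mem_act_of_mem hwA))
            (Submodule.mem_sup_left ?_)
          exact (act_mono (le_sup_left.trans le_sup_left))
            (h (mem_act_of_mem (mem_sup_span_self _ _)))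
        · rw [Submodule.span_singleton_le_iff_mem]
          exact Submodule.mem_sup_left (mem_act_of_mem (mem_sup_span_self _ _))
    have hw1 : φ (e + y) ∉ X₀ := by
      intro hw
      rw [map_add] at hw
      have := (mem_of_add_mem_sup hU ((act_mono le_sup_left).trans hφU₁)
        (sup_le hφB₂ ((tS_le _).trans hA₂U)) (hφ₁ e he) (hφ₂ y hy) hw).1
      obtain ⟨c, hc, hce⟩ := this
      rw [hinj (h₁ hc) he hce] at hc
      exact heC hc
    have hw2 : τ F • φ (e + y) ∈ X₀ := by
      rw [map_add, smul_add, ← map_smul, ← map_smul]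
      exact Submodule.add_mem_sup (mem_act_of_mem hτe)
        (Submodule.mem_sup_left (mem_act_of_mem (hCB hτy)))
    -- The chain is `tA ≤ D ≤ X₀ ≤ X₀ + 𝒪 φ(e + y)`. Its first and last steps have length one and
    -- match the two steps by which `φ (C₁ + 𝒪 e)` over `t C₁` exceeds `φ C₁` over `t (C₁ + 𝒪 e)`;
    -- the middle step is a direct sum.
    have hAD : D = tS F A ⊔ ⟪tEnd F V e⟫ := by
      apply le_antisymm
      · rw [hD, hA₂, tS_sup, tS_sup, tS_span_singleton, tS_span_singleton]
        refine sup_le (sup_le (le_sup_of_le_left (act_mono hC₁A)) le_sup_right)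
          (sup_le (le_sup_of_le_left (act_mono hC₂A)) ?_)
        rw [Submodule.span_singleton_le_iff_mem]
        have : tEnd F V y = tEnd F V (e + y) - tEnd F V e := by rw [map_add]; abel
        rw [this]
        exact Submodule.sub_mem _ (Submodule.mem_sup_left (mem_act_of_mem hwA))
          (mem_sup_span_self _ _)
      · rw [hA, tS_sup, tS_sup, tS_span_singleton]
        refine sup_le (sup_le (sup_le ?_ ?_) ?_) ?_
        · exact le_sup_of_le_left (act_mono le_sup_left)
        · exact le_sup_of_le_right (act_mono le_sup_left)
        · rw [Submodule.span_singleton_le_iff_mem, map_add]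
          exact Submodule.add_mem_sup (mem_act_of_mem (mem_sup_span_self _ _))
            (mem_act_of_mem (mem_sup_span_self _ _))
        · rw [Submodule.span_singleton_le_iff_mem]
          exact Submodule.mem_sup_left (mem_act_of_mem (mem_sup_span_self _ _))
    have hl1 : relLen (tS F A) D = 1 := by
      rw [hAD]
      refine relLen_sup_span (F := F) ?_ ?_
      · intro hte
        rw [tEnd_apply] at hte
        exact heC (mem_of_mem_glue hU h₁ hC₂ he hy hτe hyC hτy he (of_smul_mem_tS hte))
      · rw [tEnd_apply]; exact smul_mem_tS (hC₁A hτe)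
    have hAleD : tS F A ≤ D := by rw [hAD]; exact le_sup_left
    have hDX₀ : D ≤ X₀ := sup_le_sup h le_sup_right
    have hl2 : relLen D X₀ = relLen (tS F (C₁ ⊔ ⟪e⟫)) (act φ C₁) +
        relLen (tS F A₂) (act φ B₂ ⊔ tS F A₂) :=
      relLen_sup_sup (disjoint_restrictScalars hU) h le_sup_right
        ((act_mono le_sup_left).trans hφU₁) (sup_le hφB₂ ((tS_le _).trans hA₂U))
    have hl3 : relLen X₀ (X₀ ⊔ ⟪φ (e + y)⟫) = 1 := relLen_sup_span hw1 hw2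
    have hCe : C₁ ≤ C₁ ⊔ ⟪e⟫ := le_sup_left
    have hR1 : relLen (tS F C₁) (act φ (C₁ ⊔ ⟪e⟫) ⊔ tS F C₁) =
        1 + relLen (tS F (C₁ ⊔ ⟪e⟫)) (act φ C₁) + 1 := by
      rw [sup_eq_left.2 ((act_mono hCe).trans (h.trans (act_mono hCe))),
        relLen_add ((act_mono hCe).trans h) (act_mono hCe), relLen_add (act_mono hCe) h,
        relLen_act (hinj.mono (sup_le h₁ (span_le_restrict he))) hCe, relLen_tS hCe,
        relLen_sup_span heC hτe]
    rw [hX, relLen_add (hAleD.trans hDX₀) le_sup_left, relLen_add hAleD hDX₀, hl1, hl2, hl3, hR1]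
    ring
  · have hX : act φ (C₁ ⊔ B₂ ⊔ ⟪e + y⟫) ⊔ tS F A = (act φ (C₁ ⊔ ⟪e⟫) ⊔ tS F C₁) ⊔ tS F A := by
      have hφy : φ y ∈ tS F A := act_mono hC₂A (h (mem_act_of_mem (mem_sup_span_self _ _)))
      apply le_antisymm
      · refine sup_le ?_ le_sup_right
        rw [act_sup, act_sup, act_span_singleton]
        refine sup_le (sup_le ?_ ?_) ?_
        · exact le_sup_of_le_left (le_sup_of_le_left (act_mono le_sup_left))
        · exact le_sup_of_le_right ((act_mono le_sup_left).trans (h.trans (act_mono hC₂A)))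
        · rw [Submodule.span_singleton_le_iff_mem, map_add]
          exact Submodule.add_mem_sup (Submodule.mem_sup_left
            (mem_act_of_mem (mem_sup_span_self _ _))) hφy
      · refine sup_le (sup_le ?_ (le_sup_of_le_right (act_mono hC₁A))) le_sup_right
        rw [act_sup, act_span_singleton]
        refine sup_le (le_sup_of_le_left (act_mono (le_sup_left.trans le_sup_left))) ?_
        rw [Submodule.span_singleton_le_iff_mem]
        have : φ e = φ (e + y) - φ y := by rw [map_add]; abel
        rw [this]
        exact Submodule.sub_mem _ (Submodule.mem_sup_left
          (mem_act_of_mem (mem_sup_span_self _ _))) (Submodule.mem_sup_right hφy)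
    -- The remaining contribution lies in `U₁`, and the glued lattice meets `U₁` only in `C₁`
    -- because `y` is outside `C₂`.
    rw [hX, relLen_sup_of_inf (C := tS F C₁) ?_,
      relLen_eq_zero_iff.2 (sup_le ((act_mono le_sup_left).trans (h.trans (act_mono le_sup_left)))
        le_rfl : act φ B₂ ⊔ tS F (C₂ ⊔ ⟪y⟫) ≤ tS F (C₂ ⊔ ⟪y⟫)), add_zero]
    apply le_antisymm
    · rintro x ⟨hx, z, hz, rfl⟩
      change tEnd F V z ∈ _
      change tEnd F V z ∈ _ at hx
      refine mem_act_of_mem (mem_of_mem_glue hU h₁ hC₂ he hy hτe hyC hτy ?_ hz)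
      have : tEnd F V z ∈ U₁ := sup_le hφU₁ ((tS_le _).trans h₁) hx
      rw [tEnd_apply] at this
      exact (U₁.smul_mem_iff τ_ne_zero).1 this
    · exact le_inf le_sup_right (act_mono hC₁A)

end Glue

/-! ### Closed, open and glue lattices, and the gluing construction. -/

section Objects

/-- The number of boxes of the partition `d` outside of the first `j` columns. -/
def partSum (d : Multiset ℕ) (j : ℕ) : ℕ := (d.map (· - j)).sum

theorem partSum_add (d d' : Multiset ℕ) (j : ℕ) :
    partSum (d + d') j = partSum d j + partSum d' j := by simp [partSum]

theorem partSum_zero (j : ℕ) : partSum 0 j = 0 := rfl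

theorem partSum_replicate (a k j : ℕ) : partSum (Multiset.replicate a k) j = a * (k - j) := by
  simp [partSum]

theorem partSum_singleton (k j : ℕ) : partSum {k} j = k - j := by simp [partSum]

variable {F : Type*} [Field F] [Algebra O F] [IsFractionRing O F]
variable {V : Type*} [AddCommGroup V] [Module F V] [Module O V] [IsScalarTower O F V]

/-- The `𝒪`-submodule generated by `v`. -/
local notation "⟪" v "⟫" => Submodule.span O {v}

/-- The length of `(γ^j D + tA) / tA`. -/
def rankLen (γ : Module.End F V) (A D : Submodule O V) (j : ℕ) : ℕ∞ :=
  relLen (tS F A) (act (γ ^ j) D ⊔ tS F A)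

/-- A self-dual lattice in `U`, stable under `γ`, whose reduction has the partition `d`. -/
structure IsClosedLat (B : LinearMap.BilinForm F V) (γ : Module.End F V) (U : Submodule F V)
    (d : Multiset ℕ) (Λ : Submodule O V) : Prop where
  lat : IsLat U Λ
  dual : dualIn B U Λ = Λ
  stable : act γ Λ ≤ Λ
  rank : ∀ j, rankLen γ Λ Λ j = partSum d j

/-- A lattice `C` of index one in its dual `C + 𝒪 e`, with `γ (C + 𝒪 e) ⊆ C`. -/
structure IsOpenLat (B : LinearMap.BilinForm F V) (γ : Module.End F V) (U : Submodule F V)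
    (d : Multiset ℕ) (C : Submodule O V) (e : V) : Prop where
  lat : IsLat U C
  mem : e ∈ U
  notMem : e ∉ C
  smul_mem : τ F • e ∈ C
  dual : dualIn B U C = C ⊔ ⟪e⟫
  stable : act γ (C ⊔ ⟪e⟫) ≤ C
  rank : ∀ j, rankLen γ C (C ⊔ ⟪e⟫) j = partSum d j

/-- A lattice `P`, whose dual is `R + 𝒪 y`, prepared for being glued along `y` to an open
lattice. -/
structure IsGlueLat (B : LinearMap.BilinForm F V) (γ : Module.End F V) (U : Submodule F V)
    (d : Multiset ℕ) (P R : Submodule O V) (y : V) : Prop where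
  lat : IsLat U P
  le : P ≤ R
  mem : y ∈ U
  notMem : y ∉ P
  smul_mem : τ F • y ∈ P
  dual : dualIn B U P = R ⊔ ⟪y⟫
  norm : B y y ∉ (1 : Submodule O F)
  integral : ∀ r ∈ R, B r y ∈ (1 : Submodule O F)
  stable : act γ (R ⊔ ⟪y⟫) ≤ P
  rank : ∀ j, rankLen γ (P ⊔ ⟪y⟫) R j = partSum d j

variable {B : LinearMap.BilinForm F V} {γ : Module.End F V} {U₁ U₂ : Submodule F V}
  {d₁ d₂ : Multiset ℕ}

theorem dualIn_sup (hs : B.IsSymm) (horth : ∀ x ∈ U₁, ∀ y ∈ U₂, B x y = 0)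
    {A₁ A₂ : Submodule O V} (h₁ : A₁ ≤ U₁.restrictScalars O) (h₂ : A₂ ≤ U₂.restrictScalars O) :
    dualIn B (U₁ ⊔ U₂) (A₁ ⊔ A₂) = dualIn B U₁ A₁ ⊔ dualIn B U₂ A₂ := by
  have horth' : ∀ x ∈ U₂, ∀ y ∈ U₁, B x y = 0 := fun x hx y hy => by
    rw [hs.eq]; exact horth y hy x hx
  apply le_antisymm
  · intro z hz
    obtain ⟨z₁, hz₁, z₂, hz₂, rfl⟩ := Submodule.mem_sup.1 hz.2
    refine Submodule.add_mem_sup ⟨fun y hy => ?_, hz₁⟩ ⟨fun y hy => ?_, hz₂⟩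
    · have := hz.1 y (Submodule.mem_sup_left hy)
      rwa [map_add, LinearMap.add_apply, horth' z₂ hz₂ y (h₁ hy), add_zero] at this
    · have := hz.1 y (Submodule.mem_sup_right hy)
      rwa [map_add, LinearMap.add_apply, horth z₁ hz₁ y (h₂ hy), zero_add] at this
  · intro z hz
    obtain ⟨z₁, hz₁, z₂, hz₂, rfl⟩ := Submodule.mem_sup.1 hz
    refine ⟨fun y hy => ?_, Submodule.add_mem_sup hz₁.2 hz₂.2⟩
    obtain ⟨y₁, hy₁, y₂, hy₂, rfl⟩ := Submodule.mem_sup.1 hy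
    rw [LinearMap.map_add₂, map_add, map_add, horth z₁ hz₁.2 y₂ (h₂ hy₂),
      horth' z₂ hz₂.2 y₁ (h₁ hy₁), add_zero, zero_add]
    exact add_mem (hz₁.1 y₁ hy₁) (hz₂.1 y₂ hy₂)

theorem pow_mem_of_forall {U : Submodule F V} (h : ∀ x ∈ U, γ x ∈ U) (j : ℕ) :
    ∀ x ∈ U, (γ ^ j) x ∈ U := by
  induction j with
  | zero => intro x hx; simpa using hx
  | succ j ih => intro x hx; rw [pow_succ', Module.End.mul_apply]; exact h _ (ih x hx)

theorem pow_injOn {U : Submodule F V} (h : ∀ x ∈ U, γ x ∈ U) (hi : Set.InjOn γ U) (j : ℕ) :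
    Set.InjOn (γ ^ j) U := by
  induction j with
  | zero => intro x _ y _ hxy; simpa using hxy
  | succ j ih =>
    intro x hx y hy hxy
    rw [pow_succ', Module.End.mul_apply, Module.End.mul_apply] at hxy
    exact ih hx hy (hi (pow_mem_of_forall h j x hx) (pow_mem_of_forall h j y hy) hxy)

theorem rankLen_sup (hU : Disjoint U₁ U₂) (hU₁ : ∀ x ∈ U₁, γ x ∈ U₁) (hU₂ : ∀ x ∈ U₂, γ x ∈ U₂)
    {A₁ D₁ A₂ D₂ : Submodule O V} (hA₁ : A₁ ≤ U₁.restrictScalars O)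
    (hD₁ : D₁ ≤ U₁.restrictScalars O) (hA₂ : A₂ ≤ U₂.restrictScalars O)
    (hD₂ : D₂ ≤ U₂.restrictScalars O) (j : ℕ) :
    rankLen γ (A₁ ⊔ A₂) (D₁ ⊔ D₂) j = rankLen γ A₁ D₁ j + rankLen γ A₂ D₂ j := by
  have hj : ∀ {U : Submodule F V} {A D : Submodule O V}, (∀ x ∈ U, γ x ∈ U) →
      A ≤ U.restrictScalars O → D ≤ U.restrictScalars O →
      act (γ ^ j) D ⊔ tS F A ≤ U.restrictScalars O := fun h hA hD =>
    sup_le (act_le.2 fun x hx => pow_mem_of_forall h j x (hD hx)) ((tS_le _).trans hA)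
  rw [rankLen, act_sup, tS_sup, sup_sup_sup_comm]
  exact relLen_sup_sup (disjoint_restrictScalars hU) le_sup_right le_sup_right
    (hj hU₁ hA₁ hD₁) (hj hU₂ hA₂ hD₂)

theorem IsClosedLat.sup (hs : B.IsSymm) (hU : Disjoint U₁ U₂)
    (horth : ∀ x ∈ U₁, ∀ y ∈ U₂, B x y = 0)
    (hU₁ : ∀ x ∈ U₁, γ x ∈ U₁) (hU₂ : ∀ x ∈ U₂, γ x ∈ U₂) {Λ₁ Λ₂ : Submodule O V}
    (h₁ : IsClosedLat B γ U₁ d₁ Λ₁) (h₂ : IsClosedLat B γ U₂ d₂ Λ₂) :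
    IsClosedLat B γ (U₁ ⊔ U₂) (d₁ + d₂) (Λ₁ ⊔ Λ₂) where
  lat := h₁.lat.sup h₂.lat
  dual := by rw [dualIn_sup hs horth h₁.lat.le h₂.lat.le, h₁.dual, h₂.dual]
  stable := by rw [act_sup]; exact sup_le_sup h₁.stable h₂.stable
  rank j := by
    rw [rankLen_sup hU hU₁ hU₂ h₁.lat.le h₁.lat.le h₂.lat.le h₂.lat.le, h₁.rank, h₂.rank,
      partSum_add]
    norm_cast

theorem IsOpenLat.le {U : Submodule F V} {d : Multiset ℕ} {C : Submodule O V} {e : V}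
    (h : IsOpenLat B γ U d C e) : C ⊔ ⟪e⟫ ≤ U.restrictScalars O :=
  sup_le h.lat.le (span_le_restrict h.mem)

theorem IsOpenLat.sup (hs : B.IsSymm) (hU : Disjoint U₁ U₂)
    (horth : ∀ x ∈ U₁, ∀ y ∈ U₂, B x y = 0)
    (hU₁ : ∀ x ∈ U₁, γ x ∈ U₁) (hU₂ : ∀ x ∈ U₂, γ x ∈ U₂) {C Λ : Submodule O V} {e : V}
    (h₁ : IsOpenLat B γ U₁ d₁ C e) (h₂ : IsClosedLat B γ U₂ d₂ Λ) :
    IsOpenLat B γ (U₁ ⊔ U₂) (d₁ + d₂) (C ⊔ Λ) e := by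
  have hC : C ⊔ Λ ⊔ ⟪e⟫ = C ⊔ ⟪e⟫ ⊔ Λ := by rw [sup_assoc, sup_comm Λ, ← sup_assoc]
  refine ⟨h₁.lat.sup h₂.lat, Submodule.mem_sup_left h₁.mem, fun he => h₁.notMem ?_,
    Submodule.mem_sup_left h₁.smul_mem, ?_, ?_, fun j => ?_⟩
  · exact (mem_of_add_mem_sup hU h₁.lat.le h₂.lat.le h₁.mem U₂.zero_mem
      (by rwa [add_zero])).1
  · rw [dualIn_sup hs horth h₁.lat.le h₂.lat.le, h₁.dual, h₂.dual, hC]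
  · rw [hC, act_sup]; exact sup_le_sup h₁.stable h₂.stable
  · rw [hC, rankLen_sup hU hU₁ hU₂ h₁.lat.le h₁.le h₂.lat.le h₂.lat.le, h₁.rank, h₂.rank,
      partSum_add]
    norm_cast

theorem cst_smul (c : ℂ) (x : V) : cst F c • x = (PowerSeries.C c : O) • x :=
  algebraMap_smul F _ x

theorem span_cst_smul {c : ℂ} (hc : c ≠ 0) (x : V) : ⟪cst F c • x⟫ = ⟪x⟫ := by
  rw [cst_smul]
  exact Submodule.span_singleton_smul_eq ((isUnit_iff_ne_zero.2 hc).map _) x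

/-- If the norm of `e` were integral, `e` would pair integrally with all of `C + 𝒪 e = C^∨` and so
lie in the double dual, which is `C`. -/
theorem IsOpenLat.norm (hs : B.IsSymm) {U : Submodule F V} (hU : NondegOn B U) {d : Multiset ℕ}
    {C : Submodule O V} {e : V} (h : IsOpenLat B γ U d C e) : B e e ∉ (1 : Submodule O F) := by
  intro he
  apply h.notMem
  rw [← h.lat.dualIn_dualIn hs hU, h.dual]
  refine ⟨fun y hy => ?_, h.mem⟩
  obtain ⟨c, hc, a, rfl⟩ := mem_sup_span.1 hy
  have hed : e ∈ dualIn B U C := by rw [h.dual]; exact mem_sup_span_self _ _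
  rw [map_add, ← algebraMap_smul F a e, map_smul]
  exact add_mem (hed.1 c hc) (mul_mem_one (algebraMap_mem_one a) he)

theorem mul_notMem_one {a : O} {x : F} (hx : x ∉ (1 : Submodule O F))
    (h : algebraMap O F a * x ∈ (1 : Submodule O F)) : ∃ b, a = b * PowerSeries.X := by
  obtain ⟨c, b, rfl⟩ := exists_const a
  by_cases hc : c = 0
  · exact ⟨b, by simp [hc]⟩
  · exfalso
    have hu : IsUnit (PowerSeries.C c + b * PowerSeries.X : O) := by
      rw [PowerSeries.isUnit_iff_constantCoeff]; simpa using hc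
    obtain ⟨u, hu⟩ := hu
    rw [← hu] at h
    apply hx
    have := mul_mem_one (algebraMap_mem_one (F := F) (↑u⁻¹ : O)) h
    rwa [← mul_assoc, ← map_mul, Units.inv_mul, map_one, one_mul] at this

/-- Gluing an open lattice to a second one. -/
theorem IsOpenLat.glue (hs : B.IsSymm) (hU : Disjoint U₁ U₂)
    (horth : ∀ x ∈ U₁, ∀ y ∈ U₂, B x y = 0) (hB₁ : NondegOn B U₁)
    (hU₁ : ∀ x ∈ U₁, γ x ∈ U₁) (hU₂ : ∀ x ∈ U₂, γ x ∈ U₂) (hinj : Set.InjOn γ U₁)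
    {C P R : Submodule O V} {e y : V}
    (h₁ : IsOpenLat B γ U₁ d₁ C e) (h₂ : IsGlueLat B γ U₂ d₂ P R y)
    (h : ∀ j, tS F (C ⊔ ⟪e⟫) ≤ act (γ ^ j) C ∨ act (γ ^ j) (R ⊔ ⟪y⟫) ≤ tS F P) :
    ∃ w : V, IsLat (U₁ ⊔ U₂) (C ⊔ P ⊔ ⟪w⟫) ∧
      dualIn B (U₁ ⊔ U₂) (C ⊔ P ⊔ ⟪w⟫) = C ⊔ R ⊔ ⟪w⟫ ∧
      act γ (C ⊔ R ⊔ ⟪w⟫) ≤ C ⊔ P ∧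
      (∀ j, rankLen γ (C ⊔ P ⊔ ⟪w⟫) (C ⊔ R ⊔ ⟪w⟫) j = partSum (d₁ + d₂) j) ∧
      (∀ j, tS F (C ⊔ ⟪e⟫) ≤ act (γ ^ j) C → tS F (R ⊔ ⟪y⟫) ≤ act (γ ^ j) P →
        tS F (C ⊔ R ⊔ ⟪w⟫) ≤ act (γ ^ j) (C ⊔ P ⊔ ⟪w⟫)) ∧
      (∀ x ∈ U₂, x ∈ C ⊔ P ⊔ ⟪w⟫ → x ∈ P) := by
  have hen := h₁.norm hs hB₁
  have hRU : R ⊔ ⟪y⟫ ≤ U₂.restrictScalars O := h₂.dual ▸ dualIn_le _ _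
  have hed : e ∈ dualIn B U₁ C := by rw [h₁.dual]; exact mem_sup_span_self _ _
  have hyd : y ∈ dualIn B U₂ P := by rw [h₂.dual]; exact mem_sup_span_self _ _
  -- By orthogonality the norm of `e + c y` is `B e e + c² B y y`, without a linear term; both
  -- values have at most a simple pole and the second is not integral.
  obtain ⟨c, hc⟩ := exists_quadratic_mem (a := B e e) (b := 0) (d := B y y)
    (by rw [← smul_eq_mul, ← map_smul]; exact hed.1 _ h₁.smul_mem) (by simp)
    (by rw [← smul_eq_mul, ← map_smul]; exact hyd.1 _ h₂.smul_mem) h₂.norm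
  have hc0 : c ≠ 0 := by
    rintro rfl
    rw [cst_zero] at hc
    exact hen (by simpa using hc)
  set y' := cst F c • y with hy'
  have hsp : ⟪y'⟫ = ⟪y⟫ := span_cst_smul hc0 y
  have hy'U : y' ∈ U₂ := U₂.smul_mem _ h₂.mem
  have hy'P : y' ∉ P := by
    rw [← Submodule.span_singleton_le_iff_mem, hsp, Submodule.span_singleton_le_iff_mem]
    exact h₂.notMem
  have hτy' : τ F • y' ∈ P := by
    rw [hy', smul_comm, cst_smul]; exact P.smul_mem _ h₂.smul_mem
  have hw : B (e + y') (e + y') ∈ (1 : Submodule O F) := by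
    have : B (e + y') (e + y') = B e e + cst F c * 0 + cst F c ^ 2 * B y y := by
      simp only [map_add, LinearMap.add_apply]
      rw [horth e h₁.mem y' hy'U, hs.eq y' e, horth e h₁.mem y' hy'U, hy', map_smul,
        map_smul, LinearMap.smul_apply, smul_eq_mul, smul_eq_mul]
      ring
    rwa [this]
  have hinR : ∀ r ∈ R, B r y' ∈ (1 : Submodule O F) := fun r hr => by
    rw [hy', map_smul]; exact mul_mem_one (cst_mem_one c) (h₂.integral r hr)
  have hRU' : R ≤ U₂.restrictScalars O := le_sup_left.trans hRU
  have hdual : dualIn B U₂ P = R ⊔ ⟪y'⟫ := by rw [hsp]; exact h₂.dual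
  have hy'd : y' ∈ dualIn B U₂ P := by rw [hdual]; exact mem_sup_span_self _ _
  have hCR : ∀ z ∈ C ⊔ R, B z (e + y') ∈ (1 : Submodule O F) := by
    intro z hz
    obtain ⟨c, hc, r, hr, rfl⟩ := Submodule.mem_sup.1 hz
    simp only [map_add, LinearMap.add_apply]
    rw [horth c (h₁.lat.le hc) y' hy'U, hs.eq r e, horth e h₁.mem r (hRU' hr), add_zero, zero_add,
      hs.eq c e]
    exact add_mem (hed.1 c hc) (hinR r hr)
  have hdle : dualIn B (U₁ ⊔ U₂) (C ⊔ P) = (C ⊔ ⟪e⟫) ⊔ (R ⊔ ⟪y'⟫) := by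
    rw [dualIn_sup hs horth h₁.lat.le h₂.lat.le, h₁.dual, hdual]
  refine ⟨e + y', (h₁.lat.sup h₂.lat).sup_span
      (U := U₁ ⊔ U₂) (Submodule.add_mem_sup h₁.mem hy'U), ?_, ?_, fun j => ?_, fun j hj₁ hj₂ => ?_,
      fun x hx hxA => ?_⟩
  · apply le_antisymm
    · intro z hz
      have hz' := dualIn_anti (B := B) (U₁ ⊔ U₂) (le_sup_left : C ⊔ P ≤ C ⊔ P ⊔ ⟪e + y'⟫) hz
      rw [hdle] at hz'
      obtain ⟨z₁, hz₁, z₂, hz₂, rfl⟩ := Submodule.mem_sup.1 hz'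
      obtain ⟨c₀, hc₀, a, rfl⟩ := mem_sup_span.1 hz₁
      obtain ⟨r, hr, b, rfl⟩ := mem_sup_span.1 hz₂
      -- Modulo `C + R` and the gluing vector only a multiple of `e` is left. It pairs with the
      -- gluing vector to `(a - b) B e e`, which is integral only if `t` divides `a - b`; and `t e`
      -- lies in `C`.
      have e1 : c₀ + a • e + (r + b • y') = (c₀ + r) + (a - b) • e + b • (e + y') := by
        rw [sub_smul, smul_add]; abel
      have h2 := hz.1 (e + y') (mem_sup_span_self _ _)
      rw [e1] at h2 ⊢
      have h3 : B ((a - b) • e) (e + y') ∈ (1 : Submodule O F) := by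
        rw [LinearMap.map_add₂, LinearMap.map_add₂] at h2
        have h4 : B (b • (e + y')) (e + y') ∈ (1 : Submodule O F) := by
          rw [← algebraMap_smul F b, map_smul, LinearMap.smul_apply]
          exact mul_mem_one (algebraMap_mem_one b) hw
        rw [add_mem_cancel_right h4] at h2
        rwa [add_mem_cancel_left (hCR _ (Submodule.add_mem_sup hc₀ hr))] at h2
      rw [← algebraMap_smul F (a - b), map_smul, LinearMap.smul_apply, smul_eq_mul, map_add,
        horth e h₁.mem y' hy'U, add_zero] at h3
      obtain ⟨f, hf⟩ := mul_notMem_one hen h3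
      rw [hf, mul_smul, ← τ_smul (F := F)]
      refine Submodule.add_mem _ (Submodule.mem_sup_left (Submodule.add_mem _
        (Submodule.add_mem_sup hc₀ hr) (Submodule.mem_sup_left (C.smul_mem f h₁.smul_mem)))) ?_
      exact Submodule.smul_mem _ b (mem_sup_span_self _ _)
    · intro z hz
      obtain ⟨u, hu, b, rfl⟩ := mem_sup_span.1 hz
      have huU : u ∈ dualIn B (U₁ ⊔ U₂) (C ⊔ P) := by
        rw [hdle]
        exact (sup_le_sup le_sup_left le_sup_left : C ⊔ R ≤ (C ⊔ ⟪e⟫) ⊔ (R ⊔ ⟪y'⟫)) hu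
      refine ⟨fun v hv => ?_, Submodule.add_mem _ huU.2 ((Submodule.smul_mem
        ((U₁ ⊔ U₂).restrictScalars O) b (Submodule.add_mem_sup h₁.mem hy'U)))⟩
      obtain ⟨u', hu', a, rfl⟩ := mem_sup_span.1 hv
      rw [LinearMap.map_add₂, map_add, map_add, ← algebraMap_smul F a, ← algebraMap_smul F b]
      simp only [map_smul, LinearMap.smul_apply, smul_eq_mul]
      refine add_mem (add_mem (huU.1 u' hu') (mul_mem_one (algebraMap_mem_one a) (hCR u hu)))
        (add_mem (mul_mem_one (algebraMap_mem_one b) ?_) (mul_mem_one (algebraMap_mem_one a)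
          (mul_mem_one (algebraMap_mem_one b) hw)))
      rw [hs.eq]
      exact hCR u' (sup_le_sup_left h₂.le C hu')
  · have hle : C ⊔ R ⊔ ⟪e + y'⟫ ≤ (C ⊔ ⟪e⟫) ⊔ (R ⊔ ⟪y⟫) := by
      refine sup_le (sup_le_sup le_sup_left le_sup_left) ?_
      rw [Submodule.span_singleton_le_iff_mem, ← hsp]
      exact Submodule.add_mem_sup (mem_sup_span_self _ _) (mem_sup_span_self _ _)
    refine (act_mono hle).trans ?_
    rw [act_sup]
    exact sup_le_sup h₁.stable h₂.stable
  · rw [rankLen, relLen_glue_aux hU h₁.lat.le h₂.le hRU' h₁.mem h₁.notMem h₁.smul_mem hy'U hy'P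
      hτy' (pow_mem_of_forall hU₁ j) (pow_mem_of_forall hU₂ j) (pow_injOn hU₁ hinj j)
      (by rw [hsp]; exact h j), hsp]
    have r₁ := h₁.rank j
    have r₂ := h₂.rank j
    rw [rankLen] at r₁ r₂
    rw [r₁, r₂, partSum_add]
    norm_cast
  · rw [tS_sup, tS_sup]
    have hC : act (γ ^ j) C ≤ act (γ ^ j) (C ⊔ P ⊔ ⟪e + y'⟫) :=
      act_mono (le_sup_left.trans le_sup_left)
    have hP : act (γ ^ j) P ≤ act (γ ^ j) (C ⊔ P ⊔ ⟪e + y'⟫) :=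
      act_mono (le_sup_right.trans le_sup_left)
    refine sup_le (sup_le (((act_mono le_sup_left).trans hj₁).trans hC)
      (((act_mono le_sup_left).trans hj₂).trans hP)) ?_
    rw [tS_span_singleton, Submodule.span_singleton_le_iff_mem, map_add]
    refine Submodule.add_mem _ (hC (hj₁ (mem_act_of_mem (mem_sup_span_self _ _))))
      (hP (hj₂ (mem_act_of_mem ?_)))
    rw [← hsp]
    exact mem_sup_span_self _ _
  -- The intersection with the second summand is found by exchanging the roles of `e` and `y'`.
  · rw [sup_comm C P, add_comm e y'] at hxA
    exact mem_of_mem_glue hU.symm h₂.lat.le h₁.lat.le hy'U h₁.mem hτy' h₁.notMem h₁.smul_mem hx hxA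

/-- Gluing an open lattice to a lowered one. -/
theorem IsOpenLat.exists_closed (hs : B.IsSymm) (hU : Disjoint U₁ U₂)
    (horth : ∀ x ∈ U₁, ∀ y ∈ U₂, B x y = 0) (hB₁ : NondegOn B U₁)
    (hU₁ : ∀ x ∈ U₁, γ x ∈ U₁) (hU₂ : ∀ x ∈ U₂, γ x ∈ U₂) (hinj : Set.InjOn γ U₁)
    {C P : Submodule O V} {e y : V}
    (h₁ : IsOpenLat B γ U₁ d₁ C e) (h₂ : IsGlueLat B γ U₂ d₂ P P y)
    (h : ∀ j, tS F (C ⊔ ⟪e⟫) ≤ act (γ ^ j) C ∨ act (γ ^ j) (P ⊔ ⟪y⟫) ≤ tS F P) :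
    ∃ Λ : Submodule O V, IsClosedLat B γ (U₁ ⊔ U₂) (d₁ + d₂) Λ := by
  obtain ⟨w, h3, h4, h5, h6, -⟩ := h₁.glue hs hU horth hB₁ hU₁ hU₂ hinj h₂ h
  exact ⟨_, h3, h4, h5.trans le_sup_left, h6⟩

/-- Gluing an open lattice to one that passes the defect on to `x`. -/
theorem IsOpenLat.exists_open (hs : B.IsSymm) (hU : Disjoint U₁ U₂)
    (horth : ∀ x ∈ U₁, ∀ y ∈ U₂, B x y = 0) (hB₁ : NondegOn B U₁)
    (hU₁ : ∀ x ∈ U₁, γ x ∈ U₁) (hU₂ : ∀ x ∈ U₂, γ x ∈ U₂) (hinj : Set.InjOn γ U₁)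
    {C P : Submodule O V} {e x y : V}
    (h₁ : IsOpenLat B γ U₁ d₁ C e) (h₂ : IsGlueLat B γ U₂ d₂ P (P ⊔ ⟪x⟫) y)
    (hx : x ∉ P) (hτx : τ F • x ∈ P)
    (h : ∀ j, tS F (C ⊔ ⟪e⟫) ≤ act (γ ^ j) C ∨ act (γ ^ j) (P ⊔ ⟪x⟫ ⊔ ⟪y⟫) ≤ tS F P) :
    ∃ C' : Submodule O V, IsOpenLat B γ (U₁ ⊔ U₂) (d₁ + d₂) C' x ∧
      ∀ j, tS F (C ⊔ ⟪e⟫) ≤ act (γ ^ j) C → tS F (P ⊔ ⟪x⟫ ⊔ ⟪y⟫) ≤ act (γ ^ j) P →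
        tS F (C' ⊔ ⟪x⟫) ≤ act (γ ^ j) C' := by
  obtain ⟨w, h3, h4, h5, h6, h7, h8⟩ := h₁.glue hs hU horth hB₁ hU₁ hU₂ hinj h₂ h
  -- The dual of the glued lattice is that lattice together with `x`, which thus becomes the new
  -- defect.
  have e1 : C ⊔ (P ⊔ ⟪x⟫) ⊔ ⟪w⟫ = C ⊔ P ⊔ ⟪w⟫ ⊔ ⟪x⟫ := by
    rw [← sup_assoc, sup_assoc, sup_comm ⟪x⟫, ← sup_assoc]
  have hxU : x ∈ U₂ := by
    have : x ∈ dualIn B U₂ P := by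
      rw [h₂.dual]; exact Submodule.mem_sup_left (mem_sup_span_self _ _)
    exact this.2
  rw [e1] at h4 h5 h6 h7
  exact ⟨C ⊔ P ⊔ ⟪w⟫, ⟨h3, Submodule.mem_sup_right hxU, fun hx' => hx (h8 x hxU hx'),
    Submodule.mem_sup_left (Submodule.mem_sup_right hτx), h4, h5.trans le_sup_left, h6⟩, h7⟩

end Objects

/-! ### The monomials `t^b γ^a` and the lattices adapted to a slope. -/

section Monomials

variable {F : Type*} [Field F] [Algebra O F] [IsFractionRing O F]
variable {V : Type*} [AddCommGroup V] [Module F V] [Module O V] [IsScalarTower O F V]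

variable (F V) in
/-- Multiplication by `t` as a unit. -/
def tUnit : (Module.End F V)ˣ :=
  Units.map (algebraMap F (Module.End F V)).toMonoidHom (Units.mk0 (τ F) τ_ne_zero)

theorem coe_tUnit : (tUnit F V : Module.End F V) = tEnd F V := rfl

theorem commute_tUnit (γ : (Module.End F V)ˣ) : Commute (tUnit F V) γ :=
  Units.ext (commute_tEnd (γ : Module.End F V)).eq

/-- The operator `t ^ b γ ^ a`. -/
def mon (γ : (Module.End F V)ˣ) (a b : ℤ) : (Module.End F V)ˣ := tUnit F V ^ b * γ ^ a

variable (γ : (Module.End F V)ˣ)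

theorem mon_add (a b a' b' : ℤ) : mon γ (a + a') (b + b') = mon γ a b * mon γ a' b' := by
  have h := ((commute_tUnit γ).zpow_zpow b' a).eq
  rw [mon, mon, mon, zpow_add, zpow_add, mul_assoc, mul_assoc, ← mul_assoc (tUnit F V ^ b') (γ ^ a),
    h, mul_assoc]

theorem mon_zero : mon γ 0 0 = 1 := by simp [mon]

theorem coe_mon_nat (j : ℕ) : (mon γ j 0 : Module.End F V) = (γ : Module.End F V) ^ j := by
  simp [mon]

theorem coe_mon_one : (mon γ 1 0 : Module.End F V) = γ := by simp [mon]

theorem coe_mon_t : (mon γ 0 1 : Module.End F V) = tEnd F V := by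
  simp [mon, coe_tUnit]

theorem coe_mon_t_nat (j : ℕ) : (mon γ 0 j : Module.End F V) = tEnd F V ^ j := by
  simp [mon, coe_tUnit]

theorem mon_apply_mon (a b a' b' : ℤ) (x : V) :
    (mon γ a b : Module.End F V) ((mon γ a' b' : Module.End F V) x) =
      (mon γ (a + a') (b + b') : Module.End F V) x := by
  rw [mon_add, Units.val_mul, Module.End.mul_apply]

theorem mon_zero_apply (x : V) : (mon γ 0 0 : Module.End F V) x = x := by
  rw [mon_zero]; rfl

theorem X_pow_smul_mon (a b : ℤ) (c : ℕ) (x : V) :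
    (PowerSeries.X : O) ^ c • (mon γ a b : Module.End F V) x =
      (mon γ a (b + c) : Module.End F V) x := by
  have := mon_apply_mon γ 0 c a b x
  rw [coe_mon_t_nat, tEnd_pow_apply, zero_add, add_comm] at this
  rw [← this, τ, ← map_pow, algebraMap_smul]

theorem mon_injective (a b : ℤ) : Function.Injective (mon γ a b : Module.End F V) := by
  intro x y h
  have := congrArg (mon γ (-a) (-b) : Module.End F V) h
  simpa [mon_apply_mon, mon_zero_apply] using this

theorem commute_mon (a b a' b' : ℤ) :
    Commute (mon γ a b : Module.End F V) (mon γ a' b' : Module.End F V) := by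
  rw [Commute, SemiconjBy, ← Units.val_mul, ← Units.val_mul, ← mon_add, ← mon_add, add_comm a,
    add_comm b]

/-- The lattice `t ^ b γ ^ a A`. -/
def shift (a b : ℤ) (A : Submodule O V) : Submodule O V := act (mon γ a b : Module.End F V) A

variable {γ}

theorem mem_shift_of_mem {A : Submodule O V} {x : V} (h : x ∈ A) (a b : ℤ) :
    (mon γ a b : Module.End F V) x ∈ shift γ a b A := mem_act_of_mem h

theorem shift_mono {A A' : Submodule O V} (h : A ≤ A') (a b : ℤ) :
    shift γ a b A ≤ shift γ a b A' := act_mono h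

theorem shift_shift (a b a' b' : ℤ) (A : Submodule O V) :
    shift γ a b (shift γ a' b' A) = shift γ (a + a') (b + b') A := by
  rw [shift, shift, shift, mon_add, Units.val_mul, act_mul]

theorem shift_zero (A : Submodule O V) : shift γ 0 0 A = A := by
  rw [shift, mon_zero]; exact act_one A

theorem shift_sup (a b : ℤ) (A A' : Submodule O V) :
    shift γ a b (A ⊔ A') = shift γ a b A ⊔ shift γ a b A' := act_sup _ _ _

theorem shift_span_singleton (a b : ℤ) (x : V) :
    shift γ a b (Submodule.span O {x}) = Submodule.span O {(mon γ a b : Module.End F V) x} :=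
  act_span_singleton _ _

theorem act_pow_eq_shift (j : ℕ) (A : Submodule O V) :
    act ((γ : Module.End F V) ^ j) A = shift γ j 0 A := by rw [shift, coe_mon_nat]

theorem act_eq_shift (A : Submodule O V) :
    act (γ : Module.End F V) A = shift γ 1 0 A := by rw [shift, coe_mon_one]

theorem tS_eq_shift (A : Submodule O V) : tS F A = shift γ 0 1 A := by rw [shift, coe_mon_t]

theorem relLen_shift {A A' : Submodule O V} (h : A ≤ A') (a b : ℤ) :
    relLen (shift γ a b A) (shift γ a b A') = relLen A A' :=
  relLen_act (mon_injective γ a b).injOn h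

theorem shift_le_iff {A A' : Submodule O V} {a b : ℤ} :
    shift γ a b A ≤ A' ↔ A ≤ shift γ (-a) (-b) A' := by
  constructor <;> intro h
  · have := shift_mono h (γ := γ) (-a) (-b)
    rwa [shift_shift, neg_add_cancel, neg_add_cancel, shift_zero] at this
  · have := shift_mono h (γ := γ) a b
    rwa [shift_shift, add_neg_cancel, add_neg_cancel, shift_zero] at this

theorem IsLat.shift {A : Submodule O V} (h : IsLat (⊤ : Submodule F V) A) (a b : ℤ) :
    IsLat (⊤ : Submodule F V) (SOOdd.shift γ a b A) := by
  have := h.act (mon γ a b : Module.End F V)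
  rwa [show (⊤ : Submodule F V).map (mon γ a b : Module.End F V) = ⊤ from ?_] at this
  rw [Submodule.map_top, LinearMap.range_eq_top]
  intro x
  exact ⟨(mon γ (-a) (-b) : Module.End F V) x, by
    rw [mon_apply_mon, add_neg_cancel, add_neg_cancel, mon_zero_apply]⟩

variable (γ) in
/-- `A` is stable under all monomials of non-negative weight, where `γ` has weight `m` and `t` has
weight `N`. -/
def Adapted (N m : ℕ) (A : Submodule O V) : Prop :=
  ∀ a b : ℤ, 0 ≤ b * N + a * m → shift γ a b A ≤ A

variable {N m : ℕ}

/-- The quotient of the two monomials has non-negative weight. Thus the shifts of an adapted lattice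
form a chain indexed by the weight alone, which reduces all later inclusions to linear inequalities.
-/
theorem Adapted.shift_le {A : Submodule O V} (h : Adapted γ N m A) {a b a' b' : ℤ}
    (hab : b' * N + a' * m ≤ b * N + a * m) : shift γ a b A ≤ shift γ a' b' A := by
  have h1 := shift_mono (γ := γ) (h (a - a') (b - b') (by linarith)) a' b'
  rwa [shift_shift, add_sub_cancel, add_sub_cancel] at h1

theorem Adapted.shift_eq {A : Submodule O V} (h : Adapted γ N m A) {a b a' b' : ℤ}
    (hab : b' * N + a' * m = b * N + a * m) : shift γ a b A = shift γ a' b' A :=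
  le_antisymm (h.shift_le hab.le) (h.shift_le hab.ge)

theorem Adapted.shift {A : Submodule O V} (h : Adapted γ N m A) (a b : ℤ) :
    Adapted γ N m (SOOdd.shift γ a b A) := by
  intro c d hcd
  rw [shift_shift, add_comm c, add_comm d, ← shift_shift]
  exact shift_mono (h c d hcd) a b

theorem Adapted.sup {A A' : Submodule O V} (h : Adapted γ N m A) (h' : Adapted γ N m A') :
    Adapted γ N m (A ⊔ A') := by
  intro a b hab
  rw [shift_sup]
  exact sup_le_sup (h a b hab) (h' a b hab)

theorem relLen_shift_pow {A : Submodule O V} {a b : ℤ} (h : SOOdd.shift γ a b A ≤ A) (e : ℕ) :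
    SOOdd.shift γ (e * a) (e * b) A ≤ A ∧
      relLen (SOOdd.shift γ (e * a) (e * b) A) A = e * relLen (SOOdd.shift γ a b A) A := by
  induction e with
  | zero => simp [shift_zero, relLen_self]
  | succ e ih =>
    have h1 : SOOdd.shift γ ((e + 1 : ℕ) * a) ((e + 1 : ℕ) * b) A =
        SOOdd.shift γ (e * a) (e * b) (SOOdd.shift γ a b A) := by
      rw [shift_shift]; push_cast; rw [add_one_mul, add_one_mul]
    rw [h1]
    have h2 := shift_mono h (γ := γ) (e * a) (e * b)
    refine ⟨h2.trans ih.1, ?_⟩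
    rw [relLen_add h2 ih.1, relLen_shift h, ih.2]
    push_cast; ring

/-- The index of the shift of an adapted lattice is its weight. -/
theorem Adapted.relLen_shift {A : Submodule O V} (h : Adapted γ N m A) (hA : IsLat (⊤ : Submodule F V) A)
    (hN : Module.finrank F V = N) (hN0 : 0 < N) {a b : ℤ} {w : ℕ} (hw : b * N + a * m = w) :
    relLen (SOOdd.shift γ a b A) A = w := by
  have h0 : SOOdd.shift γ a b A ≤ A := h a b (by rw [hw]; positivity)
  have h1 := (relLen_shift_pow h0 N).2
  -- The `N`-th power of the monomial has the weight of `t^w`, whose index is `w N` because the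
  -- space has dimension `N`. Dividing by `N` gives the index of the monomial.
  have h2 : SOOdd.shift γ (N * a) (N * b) A = SOOdd.shift γ 0 w A :=
    h.shift_eq (by rw [← hw]; ring)
  rw [h2, SOOdd.shift, coe_mon_t_nat, hA.relLen_tS_pow, finrank_top, hN] at h1
  have hn := (hA.shift (γ := γ) a b).relLen_ne_top hA h0
  lift relLen (SOOdd.shift γ a b A) A to ℕ using hn with r
  norm_cast at h1 ⊢
  have : N * w = N * r := by rw [← h1]; ring
  exact (Nat.eq_of_mul_eq_mul_left hN0 this).symm

theorem Adapted.relLen_shift_shift {A : Submodule O V} (h : Adapted γ N m A) (hA : IsLat (⊤ : Submodule F V) A)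
    (hN : Module.finrank F V = N) (hN0 : 0 < N) {a b a' b' : ℤ} {w : ℕ}
    (hw : b * N + a * m = b' * N + a' * m + w) :
    relLen (SOOdd.shift γ a b A) (SOOdd.shift γ a' b' A) = w := by
  have h1 : relLen (SOOdd.shift γ (a - a') (b - b') A) A = w :=
    h.relLen_shift hA hN hN0 (by linarith)
  rw [← h1, ← SOOdd.relLen_shift (γ := γ) (h (a - a') (b - b') (by linarith)) a' b', shift_shift,
    add_sub_cancel, add_sub_cancel]

end Monomials

/-! ### Adapted lattices from a polynomial with a single slope. -/

section SingleSlope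

variable {F : Type*} [Field F] [Algebra O F] [IsFractionRing O F]
variable {V : Type*} [AddCommGroup V] [Module F V] [Module O V] [IsScalarTower O F V]

theorem IsSingleSlope.exists_coeff {f : O[X]} (hf : IsSingleSlope f) {j : ℕ}
    (hj : j ≤ f.natDegree) : ∃ (c : ℕ) (b : O), f.coeff j = b * PowerSeries.X ^ c ∧
      (f.natDegree - j) * ordConst f ≤ f.natDegree * c := by
  have h := hf.2.2.2 (f.natDegree - j) (Nat.sub_le _ _)
  rw [Nat.sub_sub_self hj] at h
  by_cases h0 : f.coeff j = 0
  -- A vanishing coefficient has infinite order; any sufficiently large exponent may be used for it.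
  · exact ⟨(f.natDegree - j) * ordConst f, 0, by simp [h0],
      Nat.le_mul_of_pos_left _ hf.2.1⟩
  · obtain ⟨b, hb⟩ := PowerSeries.X_pow_order_dvd (φ := f.coeff j)
    have hne : (f.coeff j).order ≠ ⊤ := fun h => h0 (PowerSeries.order_eq_top.1 h)
    refine ⟨(f.coeff j).order.toNat, b, by rw [mul_comm]; exact hb, ?_⟩
    rw [← ENat.natCast_toNat hne] at h
    exact_mod_cast h

theorem exists_unit_coeff_zero {f : O[X]} (hf : f.coeff 0 ≠ 0) :
    ∃ u : Oˣ, f.coeff 0 = (u : O) * PowerSeries.X ^ ordConst f := by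
  obtain ⟨b, hb⟩ := PowerSeries.X_pow_order_dvd (φ := f.coeff 0)
  have hu : IsUnit b := by
    rw [PowerSeries.isUnit_iff_constantCoeff, isUnit_iff_ne_zero]
    intro h0
    have h1 := congrArg (PowerSeries.coeff (f.coeff 0).order.toNat) hb
    rw [mul_comm, PowerSeries.coeff_mul_X_pow', if_pos le_rfl, Nat.sub_self,
      PowerSeries.coeff_zero_eq_constantCoeff, h0] at h1
    exact PowerSeries.coeff_order hf h1
  obtain ⟨u, rfl⟩ := hu
  exact ⟨u, by rw [mul_comm]; exact hb⟩

theorem sum_coeff_smul_pow {f : O[X]} {γ : Module.End F V}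
    (h : aeval γ (f.map (algebraMap O F)) = 0) (x : V) :
    ∑ j ∈ Finset.range (f.natDegree + 1), f.coeff j • (γ ^ j) x = 0 := by
  have h1 := congrArg (fun φ : Module.End F V => φ x) h
  rw [aeval_eq_sum_range' (n := f.natDegree + 1)
    (Nat.lt_succ_of_le natDegree_map_le)] at h1
  simpa [LinearMap.sum_apply, coeff_map, algebraMap_smul] using h1

variable {f : O[X]} {γ : (Module.End F V)ˣ}

theorem sum_coeff_smul_mon (h : aeval (γ : Module.End F V) (f.map (algebraMap O F)) = 0)
    (a b : ℤ) (x : V) : ∑ j ∈ Finset.range (f.natDegree + 1),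
      f.coeff j • (mon γ (a + j) b : Module.End F V) x = 0 := by
  rw [← sum_coeff_smul_pow h ((mon γ a b : Module.End F V) x)]
  refine Finset.sum_congr rfl fun j _ => ?_
  rw [← coe_mon_nat, mon_apply_mon, add_comm a, zero_add]

/-- If `G` contains the monomial translates of `x` of non-negative weight whose exponent of `γ` is
in `[0, N)`, then it contains all those of non-negative weight. -/
theorem mon_mem_of_window (hf : IsSingleSlope f)
    (h : aeval (γ : Module.End F V) (f.map (algebraMap O F)) = 0) {G : Submodule O V} {x : V}
    (hG : ∀ n : ℕ, n < f.natDegree →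
      (mon γ n (-(n * ordConst f / f.natDegree : ℤ)) : Module.End F V) x ∈ G)
    {a b : ℤ} (hab : 0 ≤ b * f.natDegree + a * ordConst f) :
    (mon γ a b : Module.End F V) x ∈ G := by
  set N := f.natDegree with hN
  set m := ordConst f with hm
  have hN0 : (0 : ℤ) < N := by exact_mod_cast hf.2.1
  let Good : ℤ → Prop := fun n => ∀ b : ℤ, 0 ≤ b * N + n * m → (mon γ n b : Module.End F V) x ∈ G
  have hwin : ∀ n : ℤ, 0 ≤ n → n < N → Good n := by
    intro n hn hnN b hb
    lift n to ℕ using hn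
    have h1 : -b ≤ (n * m / N : ℤ) := (Int.le_ediv_iff_mul_le hN0).2 (by linarith)
    obtain ⟨e, he⟩ := Int.eq_ofNat_of_zero_le (show 0 ≤ b + (n * m / N : ℤ) by linarith)
    have h2 := G.smul_mem (PowerSeries.X ^ e) (hG n (by exact_mod_cast hnN))
    rw [X_pow_smul_mon] at h2
    rwa [show -(n * m / N : ℤ) + e = b by linarith] at h2
  have hcoef : ∀ (a b : ℤ) (j : ℕ), j ≤ N → (∀ c : ℕ, (N - j : ℤ) * m ≤ N * c →
      (mon γ a (b + c) : Module.End F V) x ∈ G) →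
      f.coeff j • (mon γ a b : Module.End F V) x ∈ G := by
    intro a b j hj hc
    obtain ⟨c, d, hd, hcd⟩ := hf.exists_coeff hj
    rw [hd, mul_smul, X_pow_smul_mon]
    refine G.smul_mem d (hc c ?_)
    have := hcd
    rw [← hN, ← hm] at this
    zify [hj] at this
    exact this
  -- The relation `f(γ) = 0` is solved for its leading term. The Newton polygon condition says
  -- exactly that the other terms have at least the weight of `γ^N`.
  have hup : ∀ n : ℤ, (∀ i : ℤ, n - N ≤ i → i < n → Good i) → Good n := by
    intro n hi b hb
    have h1 := sum_coeff_smul_mon h (n - N) b x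
    rw [Finset.sum_range_succ, ← hN, show f.coeff N = 1 from hf.1.coeff_natDegree, one_smul,
      sub_add_cancel] at h1
    rw [eq_neg_of_add_eq_zero_right h1]
    refine G.neg_mem (G.sum_mem fun j hj => ?_)
    have hj' := Finset.mem_range.1 hj
    refine hcoef _ _ j hj'.le fun c hc => hi _ (by linarith) (by omega) _ ?_
    linarith
  have hdown : ∀ n : ℤ, (∀ i : ℤ, n < i → i ≤ n + N → Good i) → Good n := by
    intro n hi b hb
    -- The relation is now solved for its constant term, a unit times `t^m`; the exponent `b - m`
    -- makes this term contribute `t^b`.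
    have h1 := sum_coeff_smul_mon h n (b - m) x
    obtain ⟨u, hu⟩ := exists_unit_coeff_zero hf.2.2.1
    rw [Finset.sum_range_succ', hu, mul_smul, X_pow_smul_mon, Nat.cast_zero, add_zero,
      sub_add_cancel] at h1
    have h2 : (u : O) • (mon γ n b : Module.End F V) x ∈ G := by
      rw [eq_neg_of_add_eq_zero_right h1]
      refine G.neg_mem (G.sum_mem fun j hj => ?_)
      have hj' := Finset.mem_range.1 hj
      refine hcoef _ _ (j + 1) hj' fun c hc => hi _ (by push_cast; linarith)
        (by push_cast; omega) _ ?_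
      push_cast at hc ⊢
      linarith
    have h3 := G.smul_mem (↑u⁻¹ : O) h2
    rwa [smul_smul, Units.inv_mul, one_smul] at h3
  -- The window of good exponents grows by one on both sides in every step.
  have hall : ∀ k : ℕ, ∀ n : ℤ, -k ≤ n → n < N + k → Good n := by
    intro k
    induction k with
    | zero => intro n h1 h2; exact hwin n (by simpa using h1) (by simpa using h2)
    | succ k ih =>
      intro n h1 h2
      push_cast at h1 h2
      rcases eq_or_lt_of_le (show n ≤ N + k by linarith) with h3 | h3
      · exact hup n fun i hi hi' => ih i (by linarith) (by linarith)
      · rcases eq_or_lt_of_le (show -(k : ℤ) - 1 ≤ n by linarith) with h4 | h4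
        · exact hdown n fun i hi hi' => ih i (by linarith) (by linarith)
        · exact ih n (by linarith) h3
  exact hall a.natAbs a (by omega) (by omega) b hab

/-- The adapted module generated by `x`. -/
def adaptedSpan (f : O[X]) (γ : (Module.End F V)ˣ) (x : V) : Submodule O V :=
  Submodule.span O (Set.range fun n : Fin f.natDegree =>
    (mon γ n (-(n * ordConst f / f.natDegree : ℤ)) : Module.End F V) x)

theorem adaptedSpan_fg (x : V) : (adaptedSpan f γ x).FG :=
  Submodule.fg_span (Set.finite_range _)

theorem mon_mem_adaptedSpan (hf : IsSingleSlope f)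
    (h : aeval (γ : Module.End F V) (f.map (algebraMap O F)) = 0) (x : V)
    {a b : ℤ} (hab : 0 ≤ b * f.natDegree + a * ordConst f) :
    (mon γ a b : Module.End F V) x ∈ adaptedSpan f γ x :=
  mon_mem_of_window hf h (fun n hn => Submodule.subset_span (Set.mem_range_self (⟨n, hn⟩ : Fin f.natDegree))) hab

/-- The exponent `-⌊n m / N⌋` is the least power of `t` for which the weight is not negative, so
each generator of `adaptedSpan` has weight `n m` modulo `N`, between `0` and `N - 1`. -/
theorem weight_window (hf : IsSingleSlope f) (n : ℕ) :
    (0 : ℤ) ≤ -(n * ordConst f / f.natDegree : ℤ) * f.natDegree + n * ordConst f := by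
  have := Int.ediv_mul_le (n * ordConst f : ℤ) (b := f.natDegree) (by have := hf.2.1; omega)
  linarith

theorem adapted_adaptedSpan (hf : IsSingleSlope f)
    (h : aeval (γ : Module.End F V) (f.map (algebraMap O F)) = 0) (x : V) :
    Adapted γ f.natDegree (ordConst f) (adaptedSpan f γ x) := by
  intro a b hab
  rw [shift, act, adaptedSpan, Submodule.map_span_le]
  rintro _ ⟨n, rfl⟩
  change (mon γ a b : Module.End F V) _ ∈ _
  rw [mon_apply_mon]
  refine mon_mem_adaptedSpan hf h x ?_
  have := weight_window hf n
  linarith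

theorem mem_adaptedSpan (hf : IsSingleSlope f)
    (h : aeval (γ : Module.End F V) (f.map (algebraMap O F)) = 0) (x : V) :
    x ∈ adaptedSpan f γ x := by
  have := mon_mem_adaptedSpan hf h x (a := 0) (b := 0) (by simp)
  rwa [mon_zero_apply] at this

/-- There are adapted lattices. -/
theorem exists_adapted_lattice [FiniteDimensional F V] (hf : IsSingleSlope f)
    (h : aeval (γ : Module.End F V) (f.map (algebraMap O F)) = 0) :
    ∃ A : Submodule O V, IsLat (⊤ : Submodule F V) A ∧ Adapted γ f.natDegree (ordConst f) A := by
  let b := Module.finBasis F V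
  refine ⟨⨆ i, adaptedSpan f γ (b i), ⟨Submodule.fg_iSup _ fun i => adaptedSpan_fg _, ?_⟩, ?_⟩
  · rw [eq_top_iff, ← b.span_eq, Submodule.span_le]
    rintro _ ⟨i, rfl⟩
    exact Submodule.subset_span
      ((le_iSup (fun i => adaptedSpan f γ (b i)) i) (mem_adaptedSpan hf h (b i)))
  · intro a c hac
    rw [shift, act, Submodule.map_iSup]
    exact iSup_mono fun i => adapted_adaptedSpan hf h (b i) a c hac

end SingleSlope

/-! ### The column counts of the balanced, raised and lowered partitions. -/

section Partitions

/-- The first `N / m` columns have `m` boxes and the next one has `N % m`; truncated subtraction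
accounts for the empty columns. -/
theorem partSum_balanced {N m : ℕ} (hm : 0 < m) (j : ℕ) :
    partSum (balanced N m) j = N - j * m := by
  obtain ⟨k, l, hl, rfl⟩ : ∃ k l, l < m ∧ N = m * k + l :=
    ⟨N / m, N % m, Nat.mod_lt _ hm, (Nat.div_add_mod _ _).symm⟩
  rw [balanced, Nat.mul_add_mod, Nat.mod_eq_of_lt hl, Nat.mul_add_div hm, Nat.div_eq_of_lt hl,
    add_zero, partSum_add, partSum_replicate, partSum_replicate]
  rcases le_or_gt j k with h | h
  · obtain ⟨i, rfl⟩ := Nat.exists_eq_add_of_le h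
    obtain ⟨c, rfl⟩ := Nat.exists_eq_add_of_lt hl
    rw [show j + i + 1 - j = i + 1 by omega, show j + i - j = i by omega,
      show l + c + 1 - l = c + 1 by omega]
    symm
    apply Nat.sub_eq_of_eq_add
    ring
  · obtain ⟨i, rfl⟩ := Nat.exists_eq_add_of_lt h
    rw [show k + 1 - (k + i + 1) = 0 by omega, show k - (k + i + 1) = 0 by omega]
    symm
    simp only [mul_zero, add_zero]
    apply Nat.sub_eq_zero_of_le
    nlinarith

/-- The additional box is at the bottom of column number `N / m`, counted from zero. It is outside
of the first `j` columns exactly when `j * m ≤ N`, and it is the only box left there when equality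
holds. -/
theorem partSum_raised {N m : ℕ} (hm : 0 < m) (j : ℕ) :
    partSum (raised N m) j = if j * m ≤ N then N + 1 - j * m else 0 := by
  obtain ⟨k, l, hl, rfl⟩ : ∃ k l, l < m ∧ N = m * k + l :=
    ⟨N / m, N % m, Nat.mod_lt _ hm, (Nat.div_add_mod _ _).symm⟩
  rw [raised, Nat.mul_add_mod, Nat.mod_eq_of_lt hl, Nat.mul_add_div hm, Nat.div_eq_of_lt hl,
    add_zero, partSum_add, partSum_replicate, partSum_replicate]
  rcases le_or_gt j k with h | h
  · obtain ⟨i, rfl⟩ := Nat.exists_eq_add_of_le h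
    obtain ⟨c, rfl⟩ := Nat.exists_eq_add_of_lt hl
    rw [if_pos (by nlinarith), show j + i + 1 - j = i + 1 by omega, show j + i - j = i by omega,
      show l + c + 1 - l - 1 = c by omega]
    symm
    apply Nat.sub_eq_of_eq_add
    ring
  · obtain ⟨i, rfl⟩ := Nat.exists_eq_add_of_lt h
    rw [if_neg (by nlinarith), show k + 1 - (k + i + 1) = 0 by omega,
      show k - (k + i + 1) = 0 by omega]
    simp

/-- Both cases of the definition remove one box from the last non-empty column of the balanced
partition, which explains the uniform formula. -/
theorem partSum_lowered {N m : ℕ} (hm : 0 < m) (j : ℕ) :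
    partSum (lowered N m) j = N - 1 - j * m := by
  obtain ⟨k, l, hl, rfl⟩ : ∃ k l, l < m ∧ N = m * k + l :=
    ⟨N / m, N % m, Nat.mod_lt _ hm, (Nat.div_add_mod _ _).symm⟩
  rw [lowered, Nat.mul_add_mod, Nat.mod_eq_of_lt hl, Nat.mul_add_div hm, Nat.div_eq_of_lt hl,
    add_zero]
  split_ifs with h0
  · subst h0
    rw [partSum_add, partSum_replicate, partSum_singleton]
    rcases lt_or_ge j k with h | h
    · obtain ⟨i, rfl⟩ := Nat.exists_eq_add_of_lt h
      obtain ⟨c, rfl⟩ := Nat.exists_eq_add_of_lt hl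
      rw [show j + i + 1 - j = i + 1 by omega, show j + i + 1 - 1 - j = i by omega,
        show 0 + c + 1 - 1 = c by omega]
      symm
      apply Nat.sub_eq_of_eq_add
      apply Nat.sub_eq_of_eq_add
      ring
    · rw [Nat.sub_eq_zero_of_le h, show k - 1 - j = 0 by omega]
      symm
      simp only [mul_zero, add_zero]
      apply Nat.sub_eq_zero_of_le
      have : m * k ≤ j * m := by rw [mul_comm]; exact Nat.mul_le_mul_right m h
      omega
  · rw [partSum_add, partSum_replicate, partSum_replicate]
    rcases le_or_gt j k with h | h
    · obtain ⟨i, rfl⟩ := Nat.exists_eq_add_of_le h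
      obtain ⟨c, rfl⟩ := Nat.exists_eq_add_of_lt hl
      obtain ⟨l, rfl⟩ := Nat.exists_eq_succ_of_ne_zero h0
      rw [show j + i + 1 - j = i + 1 by omega, show j + i - j = i by omega,
        show l.succ + c + 1 - l.succ + 1 = c + 2 by omega, show l.succ - 1 = l by omega,
        Nat.succ_eq_add_one, ← add_assoc, Nat.add_sub_cancel]
      symm
      apply Nat.sub_eq_of_eq_add
      ring
    · obtain ⟨i, rfl⟩ := Nat.exists_eq_add_of_lt h
      rw [show k + 1 - (k + i + 1) = 0 by omega, show k - (k + i + 1) = 0 by omega]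
      symm
      simp only [mul_zero, add_zero]
      apply Nat.sub_eq_zero_of_le
      have : m * k + l ≤ (k + i + 1) * m := by nlinarith
      omega

end Partitions

/-! ### Maximal adapted integral lattices, and maximal integral lattices above them. -/

section MaximalLattices

variable {F : Type*} [Field F] [Algebra O F] [IsFractionRing O F]
variable {V : Type*} [AddCommGroup V] [Module F V] [Module O V] [IsScalarTower O F V]

/-- The `𝒪`-submodule generated by `v`. -/
local notation "⟪" v "⟫" => Submodule.span O {v}

variable {B : LinearMap.BilinForm F V} {γ : (Module.End F V)ˣ} {N m : ℕ}

/-- Multiplication by `t` is self-adjoint and `γ` is skew. Negative exponents follow by applying the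
positive case to the images under the inverse monomial. -/
theorem mon_adjoint (hskew : ∀ x y, B ((γ : Module.End F V) x) y = -B x ((γ : Module.End F V) y))
    (a b : ℤ) (x y : V) : B ((mon γ a b : Module.End F V) x) y =
      (-1) ^ a * B x ((mon γ a b : Module.End F V) y) := by
  have ht : ∀ (b : ℤ) (x y : V), B ((mon γ 0 b : Module.End F V) x) y =
      B x ((mon γ 0 b : Module.End F V) y) := by
    have h1 : ∀ (b : ℕ) (x y : V), B ((mon γ 0 b : Module.End F V) x) y =
        B x ((mon γ 0 b : Module.End F V) y) := by
      intro b x y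
      rw [coe_mon_t_nat, tEnd_pow_apply, tEnd_pow_apply, map_smul, map_smul, LinearMap.smul_apply]
    intro b x y
    obtain ⟨b, rfl | rfl⟩ := b.eq_nat_or_neg
    · exact h1 b x y
    · have := h1 b ((mon γ 0 (-b) : Module.End F V) x) ((mon γ 0 (-b) : Module.End F V) y)
      rw [mon_apply_mon, mon_apply_mon, add_zero, add_neg_cancel, mon_zero_apply,
        mon_zero_apply] at this
      exact this.symm
  have hg : ∀ (a : ℤ) (x y : V), B ((mon γ a 0 : Module.End F V) x) y =
      (-1) ^ a * B x ((mon γ a 0 : Module.End F V) y) := by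
    have h1 : ∀ (a : ℕ) (x y : V), B ((mon γ a 0 : Module.End F V) x) y =
        (-1) ^ a * B x ((mon γ a 0 : Module.End F V) y) := by
      intro a
      induction a with
      | zero => intro x y; simp [mon_zero_apply]
      | succ a ih =>
        intro x y
        rw [coe_mon_nat] at ih ⊢
        rw [pow_succ', Module.End.mul_apply, hskew, ih, ← Module.End.mul_apply, ← pow_succ,
          ← pow_succ']
        ring
    intro a x y
    obtain ⟨a, rfl | rfl⟩ := a.eq_nat_or_neg
    · rw [h1, zpow_natCast]
    · have := h1 a ((mon γ (-a) 0 : Module.End F V) x) ((mon γ (-a) 0 : Module.End F V) y)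
      rw [mon_apply_mon, mon_apply_mon, add_zero, add_neg_cancel, mon_zero_apply,
        mon_zero_apply] at this
      rw [this, zpow_neg, zpow_natCast, ← mul_assoc, inv_mul_cancel₀, one_mul]
      exact pow_ne_zero _ (neg_ne_zero.2 one_ne_zero)
  have h2 : ∀ x : V, (mon γ a b : Module.End F V) x =
      (mon γ a 0 : Module.End F V) ((mon γ 0 b : Module.End F V) x) := fun x => by
    rw [mon_apply_mon, add_zero, zero_add]
  rw [h2, h2, hg, ht, mon_apply_mon, mon_apply_mon, add_comm 0 a, add_comm 0 b]

theorem neg_one_zpow_mul_mem_iff (a : ℤ) (x : F) :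
    (-1) ^ a * x ∈ (1 : Submodule O F) ↔ x ∈ (1 : Submodule O F) := by
  rcases Int.even_or_odd a with h | h
  · rw [h.neg_one_zpow, one_mul]
  · rw [h.neg_one_zpow, neg_one_mul, neg_mem_iff]

theorem mon_adjoint_mem
    (hskew : ∀ x y, B ((γ : Module.End F V) x) y = -B x ((γ : Module.End F V) y))
    (a b : ℤ) (x y : V) : B ((mon γ a b : Module.End F V) x) y ∈ (1 : Submodule O F) ↔
      B x ((mon γ a b : Module.End F V) y) ∈ (1 : Submodule O F) := by
  rw [mon_adjoint hskew, neg_one_zpow_mul_mem_iff]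

theorem Adapted.dualIn
    (hskew : ∀ x y, B ((γ : Module.End F V) x) y = -B x ((γ : Module.End F V) y))
    {A : Submodule O V} (h : Adapted γ N m A) : Adapted γ N m (SOOdd.dualIn B ⊤ A) := by
  intro a b hab
  rw [SOOdd.shift, act_le]
  refine fun x hx => ⟨fun y hy => ?_, trivial⟩
  rw [mon_adjoint_mem hskew]
  exact hx.1 _ (h a b hab (mem_shift_of_mem hy a b))

/-- For large `e` the lattice `t^e A` is integral, and every integral module above it lies in its
dual, which is noetherian. Maximality within adapted modules is what later forces positive weights
to kill `M^∨ / M`. -/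
theorem exists_max_adapted (hs : B.IsSymm) (hB : NondegOn B ⊤) {A : Submodule O V}
    (hA : IsLat (⊤ : Submodule F V) A) (hA' : Adapted γ N m A) :
    ∃ M : Submodule O V, IsLat (⊤ : Submodule F V) M ∧ Adapted γ N m M ∧ M ≤ dualIn B ⊤ M ∧
      ∀ X : Submodule O V, Adapted γ N m X → X ≤ dualIn B ⊤ X → M ≤ X → X = M := by
  obtain ⟨e, he⟩ := (hA.dualIn hs hB).exists_tS_pow_le hA.fg hA.le
  set A₁ := act (tEnd F V ^ e) A with hA₁
  have hL : IsLat (⊤ : Submodule F V) A₁ := hA.tS_pow e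
  have hA₁' : Adapted γ N m A₁ := by rw [hA₁, ← coe_mon_t_nat γ]; exact hA'.shift _ _
  have hint : A₁ ≤ dualIn B ⊤ A₁ :=
    he.trans (dualIn_anti ⊤ (tS_pow_le A e))
  obtain ⟨M, h1, ⟨h2, h3⟩, h4⟩ := exists_maximal_of_fg (hL.dualIn hs hB).fg
    (fun X => A₁ ≤ X ∧ Adapted γ N m X ∧ X ≤ dualIn B ⊤ X)
    (fun X hX => hX.2.2.trans (dualIn_anti ⊤ hX.1)) (A := A₁) ⟨le_rfl, hA₁', hint⟩
  exact ⟨M, hL.of_le_of_le (hL.dualIn hs hB) h2 (h3.2.trans (dualIn_anti ⊤ h2)), h3.1, h3.2,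
    fun X hX hX' hMX => h4 X ⟨h2.trans hMX, hX, hX'⟩ hMX⟩

theorem sup_le_dualIn (hs : B.IsSymm) {M X : Submodule O V} (hM : M ≤ dualIn B ⊤ M)
    (hX : X ≤ dualIn B ⊤ M) (hX' : X ≤ dualIn B ⊤ X) : M ⊔ X ≤ dualIn B ⊤ (M ⊔ X) := by
  intro z hz
  refine ⟨fun w hw => ?_, trivial⟩
  obtain ⟨a, ha, b, hb, rfl⟩ := Submodule.mem_sup.1 hz
  obtain ⟨c, hc, d, hd, rfl⟩ := Submodule.mem_sup.1 hw
  rw [LinearMap.map_add₂, map_add, map_add, hs.eq a d]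
  exact add_mem (add_mem ((hM ha).1 c hc) ((hX hd).1 a ha))
    (add_mem ((hX hb).1 c hc) ((hX' hb).1 d hd))

/-- Monomials of positive weight map the dual of a maximal adapted lattice into the lattice. -/
theorem shift_dualIn_le (hs : B.IsSymm) (hB : NondegOn B ⊤)
    (hskew : ∀ x y, B ((γ : Module.End F V) x) y = -B x ((γ : Module.End F V) y))
    {M : Submodule O V} (hM : IsLat (⊤ : Submodule F V) M) (hMa : Adapted γ N m M)
    (hMi : M ≤ dualIn B ⊤ M)
    (hmax : ∀ X : Submodule O V, Adapted γ N m X → X ≤ dualIn B ⊤ X → M ≤ X → X = M)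
    {a b : ℤ} (hab : 0 < b * N + a * m) : shift γ a b (dualIn B ⊤ M) ≤ M := by
  have hda := hMa.dualIn hskew
  -- Descent on the exponent, with `μ = t^b γ^a`. If `μ^e` maps `M^∨` into `M` and `i = ⌈e/2⌉`, then
  -- `X = μ^i M^∨` is integral, since `B(μ^i x, μ^i y) = ± B(x, μ^(2i) y)`. So `M + X` is adapted
  -- and integral, and maximality gives `X ≤ M`.
  have key : ∀ e : ℕ, shift γ (e * a) (e * b) (dualIn B ⊤ M) ≤ M →
      shift γ a b (dualIn B ⊤ M) ≤ M := by
    intro e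
    induction e using Nat.strong_induction_on with
    | _ e ih =>
      intro he
      rcases Nat.lt_or_ge e 2 with h2 | h2
      · have : e = 0 ∨ e = 1 := by omega
        rcases this with rfl | rfl
        · rw [Nat.cast_zero, zero_mul, zero_mul, shift_zero] at he
          exact (hda a b hab.le).trans he
        · simpa using he
      · refine ih ((e + 1) / 2) (by omega) ?_
        obtain ⟨i, hi⟩ : ∃ i : ℤ, i = (((e + 1) / 2 : ℕ) : ℤ) := ⟨_, rfl⟩
        rw [← hi]
        have hi0 : 0 ≤ i := by omega
        set X := shift γ (i * a) (i * b) (dualIn B ⊤ M) with hX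
        have hw : 0 ≤ i * b * N + i * a * m := by
          have := mul_nonneg hi0 hab.le
          linarith
        have h2i : shift γ (i * a + i * a) (i * b + i * b) (dualIn B ⊤ M) ≤ M := by
          refine (hda.shift_le ?_).trans he
          have h3 : (e : ℤ) ≤ 2 * i := by omega
          nlinarith
        have hXM : X ≤ dualIn B ⊤ M := hda _ _ hw
        have hXX : X ≤ dualIn B ⊤ X := by
          rw [hX, shift, act_le]
          refine fun x hx => ⟨?_, trivial⟩
          rintro _ ⟨y, hy, rfl⟩
          rw [mon_adjoint_mem hskew]
          change B x ((mon γ (i * a) (i * b) : Module.End F V)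
            ((mon γ (i * a) (i * b) : Module.End F V) y)) ∈ _
          rw [mon_apply_mon]
          exact hx.1 _ (h2i (mem_shift_of_mem hy _ _))
        rw [← hmax (M ⊔ X) (hMa.sup (hda.shift _ _)) (sup_le_dualIn hs hMi hXM hXX) le_sup_left]
        exact le_sup_right
  obtain ⟨e, he⟩ := hM.exists_tS_pow_le (hM.dualIn hs hB).fg (dualIn_le _ _)
  -- A positive weight is at least one, so the power `N e` of the monomial has at least the weight
  -- of `t^e`, which does map the dual into `M`.
  refine key (N * e) ((hda.shift_le ?_).trans (?_ : shift γ 0 e (dualIn B ⊤ M) ≤ M))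
  · have h1 : (0 : ℤ) ≤ (N * e : ℕ) := by positivity
    push_cast at h1 ⊢
    nlinarith
  · rw [shift, coe_mon_t_nat]; exact he

/-- A maximal integral lattice has index at most one in its dual. -/
theorem exists_max_integral (hs : B.IsSymm) (hB : NondegOn B ⊤)
    {M : Submodule O V} (hM : IsLat (⊤ : Submodule F V) M) (hMi : M ≤ dualIn B ⊤ M)
    (hMt : tS F (dualIn B ⊤ M) ≤ M) :
    ∃ P : Submodule O V, IsLat (⊤ : Submodule F V) P ∧ M ≤ P ∧ P ≤ dualIn B ⊤ P ∧
      (dualIn B ⊤ P = P ∨ ∃ e : V, e ∉ P ∧ τ F • e ∈ P ∧ dualIn B ⊤ P = P ⊔ ⟪e⟫ ∧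
        B e e ∉ (1 : Submodule O F)) := by
  obtain ⟨P, h1, ⟨-, h3⟩, h4⟩ := exists_maximal_of_fg (hM.dualIn hs hB).fg
    (fun X => M ≤ X ∧ X ≤ dualIn B ⊤ X)
    (fun X hX => hX.2.trans (dualIn_anti ⊤ hX.1)) (A := M) ⟨le_rfl, hMi⟩
  have hτ : ∀ x ∈ dualIn B ⊤ P, τ F • x ∈ P := fun x hx =>
    h1 (hMt (by rw [← tEnd_apply]; exact mem_act_of_mem (dualIn_anti ⊤ h1 hx)))
  have hτB : ∀ x ∈ dualIn B ⊤ P, ∀ y ∈ dualIn B ⊤ P, τ F * B x y ∈ (1 : Submodule O F) :=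
    fun x hx y hy => by
      rw [← smul_eq_mul, ← map_smul]; exact hx.1 _ (hτ y hy)
  -- By maximality the residue form on `P^∨ / P` is anisotropic; over `ℂ` this bounds the dimension
  -- by one.
  have haniso : ∀ x ∈ dualIn B ⊤ P, B x x ∈ (1 : Submodule O F) → x ∈ P := by
    intro x hx hxx
    rw [← h4 (P ⊔ ⟪x⟫) ⟨h1.trans le_sup_left, sup_le_dualIn hs h3
      ((Submodule.span_singleton_le_iff_mem _ _).2 hx) ?_⟩ le_sup_left]
    · exact mem_sup_span_self _ _
    · intro u hu
      obtain ⟨c, rfl⟩ := Submodule.mem_span_singleton.1 hu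
      refine ⟨fun v hv => ?_, trivial⟩
      obtain ⟨d, rfl⟩ := Submodule.mem_span_singleton.1 hv
      rw [← algebraMap_smul F c, ← algebraMap_smul F d, map_smul, map_smul, LinearMap.smul_apply]
      exact mul_mem_one (algebraMap_mem_one d) (mul_mem_one (algebraMap_mem_one c) hxx)
  refine ⟨P, hM.of_le_of_le (hM.dualIn hs hB) h1 (h3.trans (dualIn_anti ⊤ h1)), h1, h3, ?_⟩
  by_cases hP : dualIn B ⊤ P ≤ P
  · exact Or.inl (le_antisymm hP h3)
  · obtain ⟨e, he, heP⟩ := SetLike.not_le_iff_exists.1 hP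
    have hee : B e e ∉ (1 : Submodule O F) := fun h => heP (haniso e he h)
    refine Or.inr ⟨e, heP, hτ e he, le_antisymm (fun x hx => ?_)
      (sup_le h3 ((Submodule.span_singleton_le_iff_mem _ _).2 he)), hee⟩
    -- A plane over `ℂ` always contains an isotropic vector `x + c e`, so every `x` is a multiple of
    -- `e` modulo `P`.
    obtain ⟨c, hc⟩ := exists_quadratic_mem (a := B x x) (b := 2 * B x e) (d := B e e)
      (hτB x hx x hx) (by
        rw [two_mul, mul_add]; exact add_mem (hτB x hx e he) (hτB x hx e he)) (hτB e he e he) hee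
    have hce : cst F c • e ∈ dualIn B ⊤ P := by
      rw [cst_smul]; exact Submodule.smul_mem _ _ he
    have h5 : x + cst F c • e ∈ P := by
      refine haniso _ (add_mem hx hce) ?_
      have : B (x + cst F c • e) (x + cst F c • e) =
          B x x + cst F c * (2 * B x e) + cst F c ^ 2 * B e e := by
        rw [LinearMap.map_add₂, map_add, map_add, map_smul, map_smul, LinearMap.smul_apply,
          LinearMap.smul_apply, map_smul, hs.eq e x]
        simp only [smul_eq_mul]
        ring
      rwa [this]
    rw [show x = x + cst F c • e + (-PowerSeries.C c : O) • e by
      rw [cst_smul, neg_smul]; abel]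
    exact mem_sup_span.2 ⟨_, h5, _, rfl⟩

theorem rankLen_eq_zero {A D : Submodule O V} {j : ℕ}
    (h : act ((γ : Module.End F V) ^ j) D ≤ tS F A) : rankLen (γ : Module.End F V) A D j = 0 := by
  rw [rankLen, relLen_eq_zero_iff]; exact sup_le h le_rfl

/-- The rank in low degrees, in terms of the indices over an adapted lattice. -/
theorem Adapted.rankLen_add {M : Submodule O V} (hMa : Adapted γ N m M)
    (hM : IsLat (⊤ : Submodule F V) M) (hN : Module.finrank F V = N) (hN0 : 0 < N) {j : ℕ}
    (hj : j * m ≤ N) {A D : Submodule O V} (hA : M ≤ A) (hD : M ≤ D)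
    (h : tS F A ≤ act ((γ : Module.End F V) ^ j) D) :
    relLen M A + rankLen (γ : Module.End F V) A D j = (N - j * m : ℕ) + relLen M D := by
  have h1 : relLen (tS F M) (act ((γ : Module.End F V) ^ j) M) = (N - j * m : ℕ) := by
    rw [tS_eq_shift (γ := γ), act_pow_eq_shift]
    refine hMa.relLen_shift_shift hM hN hN0 ?_
    push_cast [hj]; ring
  have h0 : tS F M ≤ act ((γ : Module.End F V) ^ j) M := by
    rw [tS_eq_shift (γ := γ), act_pow_eq_shift]
    refine hMa.shift_le ?_
    zify at hj
    linarith
  have hj' : act ((γ : Module.End F V) ^ j) M ≤ act ((γ : Module.End F V) ^ j) D := act_mono hD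
  -- Both sides are the length of `γ^j D / t M`, computed through `t A` and through `γ^j M`.
  rw [rankLen, sup_eq_left.2 h, ← relLen_tS (F := F) hA, ← relLen_add (act_mono hA) h,
    relLen_add h0 hj', h1, act_pow_eq_shift, act_pow_eq_shift, SOOdd.relLen_shift hD]

end MaximalLattices

/-! ### Blocks, and the case where the slope is not an integer. -/

section BlockDefs

variable {F : Type*} [Field F] [Algebra O F] [IsFractionRing O F]
variable {V : Type*} [AddCommGroup V] [Module F V] [Module O V] [IsScalarTower O F V]

/-- The `𝒪`-submodule generated by `v`. -/
local notation "⟪" v "⟫" => Submodule.span O {v}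

/-- There is a closed lattice, with a bound on `t γ ^ (-j)`. -/
def HasClosed (B : LinearMap.BilinForm F V) (γ : Module.End F V) (U : Submodule F V)
    (d : Multiset ℕ) (N m : ℕ) : Prop :=
  ∃ Λ : Submodule O V, IsClosedLat B γ U d Λ ∧ ∀ j, j * m < N → tS F Λ ≤ act (γ ^ j) Λ

/-- There is an open lattice, with a bound on `t γ ^ (-j)`. -/
def HasOpen (B : LinearMap.BilinForm F V) (γ : Module.End F V) (U : Submodule F V)
    (d : Multiset ℕ) (N m : ℕ) : Prop :=
  ∃ (C : Submodule O V) (e : V), IsOpenLat B γ U d C e ∧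
    ∀ j, j * m < N → tS F (C ⊔ ⟪e⟫) ≤ act (γ ^ j) C

/-- There is a lattice that closes an open one. -/
def HasLowered (B : LinearMap.BilinForm F V) (γ : Module.End F V) (U : Submodule F V)
    (d : Multiset ℕ) (N m : ℕ) : Prop :=
  ∃ (P : Submodule O V) (y : V), IsGlueLat B γ U d P P y ∧
    ∀ j, N < j * m → act (γ ^ j) (P ⊔ ⟪y⟫) ≤ tS F P

/-- There is a lattice that passes on the defect of an open one. -/
def HasPass (B : LinearMap.BilinForm F V) (γ : Module.End F V) (U : Submodule F V)
    (d : Multiset ℕ) (N m : ℕ) : Prop :=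
  ∃ (P : Submodule O V) (x y : V), IsGlueLat B γ U d P (P ⊔ ⟪x⟫) y ∧ x ∉ P ∧ τ F • x ∈ P ∧
    (∀ j, j * m < N → tS F (P ⊔ ⟪x⟫ ⊔ ⟪y⟫) ≤ act (γ ^ j) P) ∧
    ∀ j, N < j * m → act (γ ^ j) (P ⊔ ⟪x⟫ ⊔ ⟪y⟫) ≤ tS F P

/-- A quadratic space with a skew automorphism killed by a polynomial with a single slope. -/
structure IsBlock (B : LinearMap.BilinForm F V) (γ : (Module.End F V)ˣ) (f : O[X]) : Prop where
  symm : B.IsSymm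
  nondeg : NondegOn B ⊤
  skew : ∀ x y, B ((γ : Module.End F V) x) y = -B x ((γ : Module.End F V) y)
  slope : IsSingleSlope f
  ord_pos : 0 < ordConst f
  finrank : Module.finrank F V = f.natDegree
  root : aeval (γ : Module.End F V) (f.map (algebraMap O F)) = 0

variable {B : LinearMap.BilinForm F V} {γ : (Module.End F V)ˣ} {f : O[X]}

theorem IsBlock.exists_lattice (h : IsBlock B γ f) : ∃ M : Submodule O V,
    IsLat (⊤ : Submodule F V) M ∧ Adapted γ f.natDegree (ordConst f) M ∧ M ≤ dualIn B ⊤ M ∧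
      ∀ X : Submodule O V, Adapted γ f.natDegree (ordConst f) X → X ≤ dualIn B ⊤ X → M ≤ X →
        X = M := by
  have : FiniteDimensional F V :=
    FiniteDimensional.of_finrank_pos (by rw [h.finrank]; exact h.slope.2.1)
  obtain ⟨A, hA, hA'⟩ := exists_adapted_lattice h.slope h.root
  exact exists_max_adapted h.symm h.nondeg hA hA'

theorem unit_injOn (γ : (Module.End F V)ˣ) (s : Set V) : Set.InjOn (γ : Module.End F V) s := by
  rw [← coe_mon_one]; exact (mon_injective γ 1 0).injOn

theorem unit_map_top (γ : (Module.End F V)ˣ) :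
    (⊤ : Submodule F V).map (γ : Module.End F V) = ⊤ := by
  rw [Submodule.map_top, LinearMap.range_eq_top]
  intro x
  refine ⟨(↑γ⁻¹ : Module.End F V) x, ?_⟩
  rw [← Module.End.mul_apply, Units.mul_inv]; rfl

/-- The index of `γ` is the same on all stable lattices, and on an adapted one it is the weight `m`
of `γ`. -/
theorem IsBlock.relLen_act (h : IsBlock B γ f) {P : Submodule O V}
    (hP : IsLat (⊤ : Submodule F V) P) (hγP : act (γ : Module.End F V) P ≤ P) :
    relLen (act (γ : Module.End F V) P) P = ordConst f := by
  obtain ⟨M, hM, hMa, -⟩ := h.exists_lattice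
  have hw : (0 : ℤ) * f.natDegree + 1 * ordConst f = ordConst f := by ring
  have hγM : act (γ : Module.End F V) M ≤ M := by
    rw [act_eq_shift]; exact hMa 1 0 (by rw [hw]; positivity)
  rw [hP.relLen_act_eq hM (unit_injOn γ _) hγP hγM, act_eq_shift]
  exact hMa.relLen_shift hM h.finrank h.slope.2.1 hw

/-- This decides the type of a block: a stable integral lattice with `P^∨ / P` of length zero or one
is self-dual precisely when `m` is even. -/
theorem IsBlock.even_add (h : IsBlock B γ f) {P : Submodule O V}
    (hP : IsLat (⊤ : Submodule F V) P) (hPd : P ≤ dualIn B ⊤ P)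
    (hγP : act (γ : Module.End F V) P ≤ P) :
    ∃ n : ℕ, relLen P (dualIn B ⊤ P) + ordConst f = (2 * n : ℕ) := by
  rw [← h.relLen_act hP hγP]
  exact even_relLen_dualIn_add h.symm h.nondeg (unit_injOn γ _) (unit_map_top γ) h.skew hP hPd hγP

theorem natDegree_lt_of_mod_ne_zero {N m j : ℕ} (hl : N % m ≠ 0) (h : ¬ j * m < N) :
    N < j * m := by
  refine lt_of_le_of_ne (not_lt.1 h) fun h => hl ?_
  rw [h, Nat.mul_mod_left]

/-- Blocks whose slope is not an integer. -/
theorem IsBlock.of_mod_ne_zero (h : IsBlock B γ f) (hl : f.natDegree % ordConst f ≠ 0) :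
    (Even (ordConst f) → HasClosed B (γ : Module.End F V) ⊤ (balanced f.natDegree (ordConst f))
      f.natDegree (ordConst f)) ∧
    (¬ Even (ordConst f) →
      HasOpen B (γ : Module.End F V) ⊤ (raised f.natDegree (ordConst f))
        f.natDegree (ordConst f) ∧
      HasLowered B (γ : Module.End F V) ⊤ (lowered f.natDegree (ordConst f))
        f.natDegree (ordConst f)) := by
  obtain ⟨M, hM, hMa, hMi, hmax⟩ := h.exists_lattice
  have hN0 := h.slope.2.1
  have hm0 := h.ord_pos
  have hpos : ∀ {a b : ℤ}, 0 < b * f.natDegree + a * ordConst f → shift γ a b (dualIn B ⊤ M) ≤ M :=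
    shift_dualIn_le h.symm h.nondeg h.skew hM hMa hMi hmax
  have hMt : tS F (dualIn B ⊤ M) ≤ M := by
    rw [tS_eq_shift (γ := γ)]; exact hpos (by simpa using hN0)
  obtain ⟨P, hP, hMP, hPi, hPd⟩ := exists_max_integral h.symm h.nondeg hM hMi hMt
  have hP' := hP.dualIn h.symm h.nondeg
  have hdd : dualIn B ⊤ P ≤ dualIn B ⊤ M := dualIn_anti ⊤ hMP
  have hγ : act (γ : Module.End F V) (dualIn B ⊤ P) ≤ M := by
    rw [act_eq_shift]; exact (shift_mono hdd 1 0).trans (hpos (by simpa using hm0))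
  -- Since `j m` is never equal to `N`, one of `t γ^(-j)` and `γ^j t⁻¹` has positive weight and maps
  -- `M^∨` into `M`. Every lattice between `M` and `M^∨` then has full rank for small `j` and rank
  -- zero for large `j`.
  have hlow : ∀ j : ℕ, j * ordConst f < f.natDegree →
      tS F (dualIn B ⊤ P) ≤ act ((γ : Module.End F V) ^ j) M := by
    intro j hj
    rw [tS_eq_shift (γ := γ), act_pow_eq_shift, ← neg_neg (j : ℤ), ← neg_zero, ← shift_le_iff,
      shift_shift]
    refine (shift_mono hdd _ _).trans (hpos ?_)
    zify at hj
    push_cast; linarith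
  have hhigh : ∀ j : ℕ, ¬ j * ordConst f < f.natDegree →
      act ((γ : Module.End F V) ^ j) (dualIn B ⊤ P) ≤ tS F M := by
    intro j hj
    have hj' := natDegree_lt_of_mod_ne_zero hl hj
    rw [tS_eq_shift (γ := γ), act_pow_eq_shift, ← neg_neg (1 : ℤ), ← neg_zero, ← shift_le_iff,
      shift_shift]
    refine (shift_mono hdd _ _).trans (hpos ?_)
    zify at hj'
    push_cast; linarith
  have hMP' := hM.relLen_ne_top hP hMP
  obtain ⟨n, hn⟩ := h.even_add hP hPi ((act_mono hPi).trans (hγ.trans hMP))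
  rcases hPd with hPd | ⟨e, heP, hτe, hPd, hee⟩
  · rw [hPd] at hγ hlow hhigh
    rw [hPd, relLen_self, zero_add] at hn
    have hev : Even (ordConst f) := ⟨n, by norm_cast at hn; omega⟩
    refine ⟨fun _ => ⟨P, ⟨hP, hPd, hγ.trans hMP, fun j => ?_⟩,
      fun j hj => (hlow j hj).trans (act_mono hMP)⟩, fun h => absurd hev h⟩
    rw [partSum_balanced hm0]
    by_cases hj : j * ordConst f < f.natDegree
    · have h1 := hMa.rankLen_add hM h.finrank hN0 hj.le hMP hMP ((hlow j hj).trans (act_mono hMP))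
      rw [add_comm] at h1
      exact ENat.add_left_injective_of_ne_top hMP' h1
    · rw [rankLen_eq_zero ((hhigh j hj).trans (act_mono hMP)),
        Nat.sub_eq_zero_of_le (not_lt.1 hj)]; rfl
  · have h1 : relLen P (dualIn B ⊤ P) = 1 := by rw [hPd]; exact relLen_sup_span heP hτe
    have h2 : relLen M (dualIn B ⊤ P) = relLen M P + 1 := by rw [relLen_add hMP hPi, h1]
    rw [h1] at hn
    have hodd : ¬ Even (ordConst f) := by
      rw [← Nat.odd_iff.trans Nat.not_even_iff.symm]
      norm_cast at hn
      exact Nat.odd_iff.2 (by omega)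
    rw [hPd] at hγ hlow hhigh h2
    have hle : P ≤ P ⊔ ⟪e⟫ := le_sup_left
    -- The same pair `(P, e)` serves as open lattice and as glue lattice. In the first use the rank
    -- is that of `P^∨` over `t P`, in the second that of `P` over `t P^∨`, and the values differ by
    -- the extra box and the missing box.
    refine ⟨fun h => absurd h hodd, fun _ => ⟨⟨P, e, ⟨hP, trivial, heP, hτe, hPd, hγ.trans hMP,
      fun j => ?_⟩, fun j hj => (hlow j hj).trans (act_mono hMP)⟩, P, e, ⟨hP, le_rfl, trivial, heP,
      hτe, hPd, hee, fun r hr => ?_, hγ.trans hMP, fun j => ?_⟩, fun j hj =>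
      (hhigh j (by omega)).trans (act_mono hMP)⟩⟩
    · rw [partSum_raised hm0]
      by_cases hj : j * ordConst f < f.natDegree
      · have h3 := hMa.rankLen_add hM h.finrank hN0 hj.le hMP (hMP.trans hle)
          ((act_mono hle).trans ((hlow j hj).trans (act_mono (hMP.trans hle))))
        rw [if_pos hj.le]
        rw [h2, ← add_assoc, add_right_comm, add_comm] at h3
        rw [ENat.add_left_injective_of_ne_top hMP' h3, Nat.sub_add_comm hj.le]
        norm_cast
      · rw [rankLen_eq_zero ((hhigh j hj).trans (act_mono hMP)),
          if_neg (by have := natDegree_lt_of_mod_ne_zero hl hj; omega)]; rfl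
    · have : e ∈ dualIn B ⊤ P := by rw [hPd]; exact mem_sup_span_self _ _
      rw [h.symm.eq]; exact this.1 r hr
    · rw [partSum_lowered hm0]
      by_cases hj : j * ordConst f < f.natDegree
      · have h3 := hMa.rankLen_add hM h.finrank hN0 hj.le (hMP.trans hle) hMP
          ((hlow j hj).trans (act_mono hMP))
        rw [h2, show f.natDegree - j * ordConst f = (f.natDegree - 1 - j * ordConst f) + 1 by omega,
          Nat.cast_add, Nat.cast_one, add_right_comm, add_right_comm _ (1 : ℕ∞)] at h3
        have h4 := ENat.add_left_injective_of_ne_top (n := 1) (by simp) h3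
        rw [add_comm] at h4
        exact ENat.add_left_injective_of_ne_top hMP' h4
      · rw [rankLen_eq_zero (((act_mono hle).trans (hhigh j hj)).trans (act_mono (hMP.trans hle))),
          show f.natDegree - 1 - j * ordConst f = 0 by omega]; rfl

end BlockDefs

/-! ### The graded polynomial as a polynomial in `ζ = γ^k / t`, and the case of odd `k`. -/

section Graded

variable {F : Type*} [Field F] [Algebra O F] [IsFractionRing O F]
variable {V : Type*} [AddCommGroup V] [Module F V] [Module O V] [IsScalarTower O F V]

variable (F) in
/-- The constants of `F`. -/
def cstHom : ℂ →+* F := (algebraMap O F).comp (PowerSeries.C (R := ℂ))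

theorem cstHom_smul (c : ℂ) (x : V) : cstHom F c • x = (PowerSeries.C c : O) • x :=
  algebraMap_smul F _ x

/-- The graded polynomial `gr_{d,k}(f)` of a polynomial with the slope `1 / k`. -/
def grSlope (k : ℕ) (f : O[X]) : ℂ[X] :=
  ∑ α ∈ Finset.range (ordConst f + 1),
    C (PowerSeries.coeff α (f.coeff (f.natDegree - α * k))) * X ^ (ordConst f - α)

theorem gr_balanced {f : O[X]} {k : ℕ} (hm : 0 < ordConst f)
    (hk : f.natDegree = ordConst f * k) :
    gr (balanced f.natDegree (ordConst f)) (f.natDegree / ordConst f) f = grSlope k f := by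
  have hd : f.natDegree / ordConst f = k := by rw [hk, Nat.mul_div_cancel_left _ hm]
  have hb : balanced f.natDegree (ordConst f) = Multiset.replicate (ordConst f) k := by
    rw [balanced, hd, hk, Nat.mul_mod_right]; simp
  have hf : (Multiset.replicate (ordConst f) k).filter (k < ·) = 0 := by
    rw [Multiset.filter_eq_nil]
    intro a ha
    rw [Multiset.eq_of_mem_replicate ha]; exact lt_irrefl _
  rw [gr, hd, hb, hf, Multiset.count_replicate_self, grSlope]
  simp

/-- Evaluation of a complex polynomial at `γ ^ k / t`. -/
def zEval (γ : (Module.End F V)ˣ) (k : ℕ) (q : ℂ[X]) : Module.End F V :=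
  aeval (mon γ k (-1) : Module.End F V) (q.map (cstHom F))

variable {γ : (Module.End F V)ˣ} {k : ℕ}

theorem zEval_mul (p q : ℂ[X]) : zEval γ k (p * q) = zEval γ k p * zEval γ k q := by
  rw [zEval, Polynomial.map_mul, map_mul]; rfl

theorem zEval_add (p q : ℂ[X]) : zEval γ k (p + q) = zEval γ k p + zEval γ k q := by
  rw [zEval, Polynomial.map_add, map_add]; rfl

theorem zEval_sub (p q : ℂ[X]) : zEval γ k (p - q) = zEval γ k p - zEval γ k q := by
  rw [zEval, Polynomial.map_sub, map_sub]; rfl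

theorem zEval_one : zEval γ k 1 = 1 := by
  rw [zEval, Polynomial.map_one, map_one]

theorem zEval_C (c : ℂ) (x : V) : zEval γ k (C c) x = (PowerSeries.C c : O) • x := by
  rw [zEval, Polynomial.map_C, aeval_C, Module.algebraMap_end_apply, cstHom_smul]

theorem mon_pow_zeta (i : ℕ) :
    (mon γ k (-1) : Module.End F V) ^ i = (mon γ (k * i) (-i) : Module.End F V) := by
  induction i with
  | zero => simp [mon_zero]
  | succ i ih =>
    rw [pow_succ, ih, ← Units.val_mul, ← mon_add, show (k * (i + 1 : ℕ) : ℤ) = k * i + k by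
      push_cast; ring, show (-(i + 1 : ℕ) : ℤ) = -i + -1 by push_cast; ring]

theorem zEval_X_pow (i : ℕ) : zEval γ k (X ^ i) = (mon γ (k * i) (-i) : Module.End F V) := by
  rw [zEval, Polynomial.map_pow, map_X, map_pow, aeval_X, mon_pow_zeta]

theorem zEval_X : zEval γ k X = (mon γ k (-1) : Module.End F V) := by
  rw [zEval, map_X, aeval_X]

theorem zEval_sum {ι : Type*} (s : Finset ι) (p : ι → ℂ[X]) :
    zEval γ k (∑ i ∈ s, p i) = ∑ i ∈ s, zEval γ k (p i) := by
  rw [zEval, Polynomial.map_sum, map_sum]; rfl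

theorem zEval_mem {A : Submodule O V} (h : shift γ k (-1) A ≤ A) (q : ℂ[X]) {x : V} (hx : x ∈ A) :
    zEval γ k q x ∈ A := by
  induction q using Polynomial.induction_on' with
  | add p q hp hq => rw [zEval_add]; exact A.add_mem hp hq
  | monomial n c =>
    rw [← C_mul_X_pow_eq_monomial, zEval_mul, Module.End.mul_apply, zEval_C]
    refine A.smul_mem _ ?_
    rw [zEval_X_pow, mul_comm, ← mul_neg_one (n : ℤ)]
    exact (relLen_shift_pow h n).1 (mem_shift_of_mem hx _ _)

/-- The graded polynomial annihilates `γ ^ k / t` up to terms of positive weight. -/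
theorem zEval_grSlope_mem {f : O[X]} (hf : IsSingleSlope f) (hm : 0 < ordConst f)
    (hk : f.natDegree = ordConst f * k)
    (h : aeval (γ : Module.End F V) (f.map (algebraMap O F)) = 0) {A : Submodule O V} {x : V}
    (hx : ∀ a b : ℤ, 0 < b * f.natDegree + a * ordConst f →
      (mon γ a b : Module.End F V) x ∈ A) :
    zEval γ k (grSlope k f) x ∈ A := by
  set N := f.natDegree with hN
  set m := ordConst f with hmdef
  have hk0 : 0 < k := Nat.pos_of_ne_zero fun h0 => by
    have := hf.2.1
    rw [← hN, hk, h0] at this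
    simp at this
  -- The relation is multiplied by `t^(-m)`, so that its terms have weight at least zero.
  have h0 := sum_coeff_smul_mon h 0 (-m) x
  have h1 : zEval γ k (grSlope k f) x = ∑ α ∈ Finset.range (m + 1),
      (PowerSeries.C (PowerSeries.coeff α (f.coeff (N - α * k))) : O) •
        (mon γ (k * (m - α : ℕ)) (-(m - α : ℕ)) : Module.End F V) x := by
    rw [grSlope, zEval_sum, LinearMap.sum_apply]
    refine Finset.sum_congr rfl fun α _ => ?_
    rw [zEval_mul, Module.End.mul_apply, zEval_C, zEval_X_pow]
  classical
  -- The weight-zero part of the `j`-th term, which exists only if `k` divides `N - j`. Together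
  -- these parts are `gr(ζ) x`.
  let G : ℕ → V := fun j => if k ∣ N - j then
    (PowerSeries.C (PowerSeries.coeff ((N - j) / k) (f.coeff j)) : O) •
      (mon γ j (-m + ((N - j) / k : ℕ)) : Module.End F V) x else 0
  have h2 : ∑ α ∈ Finset.range (m + 1),
      (PowerSeries.C (PowerSeries.coeff α (f.coeff (N - α * k))) : O) •
        (mon γ (k * (m - α : ℕ)) (-(m - α : ℕ)) : Module.End F V) x =
      ∑ j ∈ Finset.range (N + 1), G j := by
    refine Finset.sum_of_injOn (fun α => N - α * k) ?_ ?_ ?_ ?_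
    · intro α hα β hβ hab
      have hα' : α ≤ m := by have := Finset.mem_range.1 hα; omega
      have hβ' : β ≤ m := by have := Finset.mem_range.1 hβ; omega
      have h3 : α * k ≤ N := by rw [hk]; exact Nat.mul_le_mul_right k hα'
      have h4 : β * k ≤ N := by rw [hk]; exact Nat.mul_le_mul_right k hβ'
      have h5 : α * k = β * k := by simp only at hab; omega
      exact Nat.eq_of_mul_eq_mul_right hk0 h5
    · intro α _
      simp only [Finset.coe_range, Set.mem_Iio]; omega
    · intro j hj hj'
      have hj1 := Finset.mem_range.1 hj
      refine if_neg fun ⟨α, hα⟩ => hj' ⟨α, ?_, ?_⟩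
      · simp only [Finset.coe_range, Set.mem_Iio]
        have : k * α ≤ k * m := by rw [← hα, mul_comm k m, ← hk]; omega
        have := Nat.le_of_mul_le_mul_left this hk0
        omega
      · simp only [mul_comm α k, ← hα]; omega
    · intro α hα
      have hα' : α ≤ m := by have := Finset.mem_range.1 hα; omega
      have h3 : α * k ≤ N := by rw [hk]; exact Nat.mul_le_mul_right k hα'
      have h4 : N - (N - α * k) = α * k := Nat.sub_sub_self h3
      simp only [G]
      have e1 : ((N - α * k : ℕ) : ℤ) = k * (m - α : ℕ) := by
        rw [hk, mul_comm α, mul_comm m, ← Nat.mul_sub]; exact Nat.cast_mul _ _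
      have e2 : (-(m : ℤ) + α) = -((m - α : ℕ) : ℤ) := by omega
      rw [h4, if_pos (Dvd.intro_left α rfl), Nat.mul_div_cancel _ hk0, e1, e2]
  -- It remains to compare term by term: what is left of each coefficient after removing its
  -- weight-zero part has positive weight.
  rw [h1, h2, ← neg_mem_iff, ← zero_sub, ← h0, ← Finset.sum_sub_distrib]
  refine A.sum_mem fun j hj => ?_
  have hj' : j ≤ N := by have := Finset.mem_range.1 hj; omega
  obtain ⟨c, b, hb, hc⟩ := hf.exists_coeff hj'
  rw [← hN, ← hmdef] at hc
  have hc' : N - j ≤ k * c := by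
    rw [hk, mul_comm, mul_assoc] at hc
    rw [hk]
    exact Nat.le_of_mul_le_mul_left hc hm
  have hwt : ∀ e : ℕ, N - j < k * e → (0 : ℤ) < (-m + e) * N + j * m := by
    intro e he
    have h5 : m * (N - j) < m * (k * e) := Nat.mul_lt_mul_of_pos_left he hm
    rw [← mul_assoc, ← hk] at h5
    zify [hj'] at h5
    linarith
  rw [zero_add, hb]
  by_cases hdvd : k ∣ N - j
  · obtain ⟨α, hα⟩ := hdvd
    have hd : (N - j) / k = α := by rw [hα, Nat.mul_div_cancel_left _ hk0]
    simp only [G]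
    rw [if_pos (Dvd.intro _ hα.symm), hd]
    have hac : α ≤ c := Nat.le_of_mul_le_mul_left (hα ▸ hc') hk0
    obtain ⟨e, rfl⟩ := Nat.exists_eq_add_of_le hac
    obtain ⟨c₀, b', hb'⟩ := exists_const (b * PowerSeries.X ^ e)
    have h6 : f.coeff j = (PowerSeries.C c₀ + b' * PowerSeries.X) * PowerSeries.X ^ α := by
      rw [hb, ← hb']; ring
    have h7 : PowerSeries.coeff α (f.coeff j) = c₀ := by
      rw [h6, PowerSeries.coeff_mul_X_pow', if_pos le_rfl, Nat.sub_self]; simp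
    rw [h7, ← hb, h6, add_mul, add_smul, mul_smul, X_pow_smul_mon, add_sub_cancel_left, mul_assoc,
      ← pow_succ', mul_smul, X_pow_smul_mon]
    refine A.smul_mem _ (hx _ _ (hwt _ ?_))
    rw [hα]; exact Nat.mul_lt_mul_of_pos_left (Nat.lt_succ_self α) hk0
  · simp only [G]
    rw [if_neg hdvd, sub_zero, mul_smul, X_pow_smul_mon]
    refine A.smul_mem _ (hx _ _ (hwt _ (lt_of_le_of_ne hc' fun h => hdvd (Dvd.intro _ h.symm))))

theorem grSlope_monic {f : O[X]} (hf : f.Monic) (k : ℕ) :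
    (grSlope k f).Monic ∧ (grSlope k f).natDegree = ordConst f := by
  have h1 : grSlope k f = X ^ ordConst f + ∑ α ∈ Finset.range (ordConst f),
      C (PowerSeries.coeff (α + 1) (f.coeff (f.natDegree - (α + 1) * k))) *
        X ^ (ordConst f - (α + 1)) := by
    rw [grSlope, Finset.sum_range_succ', add_comm]
    simp [hf.coeff_natDegree]
  have h2 : (∑ α ∈ Finset.range (ordConst f),
      C (PowerSeries.coeff (α + 1) (f.coeff (f.natDegree - (α + 1) * k))) *
        X ^ (ordConst f - (α + 1)) : ℂ[X]).degree < (ordConst f : ℕ) := by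
    refine lt_of_le_of_lt (degree_sum_le _ _) ?_
    rw [Finset.sup_lt_iff (WithBot.bot_lt_coe _)]
    intro α hα
    have := Finset.mem_range.1 hα
    refine lt_of_le_of_lt (degree_C_mul_X_pow_le _ _) ?_
    exact_mod_cast Nat.sub_lt (by omega) (Nat.succ_pos _)
  rw [h1]
  exact ⟨monic_X_pow_add h2, natDegree_eq_of_degree_eq_some (by
    rw [degree_add_eq_left_of_degree_lt (by rwa [degree_X_pow]), degree_X_pow])⟩

theorem grSlope_coeff_zero {f : O[X]} (hf : f.coeff 0 ≠ 0) {k : ℕ}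
    (hk : f.natDegree = ordConst f * k) : (grSlope k f).coeff 0 ≠ 0 := by
  rw [grSlope, finsetSum_coeff, Finset.sum_eq_single (ordConst f)]
  · rw [Nat.sub_self, pow_zero, mul_one, coeff_C_zero, hk, Nat.sub_self]
    exact PowerSeries.coeff_order hf
  · intro α hα hne
    have := Finset.mem_range.1 hα
    rw [coeff_C_mul, coeff_X_pow, if_neg (by omega), mul_zero]
  · intro h; simp at h

/-- An eigenvector modulo `M` of `γ ^ k / t`. -/
theorem exists_eigenvector {M D : Submodule O V} (hD : shift γ k (-1) D ≤ D) (s : Multiset ℂ) :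
    ∀ x ∈ D, x ∉ M → zEval γ k (s.map fun c => X - C c).prod x ∈ M →
      ∃ y ∈ D, y ∉ M ∧ ∃ c : ℂ, zEval γ k (X - C c) y ∈ M := by
  induction s using Multiset.induction_on with
  | empty =>
    intro x _ hxM h
    rw [Multiset.map_zero, Multiset.prod_zero, zEval_one] at h
    exact absurd h hxM
  | cons a s ih =>
    intro x hx hxM h
    by_cases hy : zEval γ k (X - C a) x ∈ M
    · exact ⟨x, hx, hxM, a, hy⟩
    · refine ih _ (zEval_mem hD _ hx) hy ?_
      rw [Multiset.map_cons, Multiset.prod_cons, mul_comm, zEval_mul] at h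
      exact h

/-- Blocks whose slope is the inverse of an odd integer. -/
theorem IsBlock.of_odd {B : LinearMap.BilinForm F V} {f : O[X]} (h : IsBlock B γ f)
    (hk : f.natDegree = ordConst f * k) (hodd : Odd k) :
    HasClosed B (γ : Module.End F V) ⊤ (balanced f.natDegree (ordConst f))
      f.natDegree (ordConst f) := by
  obtain ⟨M, hM, hMa, hMi, hmax⟩ := h.exists_lattice
  have hN0 := h.slope.2.1
  have hm0 := h.ord_pos
  have hpos : ∀ {a b : ℤ}, 0 < b * f.natDegree + a * ordConst f → shift γ a b (dualIn B ⊤ M) ≤ M :=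
    shift_dualIn_le h.symm h.nondeg h.skew hM hMa hMi hmax
  have hkz : (f.natDegree : ℤ) = ordConst f * k := by exact_mod_cast hk
  have hw1 : (0 : ℤ) ≤ -1 * f.natDegree + k * ordConst f := by rw [hkz]; linarith
  have hw2 : (0 : ℤ) ≤ 1 * f.natDegree + -k * ordConst f := by rw [hkz]; linarith
  have hMd : dualIn B ⊤ M = M := by
    refine le_antisymm ?_ hMi
    by_contra hne
    obtain ⟨x, hx, hxM⟩ := SetLike.not_le_iff_exists.1 hne
    -- On `M^∨ / M` the operator `ζ` is annihilated by a polynomial that splits over `ℂ`, so it has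
    -- an eigenvector as soon as the quotient is non-zero.
    have hsplit : (grSlope k f).Splits := IsAlgClosed.splits _
    have hgr := hsplit.eq_prod_roots_of_monic (grSlope_monic h.slope.1 k).1
    have hDa := hMa.dualIn h.skew
    obtain ⟨e, he, heM, c, hc⟩ := exists_eigenvector (hDa k (-1) hw1) (grSlope k f).roots x hx hxM
      (by
        rw [← hgr]
        exact zEval_grSlope_mem h.slope hm0 hk h.root fun a b hab =>
          hpos hab (mem_shift_of_mem hx a b))
    rw [zEval_sub, zEval_X, LinearMap.sub_apply, zEval_C] at hc
    set ζe := (mon γ k (-1) : Module.End F V) e with hζe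
    have hinv : (mon γ (-k) 1 : Module.End F V) ζe = e := by
      rw [hζe, mon_apply_mon, neg_add_cancel, add_neg_cancel, mon_zero_apply]
    -- The inverse of `ζ` also has weight zero and preserves `M`.
    have hc0 : c ≠ 0 := by
      rintro rfl
      rw [map_zero, zero_smul, sub_zero] at hc
      apply heM
      rw [← hinv]
      exact hMa _ _ hw2 (mem_shift_of_mem hc _ _)
    -- For odd `k` the operator `ζ` is skew. An eigenvector with eigenvalue `c ≠ 0` then has
    -- integral norm, and adding it to `M` contradicts maximality.
    have hskewζ : B ζe e = 0 := by
      have h1 := mon_adjoint h.skew k (-1) e e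
      have h2 : Odd (k : ℤ) := by exact_mod_cast hodd
      rw [h2.neg_one_zpow, neg_one_mul, h.symm.eq e] at h1
      exact eq_zero_of_eq_neg h1
    have hee : B e e ∈ (1 : Submodule O F) := by
      have h1 := he.1 _ hc
      rw [map_sub, h.symm.eq e, hskewζ, zero_sub, neg_mem_iff, ← algebraMap_smul F, map_smul] at h1
      have h2 := mul_mem_one (cst_mem_one (F := F) c⁻¹) h1
      rwa [smul_eq_mul, ← mul_assoc, cst, ← map_mul, ← map_mul, inv_mul_cancel₀ hc0, map_one,
        map_one, one_mul] at h2
    have hX1 : shift γ k (-1) (M ⊔ Submodule.span O {e}) ≤ M ⊔ Submodule.span O {e} := by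
      rw [shift_sup, shift_span_singleton]
      refine sup_le ((hMa _ _ hw1).trans le_sup_left) ?_
      rw [Submodule.span_singleton_le_iff_mem]
      exact mem_sup_span.2 ⟨_, hc, PowerSeries.C c, sub_add_cancel _ _⟩
    have hX2 : shift γ (-k) 1 (M ⊔ Submodule.span O {e}) ≤ M ⊔ Submodule.span O {e} := by
      rw [shift_sup, shift_span_singleton]
      refine sup_le ((hMa _ _ hw2).trans le_sup_left) ?_
      rw [Submodule.span_singleton_le_iff_mem]
      have h1 := hMa _ _ hw2 (mem_shift_of_mem hc (-k) 1)
      rw [map_sub, hinv, ← cst_smul (F := F), map_smul, cst_smul] at h1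
      have h2 := M.smul_mem (-PowerSeries.C c⁻¹) h1
      rw [smul_sub, smul_smul, neg_mul, ← map_mul, inv_mul_cancel₀ hc0, map_one, neg_smul,
        neg_smul, one_smul, sub_neg_eq_add, neg_add_eq_sub] at h2
      exact mem_sup_span.2 ⟨_, h2, PowerSeries.C c⁻¹, sub_add_cancel _ _⟩
    -- The monomials of weight zero are the powers of `ζ`, and those of positive weight map the dual
    -- into `M`.
    have hXa : Adapted γ f.natDegree (ordConst f) (M ⊔ Submodule.span O {e}) := by
      intro a b hab
      rcases hab.eq_or_lt with h0 | h0
      · have ha : a = -b * k := by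
          have h1 : (ordConst f : ℤ) * (b * k + a) = 0 := by rw [hkz] at h0; linarith
          have h2 := (mul_eq_zero.1 h1).resolve_left (by exact_mod_cast hm0.ne')
          linarith
        obtain ⟨n, rfl | rfl⟩ := b.eq_nat_or_neg
        · have := (relLen_shift_pow hX2 n).1
          rwa [mul_one, mul_neg, ← neg_mul, ← ha] at this
        · have := (relLen_shift_pow hX1 n).1
          rwa [mul_neg_one, ← neg_neg (n : ℤ), ← ha, neg_neg] at this
      · rw [shift_sup]
        refine sup_le ((hMa _ _ h0.le).trans le_sup_left) (le_trans ?_ le_sup_left)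
        exact (shift_mono ((Submodule.span_singleton_le_iff_mem _ _).2 he) a b).trans (hpos h0)
    have hXi : M ⊔ Submodule.span O {e} ≤ dualIn B ⊤ (M ⊔ Submodule.span O {e}) := by
      refine sup_le_dualIn h.symm hMi ((Submodule.span_singleton_le_iff_mem _ _).2 he) ?_
      intro u hu
      obtain ⟨c, rfl⟩ := Submodule.mem_span_singleton.1 hu
      refine ⟨fun v hv => ?_, trivial⟩
      obtain ⟨d, rfl⟩ := Submodule.mem_span_singleton.1 hv
      rw [← algebraMap_smul F c, ← algebraMap_smul F d, map_smul, map_smul, LinearMap.smul_apply]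
      exact mul_mem_one (algebraMap_mem_one d) (mul_mem_one (algebraMap_mem_one c) hee)
    apply heM
    rw [← hmax _ hXa hXi le_sup_left]
    exact mem_sup_span_self _ _
  have hlow : ∀ j : ℕ, j * ordConst f < f.natDegree →
      tS F M ≤ act ((γ : Module.End F V) ^ j) M := by
    intro j hj
    rw [tS_eq_shift (γ := γ), act_pow_eq_shift]
    refine hMa.shift_le ?_
    zify at hj
    linarith
  refine ⟨M, ⟨hM, hMd, ?_, fun j => ?_⟩, hlow⟩
  · rw [act_eq_shift]; exact hMa 1 0 (by simp)
  · rw [partSum_balanced hm0]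
    by_cases hj : j * ordConst f < f.natDegree
    · have h1 := hMa.rankLen_add hM h.finrank hN0 hj.le le_rfl le_rfl (hlow j hj)
      rwa [relLen_self, zero_add, add_zero] at h1
    · rw [Nat.sub_eq_zero_of_le (not_lt.1 hj)]
      refine rankLen_eq_zero ?_
      rw [tS_eq_shift (γ := γ), act_pow_eq_shift]
      refine hMa.shift_le ?_
      zify at hj
      linarith

end Graded

/-! ### Blocks with even `k`: a normalized generator and lattices spanned by intervals of powers of
`ζ`. -/

section Model

variable {F : Type*} [Field F] [Algebra O F] [IsFractionRing O F]
variable {V : Type*} [AddCommGroup V] [Module F V] [Module O V] [IsScalarTower O F V]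

/-- The `𝒪`-submodule generated by `v`. -/
local notation "⟪" v "⟫" => Submodule.span O {v}

variable {B : LinearMap.BilinForm F V} {γ : (Module.End F V)ˣ} {f : O[X]} {k : ℕ} {v : V} {p : ℤ}

/-- The vector `(γ ^ k / t) ^ i v`. -/
def zv (γ : (Module.End F V)ˣ) (k : ℕ) (v : V) (i : ℤ) : V :=
  (mon γ (k * i) (-i) : Module.End F V) v

/-- A block of slope `1 / k`, `k` even, with a generator `v`. -/
structure IsPreModel (B : LinearMap.BilinForm F V) (γ : (Module.End F V)ˣ) (f : O[X]) (k : ℕ)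
    (v : V) : Prop extends IsBlock B γ f where
  natDegree_eq : f.natDegree = ordConst f * k
  even : Even k
  lat : IsLat (⊤ : Submodule F V) (adaptedSpan f γ v)

/-- A block of slope `1 / k`, `k` even, with a generator `v` for which the values
`B (ζ ^ i v, v)`, `ζ = γ ^ k / t`, are integral for `p < i < p + m`. -/
structure IsModel (B : LinearMap.BilinForm F V) (γ : (Module.End F V)ˣ) (f : O[X]) (k : ℕ) (v : V)
    (p : ℤ) : Prop extends IsPreModel B γ f k v where
  dual : dualIn B ⊤ (adaptedSpan f γ v) = shift γ 1 0 (adaptedSpan f γ v)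
  integral : ∀ i, p < i → i < p + ordConst f → B (zv γ k v i) v ∈ (1 : Submodule O F)
  notIntegral : B (zv γ k v (p + ordConst f)) v ∉ (1 : Submodule O F)

/-- The lattice generated by elements of positive weight and by `ζ ^ i v` for `a ≤ i < a + r`. -/
def interval (f : O[X]) (γ : (Module.End F V)ˣ) (k : ℕ) (v : V) (a : ℤ) : ℕ → Submodule O V
  | 0 => shift γ 1 0 (adaptedSpan f γ v)
  | r + 1 => interval f γ k v a r ⊔ ⟪zv γ k v (a + r)⟫

theorem interval_le_iff {a : ℤ} {r : ℕ} {Y : Submodule O V} : interval f γ k v a r ≤ Y ↔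
    shift γ 1 0 (adaptedSpan f γ v) ≤ Y ∧ ∀ j : ℕ, j < r → zv γ k v (a + j) ∈ Y := by
  induction r with
  | zero => simp [interval]
  | succ r ih =>
    rw [interval, sup_le_iff, ih, Submodule.span_singleton_le_iff_mem, and_assoc]
    refine and_congr_right fun _ => ⟨fun h j hj => ?_, fun h => ⟨fun j hj => h j (by omega),
      h r (Nat.lt_succ_self r)⟩⟩
    rcases Nat.lt_succ_iff_lt_or_eq.1 hj with h' | rfl
    · exact h.1 j h'
    · exact h.2

theorem shift_le_interval (a : ℤ) (r : ℕ) :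
    shift γ 1 0 (adaptedSpan f γ v) ≤ interval f γ k v a r := (interval_le_iff.1 le_rfl).1

theorem zv_mem_interval {a : ℤ} {r j : ℕ} (hj : j < r) :
    zv γ k v (a + j) ∈ interval f γ k v a r := (interval_le_iff.1 le_rfl).2 j hj

theorem interval_succ' (a : ℤ) (r : ℕ) :
    interval f γ k v a (r + 1) = interval f γ k v (a + 1) r ⊔ ⟪zv γ k v a⟫ := by
  induction r with
  | zero => simp [interval]
  | succ r ih =>
    rw [interval, ih, interval, sup_assoc, sup_assoc, sup_comm ⟪zv γ k v a⟫]
    push_cast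
    rw [add_assoc a 1, add_comm (1 : ℤ)]

theorem mon_zv (c i : ℤ) :
    (mon γ (k * c) (-c) : Module.End F V) (zv γ k v i) = zv γ k v (c + i) := by
  rw [zv, mon_apply_mon, zv, mul_add, neg_add]

theorem IsPreModel.k_pos (h : IsPreModel B γ f k v) : 0 < k := by
  apply Nat.pos_of_ne_zero
  rintro rfl
  have := h.slope.2.1
  rw [h.natDegree_eq] at this
  simp at this

theorem IsPreModel.weight (h : IsPreModel B γ f k v) (c : ℤ) :
    -c * f.natDegree + k * c * ordConst f = 0 := by
  have : (f.natDegree : ℤ) = ordConst f * k := by exact_mod_cast h.natDegree_eq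
  rw [this]; ring

theorem IsPreModel.adapted (h : IsPreModel B γ f k v) :
    Adapted γ f.natDegree (ordConst f) (adaptedSpan f γ v) :=
  adapted_adaptedSpan h.slope h.root v

theorem IsPreModel.zv_mem (h : IsPreModel B γ f k v) (i : ℤ) : zv γ k v i ∈ adaptedSpan f γ v :=
  mon_mem_adaptedSpan h.slope h.root v (h.weight i).ge

theorem IsPreModel.shift_le (h : IsPreModel B γ f k v) :
    shift γ 1 0 (adaptedSpan f γ v) ≤ adaptedSpan f γ v := h.adapted 1 0 (by simp)

theorem IsPreModel.interval_le (h : IsPreModel B γ f k v) (a : ℤ) (r : ℕ) :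
    interval f γ k v a r ≤ adaptedSpan f γ v :=
  interval_le_iff.2 ⟨h.shift_le, fun _ _ => h.zv_mem _⟩

theorem IsPreModel.m_le (h : IsPreModel B γ f k v) : ordConst f ≤ f.natDegree := by
  rw [h.natDegree_eq]; exact Nat.le_mul_of_pos_right _ h.k_pos

theorem IsPreModel.tS_le (h : IsPreModel B γ f k v) :
    tS F (adaptedSpan f γ v) ≤ shift γ 1 0 (adaptedSpan f γ v) := by
  rw [tS_eq_shift (γ := γ)]
  refine h.adapted.shift_le ?_
  have : (ordConst f : ℤ) ≤ f.natDegree := by exact_mod_cast h.m_le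
  linarith

theorem IsPreModel.smul_zv_mem (h : IsPreModel B γ f k v) (i : ℤ) (a : ℤ) (r : ℕ) :
    τ F • zv γ k v i ∈ interval f γ k v a r := by
  refine shift_le_interval a r (h.tS_le ?_)
  rw [← tEnd_apply]; exact mem_act_of_mem (h.zv_mem i)

theorem IsPreModel.shift_interval (h : IsPreModel B γ f k v) (c a : ℤ) (r : ℕ) :
    shift γ (k * c) (-c) (interval f γ k v a r) = interval f γ k v (c + a) r := by
  induction r with
  | zero =>
    rw [interval, interval, shift_shift]
    refine h.adapted.shift_eq ?_
    have := h.weight c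
    linarith
  | succ r ih =>
    rw [interval, interval, shift_sup, ih, shift_span_singleton, mon_zv, add_assoc]

/-- All weights are multiples of `m`. A generator of the adapted lattice either has weight zero, in
which case it is some `ζ^i v` with `0 ≤ i < m`, or has weight at least `m`, in which case a factor
`γ` can be split off. -/
theorem IsPreModel.interval_zero_eq (h : IsPreModel B γ f k v) :
    interval f γ k v 0 (ordConst f) = adaptedSpan f γ v := by
  refine le_antisymm (h.interval_le _ _) ?_
  conv_lhs => rw [adaptedSpan]
  rw [Submodule.span_le]
  rintro _ ⟨⟨n, hn⟩, rfl⟩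
  have hm : (0 : ℤ) < ordConst f := by exact_mod_cast h.ord_pos
  have hw := weight_window h.slope n
  have hkz : (f.natDegree : ℤ) = ordConst f * k := by exact_mod_cast h.natDegree_eq
  by_cases hd : k ∣ n
  · obtain ⟨i, rfl⟩ := hd
    have hi : i < ordConst f := by
      rw [h.natDegree_eq, mul_comm] at hn
      exact Nat.lt_of_mul_lt_mul_right hn
    have e1 : ((k * i : ℕ) * ordConst f / f.natDegree : ℤ) = i := by
      rw [hkz]; push_cast
      rw [show (k : ℤ) * i * ordConst f = i * (ordConst f * k) by ring]
      refine Int.mul_ediv_cancel _ (mul_pos hm ?_).ne'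
      exact_mod_cast h.k_pos
    change (mon γ ((k * i : ℕ) : ℤ) _ : Module.End F V) v ∈ _
    rw [e1]
    have := zv_mem_interval (f := f) (γ := γ) (k := k) (v := v) (a := 0) hi
    rwa [zero_add, zv] at this
  · refine shift_le_interval _ _ ?_
    have h1 : (mon γ (n - 1) (-(n * ordConst f / f.natDegree : ℤ)) : Module.End F V) v ∈
        adaptedSpan f γ v := by
      refine mon_mem_adaptedSpan h.slope h.root v ?_
      rw [hkz] at hw ⊢
      set c : ℤ := n * ordConst f / (ordConst f * k) with hc
      have h2 : 0 ≤ (ordConst f : ℤ) * (n - c * k) := by linarith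
      have h3 : 0 ≤ (n : ℤ) - c * k := nonneg_of_mul_nonneg_right h2 hm
      have h4 : (n : ℤ) - c * k ≠ 0 := fun h0 => hd (by
        have : (k : ℤ) ∣ n := ⟨c, by linarith⟩
        exact_mod_cast this)
      have h5 : 0 ≤ (n : ℤ) - c * k - 1 := by omega
      have := mul_nonneg hm.le h5
      linarith
    have h2 := mem_shift_of_mem h1 1 0 (γ := γ)
    rwa [mon_apply_mon, add_sub_cancel, zero_add] at h2

/-- Both `ζ` and its inverse preserve the adapted lattice, so any `m` consecutive powers serve as
well as the first ones. -/
theorem IsPreModel.interval_eq (h : IsPreModel B γ f k v) (a : ℤ) :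
    interval f γ k v a (ordConst f) = adaptedSpan f γ v := by
  have h1 := h.shift_interval a 0 (ordConst f)
  rw [add_zero] at h1
  rw [← h1, h.interval_zero_eq]
  apply le_antisymm (h.adapted _ _ (h.weight a).ge)
  rw [← neg_neg (k * a : ℤ), ← shift_le_iff]
  exact h.adapted _ _ (by have := h.weight a; linarith)

theorem IsPreModel.relLen_adaptedSpan (h : IsPreModel B γ f k v) :
    relLen (shift γ 1 0 (adaptedSpan f γ v)) (adaptedSpan f γ v) = ordConst f :=
  h.adapted.relLen_shift h.lat h.finrank h.slope.2.1 (by ring)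

theorem interval_mono (a : ℤ) (r s : ℕ) :
    interval f γ k v a r ≤ interval f γ k v a (r + s) :=
  interval_le_iff.2 ⟨shift_le_interval _ _, fun _ hj => zv_mem_interval (by omega)⟩

theorem IsPreModel.relLen_interval_le (h : IsPreModel B γ f k v) (a : ℤ) (r s : ℕ) :
    relLen (interval f γ k v a r) (interval f γ k v a (r + s)) ≤ s := by
  induction s with
  | zero => rw [add_zero, relLen_self]; simp
  | succ s ih =>
    rw [← add_assoc, relLen_add (interval_mono a r s) (interval_mono a (r + s) 1)]
    push_cast
    exact add_le_add ih (relLen_sup_span_le (h.smul_zv_mem _ _ _))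

/-- The quotient by the vectors of positive weight has length `m`, while each of `m` vectors adds at
most one; so each of them adds exactly one. -/
theorem IsPreModel.relLen_interval (h : IsPreModel B γ f k v) (a : ℤ) {r : ℕ} (hr : r ≤ ordConst f) :
    relLen (shift γ 1 0 (adaptedSpan f γ v)) (interval f γ k v a r) = r := by
  obtain ⟨s, hs⟩ := Nat.exists_eq_add_of_le hr
  have h1 : relLen (shift γ 1 0 (adaptedSpan f γ v)) (interval f γ k v a (ordConst f)) =
      ordConst f := by rw [h.interval_eq]; exact h.relLen_adaptedSpan
  rw [hs, relLen_add (shift_le_interval a r) (interval_mono a r s)] at h1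
  have h2 := h.relLen_interval_le a r s
  have h3 := h.relLen_interval_le a 0 r
  rw [zero_add] at h3
  change relLen (shift γ 1 0 (adaptedSpan f γ v)) (interval f γ k v a r) ≤ r at h3
  have h4 : relLen (shift γ 1 0 (adaptedSpan f γ v)) (interval f γ k v a r) ≠ ⊤ :=
    ne_top_of_le_ne_top (ENat.natCast_ne_top r) h3
  have h5 : relLen (interval f γ k v a r) (interval f γ k v a (r + s)) ≠ ⊤ :=
    ne_top_of_le_ne_top (ENat.natCast_ne_top s) h2
  lift relLen (shift γ 1 0 (adaptedSpan f γ v)) (interval f γ k v a r) to ℕ using h4 with x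
  lift relLen (interval f γ k v a r) (interval f γ k v a (r + s)) to ℕ using h5 with y
  norm_cast at *
  omega

theorem IsPreModel.isLat_of (h : IsPreModel B γ f k v) {A : Submodule O V}
    (h1 : shift γ 1 0 (adaptedSpan f γ v) ≤ A) (h2 : A ≤ adaptedSpan f γ v) :
    IsLat (⊤ : Submodule F V) A := (h.lat.shift 1 0).of_le_of_le h.lat h1 h2

theorem IsPreModel.isLat_interval (h : IsPreModel B γ f k v) (a : ℤ) (r : ℕ) :
    IsLat (⊤ : Submodule F V) (interval f γ k v a r) :=
  h.isLat_of (shift_le_interval a r) (h.interval_le a r)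

/-- For even `k` the operator `ζ` is self-adjoint, so the Gram matrix of its powers on `v` is a
Hankel matrix. -/
theorem IsPreModel.form_zv (h : IsPreModel B γ f k v) (i j : ℤ) :
    B (zv γ k v i) (zv γ k v j) = B (zv γ k v (j + i)) v := by
  have h1 := mon_adjoint h.skew (k * j) (-j) (zv γ k v i) v
  have h2 : Even (k * j : ℤ) := (by exact_mod_cast h.even : Even (k : ℤ)).mul_right j
  rw [mon_zv, h2.neg_one_zpow, one_mul] at h1
  exact h1.symm

theorem IsModel.dual_shift (h : IsModel B γ f k v p) :
    dualIn B ⊤ (shift γ 1 0 (adaptedSpan f γ v)) = adaptedSpan f γ v := by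
  rw [← h.dual, h.lat.dualIn_dualIn h.symm h.nondeg]

/-- The exponents `i + j` arising from the two intervals run from `p + 1` to `p + m - 1`, where the
form is integral. This gives one inclusion, and the lengths leave no room for more. -/
theorem IsModel.dualIn_interval (h : IsModel B γ f k v p) {a a' : ℤ} {r r' : ℕ}
    (ha : a + a' = p + 1) (hr : r + r' = ordConst f) :
    dualIn B ⊤ (interval f γ k v a r) = interval f γ k v a' r' := by
  have hle : interval f γ k v a' r' ≤ dualIn B ⊤ (interval f γ k v a r) := by
    rw [interval_le_iff]
    refine ⟨by rw [← h.dual]; exact dualIn_anti ⊤ (h.interval_le a r), fun j hj => ?_⟩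
    have h1 : interval f γ k v a r ≤ dualIn B ⊤ ⟪zv γ k v (a' + j)⟫ := by
      rw [interval_le_iff]
      refine ⟨?_, fun i hi => ⟨fun y hy => ?_, trivial⟩⟩
      · rw [← h.dual]
        exact dualIn_anti ⊤ ((Submodule.span_singleton_le_iff_mem _ _).2 (h.zv_mem _))
      · obtain ⟨c, rfl⟩ := Submodule.mem_span_singleton.1 hy
        rw [← algebraMap_smul F c, map_smul]
        refine mul_mem_one (algebraMap_mem_one c) ?_
        rw [h.form_zv]
        exact h.integral _ (by omega) (by omega)
    exact le_dualIn_comm (U := (⊤ : Submodule F V)) h.symm le_top h1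
      (Submodule.mem_span_singleton_self _)
  refine le_antisymm ?_ hle
  rw [← relLen_eq_zero_iff]
  have h1 : relLen (shift γ 1 0 (adaptedSpan f γ v)) (dualIn B ⊤ (interval f γ k v a r)) =
      relLen (interval f γ k v a r) (adaptedSpan f γ v) := by
    rw [← h.dual]
    exact relLen_dualIn h.symm h.nondeg (h.isLat_interval a r) h.lat (h.interval_le a r)
  rw [relLen_add (shift_le_interval a' r') hle, h.relLen_interval a' (by omega)] at h1
  have h2 := h.relLen_interval_le a r r'
  rw [hr, h.interval_eq, ← h1] at h2
  have h3 := (ENat.add_le_add_iff_left (ENat.natCast_ne_top r')).1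
    (h2.trans_eq (add_zero _).symm)
  exact nonpos_iff_eq_zero.1 h3

/-- Because `m` divides `N`, the inequality `j m < N` improves to `(j + 1) m ≤ N`. Hence `t` times
the adapted lattice lies in `γ^(j+1)` times it, whichever lattices are chosen in between. -/
theorem IsModel.low_bound (h : IsModel B γ f k v p) {A D : Submodule O V}
    (hA : A ≤ adaptedSpan f γ v) (hD : shift γ 1 0 (adaptedSpan f γ v) ≤ D) {j : ℕ}
    (hj : j * ordConst f < f.natDegree) : tS F A ≤ act ((γ : Module.End F V) ^ j) D := by
  have hA' : tS F A ≤ tS F (adaptedSpan f γ v) := act_mono hA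
  refine hA'.trans (le_trans ?_ (act_mono hD))
  rw [tS_eq_shift (γ := γ), act_pow_eq_shift, shift_shift]
  refine h.adapted.shift_le ?_
  have h1 : (j + 1) * ordConst f ≤ f.natDegree := by
    rw [h.natDegree_eq, mul_comm] at hj ⊢
    exact Nat.mul_le_mul_left _ (Nat.lt_of_mul_lt_mul_left hj)
  zify at h1
  linarith

theorem IsModel.high_bound (h : IsModel B γ f k v p) {A D : Submodule O V}
    (hD : D ≤ adaptedSpan f γ v) (hA : shift γ 1 0 (adaptedSpan f γ v) ≤ A) {j : ℕ}
    (hj : f.natDegree < j * ordConst f) : act ((γ : Module.End F V) ^ j) D ≤ tS F A := by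
  have hA' : tS F (shift γ 1 0 (adaptedSpan f γ v)) ≤ tS F A := act_mono hA
  refine (act_mono hD).trans (le_trans ?_ hA')
  rw [tS_eq_shift (γ := γ), act_pow_eq_shift, shift_shift]
  refine h.adapted.shift_le ?_
  have h1 : f.natDegree + ordConst f ≤ j * ordConst f := by
    rw [h.natDegree_eq, mul_comm _ k] at hj ⊢
    have := Nat.lt_of_mul_lt_mul_right hj
    calc k * ordConst f + ordConst f = (k + 1) * ordConst f := by ring
      _ ≤ _ := Nat.mul_le_mul_right _ this
  zify at h1
  linarith

theorem stable_of_le {A D : Submodule O V}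
    (hD : D ≤ adaptedSpan f γ v) (hA : shift γ 1 0 (adaptedSpan f γ v) ≤ A) :
    act (γ : Module.End F V) D ≤ A := by
  rw [act_eq_shift]; exact (shift_mono hD 1 0).trans hA

/-- Away from `j = k` the rank depends only on lengths. For `j = k` one has `γ^k = t ζ`, and the
rank measures how far `ζ` moves `D` out of `A`. -/
theorem IsModel.rankLen_eq (h : IsModel B γ f k v p) {A D : Submodule O V}
    (hA : shift γ 1 0 (adaptedSpan f γ v) ≤ A) (hA' : A ≤ adaptedSpan f γ v)
    (hD : shift γ 1 0 (adaptedSpan f γ v) ≤ D) (hD' : D ≤ adaptedSpan f γ v) {x y z r : ℕ}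
    (hx : relLen (shift γ 1 0 (adaptedSpan f γ v)) A = x)
    (hy : relLen (shift γ 1 0 (adaptedSpan f γ v)) D = y)
    (hz : relLen A (shift γ k (-1) D ⊔ A) = z) {j : ℕ}
    (h1 : j * ordConst f < f.natDegree → x + r = f.natDegree - j * ordConst f + y)
    (h2 : j = k → r = z) (h3 : f.natDegree < j * ordConst f → r = 0) :
    rankLen (γ : Module.End F V) A D j = r := by
  rcases lt_trichotomy (j * ordConst f) f.natDegree with hj | hj | hj
  · have h4 := (h.adapted.shift 1 0).rankLen_add (h.lat.shift 1 0) h.finrank h.slope.2.1 hj.le hA hD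
      (h.low_bound hA' hD hj)
    rw [hx, hy, ← Nat.cast_add, ← h1 hj, Nat.cast_add] at h4
    exact (ENat.add_right_injective_of_ne_top (ENat.natCast_ne_top x)) h4
  · have hjk : j = k := by
      rw [h.natDegree_eq, mul_comm] at hj
      exact Nat.eq_of_mul_eq_mul_left h.ord_pos hj
    subst hjk
    have e1 : act ((γ : Module.End F V) ^ j) D = tS F (shift γ j (-1) D) := by
      rw [act_pow_eq_shift, tS_eq_shift (γ := γ), shift_shift]; simp
    rw [rankLen, e1, ← tS_sup, relLen_tS le_sup_right, hz, h2 rfl]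
  · rw [rankLen_eq_zero (h.high_bound hD' hA hj), h3 hj]; rfl

theorem IsModel.zv_notMem (h : IsModel B γ f k v p) {a : ℤ} {r : ℕ} (hr : r < ordConst f) :
    zv γ k v (a + r) ∉ interval f γ k v a r := by
  intro hmem
  have h1 := h.relLen_interval a (r := r + 1) hr
  rw [interval, sup_eq_left.2 ((Submodule.span_singleton_le_iff_mem _ _).2 hmem),
    h.relLen_interval a hr.le] at h1
  norm_cast at h1
  omega

theorem IsModel.zv_notMem' (h : IsModel B γ f k v p) {a : ℤ} {r : ℕ} (hr : r < ordConst f) :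
    zv γ k v a ∉ interval f γ k v (a + 1) r := by
  intro hmem
  have h1 := h.relLen_interval a (r := r + 1) hr
  rw [interval_succ', sup_eq_left.2 ((Submodule.span_singleton_le_iff_mem _ _).2 hmem),
    h.relLen_interval (a + 1) hr.le] at h1
  norm_cast at h1
  omega

theorem IsModel.shift_one_interval (h : IsModel B γ f k v p) (a : ℤ) (r : ℕ) :
    shift γ k (-1) (interval f γ k v a r) = interval f γ k v (a + 1) r := by
  have := h.shift_interval 1 a r
  rwa [mul_one, add_comm 1 a] at this

theorem interval_le_succ (a : ℤ) (r : ℕ) :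
    interval f γ k v (a + 1) r ≤ interval f γ k v a (r + 1) := by
  rw [interval_succ']; exact le_sup_left

theorem eq_of_mul_eq {m N j k : ℕ} (hm : 0 < m) (hN : N = m * k) :
    (j * m < N ↔ j < k) ∧ (N < j * m ↔ k < j) ∧ (j * m ≤ N ↔ j ≤ k) := by
  subst hN
  rw [mul_comm m k]
  exact ⟨Nat.mul_lt_mul_right hm, Nat.mul_lt_mul_right hm, Nat.mul_le_mul_right_iff hm⟩

/-- With `p = 0` and `m = 2g + 1` the exponents `1, …, g` are dual to `0, …, g`, so `v` is the
defect. Applying `ζ` to the larger interval produces one new exponent, which is the additional box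
at `j = k`. -/
theorem IsModel.hasOpen (h : IsModel B γ f k v 0) (hodd : ¬ Even (ordConst f)) :
    HasOpen B (γ : Module.End F V) ⊤ (raised f.natDegree (ordConst f)) f.natDegree (ordConst f) := by
  obtain ⟨g, hg⟩ := Nat.not_even_iff_odd.1 hodd
  have hQ : interval f γ k v 1 g ⊔ ⟪zv γ k v 0⟫ = interval f γ k v 0 (g + 1) :=
    (interval_succ' 0 g).symm
  refine ⟨interval f γ k v 1 g, zv γ k v 0, ⟨h.isLat_interval _ _, trivial, ?_,
    h.smul_zv_mem _ _ _, ?_, ?_, fun j => ?_⟩, fun j hj => ?_⟩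
  · exact h.zv_notMem' (a := 0) (by omega)
  · rw [hQ]; exact h.dualIn_interval (by norm_num) (by omega)
  · rw [hQ]; exact stable_of_le (h.interval_le _ _) (shift_le_interval _ _)
  · rw [hQ]
    obtain ⟨c1, c2, c3⟩ := eq_of_mul_eq (j := j) h.ord_pos h.natDegree_eq
    have hz : relLen (interval f γ k v 1 g)
        (shift γ k (-1) (interval f γ k v 0 (g + 1)) ⊔ interval f γ k v 1 g) = (1 : ℕ) := by
      rw [h.shift_one_interval, zero_add, sup_eq_left.2 (interval_mono 1 g 1), interval]
      exact relLen_sup_span (h.zv_notMem (by omega)) (h.smul_zv_mem _ _ _)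
    rw [partSum_raised h.ord_pos]
    refine h.rankLen_eq (shift_le_interval _ _) (h.interval_le _ _) (shift_le_interval _ _)
      (h.interval_le _ _) (h.relLen_interval _ (by omega)) (h.relLen_interval _ (by omega)) hz
      (fun hj => ?_) (fun hj => ?_) (fun hj => ?_)
    · rw [if_pos hj.le]; omega
    · have : j * ordConst f = f.natDegree := by rw [hj, h.natDegree_eq, mul_comm]
      rw [if_pos this.le]; omega
    · rw [if_neg (by omega)]
  · rw [hQ]; exact h.low_bound (h.interval_le _ _) (shift_le_interval _ _) hj

/-- With `p = 0` and `m = 2g + 2` the exponents `1, …, g` are dual to `0, …, g + 1`. The incoming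
defect is glued to `ζ^(g+1) v`, whose norm has exponent `m` and is not integral, and `v` becomes the
outgoing one. The shift by `ζ` takes `0, …, g` to `1, …, g + 1`, so there is no contribution at `j =
k`. -/
theorem IsModel.hasPass (h : IsModel B γ f k v 0) (heven : Even (ordConst f)) :
    HasPass B (γ : Module.End F V) ⊤ (balanced f.natDegree (ordConst f))
      f.natDegree (ordConst f) := by
  obtain ⟨g', hg'⟩ := heven
  obtain ⟨g, rfl⟩ := Nat.exists_eq_add_of_lt (show 0 < g' by have := h.ord_pos; omega)
  have hm : ordConst f = g + (g + 2) := by omega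
  have hR : interval f γ k v 1 g ⊔ ⟪zv γ k v 0⟫ = interval f γ k v 0 (g + 1) :=
    (interval_succ' 0 g).symm
  have hQ : interval f γ k v 0 (g + 1) ⊔ ⟪zv γ k v (1 + g)⟫ = interval f γ k v 0 (g + 2) := by
    have h1 : interval f γ k v 0 (g + 2) =
        interval f γ k v 0 (g + 1) ⊔ ⟪zv γ k v (0 + (g + 1 : ℕ))⟫ := rfl
    rw [h1, show (0 + (g + 1 : ℕ) : ℤ) = 1 + g by push_cast; ring]
  refine ⟨interval f γ k v 1 g, zv γ k v 0, zv γ k v (1 + g), ⟨h.isLat_interval _ _, le_sup_left,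
    trivial, ?_, h.smul_zv_mem _ _ _, ?_, ?_, fun r hr => ?_, ?_, fun j => ?_⟩, ?_,
    h.smul_zv_mem _ _ _, fun j hj => ?_, fun j hj => ?_⟩
  · exact h.zv_notMem (by omega)
  · rw [hR, hQ]; exact h.dualIn_interval (by norm_num) hm.symm
  · rw [h.form_zv]
    have := h.notIntegral
    rwa [show (0 : ℤ) + ordConst f = 1 + g + (1 + g) by rw [hm]; push_cast; ring] at this
  · rw [hR] at hr
    have h1 : interval f γ k v 0 (g + 1) ≤ dualIn B ⊤ ⟪zv γ k v (1 + g)⟫ := by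
      rw [interval_le_iff]
      refine ⟨?_, fun i hi => ⟨fun y hy => ?_, trivial⟩⟩
      · rw [← h.dual]
        exact dualIn_anti ⊤ ((Submodule.span_singleton_le_iff_mem _ _).2 (h.zv_mem _))
      · obtain ⟨c, rfl⟩ := Submodule.mem_span_singleton.1 hy
        rw [← algebraMap_smul F c, map_smul]
        refine mul_mem_one (algebraMap_mem_one c) ?_
        rw [h.form_zv]
        exact h.integral _ (by omega) (by omega)
    exact (h1 hr).1 _ (Submodule.mem_span_singleton_self _)
  · rw [hR, hQ]; exact stable_of_le (h.interval_le _ _) (shift_le_interval _ _)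
  · have hy : interval f γ k v 1 g ⊔ ⟪zv γ k v (1 + g)⟫ = interval f γ k v 1 (g + 1) := rfl
    rw [hR, hy, partSum_balanced h.ord_pos]
    have hz : relLen (interval f γ k v 1 (g + 1))
        (shift γ k (-1) (interval f γ k v 0 (g + 1)) ⊔ interval f γ k v 1 (g + 1)) = (0 : ℕ) := by
      rw [h.shift_one_interval, zero_add, sup_idem, relLen_self]; rfl
    refine h.rankLen_eq (shift_le_interval _ _) (h.interval_le _ _) (shift_le_interval _ _)
      (h.interval_le _ _) (h.relLen_interval _ (by omega)) (h.relLen_interval _ (by omega)) hz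
      (fun hj => by omega) (fun hj => ?_) (fun hj => by omega)
    rw [hj, h.natDegree_eq, mul_comm, Nat.sub_self]
  · exact h.zv_notMem' (a := 0) (by omega)
  · rw [hR, hQ]; exact h.low_bound (h.interval_le _ _) (shift_le_interval _ _) hj
  · rw [hR, hQ]; exact h.high_bound (h.interval_le _ _) (shift_le_interval _ _) hj

/-- With `p = -1` and `m = 2g + 1` the exponents `0, …, g - 1` are dual to `0, …, g`. The vector
`ζ^g v` has its norm at the exponent `2g = p + m`, where the form is not integral. -/
theorem IsModel.hasLowered (h : IsModel B γ f k v (-1)) (hodd : ¬ Even (ordConst f)) :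
    HasLowered B (γ : Module.End F V) ⊤ (lowered f.natDegree (ordConst f))
      f.natDegree (ordConst f) := by
  obtain ⟨g, hg⟩ := Nat.not_even_iff_odd.1 hodd
  have hQ : interval f γ k v 0 g ⊔ ⟪zv γ k v g⟫ = interval f γ k v 0 (g + 1) := by
    rw [interval, zero_add]
  have hd : dualIn B ⊤ (interval f γ k v 0 g) = interval f γ k v 0 (g + 1) :=
    h.dualIn_interval (by norm_num) (by omega)
  refine ⟨interval f γ k v 0 g, zv γ k v g, ⟨h.isLat_interval _ _, le_rfl, trivial, ?_,
    h.smul_zv_mem _ _ _, by rw [hQ, hd], ?_, fun r hr => ?_, ?_, fun j => ?_⟩, fun j hj => ?_⟩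
  · have := h.zv_notMem (a := 0) (r := g) (by omega)
    rwa [zero_add] at this
  · rw [h.form_zv]
    have := h.notIntegral
    rwa [show (-1 : ℤ) + ordConst f = g + g by rw [hg]; push_cast; ring] at this
  · have : zv γ k v g ∈ dualIn B ⊤ (interval f γ k v 0 g) := by
      rw [hd, ← hQ]; exact mem_sup_span_self _ _
    rw [h.symm.eq]; exact this.1 r hr
  · rw [hQ]; exact stable_of_le (h.interval_le _ _) (shift_le_interval _ _)
  · rw [hQ, partSum_lowered h.ord_pos]
    have hz : relLen (interval f γ k v 0 (g + 1))
        (shift γ k (-1) (interval f γ k v 0 g) ⊔ interval f γ k v 0 (g + 1)) = (0 : ℕ) := by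
      rw [h.shift_one_interval, sup_eq_right.2 (interval_le_succ 0 g), relLen_self]; rfl
    refine h.rankLen_eq (shift_le_interval _ _) (h.interval_le _ _) (shift_le_interval _ _)
      (h.interval_le _ _) (h.relLen_interval _ (by omega)) (h.relLen_interval _ (by omega)) hz
      (fun hj => by omega) (fun hj => ?_) (fun hj => by omega)
    rw [hj, h.natDegree_eq, mul_comm k]; omega
  · rw [hQ]; exact h.high_bound (h.interval_le _ _) (shift_le_interval _ _) hj

theorem partSum_exceptional {m k : ℕ} (hm : 2 ≤ m) (hk : 0 < k) (j : ℕ) :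
    partSum ({k + 1} + Multiset.replicate (m - 2) k + {k - 1}) j =
      if j = k then 1 else m * k - j * m := by
  rw [partSum_add, partSum_add, partSum_singleton, partSum_singleton, partSum_replicate]
  obtain ⟨m, rfl⟩ := Nat.exists_eq_add_of_le hm
  rw [Nat.add_sub_cancel_left]
  rcases lt_trichotomy j k with h | rfl | h
  · obtain ⟨i, rfl⟩ := Nat.exists_eq_add_of_lt h
    rw [if_neg h.ne, show j + i + 1 + 1 - j = i + 2 by omega, show j + i + 1 - j = i + 1 by omega,
      show j + i + 1 - 1 - j = i by omega]
    symm
    apply Nat.sub_eq_of_eq_add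
    ring
  · simp
  · rw [if_neg h.ne', Nat.sub_eq_zero_of_le h.le, Nat.sub_eq_zero_of_le (show k + 1 ≤ j from h),
      Nat.sub_eq_zero_of_le (show k - 1 ≤ j by omega), Nat.sub_eq_zero_of_le]
    · simp
    · rw [mul_comm]; exact Nat.mul_le_mul_right _ h.le

/-- With `p = -1` and `m = 2g` the exponents `0, …, g - 1` form a self-dual lattice. It is not
stable under `ζ`, which adds one exponent; this rank one at `j = k` turns two parts `k` into `k + 1`
and `k - 1`. -/
theorem IsModel.hasClosed_exceptional (h : IsModel B γ f k v (-1)) (heven : Even (ordConst f)) :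
    HasClosed B (γ : Module.End F V) ⊤
      ({k + 1} + Multiset.replicate (ordConst f - 2) k + {k - 1})
      f.natDegree (ordConst f) := by
  obtain ⟨g, hg⟩ := heven
  have hm := h.ord_pos
  refine ⟨interval f γ k v 0 g, ⟨h.isLat_interval _ _, h.dualIn_interval (by norm_num) hg.symm,
    stable_of_le (h.interval_le _ _) (shift_le_interval _ _), fun j => ?_⟩,
    fun j hj => h.low_bound (h.interval_le _ _) (shift_le_interval _ _) hj⟩
  have hz : relLen (interval f γ k v 0 g)
      (shift γ k (-1) (interval f γ k v 0 g) ⊔ interval f γ k v 0 g) = (1 : ℕ) := by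
    have e1 : shift γ k (-1) (interval f γ k v 0 g) ⊔ interval f γ k v 0 g =
        interval f γ k v 0 g ⊔ ⟪zv γ k v (0 + g)⟫ := by
      rw [h.shift_one_interval]
      apply le_antisymm
      · exact sup_le (interval_le_succ 0 g) le_sup_left
      · refine sup_le le_sup_right (le_sup_of_le_left ?_)
        rw [Submodule.span_singleton_le_iff_mem]
        have := zv_mem_interval (f := f) (γ := γ) (k := k) (v := v) (a := 0 + 1)
          (show g - 1 < g by omega)
        rwa [show (0 + 1 + (g - 1 : ℕ) : ℤ) = 0 + g by omega] at this
    rw [e1]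
    exact relLen_sup_span (h.zv_notMem (by omega)) (h.smul_zv_mem _ _ _)
  rw [partSum_exceptional (by omega) h.k_pos, ← h.natDegree_eq]
  refine h.rankLen_eq (shift_le_interval _ _) (h.interval_le _ _) (shift_le_interval _ _)
    (h.interval_le _ _) (h.relLen_interval _ (by omega)) (h.relLen_interval _ (by omega)) hz
    (fun hj => ?_) (fun hj => if_pos hj) (fun hj => ?_)
  · have := ((eq_of_mul_eq (j := j) h.ord_pos h.natDegree_eq).1).1 hj
    rw [if_neg this.ne]; omega
  · have := ((eq_of_mul_eq (j := j) h.ord_pos h.natDegree_eq).2.1).1 hj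
    rw [if_neg this.ne']; omega

theorem IsModel.zEval_adjoint (h : IsModel B γ f k v p) (q : ℂ[X]) (x y : V) :
    B (zEval γ k q x) y = B x (zEval γ k q y) := by
  induction q using Polynomial.induction_on' generalizing x y with
  | add p q hp hq =>
    rw [zEval_add, LinearMap.add_apply, LinearMap.map_add₂, LinearMap.add_apply, map_add, hp, hq]
  | monomial n c =>
    have h2 : Even (k * n : ℤ) := (by exact_mod_cast h.even : Even (k : ℤ)).mul_right n
    rw [← C_mul_X_pow_eq_monomial, zEval_mul, Module.End.mul_apply, Module.End.mul_apply, zEval_C,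
      zEval_C, zEval_X_pow, ← cst_smul (F := F), ← cst_smul (F := F), map_smul, map_smul,
      LinearMap.smul_apply, mon_adjoint h.skew, h2.neg_one_zpow, one_mul]

/-- If `gr = s²`, the image of `s(ζ)` is isotropic modulo the vectors of positive weight: `ζ` is
self-adjoint and `s(ζ)²` annihilates the quotient. As `s` has degree `m / 2`, the resulting lattice
is self-dual; being stable under `ζ`, it has no rank at `j = k`, which characterizes the balanced
partition. -/
theorem IsModel.hasClosed_of_isSquare (h : IsModel B γ f k v p) (hsq : IsSquare (grSlope k f)) :
    HasClosed B (γ : Module.End F V) ⊤ (balanced f.natDegree (ordConst f))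
      f.natDegree (ordConst f) := by
  obtain ⟨s, hs⟩ := hsq
  set N₀ := adaptedSpan f γ v with hN₀
  have hds : dualIn B ⊤ (shift γ 1 0 N₀) = N₀ := h.dual_shift
  have hgr := grSlope_monic h.slope.1 k
  have hs0 : s ≠ 0 := by rintro rfl; rw [mul_zero] at hs; exact hgr.1.ne_zero hs
  have hdeg : ordConst f = s.natDegree + s.natDegree := by
    rw [← hgr.2, hs, natDegree_mul hs0 hs0]
  have hw := h.weight 1
  rw [mul_one] at hw
  have hζ : shift γ k (-1) N₀ ≤ N₀ := h.adapted _ _ hw.ge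
  set Λ := shift γ 1 0 N₀ ⊔ act (zEval γ k s) N₀ with hΛ
  have hΛ1 : shift γ 1 0 N₀ ≤ Λ := le_sup_left
  have hΛ2 : Λ ≤ N₀ := sup_le h.shift_le (act_le.2 fun x hx => zEval_mem hζ s hx)
  have hL := h.isLat_of hΛ1 hΛ2
  have hiso : Λ ≤ dualIn B ⊤ Λ := by
    refine sup_le_dualIn h.symm ?_ ?_ ?_
    · exact h.shift_le.trans hds.ge
    · rw [hds]; exact act_le.2 fun x hx => zEval_mem hζ s hx
    · rw [act_le]
      refine fun x hx => ⟨?_, trivial⟩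
      rintro _ ⟨y, hy, rfl⟩
      change B _ (zEval γ k s y) ∈ _
      rw [h.zEval_adjoint, ← Module.End.mul_apply, ← zEval_mul, ← hs, h.symm.eq]
      have h1 : zEval γ k (grSlope k f) y ∈ shift γ 1 0 N₀ := by
        refine zEval_grSlope_mem h.slope h.ord_pos h.natDegree_eq h.root fun a b hab => ?_
        have h2 : shift γ a b N₀ ≤ shift γ 1 0 N₀ := by
          refine h.adapted.shift_le ?_
          have hkz : (f.natDegree : ℤ) = ordConst f * k := by exact_mod_cast h.natDegree_eq
          have hm : (0 : ℤ) < ordConst f := by exact_mod_cast h.ord_pos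
          rw [hkz] at hab ⊢
          have h3 : 0 < (ordConst f : ℤ) * (b * k + a) := by linarith
          have h4 : 1 ≤ b * k + a := pos_of_mul_pos_right h3 hm.le
          have := mul_le_mul_of_nonneg_left h4 hm.le
          linarith
        exact h2 (mem_shift_of_mem hy a b)
      rw [← h.dual] at h1
      exact h1.1 x hx
  have hspan : ∀ r : ℕ, relLen Λ (Λ ⊔ interval f γ k v 0 r) ≤ r := by
    intro r
    induction r with
    | zero => rw [interval, sup_eq_left.2 hΛ1, relLen_self]; simp
    | succ r ih =>
      rw [interval, ← sup_assoc, relLen_add (le_sup_left : Λ ≤ Λ ⊔ interval f γ k v 0 r) le_sup_left]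
      push_cast
      exact add_le_add ih
        (relLen_sup_span_le (Submodule.mem_sup_right (h.smul_zv_mem _ _ _)))
  have htop : Λ ⊔ interval f γ k v 0 s.natDegree = N₀ := by
    refine le_antisymm (sup_le hΛ2 (h.interval_le _ _)) ?_
    rw [hN₀, ← h.interval_zero_eq, interval_le_iff]
    refine ⟨hΛ1.trans le_sup_left, fun j _ => ?_⟩
    have e1 : zv γ k v (0 + j) = zEval γ k (X ^ j) v := by rw [zero_add, zEval_X_pow, zv]
    have hv : v ∈ N₀ := mem_adaptedSpan h.slope h.root v
    -- Division by `s`: modulo the image of `s(ζ)`, the powers of `ζ` below the degree of `s`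
    -- suffice.
    rw [e1, ← EuclideanDomain.div_add_mod (X ^ j) s, zEval_add, LinearMap.add_apply, zEval_mul]
    refine Submodule.add_mem_sup (Submodule.mem_sup_right (mem_act_of_mem (zEval_mem hζ _ hv))) ?_
    by_cases hz : (X ^ j % s : ℂ[X]) = 0
    · rw [hz, show zEval γ k 0 = 0 by simp [zEval]]; exact zero_mem _
    have hlt : (X ^ j % s : ℂ[X]).natDegree < s.natDegree :=
      natDegree_lt_natDegree hz (EuclideanDomain.mod_lt _ hs0)
    rw [as_sum_range_C_mul_X_pow (X ^ j % s : ℂ[X]), zEval_sum, LinearMap.sum_apply]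
    refine Submodule.sum_mem _ fun i hi => ?_
    rw [zEval_mul, Module.End.mul_apply, zEval_C, zEval_X_pow]
    refine Submodule.smul_mem _ _ ?_
    have := zv_mem_interval (f := f) (γ := γ) (k := k) (v := v) (a := 0) (r := s.natDegree) (j := i)
      (by have := Finset.mem_range.1 hi; omega)
    rwa [zero_add, zv] at this
  have hx := hspan s.natDegree
  rw [htop] at hx
  have hdN : dualIn B ⊤ Λ ≤ N₀ := by rw [← hds]; exact dualIn_anti ⊤ hΛ1
  have hd1 : relLen (dualIn B ⊤ Λ) N₀ = relLen (shift γ 1 0 N₀) Λ := by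
    rw [← relLen_dualIn h.symm h.nondeg (h.lat.shift 1 0) hL hΛ1, hds]
  have hd2 : relLen Λ N₀ = relLen Λ (dualIn B ⊤ Λ) + relLen (shift γ 1 0 N₀) Λ := by
    rw [relLen_add hiso hdN, hd1]
  have hd3 : (ordConst f : ℕ∞) = relLen (shift γ 1 0 N₀) Λ + relLen Λ N₀ := by
    rw [← h.relLen_adaptedSpan, relLen_add hΛ1 hΛ2]
  have hn1 := hL.relLen_ne_top h.lat hΛ2
  have hn2 := (h.lat.shift 1 0).relLen_ne_top hL hΛ1
  have hn3 := hL.relLen_ne_top (hL.dualIn h.symm h.nondeg) hiso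
  -- Isotropy makes the upper quotient `N₀ / Λ` at least as long as the lower one, the two add up to
  -- `m`, and division by `s` bounds the upper one by `m / 2`.
  have hfin : relLen Λ (dualIn B ⊤ Λ) = 0 ∧ relLen (shift γ 1 0 N₀) Λ = s.natDegree := by
    lift relLen Λ N₀ to ℕ using hn1 with x
    lift relLen (shift γ 1 0 N₀) Λ to ℕ using hn2 with y
    lift relLen Λ (dualIn B ⊤ Λ) to ℕ using hn3 with z
    norm_cast at *
    omega
  refine ⟨Λ, ⟨hL, le_antisymm (relLen_eq_zero_iff.1 hfin.1) hiso, stable_of_le hΛ2 hΛ1, fun j => ?_⟩,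
    fun j hj => h.low_bound hΛ2 hΛ1 hj⟩
  have hz : relLen Λ (shift γ k (-1) Λ ⊔ Λ) = (0 : ℕ) := by
    rw [sup_eq_right.2, relLen_self]; rfl
    rw [hΛ, shift_sup, shift_shift]
    refine sup_le_sup (h.adapted.shift_le ?_) ?_
    · linarith
    · rw [shift, act_comm]
      · exact act_mono hζ
      · rw [← zEval_X, Commute, SemiconjBy, ← zEval_mul, mul_comm, zEval_mul]
  rw [partSum_balanced h.ord_pos]
  refine h.rankLen_eq hΛ1 hΛ2 hΛ1 hΛ2 hfin.2 hfin.2 hz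
    (fun hj => by omega) (fun hj => ?_) (fun hj => by omega)
  rw [hj, h.natDegree_eq, mul_comm, Nat.sub_self]

end Model

/-! ### Finite free `𝒪`-algebras: completeness, Hensel lifting, square roots of units. -/

section Complete

variable (R : Type*) [CommRing R] [Algebra O R]

/-- The ideal generated by `t`. -/
def tIdeal : Ideal R := Ideal.span {algebraMap O R PowerSeries.X}

variable {R}

theorem mem_tIdeal_pow {n : ℕ} {x : R} :
    x ∈ tIdeal R ^ n ↔ ∃ y, x = (PowerSeries.X : O) ^ n • y := by
  rw [tIdeal, Ideal.span_singleton_pow, Ideal.mem_span_singleton']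
  refine exists_congr fun y => ?_
  rw [Algebra.smul_def, map_pow, mul_comm, eq_comm]

theorem mem_tIdeal {x : R} : x ∈ tIdeal R ↔ ∃ y, x = (PowerSeries.X : O) • y := by
  have := mem_tIdeal_pow (n := 1) (x := x)
  rwa [pow_one, pow_one] at this

/-- Congruence modulo `t^n` can be tested on coordinates in a basis, so limits are taken in `𝒪`
coordinate by coordinate. -/
theorem isAdicComplete_tIdeal [Module.Finite O R] [Module.Free O R] :
    IsAdicComplete (tIdeal R) R := by
  have b := Module.finBasis O R
  have hsm : ∀ (n : ℕ) (x y : R), x ≡ y [SMOD (tIdeal R ^ n • ⊤ : Submodule R R)] ↔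
      ∀ i, x - y ∈ tIdeal R ^ n ∧ (PowerSeries.X : O) ^ n ∣ b.repr x i - b.repr y i := by
    intro n x y
    rw [SModEq.sub_mem, smul_eq_mul, Ideal.mul_top, mem_tIdeal_pow]
    constructor
    · rintro ⟨z, hz⟩ i
      refine ⟨⟨z, hz⟩, b.repr z i, ?_⟩
      rw [← Finsupp.sub_apply, ← map_sub, hz, map_smul]; rfl
    · intro h
      choose c hc using fun i => (h i).2
      refine ⟨∑ i, c i • b i, ?_⟩
      rw [← b.sum_repr (x - y), Finset.smul_sum]
      refine Finset.sum_congr rfl fun i _ => ?_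
      rw [map_sub, Finsupp.sub_apply, hc, mul_smul]
  have hsO : ∀ (n : ℕ) (x y : O), x ≡ y [SMOD
      (Ideal.span {(PowerSeries.X : O)} ^ n • ⊤ : Submodule O O)] ↔
      (PowerSeries.X : O) ^ n ∣ x - y := by
    intro n x y
    rw [SModEq.sub_mem, smul_eq_mul, Ideal.mul_top, Ideal.span_singleton_pow,
      Ideal.mem_span_singleton]
  have hof : ∀ (n : ℕ) (x y : R), (∀ i, (PowerSeries.X : O) ^ n ∣ b.repr x i - b.repr y i) →
      x ≡ y [SMOD (tIdeal R ^ n • ⊤ : Submodule R R)] := by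
    intro n x y h
    rw [hsm]
    refine fun i => ⟨?_, h i⟩
    rw [mem_tIdeal_pow]
    choose c hc using h
    refine ⟨∑ i, c i • b i, ?_⟩
    rw [← b.sum_repr (x - y), Finset.smul_sum]
    refine Finset.sum_congr rfl fun i _ => ?_
    rw [map_sub, Finsupp.sub_apply, hc, mul_smul]
  refine { haus' := fun x hx => ?_, prec' := fun f hf => ?_ }
  · apply b.repr.injective
    ext1 i
    rw [map_zero, Finsupp.zero_apply]
    refine IsHausdorff.haus' (I := Ideal.span {(PowerSeries.X : O)}) _ fun n => ?_
    rw [hsO]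
    have := ((hsm n x 0).1 (hx n) i).2
    rwa [map_zero, Finsupp.zero_apply] at this
  · have h1 : ∀ i, ∃ L : O, ∀ n, b.repr (f n) i ≡ L [SMOD
        (Ideal.span {(PowerSeries.X : O)} ^ n • ⊤ : Submodule O O)] := by
      intro i
      refine IsPrecomplete.prec' _ fun {m n} hmn => ?_
      rw [hsO]
      exact ((hsm m _ _).1 (hf hmn) i).2
    choose L hL using h1
    refine ⟨∑ i, L i • b i, fun n => hof n _ _ fun i => ?_⟩
    rw [← hsO, b.repr_sum_self]
    exact hL i n

theorem henselian_tIdeal [Module.Finite O R] [Module.Free O R] : HenselianRing R (tIdeal R) := by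
  have := isAdicComplete_tIdeal (R := R)
  infer_instance

variable (R) in
/-- The constants in an `𝒪`-algebra. -/
def cstR : ℂ →+* R := (algebraMap O R).comp (PowerSeries.C (R := ℂ))

/-- Modulo `t`, every element is annihilated by a monic complex polynomial. -/
theorem exists_complex_poly [Module.Finite O R] (x : R) :
    ∃ p : ℂ[X], p.Monic ∧ p.eval₂ (cstR R) x ∈ tIdeal R := by
  obtain ⟨q, hq, hqx⟩ := Algebra.IsIntegral.isIntegral (R := O) x
  refine ⟨q.map PowerSeries.constantCoeff, hq.map _, ?_⟩
  have h1 : (q.map PowerSeries.constantCoeff).eval₂ (cstR R) x - q.eval₂ (algebraMap O R) x ∈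
      tIdeal R := by
    rw [eval₂_map, eval₂_eq_sum_range, eval₂_eq_sum_range, ← Finset.sum_sub_distrib]
    refine (tIdeal R).sum_mem fun i _ => ?_
    rw [← sub_mul]
    refine Ideal.mul_mem_right _ _ ?_
    obtain ⟨c, b, hb⟩ := exists_const (q.coeff i)
    rw [mem_tIdeal]
    refine ⟨-algebraMap O R b, ?_⟩
    rw [hb, Algebra.smul_def]
    simp [cstR, mul_comm]
  rwa [hqx, sub_zero] at h1

theorem isUnit_of_mul_sub_one_mem [Module.Finite O R] [Module.Free O R] {x y : R}
    (h : x * y - 1 ∈ tIdeal R) : IsUnit x := by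
  have := henselian_tIdeal (R := R)
  have := isLocalHom_of_le_jacobson_bot (tIdeal R) HenselianRing.jac
  apply IsUnit.of_map (Ideal.Quotient.mk (tIdeal R))
  have h1 : Ideal.Quotient.mk (tIdeal R) x * Ideal.Quotient.mk (tIdeal R) y = 1 := by
    rw [← map_mul, ← map_one (Ideal.Quotient.mk (tIdeal R)), Ideal.Quotient.eq]; exact h
  exact IsUnit.of_mul_eq_one _ h1

/-- Modulo `t`, an annihilating polynomial `X^n q` with `q(0) ≠ 0` gives `x^n ≡ x^n (x s)`, so `(x
s)^n` is idempotent modulo `t`. Hensel lifts it to an idempotent of a domain, which is `0` or `1`;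
these are the two alternatives. Consequently the algebra is local. -/
theorem isUnit_or_isNilpotent [IsDomain R] [Module.Finite O R] [Module.Free O R] (x : R) :
    IsUnit x ∨ ∃ n, x ^ n ∈ tIdeal R := by
  have hH := henselian_tIdeal (R := R)
  obtain ⟨p, hp, hpx⟩ := exists_complex_poly x
  obtain ⟨q, hq, hq0⟩ := exists_eq_pow_rootMultiplicity_mul_and_not_dvd p hp.ne_zero 0
  set n := p.rootMultiplicity 0
  rw [map_zero, sub_zero, X_dvd_iff] at hq0
  rw [map_zero, sub_zero] at hq
  obtain ⟨c, hc⟩ : ∃ c, c * q.coeff 0 = 1 := ⟨_, inv_mul_cancel₀ hq0⟩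
  obtain ⟨s, hs⟩ : ∃ s : R, x ^ n - x ^ n * (x * s) ∈ tIdeal R := by
    refine ⟨-(cstR R c * q.divX.eval₂ (cstR R) x), ?_⟩
    have h1 : x ^ n - x ^ n * (x * -(cstR R c * q.divX.eval₂ (cstR R) x)) =
        cstR R c * p.eval₂ (cstR R) x := by
      have h2 : p.eval₂ (cstR R) x = x ^ n * (q.divX.eval₂ (cstR R) x * x + cstR R (q.coeff 0)) := by
        conv_lhs => rw [hq, ← divX_mul_X_add q]
        simp
      have h3 : cstR R c * cstR R (q.coeff 0) = 1 := by rw [← map_mul, hc, map_one]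
      rw [h2]
      linear_combination (-x ^ n) * h3
    rw [h1]
    exact Ideal.mul_mem_left _ _ hpx
  have hpow : ∀ j : ℕ, x ^ n - x ^ n * (x * s) ^ j ∈ tIdeal R := by
    intro j
    induction j with
    | zero => simp
    | succ j ih =>
      have : x ^ n - x ^ n * (x * s) ^ (j + 1) = (x ^ n - x ^ n * (x * s) ^ j) +
          (x * s) ^ j * (x ^ n - x ^ n * (x * s)) := by ring
      rw [this]
      exact add_mem ih (Ideal.mul_mem_left _ _ hs)
  set e := (x * s) ^ n with he
  have hee : e ^ 2 - e ∈ tIdeal R := by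
    have : e ^ 2 - e = -(s ^ n * (x ^ n - x ^ n * (x * s) ^ n)) := by rw [he, mul_pow]; ring
    rw [this]
    exact neg_mem (Ideal.mul_mem_left _ _ (hpow n))
  obtain ⟨e', he', hee'⟩ := hH.is_henselian (X ^ 2 - X)
    (monic_X_pow_sub (by rw [degree_X]; norm_num)) e (by simpa using hee) (by
      refine IsUnit.of_mul_eq_one (Ideal.Quotient.mk _ (eval e (derivative (X ^ 2 - X)))) ?_
      rw [← map_mul, ← map_one (Ideal.Quotient.mk (tIdeal R)), Ideal.Quotient.eq]
      have : eval e (derivative (X ^ 2 - X)) * eval e (derivative (X ^ 2 - X)) - 1 =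
          4 * (e ^ 2 - e) := by simp; ring
      rw [this]
      exact Ideal.mul_mem_left _ _ hee)
  have h0 : e' * (e' - 1) = 0 := by
    have : e' ^ 2 - e' = 0 := by simpa using he'
    linear_combination this
  rcases mul_eq_zero.1 h0 with h1 | h1
  · right
    refine ⟨n, ?_⟩
    rw [h1, zero_sub, neg_mem_iff] at hee'
    have : x ^ n = (x ^ n - x ^ n * (x * s) ^ n) + x ^ n * e := by rw [he]; ring
    rw [this]
    exact add_mem (hpow n) (Ideal.mul_mem_left _ _ hee')
  · left
    rw [sub_eq_zero.1 h1] at hee'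
    rcases n.eq_zero_or_pos with hn | hn
    · rw [hn] at hs
      refine isUnit_of_mul_sub_one_mem (y := s) ?_
      rw [← neg_mem_iff]
      simpa using hs
    · refine isUnit_of_mul_sub_one_mem (y := s * (x * s) ^ (n - 1)) ?_
      rw [← mul_assoc, ← pow_succ', Nat.sub_add_cancel hn, ← neg_mem_iff, neg_sub]
      exact hee'

/-- A square root is first found up to nilpotents modulo `t`, then modulo `t`, then exactly. No
domain hypothesis is needed, which matters for the algebra generated by a symmetric matrix. -/
theorem isSquare_of_isUnit [Module.Finite O R] [Module.Free O R] {u : R} (hu : IsUnit u) :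
    IsSquare u := by
  have hH := henselian_tIdeal (R := R)
  obtain ⟨q, hq, hqu⟩ := exists_complex_poly u
  choose z hz using fun a : ℂ => IsAlgClosed.exists_eq_mul_self a
  -- A polynomial whose value at each root `a` of `q` is a square root of `a`. Then `h₀² - X`
  -- vanishes at all roots, so a power of it is divisible by `q`.
  let h₀ : ℂ[X] := Lagrange.interpolate q.roots.toFinset id z
  have hroot : ∀ a ∈ q.roots, X - C a ∣ h₀ ^ 2 - X := by
    intro a ha
    rw [dvd_iff_isRoot, IsRoot, eval_sub, eval_pow, eval_X]
    have h1 : eval a h₀ = z a := Lagrange.eval_interpolate_at_node (v := id) z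
      Function.injective_id.injOn (Multiset.mem_toFinset.2 ha)
    rw [h1, sq, ← hz, sub_self]
  have hdvd : q ∣ (h₀ ^ 2 - X) ^ q.roots.card := by
    have h1 := (IsAlgClosed.splits q).eq_prod_roots_of_monic hq
    have h2 := Multiset.prod_dvd_prod_of_dvd (S := q.roots) (fun a => X - C a)
      (fun _ => h₀ ^ 2 - X) hroot
    rw [← h1, Multiset.map_const', Multiset.prod_replicate] at h2
    exact h2
  set π := Ideal.Quotient.mk (tIdeal R)
  set y := h₀.eval₂ (cstR R) u with hy
  have hnil : IsNilpotent (π (y ^ 2 - u)) := by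
    refine ⟨q.roots.card, ?_⟩
    rw [← map_pow, Ideal.Quotient.eq_zero_iff_mem]
    obtain ⟨e, he⟩ := hdvd
    have h1 := congrArg (eval₂ (cstR R) u) he
    rw [eval₂_pow, eval₂_sub, eval₂_pow, eval₂_X, eval₂_mul] at h1
    rw [hy, h1]
    exact Ideal.mul_mem_right _ _ hqu
  have htwo : IsUnit (2 : R) := by
    have h1 : cstR R 2 = 2 := map_ofNat _ 2
    rw [← h1]
    exact (isUnit_iff_ne_zero.2 two_ne_zero).map (cstR R)
  have hyu : IsUnit (π y) := by
    have h1 : IsUnit (π u + π (y ^ 2 - u)) := by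
      rw [add_comm]
      exact hnil.isUnit_add_right_of_commute (hu.map π) (Commute.all _ _)
    rw [← map_add, add_sub_cancel, map_pow] at h1
    exact (isUnit_pow_iff two_ne_zero).1 h1
  -- Newton's method removes the nilpotent error in the quotient by `t`; the derivative `2 y` is
  -- invertible because `u` is.
  obtain ⟨r, ⟨hr1, hr2⟩, -⟩ := existsUnique_nilpotent_sub_and_aeval_eq_zero
    (P := X ^ 2 - C (π u)) (x := π y) (by simpa [π] using hnil) (by
      have h1 : aeval (π y) (derivative (X ^ 2 - C (π u))) = π 2 * π y := by
        simp [one_add_one_eq_two, map_ofNat]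
      rw [h1]
      exact (htwo.map π).mul hyu)
  obtain ⟨r, rfl⟩ := Ideal.Quotient.mk_surjective r
  have hr3 : r ^ 2 - u ∈ tIdeal R := by
    rw [← Ideal.Quotient.eq_zero_iff_mem]
    simpa [π] using hr2
  obtain ⟨a, ha, -⟩ := hH.is_henselian (X ^ 2 - C u)
    (monic_X_pow_sub_C u two_ne_zero) r (by simpa using hr3) (by
      have h2 : eval r (derivative (X ^ 2 - C u)) = 2 * r := by
        simp [one_add_one_eq_two]
      rw [h2, map_mul]
      have h3 : IsUnit (π r ^ 2) := by
        rw [← map_pow, ← sub_add_cancel (r ^ 2) u, map_add, Ideal.Quotient.eq_zero_iff_mem.2 hr3,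
          zero_add]
        exact hu.map π
      exact (htwo.map π).mul ((isUnit_pow_iff two_ne_zero).1 h3))
  refine ⟨a, ?_⟩
  have : a ^ 2 - u = 0 := by simpa using ha
  linear_combination -this

end Complete

/-! ### Square classes in finite extensions, and universality of norm forms. -/

section LocalField

variable {F : Type*} [Field F] [Algebra O F] [IsFractionRing O F]

/-- In a finite extension of the fraction field of `𝒪`, one of `a`, `b`, `a b` is a square. -/
theorem isSquare_or (F : Type*) [Field F] [Algebra O F] [IsFractionRing O F]
    {L : Type*} [Field L] [Algebra F L] [FiniteDimensional F L] (a b : L) :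
    IsSquare a ∨ IsSquare b ∨ IsSquare (a * b) := by
  let _ : Algebra O L := ((algebraMap F L).comp (algebraMap O F)).toAlgebra
  have : IsScalarTower O F L := IsScalarTower.of_algebraMap_eq fun _ => rfl
  have : CharZero F := charZero_of_fraction F
  let R := integralClosure O L
  have : Module.Finite O R := IsIntegralClosure.finite O F L R
  have : IsFractionRing R L := integralClosure.isFractionRing_of_finite_extension F L
  have hinj : Function.Injective (algebraMap O L) :=
    (algebraMap F L).injective.comp (IsFractionRing.injective O F)
  have hinjR : Function.Injective (algebraMap O R) := fun x y h =>
    hinj (congrArg (algebraMap R L) h)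
  have : FaithfulSMul O R := (faithfulSMul_iff_algebraMap_injective O R).2 hinjR
  have : Module.IsTorsionFree O R := inferInstance
  have : Module.Free O R := inferInstance
  have : IsDedekindDomain R := integralClosure.isDedekindDomain O F L
  have hX : ¬ IsUnit (algebraMap O R PowerSeries.X) := fun h =>
    PowerSeries.X_prime.not_isUnit ((isUnit_map_iff (algebraMap O R) _).1 h)
  have hloc : IsLocalRing R := by
    refine IsLocalRing.of_isUnit_or_isUnit_one_sub_self fun x => ?_
    refine (isUnit_or_isNilpotent x).imp_right fun ⟨n, hn⟩ => ?_
    refine isUnit_of_mul_sub_one_mem (y := ∑ i ∈ Finset.range n, x ^ i) ?_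
    rw [mul_neg_geom_sum, sub_sub_cancel_left, neg_mem_iff]
    exact hn
  have hnf : ¬ IsField R := fun h => by
    obtain ⟨y, hy⟩ := h.mul_inv_cancel (a := algebraMap O R PowerSeries.X) (by
      rw [Ne, map_eq_zero_iff _ hinjR]; exact PowerSeries.X_ne_zero)
    exact hX (IsUnit.of_mul_eq_one _ hy)
  -- The integral closure is a Dedekind domain that is local and not a field.
  have hdvr : IsDiscreteValuationRing R := ((IsDiscreteValuationRing.TFAE R hnf).out 2 0).1 ‹_›
  obtain ⟨π, hπ⟩ := IsDiscreteValuationRing.exists_irreducible R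
  have hπ0 : algebraMap R L π ≠ 0 := by
    rw [Ne, map_eq_zero_iff _ (IsFractionRing.injective R L)]; exact hπ.ne_zero
  -- All units are squares, so the square class of an element is given by the parity of its
  -- valuation.
  have key : ∀ x : L, IsSquare x ∨ ∃ y, x = algebraMap R L π * (y * y) := by
    intro x
    by_cases hx : x = 0
    · left; rw [hx]; exact IsSquare.zero
    obtain ⟨p, q, hq, rfl⟩ := IsFractionRing.div_surjective (A := R) x
    have hq0 : algebraMap R L q ≠ 0 := fun h => hx (by rw [h, div_zero])
    have hp0 : p ≠ 0 := by rintro rfl; simp at hx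
    have hpq : p * q ≠ 0 := mul_ne_zero hp0 (nonZeroDivisors.ne_zero hq)
    obtain ⟨n, u, hu⟩ := IsDiscreteValuationRing.eq_unit_mul_pow_irreducible hpq hπ
    obtain ⟨s, hs⟩ := isSquare_of_isUnit u.isUnit
    have e1 : algebraMap R L p / algebraMap R L q =
        (algebraMap R L s / algebraMap R L q) * (algebraMap R L s / algebraMap R L q) *
          algebraMap R L π ^ n := by
      have h1 := congrArg (algebraMap R L) hu
      rw [hs] at h1
      simp only [map_mul, map_pow] at h1
      field_simp
      linear_combination h1
    obtain ⟨i, rfl | rfl⟩ := Nat.even_or_odd' n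
    · left
      exact ⟨algebraMap R L s / algebraMap R L q * algebraMap R L π ^ i, by rw [e1]; ring⟩
    · right
      exact ⟨algebraMap R L s / algebraMap R L q * algebraMap R L π ^ i, by rw [e1]; ring⟩
  rcases key a with h | ⟨x, rfl⟩
  · exact Or.inl h
  rcases key b with h | ⟨y, rfl⟩
  · exact Or.inr (Or.inl h)
  · exact Or.inr (Or.inr ⟨algebraMap R L π * x * y, by ring⟩)

theorem isSquare_neg_one (F : Type*) [Field F] [Algebra O F] [IsFractionRing O F] : IsSquare (-1 : F) := by
  refine ⟨cst F Complex.I, ?_⟩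
  rw [← cst_mul, Complex.I_mul_I, cst_neg, cst_one]

/-- The norm form `x² - μ y²` is universal. -/
theorem exists_sq_sub_mul_sq (F : Type*) [Field F] [Algebra O F] [IsFractionRing O F]
    {L : Type*} [Field L] [Algebra F L] [FiniteDimensional F L] {μ : L} (hμ : μ ≠ 0) (c : L) :
    ∃ x y : L, x * x - μ * (y * y) = c := by
  have : CharZero F := charZero_of_fraction F
  have : CharZero L := charZero_of_injective_algebraMap (algebraMap F L).injective
  obtain ⟨i, hi⟩ : IsSquare (-1 : L) := by
    have := (isSquare_neg_one F).map (algebraMap F L)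
    rwa [map_neg, map_one] at this
  -- If `c` is a square, take `y = 0`. If `μ = s²`, the form factors as `(x - s y)(x + s y)`, and
  -- the factors are made equal to `1` and `c`. If `c μ = s²`, take `x = 0` and use a square root of
  -- `-1`.
  rcases isSquare_or F c μ with ⟨s, hs⟩ | ⟨s, hs⟩ | ⟨s, hs⟩
  · exact ⟨s, 0, by rw [hs]; ring⟩
  · have hs0 : s ≠ 0 := by rintro rfl; simp at hs; exact hμ hs
    refine ⟨(c + 1) / 2, (c - 1) / (2 * s), ?_⟩
    rw [hs]
    field_simp
    ring
  · refine ⟨0, i * s / μ, ?_⟩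
    have : i * s / μ * (i * s / μ) = (i * i) * (s * s) / (μ * μ) := by field_simp
    rw [this, ← hi, ← hs]
    field_simp
    ring

end LocalField

/-! ### Even polynomials as norms `u(X) u(-X)` modulo a squarefree even polynomial. -/

section EvenNorm

variable (F : Type*) [Field F] [Algebra O F] [IsFractionRing O F]

/-- Every polynomial is congruent to a value of the norm form `a² - X b²` modulo a squarefree
polynomial prime to `X`. -/
theorem exists_sq_sub_X_mul_sq {g : F[X]} (hg : Squarefree g) (h0 : g.coeff 0 ≠ 0) (q : F[X]) :
    ∃ a b : F[X], g ∣ a * a - X * (b * b) - q := by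
  induction g using UniqueFactorizationMonoid.induction_on_prime with
  | h₁ => simp at h0
  | h₂ x hx => exact ⟨0, 0, hx.dvd⟩
  | h₃ g p hg0 hp ih =>
    have hpg : IsCoprime p g := by
      rcases EuclideanDomain.dvd_or_coprime p g hp.irreducible with h | h
      swap
      · exact h
      · obtain ⟨s, rfl⟩ := h
        exact (hp.not_isUnit (hg p ⟨s, by ring⟩)).elim
    rw [mul_coeff_zero] at h0
    obtain ⟨a₂, b₂, h₂⟩ := ih (hg.of_mul_right) (right_ne_zero_of_mul h0)
    have : Fact (Irreducible p) := ⟨hp.irreducible⟩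
    have : FiniteDimensional F (AdjoinRoot p) := (AdjoinRoot.powerBasis hp.ne_zero).finite
    -- Modulo a prime `p` the problem is the universality of `x² - μ y²` in a finite extension, with
    -- `μ` the class of `X`; it is non-zero because `p(0) ≠ 0`.
    obtain ⟨x, y, hxy⟩ := exists_sq_sub_mul_sq F (μ := AdjoinRoot.root p) (fun h => by
      rw [← AdjoinRoot.mk_X, AdjoinRoot.mk_eq_zero] at h
      obtain ⟨s, hs⟩ := h
      have h1 := congrArg (fun r => coeff r 0) hs
      have h2 := congrArg (fun r => coeff r 1) hs
      simp only [coeff_X_zero, mul_coeff_zero] at h1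
      have h3 : s.coeff 0 = 0 := (mul_eq_zero.1 h1.symm).resolve_left (left_ne_zero_of_mul h0)
      obtain ⟨s', rfl⟩ := X_dvd_iff.2 h3
      have h4 : p * s' = 1 := by
        apply mul_right_cancel₀ (X_ne_zero (R := F))
        linear_combination -hs
      exact hp.not_isUnit (IsUnit.of_mul_eq_one _ h4)) (AdjoinRoot.mk p q)
    obtain ⟨a₁, rfl⟩ := AdjoinRoot.mk_surjective x
    obtain ⟨b₁, rfl⟩ := AdjoinRoot.mk_surjective y
    rw [← AdjoinRoot.mk_X, ← map_mul, ← map_mul, ← map_mul, ← map_sub, ← sub_eq_zero, ← map_sub,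
      AdjoinRoot.mk_eq_zero] at hxy
    obtain ⟨r, s, hrs⟩ := id hpg
    -- The solutions modulo `p` and modulo `g` are combined by the Chinese remainder theorem.
    refine ⟨a₁ * (s * g) + a₂ * (r * p), b₁ * (s * g) + b₂ * (r * p), hpg.mul_dvd ?_ ?_⟩
    · have e : s * g = 1 - r * p := by rw [← hrs]; ring
      obtain ⟨z, hz⟩ := hxy
      rw [e]
      refine ⟨z + r * (-2 * a₁ * a₁ + 2 * a₁ * a₂ + 2 * X * b₁ * b₁ - 2 * X * b₁ * b₂) +
        r * r * p * ((a₂ - a₁) ^ 2 - X * (b₂ - b₁) ^ 2), ?_⟩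
      linear_combination hz
    · have e : r * p = 1 - s * g := by rw [← hrs]; ring
      obtain ⟨z, hz⟩ := h₂
      rw [e]
      refine ⟨z + s * (-2 * a₂ * a₂ + 2 * a₁ * a₂ + 2 * X * b₂ * b₂ - 2 * X * b₁ * b₂) +
        s * s * g * ((a₂ - a₁) ^ 2 - X * (b₂ - b₁) ^ 2), ?_⟩
      linear_combination hz

variable {F}

theorem coeff_comp_neg_X {R : Type*} [CommRing R] (q : R[X]) (n : ℕ) : (q.comp (-X)).coeff n = (-1) ^ n * q.coeff n := by
  have : q.comp (-X) = q.comp (C (-1) * X) := by simp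
  rw [this, comp_C_mul_X_coeff, mul_comm]

theorem exists_eq_expand {q : F[X]} (h : q.comp (-X) = q) : ∃ g, q = expand F 2 g := by
  have : CharZero F := charZero_of_fraction F
  refine ⟨contract 2 q, ?_⟩
  ext n
  rw [coeff_expand two_pos]
  split_ifs with hn
  · rw [coeff_contract two_ne_zero, Nat.div_mul_cancel hn]
  · have h1 := coeff_comp_neg_X q n
    rw [h, (Nat.odd_iff.2 (Nat.two_dvd_ne_zero.1 hn)).neg_one_pow, neg_one_mul] at h1
    exact eq_zero_of_eq_neg h1

/-- An even polynomial is congruent to `u(X) u(-X)` modulo a squarefree even polynomial prime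
to `X`. -/
theorem exists_mul_comp_neg {P c : F[X]} (hP : P.comp (-X) = P) (hc : c.comp (-X) = c)
    (hsq : Squarefree P) (h0 : P.coeff 0 ≠ 0) : ∃ u : F[X], P ∣ u * u.comp (-X) - c := by
  obtain ⟨g, rfl⟩ := exists_eq_expand hP
  obtain ⟨q, rfl⟩ := exists_eq_expand hc
  have hg : Squarefree g := fun x ⟨y, hy⟩ => by
    have := hsq (expand F 2 x) ⟨expand F 2 y, by rw [hy, map_mul, map_mul]⟩
    have h1 := natDegree_eq_zero_of_isUnit this
    rw [natDegree_expand] at h1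
    have hx : x ≠ 0 := by rintro rfl; simp at this
    rw [isUnit_iff_degree_eq_zero, degree_eq_natDegree hx, show x.natDegree = 0 by omega]
    rfl
  obtain ⟨a, b, s, hs⟩ := exists_sq_sub_X_mul_sq F hg (by
    rw [coeff_expand two_pos] at h0; simpa using h0) q
  have hexp : ∀ r : F[X], (expand F 2 r).comp (-X) = expand F 2 r := fun r => by
    rw [expand_eq_comp_X_pow, comp_assoc]; simp
  -- For `u = a(X²) + X b(X²)` the product `u(X) u(-X)` is `a² - Y b²` evaluated at `Y = X²`.
  refine ⟨expand F 2 a + X * expand F 2 b, expand F 2 s, ?_⟩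
  have h1 := congrArg (expand F 2) hs
  simp only [map_sub, map_mul, expand_X] at h1
  rw [add_comp, mul_comp, hexp, hexp, X_comp]
  linear_combination h1

end EvenNorm

/-! ### Recognizing a model by the values of the form. -/

section ExistsModel

variable {F : Type*} [Field F] [Algebra O F] [IsFractionRing O F]
variable {V : Type*} [AddCommGroup V] [Module F V] [Module O V] [IsScalarTower O F V]

local notation "⟪" v "⟫" => Submodule.span O {v}

variable {B : LinearMap.BilinForm F V} {γ : (Module.End F V)ˣ} {f : O[X]} {k : ℕ} {v : V} {p : ℤ}

theorem inv_τ_not_mem_one {u : O} (hu : IsUnit u) :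
    algebraMap O F u * (τ F)⁻¹ ∉ (1 : Submodule O F) := by
  intro h
  obtain ⟨w, rfl⟩ := hu
  have h1 := mul_mem_one (algebraMap_mem_one (F := F) (↑w⁻¹ : O)) h
  rw [← mul_assoc, ← map_mul, Units.inv_mul, map_one, one_mul] at h1
  have h2 := cst_div_mem_one_iff (F := F) (c := 1)
  rw [cst_one, one_div] at h2
  exact one_ne_zero (h2.1 h1)

/-- The Hankel matrix of the `ζ^i v` is triangular modulo integers with non-integral antidiagonal,
so the pairing on `N₀ / γ N₀` is perfect, where `N₀` is the adapted lattice (`key`). For `z` in the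
dual some `γ^a z` lies in `N₀`; perfectness puts it in `γ N₀`, and cancelling `γ` lowers `a` to
zero. -/
theorem IsPreModel.isModel (h : IsPreModel B γ f k v)
    (hle : shift γ 1 0 (adaptedSpan f γ v) ≤ dualIn B ⊤ (adaptedSpan f γ v))
    (hint : ∀ i, p < i → i < p + ordConst f → B (zv γ k v i) v ∈ (1 : Submodule O F))
    (hnot : B (zv γ k v (p + ordConst f)) v ∉ (1 : Submodule O F)) : IsModel B γ f k v p := by
  refine { h with dual := le_antisymm ?_ hle, integral := hint, notIntegral := hnot }
  have key : ∀ y ∈ adaptedSpan f γ v, (∀ s, B y (zv γ k v s) ∈ (1 : Submodule O F)) →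
      y ∈ shift γ 1 0 (adaptedSpan f γ v) := by
    intro y hy hyB
    have hind : ∀ r : ℕ, r ≤ ordConst f → y ∈ interval f γ k v 0 r →
        y ∈ interval f γ k v 0 0 := by
      intro r
      induction r with
      | zero => exact fun _ h => h
      | succ r ih =>
        intro hr hyr
        refine ih (by omega) ?_
        obtain ⟨y', hy', x, hx, hxy⟩ := Submodule.mem_sup.1 hyr
        obtain ⟨c, rfl⟩ := Submodule.mem_span_singleton.1 hx
        -- Pairing with this power of `ζ` puts the top exponent `r` on the antidiagonal and the
        -- exponents below `r` in the integral range.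
        set s : ℤ := p + ordConst f - r with hs
        have h1 : interval f γ k v 0 r ≤ dualIn B ⊤ ⟪zv γ k v s⟫ := by
          rw [interval_le_iff]
          refine ⟨hle.trans (dualIn_anti ⊤ ((Submodule.span_singleton_le_iff_mem _ _).2
            (h.zv_mem _))), fun i hi => ⟨fun z hz => ?_, trivial⟩⟩
          obtain ⟨d, rfl⟩ := Submodule.mem_span_singleton.1 hz
          rw [← algebraMap_smul F d, map_smul]
          refine mul_mem_one (algebraMap_mem_one d) ?_
          rw [h.form_zv]
          exact hint _ (by omega) (by omega)
        have h2 : B y' (zv γ k v s) ∈ (1 : Submodule O F) :=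
          (h1 hy').1 _ (Submodule.mem_span_singleton_self _)
        have h3 := hyB s
        rw [← hxy, map_add, LinearMap.add_apply, add_mem_cancel_left h2, zero_add,
          ← algebraMap_smul F c, map_smul, LinearMap.smul_apply, h.form_zv, hs,
          sub_add_cancel, smul_eq_mul] at h3
        have h4 : ¬ IsUnit c := by
          rintro ⟨u, rfl⟩
          have h5 := mul_mem_one (algebraMap_mem_one (F := F) (↑u⁻¹ : O)) h3
          rw [← mul_assoc, ← map_mul, Units.inv_mul, map_one, one_mul] at h5
          exact hnot h5
        obtain ⟨d, e, rfl⟩ := exists_const c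
        have hd : d = 0 := by
          by_contra hd
          apply h4
          rw [PowerSeries.isUnit_iff_constantCoeff]
          simpa using hd
        rw [← hxy]
        refine add_mem hy' ?_
        rw [hd, map_zero, zero_add, mul_smul, ← τ_smul (F := F)]
        exact Submodule.smul_mem _ _ (h.smul_zv_mem _ _ _)
    exact hind _ le_rfl (by rwa [h.interval_zero_eq])
  intro z hz
  have hpair : ∀ (a : ℕ) (s : ℤ),
      B ((mon γ a 0 : Module.End F V) z) (zv γ k v s) ∈ (1 : Submodule O F) := by
    intro a s
    rw [mon_adjoint_mem h.skew]
    exact hz.1 _ (h.adapted _ _ (by positivity) (mem_shift_of_mem (h.zv_mem s) _ _))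
  obtain ⟨e, he⟩ := exists_pow_smul_mem (A := adaptedSpan f γ v) (x := z)
    (by rw [h.lat.span_eq]; trivial)
  have hstart : (mon γ (f.natDegree * e : ℕ) 0 : Module.End F V) z ∈ adaptedSpan f γ v := by
    have h1 : z ∈ shift γ 0 (-e) (adaptedSpan f γ v) := by
      have h2 := mem_shift_of_mem he (γ := γ) 0 (-e)
      rwa [← tEnd_pow_apply, ← coe_mon_t_nat (γ := γ), mon_apply_mon, add_zero, neg_add_cancel,
        mon_zero_apply] at h2
    have h2 := mem_shift_of_mem h1 (γ := γ) (f.natDegree * e : ℕ) 0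
    rw [shift_shift] at h2
    refine h.adapted _ _ ?_ h2
    push_cast
    have : (1 : ℤ) ≤ ordConst f := by exact_mod_cast h.ord_pos
    have h3 := mul_le_mul_of_nonneg_left this (show (0 : ℤ) ≤ f.natDegree * e by positivity)
    linarith
  have hdown : ∀ a : ℕ, (mon γ a 0 : Module.End F V) z ∈ adaptedSpan f γ v →
      (mon γ a 0 : Module.End F V) z ∈ shift γ 1 0 (adaptedSpan f γ v) := fun a ha =>
    key _ ha (hpair a)
  have hfin : ∀ a : ℕ, (mon γ a 0 : Module.End F V) z ∈ adaptedSpan f γ v →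
      z ∈ adaptedSpan f γ v := by
    intro a
    induction a with
    | zero => intro ha; rwa [Nat.cast_zero, mon_zero_apply] at ha
    | succ a ih =>
      intro ha
      refine ih ?_
      have h1 := mem_shift_of_mem (hdown _ ha) (γ := γ) (-1) 0
      rw [shift_shift, mon_apply_mon] at h1
      push_cast at h1
      simpa [shift_zero] using h1
  have h1 := hdown 0 (by rw [Nat.cast_zero, mon_zero_apply]; exact hfin _ hstart)
  rwa [Nat.cast_zero, mon_zero_apply] at h1

theorem mon_eq_smul (a b : ℤ) (x : V) :
    (mon γ a b : Module.End F V) x = τ F ^ b • (mon γ a 0 : Module.End F V) x := by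
  have h1 : ∀ (b : ℕ) (x : V), (mon γ 0 b : Module.End F V) x = τ F ^ (b : ℤ) • x := by
    intro b x
    rw [coe_mon_t_nat, tEnd_pow_apply, zpow_natCast]
  have h2 : (mon γ a b : Module.End F V) x =
      (mon γ 0 b : Module.End F V) ((mon γ a 0 : Module.End F V) x) := by
    rw [mon_apply_mon, zero_add, add_zero]
  rw [h2]
  generalize (mon γ a 0 : Module.End F V) x = y
  obtain ⟨b, rfl | rfl⟩ := b.eq_nat_or_neg
  · exact h1 b y
  · rw [zpow_neg, eq_inv_smul_iff₀ (zpow_ne_zero _ τ_ne_zero), ← h1, mon_apply_mon, add_zero,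
      add_neg_cancel, mon_zero_apply]

theorem zpow_τ_mem_one {e : ℤ} (he : 0 ≤ e) : τ F ^ e ∈ (1 : Submodule O F) := by
  lift e to ℕ using he
  rw [zpow_natCast, τ, ← map_pow]
  exact algebraMap_mem_one _

/-- The block is a model if the form is, up to a power of `ζ`, the coefficient of `γ ^ 0`. -/
theorem IsPreModel.isModel_of_form (h : IsPreModel B γ f k v)
    (hv : ∀ n : ℕ, n < f.natDegree →
      B ((mon γ n 0 : Module.End F V) (zv γ k v p)) v = if n = 0 then (τ F)⁻¹ else 0) :
    IsModel B γ f k v p := by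
  -- By the relation `f(γ) = 0`, only the constant coefficient of `f` contributes to the first value
  -- outside the prescribed range; it is a unit times `t^m`.
  have hN : B ((mon γ f.natDegree 0 : Module.End F V) (zv γ k v p)) v =
      -(algebraMap O F (f.coeff 0) * (τ F)⁻¹) := by
    have h1 := sum_coeff_smul_mon h.root 0 0 (zv γ k v p)
    rw [Finset.sum_range_succ, show f.coeff f.natDegree = 1 from h.slope.1.coeff_natDegree,
      one_smul, zero_add] at h1
    rw [eq_neg_of_add_eq_zero_right h1, map_neg, LinearMap.neg_apply, map_sum,
      LinearMap.sum_apply, neg_inj,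
      Finset.sum_eq_single_of_mem 0 (Finset.mem_range.2 h.slope.2.1) fun n hn hn0 => ?_]
    · rw [← algebraMap_smul F, map_smul, LinearMap.smul_apply, zero_add, Nat.cast_zero]
      have := hv 0 h.slope.2.1
      rw [Nat.cast_zero] at this
      rw [this, if_pos rfl, smul_eq_mul]
    · rw [← algebraMap_smul F, map_smul, LinearMap.smul_apply, zero_add,
        hv n (Finset.mem_range.1 hn), if_neg hn0, smul_zero]
  obtain ⟨u, hu⟩ := exists_unit_coeff_zero h.slope.2.2.1
  have hN' : B ((mon γ f.natDegree 0 : Module.End F V) (zv γ k v p)) v =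
      τ F ^ (ordConst f : ℤ) * -(algebraMap O F u * (τ F)⁻¹) := by
    rw [hN, hu, map_mul, map_pow, zpow_natCast]; change -(_ * τ F ^ _ * _) = _; ring
  refine h.isModel ?_ (fun i hi hi' => ?_) ?_
  · have key : ∀ x ∈ shift γ 1 0 (adaptedSpan f γ v),
        B ((mon γ (k * p) (-p) : Module.End F V) x) v ∈ (1 : Submodule O F) := by
      have hle : shift γ 1 0 (adaptedSpan f γ v) ≤
          (Submodule.comap ((B.flip v).restrictScalars O ∘ₗ
            ((mon γ (k * p) (-p) : Module.End F V).restrictScalars O)) (1 : Submodule O F)) := by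
        conv_lhs => rw [shift, act, adaptedSpan]
        rw [Submodule.map_span_le]
        rintro _ ⟨⟨n, hn⟩, rfl⟩
        change B ((mon γ (k * p) (-p) : Module.End F V) ((mon γ 1 0 : Module.End F V)
          ((mon γ n (-(n * ordConst f / f.natDegree : ℤ)) : Module.End F V) v))) v ∈ (1 : Submodule O F)
        rw [mon_apply_mon, mon_apply_mon,
          show (k * p + 1 + n : ℤ) = (n + 1 : ℕ) + k * p by push_cast; ring,
          show (-p + 0 + -(n * ordConst f / f.natDegree : ℤ) : ℤ) =
            -(n * ordConst f / f.natDegree : ℤ) + -p by ring, ← mon_apply_mon]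
        change B ((mon γ _ _ : Module.End F V) (zv γ k v p)) v ∈ (1 : Submodule O F)
        rw [mon_eq_smul, map_smul, LinearMap.smul_apply, smul_eq_mul]
        rcases Nat.lt_or_ge (n + 1) f.natDegree with hn' | hn'
        · rw [hv _ hn', if_neg (Nat.succ_ne_zero n), mul_zero]
          exact zero_mem _
        -- For the last generator the value is a unit times `t^(m - 1 - ⌊n m / N⌋)`, and the floor
        -- is less than `m` since `n < N`.
        · rw [show n + 1 = f.natDegree by omega, hN', ← mul_assoc, ← zpow_add₀ τ_ne_zero]
          have hlt : (n * ordConst f / f.natDegree : ℤ) < ordConst f := by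
            refine Int.ediv_lt_of_lt_mul (by have := h.slope.2.1; omega) ?_
            have h1 : (n : ℤ) < f.natDegree := by exact_mod_cast hn
            have h2 : (0 : ℤ) < ordConst f := by exact_mod_cast h.ord_pos
            rw [mul_comm]
            exact mul_lt_mul_of_pos_left h1 h2
          obtain ⟨e, he⟩ := Int.eq_ofNat_of_zero_le
            (show 0 ≤ -(n * ordConst f / f.natDegree : ℤ) + ordConst f - 1 by omega)
          rw [show -(n * ordConst f / f.natDegree : ℤ) + ordConst f = (e : ℤ) + 1 by omega,
            zpow_add₀ τ_ne_zero, zpow_one]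
          have h0 := τ_ne_zero (F := F)
          rw [show τ F ^ (e : ℤ) * τ F * -(algebraMap O F u * (τ F)⁻¹) =
            τ F ^ (e : ℤ) * algebraMap O F (-u) by rw [map_neg]; field_simp]
          exact mul_mem_one (zpow_τ_mem_one (by positivity)) (algebraMap_mem_one _)
      exact fun x hx => hle hx
    have hstab : ∀ (a b : ℤ), 0 ≤ b * f.natDegree + a * ordConst f →
        shift γ a b (shift γ 1 0 (adaptedSpan f γ v)) ≤ shift γ 1 0 (adaptedSpan f γ v) :=
      fun a b hab => h.adapted.shift 1 0 a b hab
    have hx : ∀ x ∈ shift γ 1 0 (adaptedSpan f γ v), B x v ∈ (1 : Submodule O F) := by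
      intro x hx
      have h1 := key _ (hstab (k * -p) (- -p) (h.weight (-p)).ge (mem_shift_of_mem hx _ _))
      rwa [mon_apply_mon, show k * p + k * -p = 0 by ring, show -p + - -p = 0 by ring,
        mon_zero_apply] at h1
    intro x hxm
    refine ⟨?_, trivial⟩
    have hle : adaptedSpan f γ v ≤
        Submodule.comap ((B x).restrictScalars O) (1 : Submodule O F) := by
      conv_lhs => rw [adaptedSpan]
      rw [Submodule.span_le]
      rintro _ ⟨n, rfl⟩
      change B x _ ∈ (1 : Submodule O F)
      rw [← mon_adjoint_mem h.skew]
      exact hx _ (hstab _ _ (weight_window h.slope n) (mem_shift_of_mem hxm _ _))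
    exact fun y hy => hle hy
  · obtain ⟨n, hn⟩ := Int.eq_ofNat_of_zero_le (show 0 ≤ i - p by omega)
    rw [show i = n + p by omega, ← mon_zv, mon_eq_smul, map_smul, LinearMap.smul_apply,
      show (k * n : ℤ) = (k * n : ℕ) by push_cast; rfl, hv, if_neg, smul_zero]
    · exact zero_mem _
    · have h1 := h.k_pos
      have h2 : 0 < n := by omega
      exact (Nat.mul_pos h1 h2).ne'
    · rw [h.natDegree_eq, mul_comm]
      exact Nat.mul_lt_mul_of_pos_right (by omega) h.k_pos
  · rw [add_comm p, ← mon_zv, mon_eq_smul, map_smul, LinearMap.smul_apply,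
      show (k * ordConst f : ℤ) = f.natDegree by rw [h.natDegree_eq]; push_cast; ring, hN',
      smul_eq_mul, ← mul_assoc, ← zpow_add₀ τ_ne_zero, neg_add_cancel, zpow_zero, one_mul,
      neg_mem_iff]
    exact inv_τ_not_mem_one u.isUnit

end ExistsModel

/-! ### Cyclic blocks with even `k` have a normalized generator. -/

section Cyclic

variable {F : Type*} [Field F] [Algebra O F] [IsFractionRing O F]
variable {V : Type*} [AddCommGroup V] [Module F V] [Module O V] [IsScalarTower O F V]

local notation "⟪" v "⟫" => Submodule.span O {v}

variable {B : LinearMap.BilinForm F V} {γ : (Module.End F V)ˣ} {f : O[X]} {k : ℕ} {v : V} {p : ℤ}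

theorem finrank_degreeLT (N : ℕ) : Module.finrank F (degreeLT F N) = N := by
  rw [(degreeLTEquiv F N).finrank_eq, Module.finrank_fin_fun]

/-- Evaluation of polynomials of degree less than `N` at an endomorphism, applied to `v`. -/
def evalLT (φ : Module.End F V) (N : ℕ) (v : V) : degreeLT F N →ₗ[F] V :=
  (LinearMap.applyₗ v ∘ₗ (aeval φ).toLinearMap) ∘ₗ (degreeLT F N).subtype

theorem evalLT_apply (φ : Module.End F V) (N : ℕ) (v : V) (q : degreeLT F N) :
    evalLT φ N v q = aeval φ (q : F[X]) v := rfl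

/-- A vector is cyclic as soon as no polynomial of degree less than the dimension kills it. -/
theorem evalLT_bijective [FiniteDimensional F V] {φ : Module.End F V} {v : V}
    (h : ∀ q : F[X], q.degree < Module.finrank F V → aeval φ q v = 0 → q = 0) :
    Function.Bijective (evalLT φ (Module.finrank F V) v) := by
  have hinj : Function.Injective (evalLT φ (Module.finrank F V) v) := by
    rw [← LinearMap.ker_eq_bot, LinearMap.ker_eq_bot']
    rintro ⟨q, hq⟩ h0
    exact Subtype.ext (h q (mem_degreeLT.1 hq) h0)
  refine ⟨hinj, ?_⟩
  have : Module.Finite F (degreeLT F (Module.finrank F V)) :=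
    Module.Finite.equiv (degreeLTEquiv F _).symm
  exact (LinearMap.injective_iff_surjective_of_finrank_eq_finrank (finrank_degreeLT _)).1 hinj

/-- A cyclic vector is not killed by a non-zero polynomial of degree less than the dimension. -/
theorem eq_zero_of_cyclic [FiniteDimensional F V] {φ : Module.End F V} {v : V} {P : F[X]}
    (hP : P.Monic) (hdeg : P.natDegree = Module.finrank F V) (hroot : aeval φ P = 0)
    (hv : ∀ x, ∃ q : F[X], aeval φ q v = x) {q : F[X]} (hq : q.degree < Module.finrank F V)
    (h0 : aeval φ q v = 0) : q = 0 := by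
  have hsurj : Function.Surjective (evalLT φ (Module.finrank F V) v) := by
    intro x
    obtain ⟨r, rfl⟩ := hv x
    refine ⟨⟨r %ₘ P, mem_degreeLT.2 ?_⟩, ?_⟩
    · rw [← hdeg, ← degree_eq_natDegree hP.ne_zero]
      exact degree_modByMonic_lt _ hP
    · rw [evalLT_apply]
      conv_rhs => rw [← modByMonic_add_div r P]
      simp [hroot]
  have : Module.Finite F (degreeLT F (Module.finrank F V)) :=
    Module.Finite.equiv (degreeLTEquiv F _).symm
  have hinj := (LinearMap.injective_iff_surjective_of_finrank_eq_finrank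
    (finrank_degreeLT _)).2 hsurj
  have h1 : (⟨q, mem_degreeLT.2 hq⟩ : degreeLT F (Module.finrank F V)) = 0 :=
    hinj (by rw [evalLT_apply, map_zero]; exact h0)
  exact congrArg Subtype.val h1

theorem exists_represent [FiniteDimensional F V] (hs : B.IsSymm) (hB : NondegOn B ⊤)
    (l : V →ₗ[F] F) : ∃ w, ∀ x, B x w = l x := by
  have hinj : Function.Injective (B : V →ₗ[F] Module.Dual F V) := by
    rw [← LinearMap.ker_eq_bot, LinearMap.ker_eq_bot']
    exact fun x hx => hB x trivial fun y _ => by rw [hx]; rfl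
  obtain ⟨w, hw⟩ := (LinearMap.injective_iff_surjective_of_finrank_eq_finrank
    Subspace.dual_finrank_eq.symm).1 hinj l
  exact ⟨w, fun x => by rw [hs.eq x w, hw]⟩

/-- Skewness makes the adjoint of `q(γ)` equal to `q(-γ)`. This is the source of the evenness of the
block polynomials and of the orthogonality of the blocks. -/
theorem aeval_adjoint {φ : Module.End F V} (hskew : ∀ x y, B (φ x) y = -B x (φ y)) (q : F[X])
    (x y : V) : B (aeval φ q x) y = B x (aeval φ (q.comp (-X)) y) := by
  induction q using Polynomial.induction_on' generalizing x y with
  | add p q hp hq => simp [hp, hq]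
  | monomial n c =>
    rw [← C_mul_X_pow_eq_monomial]
    have h1 : ∀ n x y, B ((φ ^ n) x) y = (-1) ^ n * B x ((φ ^ n) y) := by
      intro n
      induction n with
      | zero => simp
      | succ n ih =>
        intro x y
        rw [pow_succ', Module.End.mul_apply, hskew, ih, ← Module.End.mul_apply, ← pow_succ,
          ← pow_succ']
        ring
    have h2 : ((-φ) ^ n) y = (-1 : F) ^ n • (φ ^ n) y := by
      rcases Nat.even_or_odd n with h | h <;> simp [h.neg_pow]
    simp [h1, h2]
    ring

theorem aeval_mon (q : F[X]) (a b : ℤ) (x : V) :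
    aeval (γ : Module.End F V) q ((mon γ a b : Module.End F V) x) =
      (mon γ a b : Module.End F V) (aeval (γ : Module.End F V) q x) := by
  have h1 : Commute (γ : Module.End F V) (mon γ a b : Module.End F V) := by
    have := commute_mon γ 1 0 a b
    rwa [coe_mon_one] at this
  have h2 : Commute (aeval (γ : Module.End F V) q) (mon γ a b : Module.End F V) := by
    induction q using Polynomial.induction_on' with
    | add p q hp hq => rw [map_add]; exact hp.add_left hq
    | monomial n c =>
      rw [aeval_monomial]
      exact (Algebra.commute_algebraMap_left c _).mul_left (h1.pow_left n)
  have h3 := congrArg (fun ψ : Module.End F V => ψ x) h2.eq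
  exact h3

/-- The polynomial of a cyclic block is even. -/
theorem IsBlock.comp_neg_X (h : IsBlock B γ f) {v₀ : V}
    (hcyc : ∀ x, ∃ q : F[X], aeval (γ : Module.End F V) q v₀ = x) :
    Even f.natDegree ∧
      (f.map (algebraMap O F)).comp (-X) = f.map (algebraMap O F) := by
  have hfin : FiniteDimensional F V :=
    FiniteDimensional.of_finrank_pos (by rw [h.finrank]; exact h.slope.2.1)
  set P := f.map (algebraMap O F) with hPdef
  have hPm : P.Monic := h.slope.1.map _
  have hPN : P.natDegree = f.natDegree := h.slope.1.natDegree_map _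
  have hPd : P.natDegree = Module.finrank F V := by rw [h.finrank, hPN]
  have hP0 : P.coeff 0 ≠ 0 := by
    rw [coeff_map, Ne, map_eq_zero_iff _ (IsFractionRing.injective O F)]
    exact h.slope.2.2.1
  -- `P(-γ)` is the adjoint of `P(γ) = 0`. By cyclicity `P` divides `P(-X)`, so they agree up to
  -- sign, and comparing constant terms excludes odd degree.
  have h1 : aeval (γ : Module.End F V) (P.comp (-X)) = 0 := by
    ext y
    refine h.nondeg _ trivial fun x _ => ?_
    rw [h.symm.eq _ x, ← aeval_adjoint h.skew, h.root]
    simp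
  have h2 : P.comp (-X) %ₘ P = 0 := by
    refine eq_zero_of_cyclic hPm hPd h.root hcyc ?_ (v := v₀) ?_
    · rw [← hPd, ← degree_eq_natDegree hPm.ne_zero]
      exact degree_modByMonic_lt _ hPm
    · have h3 := congrArg (aeval (γ : Module.End F V)) (modByMonic_add_div (P.comp (-X)) P)
      rw [map_add, map_mul, h.root, zero_mul, add_zero, h1] at h3
      rw [h3]; rfl
  have hdeg : (P.comp (-X)).natDegree = P.natDegree := by
    rw [natDegree_comp, natDegree_neg, natDegree_X, mul_one]
  have hlc : (C ((-1) ^ P.natDegree) * P.comp (-X)).Monic := by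
    rw [Monic, leadingCoeff_mul, leadingCoeff_C, leadingCoeff, hdeg, coeff_comp_neg_X,
      hPm.coeff_natDegree, mul_one, ← mul_pow, neg_one_mul, neg_neg, one_pow]
  have h3 : C ((-1) ^ P.natDegree) * P.comp (-X) = P :=
    (eq_of_monic_of_dvd_of_natDegree_le hPm hlc
      (((modByMonic_eq_zero_iff_dvd hPm).1 h2).mul_left _)
      ((natDegree_C_mul_le _ _).trans hdeg.le))
  have hev : Even f.natDegree := by
    by_contra hodd
    rw [hPN, (Nat.not_even_iff_odd.1 hodd).neg_one_pow] at h3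
    have h4 := congrArg (fun q => coeff q 0) h3
    simp only [coeff_C_mul, coeff_comp_neg_X, pow_zero, one_mul] at h4
    have : CharZero F := charZero_of_fraction F
    exact hP0 (eq_zero_of_eq_neg (by rw [← neg_one_mul, h4]))
  refine ⟨hev, ?_⟩
  rw [hPN, hev.neg_one_pow, map_one, one_mul] at h3
  exact h3

/-- A cyclic block of slope `1 / k`, `k` even, is a model. -/
theorem IsBlock.exists_isModel (h : IsBlock B γ f) (hN : f.natDegree = ordConst f * k)
    (hk : Even k) {v₀ : V} (hcyc : ∀ x, ∃ q : F[X], aeval (γ : Module.End F V) q v₀ = x)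
    (hsq : Squarefree (f.map (algebraMap O F))) (p : ℤ) : ∃ v, IsModel B γ f k v p := by
  have hfin : FiniteDimensional F V :=
    FiniteDimensional.of_finrank_pos (by rw [h.finrank]; exact h.slope.2.1)
  have : CharZero F := charZero_of_fraction F
  set P := f.map (algebraMap O F) with hPdef
  have hPm : P.Monic := h.slope.1.map _
  have hPd : P.natDegree = Module.finrank F V := by
    rw [h.finrank]; exact h.slope.1.natDegree_map _
  have hPpos : 0 < P.natDegree := by rw [hPd, h.finrank]; exact h.slope.2.1
  have hPeven : P.comp (-X) = P := (h.comp_neg_X hcyc).2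
  have hP0 : P.coeff 0 ≠ 0 := by
    rw [coeff_map, Ne, map_eq_zero_iff _ (IsFractionRing.injective O F)]
    exact h.slope.2.2.1
  have hkp : Even (k * p : ℤ) := (by exact_mod_cast hk : Even (k : ℤ)).mul_right p
  set v₁ := zv γ k v₀ p with hv₁
  obtain ⟨hinj, hsurj⟩ := evalLT_bijective (φ := (γ : Module.End F V)) (v := v₁) fun q hq h0 => by
    rw [hv₁, zv, aeval_mon] at h0
    exact eq_zero_of_cyclic hPm hPd h.root hcyc hq
      (mon_injective γ _ _ (by rw [h0, map_zero]))
  let e := LinearEquiv.ofBijective _ ⟨hinj, hsurj⟩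
  -- The vector `w` represents `t⁻¹` times the coefficient of `γ^0` in the basis `γ^n ζ^p v₀`, the
  -- functional prescribed by `isModel_of_form`.
  obtain ⟨w, hw⟩ := exists_represent h.symm h.nondeg
    ((τ F)⁻¹ • (lcoeff F 0 ∘ₗ (degreeLT F (Module.finrank F V)).subtype ∘ₗ e.symm.toLinearMap))
  have hw' : ∀ n : ℕ, n < f.natDegree →
      B (aeval (γ : Module.End F V) (X ^ n : F[X]) v₁) w = if n = 0 then (τ F)⁻¹ else 0 := by
    intro n hn
    have hmem : (X ^ n : F[X]) ∈ degreeLT F (Module.finrank F V) := by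
      rw [mem_degreeLT, degree_X_pow, h.finrank]; exact_mod_cast hn
    have h1 : aeval (γ : Module.End F V) (X ^ n : F[X]) v₁ = e ⟨X ^ n, hmem⟩ := rfl
    rw [hw, h1]
    simp only [LinearMap.smul_apply, LinearMap.comp_apply, LinearEquiv.coe_coe,
      LinearEquiv.symm_apply_apply, Submodule.subtype_apply, lcoeff_apply, coeff_X_pow, smul_eq_mul,
      mul_ite, mul_one, mul_zero, eq_comm]
  obtain ⟨c', rfl⟩ := hcyc w
  set T : F[X] → F := fun q => B (aeval (γ : Module.End F V) q v₁) v₀ with hT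
  have hTeven : ∀ q, T (q.comp (-X)) = T q := by
    intro q
    have h1 : (q.comp (-X)).comp (-X) = q := by rw [comp_assoc]; simp
    simp only [hT]
    rw [aeval_adjoint h.skew, h1, hv₁, zv, mon_adjoint h.skew, hkp.neg_one_zpow, one_mul,
      ← aeval_mon, h.symm.eq v₀]
  have hTadd : ∀ q r, T (q + r) = T q + T r := fun q r => by simp [hT]
  have hTC : ∀ (a : F) q, T (C a * q) = a * T q := fun a q => by simp [hT]
  have hTP : ∀ q r, P ∣ q - r → T q = T r := by
    rintro q r ⟨s, hs⟩
    rw [← sub_add_cancel q r, hTadd, hs]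
    have hr : aeval (γ : Module.End F V) P = 0 := h.root
    simp [hT, hr]
  set c₀ := c'.comp (-X) with hc₀
  have hTc₀ : ∀ n : ℕ, n < f.natDegree → T (c₀ * X ^ n) = if n = 0 then (τ F)⁻¹ else 0 := by
    intro n hn
    have h1 : c₀.comp (-X) = c' := by rw [hc₀, comp_assoc]; simp
    rw [← hw' n hn, ← h1, ← aeval_adjoint h.skew, ← Module.End.mul_apply, ← map_mul]
  -- The functional `T` is invariant under `X ↦ -X`, so `c₀` may be replaced by its even part: the
  -- prescribed values vanish for all `n ≠ 0`, and `n = 0` is even.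
  set c := C (1 / 2 : F) * (c₀ + c₀.comp (-X)) with hc
  have hceven : c.comp (-X) = c := by
    have h1 : (c₀.comp (-X)).comp (-X) = c₀ := by rw [comp_assoc]; simp
    rw [hc, mul_comp, add_comp, h1, C_comp, add_comm]
  have hTc : ∀ n : ℕ, n < f.natDegree → T (c * X ^ n) = if n = 0 then (τ F)⁻¹ else 0 := by
    intro n hn
    have h1 : T (c₀.comp (-X) * X ^ n) = (-1) ^ n * T (c₀ * X ^ n) := by
      rw [← hTeven, ← hTC]
      congr 1
      rw [mul_comp, comp_assoc, X_pow_comp, map_pow, map_neg, map_one, neg_pow (X : F[X])]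
      simp
      ring
    rw [hc, mul_assoc, add_mul, hTC, hTadd, h1, hTc₀ n hn]
    split_ifs with hn0
    · subst hn0; ring
    · ring
  obtain ⟨u, hu⟩ := exists_mul_comp_neg hPeven hceven hsq hP0
  set v := aeval (γ : Module.End F V) u v₀ with hv
  have hform : ∀ n : ℕ, n < f.natDegree →
      B ((mon γ n 0 : Module.End F V) (zv γ k v p)) v = if n = 0 then (τ F)⁻¹ else 0 := by
    intro n hn
    rw [← hTc n hn, ← hTP (u * u.comp (-X) * X ^ n) (c * X ^ n)
      (by rw [← sub_mul]; exact hu.mul_right _)]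
    have h1 : (u.comp (-X)).comp (-X) = u := by rw [comp_assoc]; simp
    simp only [hT]
    rw [mul_comm u, mul_assoc, map_mul, Module.End.mul_apply, aeval_adjoint h.skew, h1, mul_comm u,
      map_mul, Module.End.mul_apply, hv₁]
    simp only [zv]
    rw [aeval_mon, ← hv, coe_mon_nat, map_pow, aeval_X]
  -- The new vector is still cyclic. If `q(γ) v = 0`, the normalized form reads off `q(0) = 0`; a
  -- factor `X` is removed, as `γ` is injective, and the argument repeats.
  have hcyc' : ∀ (d : ℕ) (q : F[X]), q.natDegree = d → q.degree < Module.finrank F V →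
      aeval (γ : Module.End F V) q v = 0 → q = 0 := by
    intro d
    induction d with
    | zero =>
      intro q hd hq h0
      rw [eq_C_of_natDegree_eq_zero hd] at h0 ⊢
      rw [aeval_C, Module.algebraMap_end_apply] at h0
      rcases smul_eq_zero.1 h0 with h1 | h1
      · rw [h1, C_0]
      · have h2 := hform 0 h.slope.2.1
        rw [h1, map_zero, if_pos rfl] at h2
        exact (inv_ne_zero τ_ne_zero h2.symm).elim
    | succ d ih =>
      intro q hd hq h0
      have hlt : q.natDegree < f.natDegree := by
        rw [← h.finrank]
        exact (natDegree_lt_iff_degree_lt (by rintro rfl; simp at hd)).2 hq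
      have h1 : q.coeff 0 = 0 := by
        have h2 : B (aeval (γ : Module.End F V) q (zv γ k v p)) v = 0 := by
          rw [zv, aeval_mon, h0, map_zero, map_zero, LinearMap.zero_apply]
        rw [aeval_eq_sum_range, LinearMap.sum_apply, map_sum, LinearMap.sum_apply,
          Finset.sum_eq_single_of_mem 0 (by simp) fun n hn hn0 => ?_] at h2
        · have := hform 0 h.slope.2.1
          rw [coe_mon_nat, if_pos rfl] at this
          rw [LinearMap.smul_apply, map_smul, LinearMap.smul_apply, this] at h2
          exact (mul_eq_zero.1 h2).resolve_right (inv_ne_zero τ_ne_zero)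
        · have := hform n (by have := Finset.mem_range.1 hn; omega)
          rw [coe_mon_nat, if_neg hn0] at this
          rw [LinearMap.smul_apply, map_smul, LinearMap.smul_apply, this, smul_zero]
      obtain ⟨r, rfl⟩ := X_dvd_iff.2 h1
      have hr : r ≠ 0 := by rintro rfl; simp at hd
      rw [natDegree_X_mul hr] at hd
      rw [map_mul, aeval_X, Module.End.mul_apply] at h0
      have hr0 := ih r (by omega) (lt_of_le_of_lt (degree_le_of_dvd ⟨X, mul_comm _ _⟩
        (mul_ne_zero X_ne_zero hr)) hq) (unit_injOn γ Set.univ trivial trivial (by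
          rw [h0, map_zero]))
      exact (hr hr0).elim
  refine ⟨v, IsPreModel.isModel_of_form { h with
    natDegree_eq := hN
    even := hk
    lat := ⟨adaptedSpan_fg v, ?_⟩ } hform⟩
  rw [eq_top_iff]
  intro x _
  obtain ⟨q, rfl⟩ := (evalLT_bijective fun q hq h0 => hcyc' _ q rfl hq h0).2 x
  rw [evalLT_apply, aeval_eq_sum_range, LinearMap.sum_apply]
  refine Submodule.sum_mem _ fun n _ => Submodule.smul_mem _ _ (Submodule.subset_span ?_)
  rw [← coe_mon_nat]
  exact mon_mem_adaptedSpan h.slope h.root v (by positivity)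

end Cyclic

/-! ### The lattices that one factor supplies. -/

section Outputs

variable {F : Type*} [Field F] [Algebra O F] [IsFractionRing O F]
variable {V : Type*} [AddCommGroup V] [Module F V] [Module O V] [IsScalarTower O F V]

local notation "⟪" v "⟫" => Submodule.span O {v}

/-- The lattices that a factor `f` contributes. -/
structure HasBlocks (B : LinearMap.BilinForm F V) (γ : Module.End F V) (U : Submodule F V)
    (f : O[X]) : Prop where
  closed : ∀ sq : Prop, (f.natDegree % ordConst f = 0 → Even (f.natDegree / ordConst f) → sq →
      squareOwn f) → Even (ordConst f) →
    HasClosed B γ U (evenBlock sq f.natDegree (ordConst f)) f.natDegree (ordConst f)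
  balanced : Even (ordConst f) →
    HasClosed B γ U (balanced f.natDegree (ordConst f)) f.natDegree (ordConst f) ∨
      HasPass B γ U (SOOdd.balanced f.natDegree (ordConst f)) f.natDegree (ordConst f)
  raised : ¬ Even (ordConst f) →
    HasOpen B γ U (raised f.natDegree (ordConst f)) f.natDegree (ordConst f)
  lowered : ¬ Even (ordConst f) →
    HasLowered B γ U (lowered f.natDegree (ordConst f)) f.natDegree (ordConst f)

theorem evenBlock_eq_balanced {sq : Prop} {N m : ℕ} (h : N % m ≠ 0 ∨ ¬ Even (N / m) ∨ sq) :
    evenBlock sq N m = balanced N m := by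
  rw [evenBlock, if_neg]
  tauto

/-- The lattices of a cyclic block. -/
theorem IsBlock.hasBlocks {B : LinearMap.BilinForm F V} {γ : (Module.End F V)ˣ} {f : O[X]}
    (h : IsBlock B γ f) {v₀ : V}
    (hcyc : ∀ x, ∃ q : F[X], aeval (γ : Module.End F V) q v₀ = x)
    (hsq : Squarefree (f.map (algebraMap O F))) :
    HasBlocks B (γ : Module.End F V) ⊤ f := by
  have hev := (h.comp_neg_X hcyc).1
  by_cases hl : f.natDegree % ordConst f = 0
  swap
  · obtain ⟨h1, h2⟩ := h.of_mod_ne_zero hl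
    exact ⟨fun sq _ he => by rw [evenBlock_eq_balanced (Or.inl hl)]; exact h1 he,
      fun he => Or.inl (h1 he), fun he => (h2 he).1, fun he => (h2 he).2⟩
  obtain ⟨k, hk⟩ := Nat.dvd_of_mod_eq_zero hl
  have hdiv : f.natDegree / ordConst f = k := by rw [hk, Nat.mul_div_cancel_left _ h.ord_pos]
  rcases Nat.even_or_odd k with hke | hko
  -- Two normalizations are needed: `p = 0` for raising and passing, `p = -1` for lowering and for
  -- the exceptional partition. The latter is available whether or not the graded polynomial is a
  -- square.
  · obtain ⟨v, hv⟩ := h.exists_isModel hk hke hcyc hsq 0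
    obtain ⟨w, hw⟩ := h.exists_isModel hk hke hcyc hsq (-1)
    refine ⟨fun sq hsq' he => ?_, fun he => Or.inr (hv.hasPass he), fun he => hv.hasOpen he,
      fun he => hw.hasLowered he⟩
    by_cases hs : sq
    · rw [evenBlock_eq_balanced (Or.inr (Or.inr hs))]
      refine hv.hasClosed_of_isSquare ?_
      have := hsq' hl (by rwa [hdiv]) hs
      rwa [squareOwn, gr_balanced h.ord_pos hk] at this
    · rw [evenBlock, if_pos ⟨hl, by rwa [hdiv], hs⟩, hdiv]
      exact hw.hasClosed_exceptional he
  · have h1 := h.of_odd hk hko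
    -- The degree `m k` is even, so for odd `k` the order is even and the requirements for odd order
    -- are vacuous.
    have h2 : Even (ordConst f) := by
      rw [hk] at hev
      exact (Nat.even_mul.1 hev).resolve_right (Nat.not_even_iff_odd.2 hko)
    exact ⟨fun sq _ he => by
      rw [evenBlock_eq_balanced (Or.inr (Or.inl (by rwa [hdiv, Nat.not_even_iff_odd])))]
      exact h1, fun _ => Or.inl h1, fun he => (he h2).elim, fun he => (he h2).elim⟩

end Outputs

/-! ### Transporting lattices from a subspace to the ambient space. -/

section Transfer

variable {F : Type*} [Field F] [Algebra O F] [IsFractionRing O F]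
variable {V : Type*} [AddCommGroup V] [Module F V] [Module O V] [IsScalarTower O F V]

local notation "⟪" v "⟫" => Submodule.span O {v}

variable {U : Submodule F V}

/-- The image in `V` of an `𝒪`-submodule of the subspace `U`. -/
def emb (A : Submodule O U) : Submodule O V := A.map (U.subtype.restrictScalars O)

theorem mem_emb {A : Submodule O U} {x : U} : (x : V) ∈ emb A ↔ x ∈ A :=
  ⟨fun ⟨_, hy, h⟩ => by rwa [← Subtype.ext h], fun h => ⟨x, h, rfl⟩⟩

theorem emb_le {A A' : Submodule O U} (h : A ≤ A') : emb A ≤ emb A' := Submodule.map_mono h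

theorem emb_sup (A A' : Submodule O U) : emb (A ⊔ A') = emb A ⊔ emb A' := Submodule.map_sup _ _ _

theorem emb_span (x : U) : emb ⟪x⟫ = ⟪(x : V)⟫ := by
  rw [emb, Submodule.map_span, Set.image_singleton]; rfl

theorem emb_sup_span (A : Submodule O U) (x : U) : emb A ⊔ ⟪(x : V)⟫ = emb (A ⊔ ⟪x⟫) := by
  rw [emb_sup, emb_span]

variable {g : Module.End F V} {g' : Module.End F U}

theorem act_emb (hg : ∀ x : U, (g' x : V) = g x) (A : Submodule O U) : act g (emb A) = emb (act g' A) := by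
  rw [act, emb, emb, act, ← Submodule.map_comp, ← Submodule.map_comp]
  congr 1
  ext x
  exact (hg x).symm

theorem act_pow_emb (hg : ∀ x : U, (g' x : V) = g x) (A : Submodule O U) (j : ℕ) :
    act (g ^ j) (emb A) = emb (act (g' ^ j) A) := by
  refine act_emb (fun x => ?_) A
  induction j with
  | zero => simp
  | succ j ih => rw [pow_succ', pow_succ', Module.End.mul_apply, Module.End.mul_apply, hg, ih]

theorem tS_emb (A : Submodule O U) : tS F (emb A) = emb (tS F A) :=
  act_emb (fun _ => rfl) A

theorem rankLen_emb (hg : ∀ x : U, (g' x : V) = g x) (A D : Submodule O U) (j : ℕ) :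
    rankLen g (emb A) (emb D) j = rankLen g' A D j := by
  rw [rankLen, rankLen, act_pow_emb hg, tS_emb, ← emb_sup]
  exact relLen_map _ (Subtype.coe_injective.injOn) le_sup_right

theorem IsLat.emb {A : Submodule O U} (h : IsLat (⊤ : Submodule F U) A) : IsLat U (emb A) where
  fg := h.fg.map _
  span_eq := by
    have h1 : (SOOdd.emb A : Set V) = U.subtype '' (A : Set U) := rfl
    rw [h1, Submodule.span_image, h.span_eq, Submodule.map_top, Submodule.range_subtype]

theorem dualIn_emb (B : LinearMap.BilinForm F V) (A : Submodule O U) :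
    dualIn B U (emb A) = emb (dualIn (B.restrict U) ⊤ A) := by
  rw [emb, dualIn_map_subtype, emb]
  congr 1
  rw [dualIn]
  exact (inf_top_eq _).symm

variable {B : LinearMap.BilinForm F V} {d : Multiset ℕ} {N m : ℕ}

theorem HasClosed.emb (hg : ∀ x : U, (g' x : V) = g x) (h : HasClosed (B.restrict U) g' ⊤ d N m) : HasClosed B g U d N m := by
  obtain ⟨Λ, h, hb⟩ := h
  refine ⟨SOOdd.emb Λ, ⟨h.lat.emb, by rw [dualIn_emb, h.dual], ?_, fun j => ?_⟩, fun j hj => ?_⟩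
  · rw [act_emb hg]; exact emb_le h.stable
  · rw [rankLen_emb hg, h.rank]
  · rw [tS_emb, act_pow_emb hg]; exact emb_le (hb j hj)

theorem HasOpen.emb (hg : ∀ x : U, (g' x : V) = g x) (h : HasOpen (B.restrict U) g' ⊤ d N m) : HasOpen B g U d N m := by
  obtain ⟨C, e, h, hb⟩ := h
  refine ⟨SOOdd.emb C, e, ⟨h.lat.emb, e.2, fun hm => h.notMem (mem_emb.1 hm),
    mem_emb.2 h.smul_mem, ?_, ?_, fun j => ?_⟩, fun j hj => ?_⟩
  · rw [dualIn_emb, h.dual, emb_sup_span]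
  · rw [emb_sup_span, act_emb hg]; exact emb_le h.stable
  · rw [emb_sup_span, rankLen_emb hg, h.rank]
  · rw [emb_sup_span, tS_emb, act_pow_emb hg]; exact emb_le (hb j hj)

theorem IsGlueLat.emb (hg : ∀ x : U, (g' x : V) = g x) {P R : Submodule O U} {y : U} (h : IsGlueLat (B.restrict U) g' ⊤ d P R y) :
    IsGlueLat B g U d (SOOdd.emb P) (SOOdd.emb R) y where
  lat := h.lat.emb
  le := emb_le h.le
  mem := y.2
  notMem hm := h.notMem (mem_emb.1 hm)
  smul_mem := mem_emb.2 h.smul_mem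
  dual := by rw [dualIn_emb, h.dual, emb_sup_span]
  norm := h.norm
  integral := by
    rintro _ ⟨r, hr, rfl⟩
    exact h.integral r hr
  stable := by rw [emb_sup_span, act_emb hg]; exact emb_le h.stable
  rank j := by rw [emb_sup_span, rankLen_emb hg, h.rank]

theorem HasLowered.emb (hg : ∀ x : U, (g' x : V) = g x) (h : HasLowered (B.restrict U) g' ⊤ d N m) : HasLowered B g U d N m := by
  obtain ⟨P, y, h, hb⟩ := h
  refine ⟨SOOdd.emb P, y, h.emb hg, fun j hj => ?_⟩
  rw [emb_sup_span, tS_emb, act_pow_emb hg]; exact emb_le (hb j hj)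

theorem HasPass.emb (hg : ∀ x : U, (g' x : V) = g x) (h : HasPass (B.restrict U) g' ⊤ d N m) : HasPass B g U d N m := by
  obtain ⟨P, x, y, h, hx, hτ, hb, hb'⟩ := h
  refine ⟨SOOdd.emb P, x, y, ?_, fun hm => hx (mem_emb.1 hm), mem_emb.2 hτ, fun j hj => ?_,
    fun j hj => ?_⟩
  · rw [emb_sup_span]; exact h.emb hg
  · rw [emb_sup_span, emb_sup_span, tS_emb, act_pow_emb hg]; exact emb_le (hb j hj)
  · rw [emb_sup_span, emb_sup_span, tS_emb, act_pow_emb hg]; exact emb_le (hb' j hj)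

theorem HasBlocks.emb (hg : ∀ x : U, (g' x : V) = g x) {f : O[X]} (h : HasBlocks (B.restrict U) g' ⊤ f) : HasBlocks B g U f where
  closed sq hsq he := (h.closed sq hsq he).emb hg
  balanced he := (h.balanced he).imp (fun h => h.emb hg) fun h => h.emb hg
  raised he := (h.raised he).emb hg
  lowered he := (h.lowered he).emb hg

end Transfer

/-! ### Assembling the blocks in order of decreasing slope. -/

section Induction

variable {F : Type*} [Field F] [Algebra O F] [IsFractionRing O F]
variable {V : Type*} [AddCommGroup V] [Module F V] [Module O V] [IsScalarTower O F V]

local notation "⟪" v "⟫" => Submodule.span O {v}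

/-- A non-degenerate stable subspace. -/
structure IsGood (B : LinearMap.BilinForm F V) (γ : Module.End F V) (W : Submodule F V) :
    Prop where
  nondeg : NondegOn B W
  stable : ∀ x ∈ W, γ x ∈ W

/-- Orthogonal subspaces. -/
def Orth (B : LinearMap.BilinForm F V) (W W' : Submodule F V) : Prop :=
  ∀ x ∈ W, ∀ y ∈ W', B x y = 0

variable {B : LinearMap.BilinForm F V} {γ : Module.End F V} {W W₁ W₂ : Submodule F V}

theorem Orth.disjoint (h : Orth B W₁ W₂) (hW : NondegOn B W₂) :
    Disjoint W₁ W₂ := by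
  rw [Submodule.disjoint_def]
  intro x hx hx'
  refine hW x hx' fun y hy => h x hx y hy

theorem Orth.symm (h : Orth B W₁ W₂) (hs : B.IsSymm) : Orth B W₂ W₁ := fun x hx y hy => by
  rw [hs.eq]; exact h y hy x hx

theorem Orth.sup_left (h₁ : Orth B W₁ W) (h₂ : Orth B W₂ W) : Orth B (W₁ ⊔ W₂) W := by
  intro x hx y hy
  obtain ⟨x₁, hx₁, x₂, hx₂, rfl⟩ := Submodule.mem_sup.1 hx
  rw [map_add, LinearMap.add_apply, h₁ x₁ hx₁ y hy, h₂ x₂ hx₂ y hy, add_zero]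

theorem NondegOn.sup (h₁ : NondegOn B W₁) (h₂ : NondegOn B W₂) (h : Orth B W₁ W₂)
    (hs : B.IsSymm) : NondegOn B (W₁ ⊔ W₂) := by
  intro x hx hB
  obtain ⟨x₁, hx₁, x₂, hx₂, rfl⟩ := Submodule.mem_sup.1 hx
  have e₁ : x₁ = 0 := h₁ x₁ hx₁ fun y hy => by
    have := hB y (Submodule.mem_sup_left hy)
    rwa [map_add, LinearMap.add_apply, h.symm hs x₂ hx₂ y hy, add_zero] at this
  have e₂ : x₂ = 0 := h₂ x₂ hx₂ fun y hy => by
    have := hB y (Submodule.mem_sup_right hy)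
    rwa [map_add, LinearMap.add_apply, h x₁ hx₁ y hy, zero_add] at this
  rw [e₁, e₂, add_zero]

theorem IsGood.sup (h₁ : IsGood B γ W₁) (h₂ : IsGood B γ W₂) (h : Orth B W₁ W₂)
    (hs : B.IsSymm) : IsGood B γ (W₁ ⊔ W₂) where
  nondeg := h₁.nondeg.sup h₂.nondeg h hs
  stable x hx := by
    obtain ⟨x₁, hx₁, x₂, hx₂, rfl⟩ := Submodule.mem_sup.1 hx
    rw [map_add]
    exact Submodule.add_mem_sup (h₁.stable x₁ hx₁) (h₂.stable x₂ hx₂)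

/-- The sum of the subspaces of the factors in a list. -/
def sumSub (U : O[X] → Submodule F V) : List O[X] → Submodule F V
  | [] => ⊥
  | p :: L => U p ⊔ sumSub U L

/-- The factors of a list, with decreasing slopes, own orthogonal blocks. -/
structure IsBlockList (B : LinearMap.BilinForm F V) (γ : Module.End F V)
    (U : O[X] → Submodule F V) (L : List O[X]) : Prop where
  good : ∀ p ∈ L, IsGood B γ (U p)
  blocks : ∀ p ∈ L, HasBlocks B γ (U p) p
  orth : L.Pairwise fun p q => Orth B (U p) (U q)
  slope : L.Pairwise fun p q => q.natDegree * ordConst p < p.natDegree * ordConst q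

variable {U : O[X] → Submodule F V} {L : List O[X]} {p : O[X]}

theorem IsBlockList.tail (h : IsBlockList B γ U (p :: L)) : IsBlockList B γ U L where
  good q hq := h.good q (List.mem_cons_of_mem _ hq)
  blocks q hq := h.blocks q (List.mem_cons_of_mem _ hq)
  orth := h.orth.of_cons
  slope := h.slope.of_cons

theorem orth_sumSub (h : ∀ q ∈ L, Orth B W (U q)) (hs : B.IsSymm) : Orth B W (sumSub U L) := by
  induction L with
  | nil => intro x _ y hy; rw [sumSub, Submodule.mem_bot] at hy; rw [hy, map_zero]
  | cons q L ih =>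
    exact (((h q List.mem_cons_self).symm hs).sup_left
      ((ih fun r hr => h r (List.mem_cons_of_mem _ hr)).symm hs)).symm hs

theorem IsBlockList.orth_head (h : IsBlockList B γ U (p :: L)) (hs : B.IsSymm) :
    Orth B (U p) (sumSub U L) :=
  orth_sumSub (List.pairwise_cons.1 h.orth).1 hs

theorem IsBlockList.good_sumSub (h : IsBlockList B γ U L) (hs : B.IsSymm) :
    IsGood B γ (sumSub U L) := by
  induction L with
  | nil =>
    exact ⟨fun x hx _ => (Submodule.mem_bot F).1 hx, fun x hx => by
      rw [sumSub, Submodule.mem_bot] at hx ⊢; rw [hx, map_zero]⟩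
  | cons q L ih => exact (h.good q List.mem_cons_self).sup (ih h.tail) (h.orth_head hs) hs

theorem isClosedLat_bot : IsClosedLat B γ ⊥ 0 ⊥ where
  lat := ⟨Submodule.fg_bot, by simp⟩
  dual := by rw [eq_bot_iff]; exact dualIn_le _ _
  stable := by simp [act]
  rank j := by
    rw [rankLen, partSum_zero, Nat.cast_zero, relLen_eq_zero_iff]
    simp [act]

/-- The sum of the orders of the constant terms. -/
def sumOrd (L : List O[X]) : ℕ := (L.map ordConst).sum

theorem sumOrd_cons (p : O[X]) (L : List O[X]) : sumOrd (p :: L) = ordConst p + sumOrd L := by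
  simp [sumOrd]

/-- The bound on the open lattice `C + 𝒪 e` with respect to the factors still to come. -/
def OpenBound (γ : Module.End F V) (C : Submodule O V) (e : V) (L : List O[X]) : Prop :=
  ∀ q ∈ L, ∀ j, j * ordConst q ≤ q.natDegree → tS F (C ⊔ ⟪e⟫) ≤ act (γ ^ j) C

/-- Reads `j ≤ N' / m' < N / m` without division. It is the place where the order of the slopes is
used: whenever a later block is not yet killed by `γ^j` modulo `t`, the earlier ones still have full
rank, as gluing requires. -/
theorem lt_of_slope {N m N' m' j : ℕ} (hs : N' * m < N * m')
    (hj : j * m' ≤ N') : j * m < N := by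
  by_contra hcon
  push Not at hcon
  have h1 : N * m' ≤ j * m * m' := Nat.mul_le_mul_right _ hcon
  have h2 : j * m' * m ≤ N' * m := Nat.mul_le_mul_right _ hj
  have h3 : j * m * m' = j * m' * m := by ring
  omega

theorem openBound_of (h : IsBlockList B γ U (p :: L)) {C : Submodule O V} {e : V}
    (hb : ∀ j, j * ordConst p < p.natDegree → tS F (C ⊔ ⟪e⟫) ≤ act (γ ^ j) C) :
    OpenBound γ C e L := fun q hq j hj =>
  hb j (lt_of_slope ((List.pairwise_cons.1 h.slope).1 q hq) hj)

/-- The lattices that the modification rules describe. -/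
theorem IsBlockList.exists_lattice {sq : O[X] → Prop} (hsq : ∀ p ∈ L, p.natDegree % ordConst p = 0 →
      Even (p.natDegree / ordConst p) → sq p → squareOwn p) (hs : B.IsSymm) (hinj : Set.InjOn γ (sumSub U L))
    (h : IsBlockList B γ U L) :
    ((Even (sumOrd L) → ∃ Λ, IsClosedLat B γ (sumSub U L) (modify sq false L) Λ) ∧
      (¬ Even (sumOrd L) → ∃ C e, IsOpenLat B γ (sumSub U L) (modify sq false L) C e)) ∧
    ∀ (W : Submodule F V) (d : Multiset ℕ) (C : Submodule O V) (e : V), IsGood B γ W →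
      Orth B W (sumSub U L) → Set.InjOn γ (W ⊔ sumSub U L : Submodule F V) →
      IsOpenLat B γ W d C e → OpenBound γ C e L →
      ((Even (sumOrd L) →
          ∃ C e, IsOpenLat B γ (W ⊔ sumSub U L) (d + modify sq true L) C e) ∧
        (¬ Even (sumOrd L) →
          ∃ Λ, IsClosedLat B γ (W ⊔ sumSub U L) (d + modify sq true L) Λ)) := by
  induction L with
  | nil =>
    refine ⟨⟨fun _ => ⟨⊥, isClosedLat_bot⟩, fun he => (he (by simp [sumOrd])).elim⟩,
      fun W d C e _ _ _ hO _ => ⟨fun _ => ⟨C, e, ?_⟩, fun he => (he (by simp [sumOrd])).elim⟩⟩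
    rw [sumSub, modify, sup_bot_eq, add_zero]
    exact hO
  | cons p L ih =>
    have hp := h.blocks p List.mem_cons_self
    have hgp := h.good p List.mem_cons_self
    have hgL := h.tail.good_sumSub hs
    have hpL := h.orth_head hs
    have hinj' : Set.InjOn γ (U p ⊔ sumSub U L : Submodule F V) := hinj
    obtain ⟨⟨ihc, iho⟩, ihw⟩ := ih (fun q hq => hsq q (List.mem_cons_of_mem _ hq)) (hinj'.mono fun x hx => Submodule.mem_sup_right hx)
      h.tail
    have hdis := hpL.disjoint hgL.nondeg
    rw [sumOrd_cons]
    constructor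
    · by_cases hev : Even (ordConst p)
      · obtain ⟨Λ, hΛ, -⟩ := hp.closed _ (hsq p List.mem_cons_self) hev
        rw [modify, if_pos hev, sumSub]
        refine ⟨fun he => ?_, fun he => ?_⟩
        · obtain ⟨Λ', hΛ'⟩ := ihc ((Nat.even_add.1 he).1 hev)
          exact ⟨_, hΛ.sup hs hdis hpL hgp.stable hgL.stable hΛ'⟩
        · obtain ⟨C, e, hC⟩ := iho fun h' => he (hev.add h')
          refine ⟨C ⊔ Λ, e, ?_⟩
          rw [sup_comm, add_comm]
          exact hC.sup hs hdis.symm (hpL.symm hs) hgL.stable hgp.stable hΛ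
      · obtain ⟨C, e, hC, hb⟩ := hp.raised hev
        rw [modify, if_neg hev, sumSub]
        -- An odd block starts a pair: its open lattice is handed to the second half of the
        -- induction hypothesis.
        have h1 := ihw (U p) _ C e hgp hpL hinj' hC (openBound_of h hb)
        refine ⟨fun he => h1.2 fun h' => hev ((Nat.even_add.1 he).2 h'), fun he => h1.1 ?_⟩
        by_contra h'
        exact he (Nat.even_add.2 (by tauto))
    · intro W d C e hgW hW hinjW hC hb
      have hWp : Orth B W (U p) := fun x hx y hy => hW x hx y (Submodule.mem_sup_left hy)
      have hWL : Orth B W (sumSub U L) := fun x hx y hy => hW x hx y (Submodule.mem_sup_right hy)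
      have hdW := hWp.disjoint hgp.nondeg
      have hWinj : Set.InjOn γ W := hinjW.mono fun x hx => Submodule.mem_sup_left hx
      have hgWp := hgW.sup hgp hWp hs
      have hWpL : Orth B (W ⊔ U p) (sumSub U L) := hWL.sup_left hpL
      rw [sumSub, ← sup_assoc] at hinjW ⊢
      by_cases hev : Even (ordConst p)
      · rw [modify, if_pos hev, ← add_assoc]
        -- An even block met while waiting is added orthogonally, with the same defect, or takes
        -- over the defect and passes on another. In both cases the partition is balanced and the
        -- bound for later factors persists.
        have key : ∃ C' e', IsOpenLat B γ (W ⊔ U p)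
            (d + balanced p.natDegree (ordConst p)) C' e' ∧ OpenBound γ C' e' L := by
          rcases hp.balanced hev with ⟨Λ, hΛ, hΛb⟩ | ⟨P, x, y, hP, hx, hτx, hPb, hPb'⟩
          · refine ⟨_, e, hC.sup hs hdW hWp hgW.stable hgp.stable hΛ, fun q hq j hj => ?_⟩
            rw [sup_right_comm, tS_sup, act_sup]
            exact sup_le_sup (hb q (List.mem_cons_of_mem _ hq) j hj)
              (hΛb j (lt_of_slope ((List.pairwise_cons.1 h.slope).1 q hq) hj))
          · obtain ⟨C', hC', hb'⟩ := hC.exists_open hs hdW hWp hgW.nondeg hgW.stable hgp.stable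
              hWinj hP hx hτx fun j => by
                rcases Nat.lt_or_ge p.natDegree (j * ordConst p) with hj | hj
                · exact Or.inr (hPb' j hj)
                · exact Or.inl (hb p List.mem_cons_self j hj)
            exact ⟨C', x, hC', fun q hq j hj => hb' j (hb q (List.mem_cons_of_mem _ hq) j hj)
              (hPb j (lt_of_slope ((List.pairwise_cons.1 h.slope).1 q hq) hj))⟩
        obtain ⟨C', e', hC', hb'⟩ := key
        have h1 := ihw (W ⊔ U p) _ C' e' hgWp hWpL hinjW hC' hb'
        exact ⟨fun he => h1.1 ((Nat.even_add.1 he).1 hev), fun he => h1.2 fun h' =>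
          he (hev.add h')⟩
      · obtain ⟨P, y, hP, hPb⟩ := hp.lowered hev
        rw [modify, if_neg hev, ← add_assoc]
        obtain ⟨Λ, hΛ⟩ := hC.exists_closed hs hdW hWp hgW.nondeg hgW.stable hgp.stable hWinj hP
          fun j => by
            rcases Nat.lt_or_ge p.natDegree (j * ordConst p) with hj | hj
            · exact Or.inr (hPb j hj)
            · exact Or.inl (hb p List.mem_cons_self j hj)
        have hdWL := hWpL.disjoint hgL.nondeg
        refine ⟨fun he => ?_, fun he => ?_⟩
        -- After the pair is closed, the rest of the list is treated with nothing waiting and added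
        -- orthogonally.
        · obtain ⟨C', e', hC'⟩ := iho fun h' => hev ((Nat.even_add.1 he).2 h')
          refine ⟨C' ⊔ Λ, e', ?_⟩
          rw [sup_comm, add_comm]
          exact hC'.sup hs hdWL.symm (hWpL.symm hs) hgL.stable hgWp.stable hΛ
        · obtain ⟨Λ', hΛ'⟩ := ihc (by
            by_contra h'
            exact he (Nat.even_add.2 (by tauto)))
          exact ⟨_, hΛ.sup hs hdWL hWpL hgWp.stable hgL.stable hΛ'⟩

end Induction

/-! ### The line `ker γ` and the lattice of the whole space. -/

section Kernel

variable {F : Type*} [Field F] [Algebra O F] [IsFractionRing O F]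
variable {V : Type*} [AddCommGroup V] [Module F V] [Module O V] [IsScalarTower O F V]

local notation "⟪" v "⟫" => Submodule.span O {v}

variable {B : LinearMap.BilinForm F V} {γ : Module.End F V} {v : V}

/-- Scaling a vector by `t^a` multiplies its norm by `t^(2a)`, so only the parity of the valuation
survives: a unit, or a unit over `t`. -/
theorem exists_zpow_normalize {c : F} (hc : c ≠ 0) : ∃ (a : ℤ) (u : O), IsUnit u ∧
    (τ F ^ a * (τ F ^ a * c) = algebraMap O F u ∨
      τ F ^ a * (τ F ^ a * c) = algebraMap O F u * (τ F)⁻¹) := by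
  have h0 := τ_ne_zero (F := F)
  obtain ⟨e, b, hb⟩ := exists_pow_mul_mem c
  have hb0 : b ≠ 0 := by
    rintro rfl
    rw [map_zero] at hb
    exact (mul_ne_zero (pow_ne_zero _ h0) hc) hb
  obtain ⟨n, u, hu⟩ := IsDiscreteValuationRing.eq_unit_mul_pow_irreducible hb0
    PowerSeries.X_irreducible
  have hc' : c = algebraMap O F u * τ F ^ (n - e : ℤ) := by
    rw [hu, map_mul, map_pow] at hb
    change _ = _ * τ F ^ n at hb
    rw [zpow_sub₀ h0, zpow_natCast, zpow_natCast, mul_div_assoc', ← hb,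
      mul_div_cancel_left₀ _ (pow_ne_zero _ h0)]
  have key : ∀ a : ℤ, τ F ^ a * (τ F ^ a * c) = algebraMap O F u * τ F ^ (a + a + (n - e)) := by
    intro a
    rw [hc', zpow_add₀ h0, zpow_add₀ h0]; ring
  rcases Int.even_or_odd' (n - e : ℤ) with ⟨i, hi | hi⟩
  · refine ⟨-i, u, u.isUnit, Or.inl ?_⟩
    rw [key, hi, show -i + -i + 2 * i = 0 by ring, zpow_zero, mul_one]
  · refine ⟨-i - 1, u, u.isUnit, Or.inr ?_⟩
    rw [key, hi, show -i - 1 + (-i - 1) + (2 * i + 1) = -1 by ring, zpow_neg_one]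

theorem pow_apply_eq_zero (hv : γ v = 0) {j : ℕ} (hj : j ≠ 0) : (γ ^ j) v = 0 := by
  obtain ⟨i, rfl⟩ := Nat.exists_eq_succ_of_ne_zero hj
  rw [pow_succ, Module.End.mul_apply, hv, map_zero]

theorem isLat_span_singleton (v : V) : IsLat (Submodule.span F {v}) ⟪v⟫ where
  fg := Submodule.fg_span_singleton v
  span_eq := by rw [Submodule.span_span_of_tower]

theorem mem_span_of_smul_mem_one {c : F} (hc : c ∈ (1 : Submodule O F)) : c • v ∈ ⟪v⟫ := by
  obtain ⟨a, rfl⟩ := Submodule.mem_one.1 hc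
  rw [algebraMap_smul]
  exact Submodule.smul_mem _ _ (Submodule.mem_span_singleton_self v)

theorem notMem_span_smul (hv : v ≠ 0) : v ∉ ⟪τ F • v⟫ := by
  intro h
  obtain ⟨a, ha⟩ := Submodule.mem_span_singleton.1 h
  rw [← algebraMap_smul F a, smul_smul] at ha
  have h1 : (algebraMap O F a * τ F - 1) • v = 0 := by rw [sub_smul, ha, one_smul, sub_self]
  have h2 := (smul_eq_zero.1 h1).resolve_right hv
  rw [sub_eq_zero, τ, ← map_mul, ← map_one (algebraMap O F)] at h2
  exact PowerSeries.X_prime.not_isUnit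
    (IsUnit.of_mul_eq_one_right _ (IsFractionRing.injective O F h2))

/-- A unimodular line killed by `γ`. -/
theorem isClosedLat_span (hv : γ v = 0) (hv0 : v ≠ 0) {u : O} (hu : IsUnit u)
    (hB : B v v = algebraMap O F u) :
    IsClosedLat B γ (Submodule.span F {v}) {1} ⟪v⟫ where
  lat := isLat_span_singleton v
  dual := by
    obtain ⟨w, rfl⟩ := hu
    ext x
    constructor
    · rintro ⟨h1, h2⟩
      obtain ⟨c, rfl⟩ := Submodule.mem_span_singleton.1 h2
      have h3 := h1 v (Submodule.mem_span_singleton_self v)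
      rw [map_smul, LinearMap.smul_apply, hB, smul_eq_mul] at h3
      have h4 := mul_mem_one h3 (algebraMap_mem_one (↑w⁻¹ : O))
      rw [mul_assoc, ← map_mul, Units.mul_inv, map_one, mul_one] at h4
      exact mem_span_of_smul_mem_one h4
    · intro hx
      refine ⟨fun y hy => ?_, (isLat_span_singleton v).le hx⟩
      obtain ⟨a, rfl⟩ := Submodule.mem_span_singleton.1 hx
      obtain ⟨b, rfl⟩ := Submodule.mem_span_singleton.1 hy
      rw [← algebraMap_smul F a, ← algebraMap_smul F b, map_smul, map_smul, LinearMap.smul_apply,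
        hB]
      exact mul_mem_one (algebraMap_mem_one _) (mul_mem_one (algebraMap_mem_one _)
        (algebraMap_mem_one _))
  stable := by rw [act_span_singleton, hv]; simp
  rank j := by
    rcases Nat.eq_zero_or_pos j with rfl | hj
    · rw [rankLen, pow_zero, act_one, tS_span_singleton, sup_comm, tEnd_apply,
        relLen_sup_span (notMem_span_smul hv0) (Submodule.mem_span_singleton_self _)]
      rfl
    · rw [rankLen, act_span_singleton, pow_apply_eq_zero hv hj.ne', Submodule.span_zero_singleton,
        bot_sup_eq, relLen_self, partSum_singleton, Nat.sub_eq_zero_of_le hj]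
      rfl

/-- A line killed by `γ` of odd norm closes an open lattice. -/
theorem isGlueLat_span (hv : γ v = 0) (hv0 : v ≠ 0) {u : O} (hu : IsUnit u)
    (hB : B v v = algebraMap O F u * (τ F)⁻¹) :
    IsGlueLat B γ (Submodule.span F {v}) 0 ⟪τ F • v⟫ ⟪τ F • v⟫ v where
  lat := by
    have := isLat_span_singleton (F := F) (τ F • v)
    rwa [Submodule.span_singleton_smul_eq (isUnit_iff_ne_zero.2 τ_ne_zero)] at this
  le := le_rfl
  mem := Submodule.mem_span_singleton_self v
  notMem := notMem_span_smul hv0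
  smul_mem := Submodule.mem_span_singleton_self _
  dual := by
    have h0 := τ_ne_zero (F := F)
    have hle : ⟪τ F • v⟫ ≤ ⟪v⟫ := by
      rw [Submodule.span_singleton_le_iff_mem]
      exact mem_span_of_smul_mem_one (algebraMap_mem_one _)
    rw [sup_eq_right.2 hle]
    obtain ⟨w, rfl⟩ := hu
    ext x
    constructor
    · rintro ⟨h1, h2⟩
      obtain ⟨c, rfl⟩ := Submodule.mem_span_singleton.1 h2
      have h3 := h1 _ (Submodule.mem_span_singleton_self _)
      rw [map_smul, map_smul, LinearMap.smul_apply, hB, smul_eq_mul, smul_eq_mul] at h3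
      have h4 := mul_mem_one h3 (algebraMap_mem_one (↑w⁻¹ : O))
      have h5 : algebraMap O F w * algebraMap O F (↑w⁻¹ : O) = 1 := by
        rw [← map_mul, Units.mul_inv, map_one]
      rw [show τ F * (c * (algebraMap O F ↑w * (τ F)⁻¹)) * algebraMap O F (↑w⁻¹ : O) =
        (algebraMap O F w * algebraMap O F (↑w⁻¹ : O)) * c by field_simp, h5, one_mul] at h4
      exact mem_span_of_smul_mem_one h4
    · intro hx
      refine ⟨fun y hy => ?_, (isLat_span_singleton v).le hx⟩
      obtain ⟨a, rfl⟩ := Submodule.mem_span_singleton.1 hx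
      obtain ⟨b, rfl⟩ := Submodule.mem_span_singleton.1 hy
      rw [← algebraMap_smul F a, ← algebraMap_smul F b, map_smul, map_smul, map_smul,
        LinearMap.smul_apply, hB, smul_eq_mul, smul_eq_mul, smul_eq_mul,
        show algebraMap O F b * (τ F * (algebraMap O F a * (algebraMap O F ↑w * (τ F)⁻¹))) =
          algebraMap O F (b * a * w) by rw [map_mul, map_mul]; field_simp]
      exact algebraMap_mem_one _
  norm := by rw [hB]; exact inv_τ_not_mem_one hu
  integral r hr := by
    obtain ⟨a, rfl⟩ := Submodule.mem_span_singleton.1 hr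
    have h0 := τ_ne_zero (F := F)
    rw [← algebraMap_smul F a, map_smul, map_smul, LinearMap.smul_apply, LinearMap.smul_apply, hB,
      smul_eq_mul, smul_eq_mul, show τ F * (algebraMap O F u * (τ F)⁻¹) = algebraMap O F u by
        field_simp]
    exact mul_mem_one (algebraMap_mem_one _) (algebraMap_mem_one _)
  stable := by
    have hle : ⟪τ F • v⟫ ≤ ⟪v⟫ := by
      rw [Submodule.span_singleton_le_iff_mem]
      exact mem_span_of_smul_mem_one (algebraMap_mem_one _)
    rw [sup_eq_right.2 hle, act_span_singleton, hv]; simp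
  rank j := by
    rw [partSum_zero, Nat.cast_zero, rankLen, relLen_eq_zero_iff]
    refine sup_le ?_ le_rfl
    rw [act_span_singleton, map_smul]
    rcases Nat.eq_zero_or_pos j with rfl | hj
    · rw [pow_zero, Module.End.one_apply, Submodule.span_singleton_le_iff_mem]
      exact smul_mem_tS (mem_sup_span_self _ _)
    · rw [pow_apply_eq_zero hv hj.ne', smul_zero]; simp

/-- The lattice of the whole space. -/
theorem exists_isClosedLat_top {U : O[X] → Submodule F V} {L : List O[X]} {sq : O[X] → Prop}
    (hsq : ∀ p ∈ L, p.natDegree % ordConst p = 0 → Even (p.natDegree / ordConst p) → sq p →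
      squareOwn p) (hs : B.IsSymm)
    (hB : NondegOn B ⊤) {Λ₀ : Submodule O V} (hΛ₀ : IsLat (⊤ : Submodule F V) Λ₀)
    (hΛ₀' : dualIn B ⊤ Λ₀ = Λ₀) (h : IsBlockList B γ U L) (hinj : Set.InjOn γ (sumSub U L))
    (hv : γ v = 0) (hv0 : v ≠ 0) (horth : Orth B (sumSub U L) (Submodule.span F {v}))
    (htop : sumSub U L ⊔ Submodule.span F {v} = ⊤) :
    ∃ Λ, IsClosedLat B γ ⊤ (if Even (sumOrd L) then modify sq false L + {1}
      else modify sq false L) Λ := by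
  -- The standard lattice is self-dual, so no lattice of the whole space can have index one in its
  -- dual. This excludes the two mismatched combinations of the list parity and the norm of the
  -- line.
  have hparity : ∀ (A : Submodule O V) (x : V), IsLat (⊤ : Submodule F V) A →
      dualIn B ⊤ A = A ⊔ ⟪x⟫ → x ∉ A → τ F • x ∈ A → False := by
    intro A x hA hd hx hx'
    obtain ⟨n, hn⟩ := even_relLen_dualIn hs hB hA hΛ₀ hΛ₀' (by rw [hd]; exact le_sup_left)
    rw [hd, relLen_sup_span hx hx'] at hn
    have : 1 = 2 * n := by exact_mod_cast hn
    omega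
  have hgU := h.good_sumSub hs
  have hvv : B v v ≠ 0 := by
    intro h0
    refine hv0 (hB v trivial fun y _ => ?_)
    obtain ⟨y₁, hy₁, y₂, hy₂, rfl⟩ := Submodule.mem_sup.1 (htop.ge (Submodule.mem_top (x := y)))
    obtain ⟨c, rfl⟩ := Submodule.mem_span_singleton.1 hy₂
    rw [map_add, horth.symm hs v (Submodule.mem_span_singleton_self v) y₁ hy₁, map_smul, h0,
      smul_zero, add_zero]
  obtain ⟨a, u, hu, huB⟩ := exists_zpow_normalize hvv
  have ha : τ F ^ a ≠ 0 := zpow_ne_zero _ τ_ne_zero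
  set w := τ F ^ a • v with hw
  have hBw : B w w = τ F ^ a * (τ F ^ a * B v v) := by
    rw [hw, map_smul, map_smul, LinearMap.smul_apply]; rfl
  rw [← hBw] at huB
  have hspan : Submodule.span F {w} = Submodule.span F {v} :=
    Submodule.span_singleton_smul_eq (isUnit_iff_ne_zero.2 ha) v
  rw [← hspan] at horth htop
  have hγw : γ w = 0 := by rw [hw, map_smul, hv, smul_zero]
  have hw0 : w ≠ 0 := smul_ne_zero ha hv0
  have hww : B w w ≠ 0 := by rw [hBw]; exact mul_ne_zero ha (mul_ne_zero ha hvv)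
  clear_value w
  have hstab : ∀ x ∈ Submodule.span F {w}, γ x ∈ Submodule.span F {w} := fun x hx => by
    obtain ⟨c, rfl⟩ := Submodule.mem_span_singleton.1 hx
    rw [map_smul, hγw, smul_zero]; exact zero_mem _
  have hnd : NondegOn B (Submodule.span F {w}) := fun x hx hxy => by
    obtain ⟨c, rfl⟩ := Submodule.mem_span_singleton.1 hx
    have := hxy w (Submodule.mem_span_singleton_self w)
    rw [map_smul, LinearMap.smul_apply] at this
    rw [(smul_eq_zero.1 this).resolve_right hww, zero_smul]
  have hdis := horth.disjoint hnd
  obtain ⟨hc, ho⟩ := (h.exists_lattice hsq hs hinj).1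
  split_ifs with he
  · obtain ⟨Λ, hΛ⟩ := hc he
    rcases huB with huB | huB
    · have := hΛ.sup hs hdis horth hgU.stable hstab (isClosedLat_span hγw hw0 hu huB)
      rw [htop] at this
      exact ⟨_, this⟩
    -- A closed lattice together with a line of odd norm would give a lattice of index one in its
    -- dual.
    · have hG := isGlueLat_span hγw hw0 hu huB
      refine (hparity (Λ ⊔ ⟪τ F • w⟫) w ?_ ?_ (fun hm => hG.notMem ?_)
        (Submodule.mem_sup_right hG.smul_mem)).elim
      · rw [← htop]; exact hΛ.lat.sup hG.lat
      · rw [← htop, dualIn_sup hs horth hΛ.lat.le hG.lat.le, hΛ.dual, hG.dual, sup_assoc]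
      · exact (mem_of_add_mem_sup hdis hΛ.lat.le hG.lat.le (zero_mem _) hG.mem
          (by rwa [zero_add])).2
  · obtain ⟨C, e, hC⟩ := ho he
    rcases huB with huB | huB
    -- Likewise for an open lattice together with a unimodular line.
    · have := hC.sup hs hdis horth hgU.stable hstab (isClosedLat_span hγw hw0 hu huB)
      rw [htop] at this
      exact (hparity _ e this.lat this.dual this.notMem this.smul_mem).elim
    · have hG := isGlueLat_span hγw hw0 hu huB
      have := hC.exists_closed hs hdis horth hgU.nondeg hgU.stable hstab hinj hG fun j => ?_
      · rwa [htop, add_zero] at this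
      -- No slope condition is needed for gluing to the line: for `j = 0` the first alternative
      -- holds trivially, and for `j > 0` the power of `γ` kills the line.
      · rcases Nat.eq_zero_or_pos j with rfl | hj
        · left
          rw [pow_zero, act_one, tS_sup, tS_span_singleton]
          refine sup_le (tS_le C) ((Submodule.span_singleton_le_iff_mem _ _).2 ?_)
          rw [tEnd_apply]; exact hC.smul_mem
        · right
          rw [act_sup, act_span_singleton, act_span_singleton, map_smul,
            pow_apply_eq_zero hγw hj.ne', smul_zero]
          simp

end Kernel

/-! ### Coprimality of factors with different slopes. -/

section Slopes

variable {F : Type*} [Field F] [Algebra O F] [IsFractionRing O F]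

/-- On a lattice adapted to `(N, m)` the operator `γ^(N N')` acts like `t^(m N')`, on one adapted to
`(N', m')` like `t^(m' N)`. If the exponents differed, iteration would push one lattice into
arbitrarily high powers of `t` times the other, against commensurability. -/
theorem not_lt_of_adapted {V : Type*} [AddCommGroup V] [Module F V] [Module O V]
    [IsScalarTower O F V] [Nontrivial V] [FiniteDimensional F V] {γ : (Module.End F V)ˣ}
    {N m N' m' : ℕ} {A A' : Submodule O V} (hN' : 0 < N')
    (hA : IsLat (⊤ : Submodule F V) A) (hA' : IsLat (⊤ : Submodule F V) A')
    (h : Adapted γ N m A) (h' : Adapted γ N' m' A') : ¬ m * N' < m' * N := by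
  intro hlt
  obtain ⟨a, ha⟩ := hA'.exists_tS_pow_le hA.fg fun _ _ => trivial
  obtain ⟨b, hb⟩ := hA.exists_tS_pow_le hA'.fg fun _ _ => trivial
  rw [← coe_mon_t_nat (γ := γ)] at ha hb
  change shift γ 0 a A ≤ A' at ha
  change shift γ 0 b A' ≤ A at hb
  have key : ∀ n : ℕ, shift γ 0 a A ≤ shift γ 0 n A' := by
    intro n
    have h1 : shift γ (n * (N * N') : ℕ) (-(n * (m * N') : ℕ)) A = shift γ 0 0 A :=
      h.shift_eq (by push_cast; ring)
    have h2 := shift_mono ha (γ := γ) (n * (N * N') : ℕ) (-(n * (m * N') : ℕ))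
    rw [shift_shift, add_comm _ (0 : ℤ), add_comm _ (a : ℤ), ← shift_shift, h1, shift_zero] at h2
    refine h2.trans (h'.shift_le ?_)
    have h3 : (m * N' : ℤ) + 1 ≤ m' * N := by exact_mod_cast hlt
    have h4 := mul_le_mul_of_nonneg_left h3 (show (0 : ℤ) ≤ n * N' by positivity)
    push_cast
    linarith
  have h1 := key (a + 1 + b)
  have h2 := shift_mono hb (γ := γ) 0 (a + 1)
  rw [shift_shift, zero_add] at h2
  push_cast at h1
  have h3 := shift_mono (h1.trans h2) (γ := γ) 0 (-a)
  rw [shift_shift, shift_shift, add_zero, neg_add_cancel, neg_add_cancel_left, shift_zero,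
    ← tS_eq_shift] at h3
  have h4 := hA.relLen_tS
  rw [relLen_eq_zero_iff.2 h3, finrank_top] at h4
  have h5 : 0 < Module.finrank F V := Module.finrank_pos
  have h6 : 0 = Module.finrank F V := by exact_mod_cast h4
  omega

/-- `± f(-X)`. -/
def reflect (f : O[X]) : O[X] := C ((-1) ^ f.natDegree) * f.comp (-X)

theorem coeff_reflect (f : O[X]) (n : ℕ) :
    (reflect f).coeff n = (-1) ^ (f.natDegree + n) * f.coeff n := by
  rw [reflect, coeff_C_mul, coeff_comp_neg_X, pow_add]; ring

theorem natDegree_reflect (f : O[X]) : (reflect f).natDegree = f.natDegree := by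
  rw [reflect, natDegree_C_mul (pow_ne_zero _ (neg_ne_zero.2 one_ne_zero)), natDegree_comp,
    natDegree_neg, natDegree_X, mul_one]

theorem order_coeff_reflect (f : O[X]) (n : ℕ) :
    ((reflect f).coeff n).order = (f.coeff n).order := by
  rw [coeff_reflect]
  rcases Nat.even_or_odd (f.natDegree + n) with h | h
  · rw [h.neg_one_pow, one_mul]
  · rw [h.neg_one_pow, neg_one_mul, PowerSeries.order_neg]

theorem ordConst_reflect (f : O[X]) : ordConst (reflect f) = ordConst f := by
  rw [ordConst, order_coeff_reflect, ordConst]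

theorem IsSingleSlope.reflect {f : O[X]} (hf : IsSingleSlope f) :
    IsSingleSlope (SOOdd.reflect f) := by
  have hd := natDegree_reflect f
  refine ⟨?_, by rw [hd]; exact hf.2.1, ?_, fun i hi => ?_⟩
  · rw [Monic, leadingCoeff, hd, coeff_reflect, hf.1.coeff_natDegree, mul_one,
      (show Even (f.natDegree + f.natDegree) from ⟨_, rfl⟩).neg_one_pow]
  · rw [coeff_reflect]
    exact mul_ne_zero (pow_ne_zero _ (neg_ne_zero.2 one_ne_zero)) hf.2.2.1
  · rw [hd] at hi ⊢
    rw [ordConst_reflect, order_coeff_reflect]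
    exact hf.2.2.2 i hi

variable (F) in
/-- Factors of different slopes are coprime. -/
theorem IsSingleSlope.isCoprime {f g : O[X]} (hf : IsSingleSlope f) (hg : IsSingleSlope g)
    (h : f.natDegree * ordConst g ≠ g.natDegree * ordConst f) :
    IsCoprime (f.map (algebraMap O F)) (g.map (algebraMap O F)) := by
  refine isCoprime_of_irreducible_dvd (fun h0 => (hf.1.map (algebraMap O F)).ne_zero h0.1) ?_
  intro π hπ hπf hπg
  have : Fact (Irreducible π) := ⟨hπ⟩
  have : FiniteDimensional F (AdjoinRoot π) := (AdjoinRoot.powerBasis hπ.ne_zero).finite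
  have hroot : ∀ {p : O[X]}, π ∣ p.map (algebraMap O F) →
      aeval (AdjoinRoot.root π) (p.map (algebraMap O F)) = 0 := fun hp => by
    rw [AdjoinRoot.aeval_eq, AdjoinRoot.mk_eq_zero]; exact hp
  have hr0 : AdjoinRoot.root π ≠ 0 := by
    intro h0
    have h1 := hroot hπf
    rw [h0, ← coeff_zero_eq_aeval_zero'] at h1
    rw [coeff_map] at h1
    exact hf.2.2.1 (IsFractionRing.injective O F ((algebraMap F (AdjoinRoot π)).injective
      (by rw [h1, map_zero, map_zero])))
  -- A common irreducible factor `π` would be a root of both polynomials for multiplication by `X`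
  -- on `F[X] / π`. That space would then carry adapted lattices for two different slopes.
  let γ : (Module.End F (AdjoinRoot π))ˣ :=
    Units.map (Algebra.lmul F (AdjoinRoot π)).toMonoidHom (Units.mk0 _ hr0)
  have hγ : ∀ {p : O[X]}, π ∣ p.map (algebraMap O F) →
      aeval (γ : Module.End F (AdjoinRoot π)) (p.map (algebraMap O F)) = 0 := fun hp => by
    change aeval (Algebra.lmul F (AdjoinRoot π) (AdjoinRoot.root π)) _ = 0
    rw [aeval_algHom_apply, hroot hp, map_zero]
  obtain ⟨A, hA, hA'⟩ := exists_adapted_lattice hf (hγ hπf)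
  obtain ⟨D, hD, hD'⟩ := exists_adapted_lattice hg (hγ hπg)
  have h1 := not_lt_of_adapted hg.2.1 hA hD hA' hD'
  have h2 := not_lt_of_adapted hf.2.1 hD hA hD' hA'
  apply h
  rw [mul_comm f.natDegree, mul_comm g.natDegree]
  omega

variable (F) in
-- Substituting `-X` changes coefficients only by signs and keeps the slope. This form is needed
-- because adjoints replace `γ` by `-γ`.
theorem IsSingleSlope.isCoprime_neg {f g : O[X]} (hf : IsSingleSlope f) (hg : IsSingleSlope g)
    (h : f.natDegree * ordConst g ≠ g.natDegree * ordConst f) :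
    IsCoprime ((f.map (algebraMap O F)).comp (-X)) (g.map (algebraMap O F)) := by
  have h1 := hf.reflect.isCoprime F hg (by
    rwa [natDegree_reflect f, ordConst_reflect])
  rw [SOOdd.reflect, Polynomial.map_mul, map_comp, Polynomial.map_neg, map_X] at h1
  exact h1.of_mul_left_right

end Slopes

/-! ### Cyclic vectors for a separable characteristic polynomial. -/

section CyclicVector

variable {F : Type*} [Field F]

/-- A matrix whose characteristic polynomial is separable is annihilated by its multiples only. -/
theorem charpoly_dvd_of_aeval_eq_zero {n : Type*} [Fintype n] [DecidableEq n] {M : Matrix n n F}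
    (hM : M.charpoly.Separable) {q : F[X]} (hq : aeval M q = 0) : M.charpoly ∣ q := by
  by_cases hq0 : q = 0
  · rw [hq0]; exact dvd_zero _
  let E := AlgebraicClosure F
  let ι := algebraMap F E
  rw [← map_dvd_map' ι]
  have hq0' : q.map ι ≠ 0 := (Polynomial.map_ne_zero_iff ι.injective).2 hq0
  have hsep : (M.charpoly.map ι).Separable := hM.map
  rw [(IsAlgClosed.splits (M.charpoly.map ι)).eq_prod_roots_of_monic (M.charpoly_monic.map ι),
    Multiset.prod_X_sub_C_dvd_iff_le_roots hq0', Multiset.le_iff_subset (nodup_roots hsep)]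
  intro r hr
  rw [mem_roots hq0']
  -- Over the algebraic closure each root `r` is an eigenvalue, so `q(r)` lies in the spectrum of
  -- `q(M) = 0`; the roots are simple, so this gives divisibility.
  have h1 : r ∈ spectrum E (M.map ι) := by
    rw [Matrix.mem_spectrum_iff_isRoot_charpoly, Matrix.charpoly_map]
    exact isRoot_of_mem_roots hr
  have h2 := spectrum.subset_polynomial_aeval (M.map ι) (q.map ι) ⟨r, h1, rfl⟩
  have h3 : aeval (M.map ι) (q.map ι) = 0 := by
    have h4 := congrArg (Algebra.ofId F E).mapMatrix hq
    rw [← aeval_algHom_apply, map_zero] at h4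
    rw [aeval_map_algebraMap]
    exact h4
  rw [h3] at h2
  have : Nontrivial (Matrix n n E) := by
    by_contra hn
    rw [not_nontrivial_iff_subsingleton] at hn
    rw [spectrum.of_subsingleton] at h1
    exact h1
  rwa [spectrum.zero_eq, Set.mem_singleton_iff] at h2

/-- If no polynomial of degree less than the dimension kills `φ`, there is a cyclic vector. -/
theorem exists_cyclic [Infinite F] {V : Type*} [AddCommGroup V] [Module F V]
    [FiniteDimensional F V] {φ : Module.End F V} {χ : F[X]} (hχ : χ.Monic)
    (hdeg : χ.natDegree = Module.finrank F V) (hroot : aeval φ χ = 0)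
    (hmin : ∀ q : F[X], aeval φ q = 0 → χ ∣ q) :
    ∃ v : V, ∀ q : F[X], q.degree < Module.finrank F V → aeval φ q v = 0 → q = 0 := by
  classical
  let S := (UniqueFactorizationMonoid.normalizedFactors χ).toFinset
  -- Over an infinite field finitely many proper subspaces do not cover the space; any vector
  -- outside the kernels of `(χ / π)(φ)` is cyclic.
  have hne : ⋃ W ∈ S.image fun π => LinearMap.ker (aeval φ (χ / π)), (W : Set V) ≠ Set.univ := by
    refine Subspace.biUnion_ne_univ_of_top_notMem ?_
    intro htop
    obtain ⟨π, hπ, hk⟩ := Finset.mem_image.1 htop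
    have hπ' := Multiset.mem_toFinset.1 hπ
    have h1 : aeval φ (χ / π) = 0 := LinearMap.ker_eq_top.1 hk
    have h2 := hmin _ h1
    have hirr := UniqueFactorizationMonoid.irreducible_of_normalized_factor _ hπ'
    obtain ⟨s, hs⟩ := UniqueFactorizationMonoid.dvd_of_mem_normalizedFactors hπ'
    rw [hs, mul_div_cancel_left₀ _ hirr.ne_zero] at h2
    have hs0 : s ≠ 0 := by rintro rfl; rw [mul_zero] at hs; exact hχ.ne_zero hs
    obtain ⟨r, hr⟩ := h2
    have h3 : π * r = 1 := mul_left_cancel₀ hs0 (by rw [mul_one]; linear_combination -hr)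
    exact hirr.not_isUnit (IsUnit.of_mul_eq_one _ h3)
  obtain ⟨v, hv⟩ := (Set.ne_univ_iff_exists_notMem _).1 hne
  refine ⟨v, fun q hq h0 => ?_⟩
  by_contra hq0
  -- A polynomial `q` of small degree killing `v` may be replaced by its gcd with `χ`, a proper
  -- divisor of `χ` and hence a divisor of some `χ / π`.
  have hd : aeval φ (EuclideanDomain.gcd q χ) v = 0 := by
    rw [EuclideanDomain.gcd_eq_gcd_ab, map_add, mul_comm q, mul_comm χ, map_mul, map_mul, hroot]
    simp [h0]
  obtain ⟨s, hs⟩ := EuclideanDomain.gcd_dvd_right q χ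
  obtain ⟨z, hz⟩ := EuclideanDomain.gcd_dvd_left q χ
  set d := EuclideanDomain.gcd q χ
  have hd0 : d ≠ 0 := by intro h; rw [h, zero_mul] at hs; exact hχ.ne_zero hs
  have hs0 : s ≠ 0 := by rintro rfl; rw [mul_zero] at hs; exact hχ.ne_zero hs
  have hsu : ¬ IsUnit s := by
    intro hu
    have h1 : d.natDegree ≤ q.natDegree := natDegree_le_of_dvd ⟨z, hz⟩ hq0
    have h2 : χ.natDegree = d.natDegree := by
      rw [hs, natDegree_mul hd0 hs0, natDegree_eq_zero_of_isUnit hu, add_zero]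
    have h3 := (natDegree_lt_iff_degree_lt hq0).2 hq
    omega
  obtain ⟨π₀, hπ₀, hdvd₀⟩ := WfDvdMonoid.exists_irreducible_factor hsu hs0
  obtain ⟨π, hπ, hass⟩ := UniqueFactorizationMonoid.exists_mem_normalizedFactors_of_dvd
    hχ.ne_zero hπ₀ (hdvd₀.trans ⟨d, by rw [hs, mul_comm]⟩)
  obtain ⟨r, hr⟩ := (hass.dvd_iff_dvd_left (c := s)).1 hdvd₀
  have hπ0 : π ≠ 0 := by rintro rfl; rw [zero_mul] at hr; exact hs0 hr
  refine hv (Set.mem_biUnion (Finset.mem_coe.2 (Finset.mem_image_of_mem _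
    (Multiset.mem_toFinset.2 hπ))) ?_)
  have : χ / π = r * d := by
    have h1 : χ = π * (r * d) := by rw [hs, hr]; ring
    rw [h1, mul_div_cancel_left₀ _ hπ0]
  change aeval φ (χ / π) v = 0
  rw [this, map_mul, Module.End.mul_apply, hd, map_zero]

end CyclicVector

/-! ### The orthogonal decomposition by the factors of the characteristic polynomial. -/

section Decomposition

variable {F : Type*} [Field F] [Algebra O F] [IsFractionRing O F]
variable {V : Type*} [AddCommGroup V] [Module F V] [Module O V] [IsScalarTower O F V]

local notation "⟪" v "⟫" => Submodule.span O {v}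

variable {B : LinearMap.BilinForm F V} {γ : Module.End F V}

theorem isCoprime_X {q : F[X]} (h : q.coeff 0 ≠ 0) : IsCoprime q X :=
  ((EuclideanDomain.dvd_or_coprime X q irreducible_X).resolve_left
    fun hd => h (X_dvd_iff.1 hd)).symm

/-- By coprimality `P(-γ)` is surjective on the kernel of `s(γ)`, and it is the adjoint of `P(γ)`,
which kills the other argument. -/
theorem orth_ker (hskew : ∀ x y, B (γ x) y = -B x (γ y)) {P s : F[X]}
    (h : IsCoprime (P.comp (-X)) s) :
    Orth B (LinearMap.ker (aeval γ P)) (LinearMap.ker (aeval γ s)) := by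
  intro x hx y hy
  obtain ⟨a, b, hab⟩ := h
  have h1 : y = aeval γ (P.comp (-X)) (aeval γ a y) := by
    have h2 := congrArg (fun q => aeval γ q y) hab
    simp only [map_add, map_mul, LinearMap.add_apply, Module.End.mul_apply,
      LinearMap.mem_ker.1 hy, map_zero, add_zero, map_one, Module.End.one_apply] at h2
    rw [← Module.End.mul_apply, ← map_mul, mul_comm, map_mul, Module.End.mul_apply, h2]
  rw [h1, ← aeval_adjoint hskew, LinearMap.mem_ker.1 hx]
  simp

theorem ker_stable (q : F[X]) : ∀ x ∈ LinearMap.ker (aeval γ q),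
    γ x ∈ LinearMap.ker (aeval γ q) := by
  intro x hx
  have h1 : aeval γ q (γ x) = γ (aeval γ q x) := by
    have := congrArg (fun r => aeval γ r x) (mul_comm q X)
    simpa using this
  rw [LinearMap.mem_ker, h1, LinearMap.mem_ker.1 hx, map_zero]

theorem aeval_of_apply_eq_zero {x : V} (hx : γ x = 0) (q : F[X]) :
    aeval γ q x = q.coeff 0 • x := by
  conv_lhs => rw [← divX_mul_X_add q]
  simp [hx]

/-- On a vector killed by `γ` the operator `q(γ)` is multiplication by `q(0)`. -/
theorem injOn_ker {q : F[X]} (h : q.coeff 0 ≠ 0) : Set.InjOn γ (LinearMap.ker (aeval γ q)) := by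
  intro x hx y hy hxy
  rw [← sub_eq_zero] at hxy ⊢
  rw [← map_sub] at hxy
  have h1 : aeval γ q (x - y) = 0 := LinearMap.mem_ker.1 (Submodule.sub_mem _ hx hy)
  rw [aeval_of_apply_eq_zero hxy] at h1
  exact (smul_eq_zero.1 h1).resolve_left h

theorem coe_aeval_restrict {U : Submodule F V} {g : Module.End F U}
    (hg : ∀ x : U, (g x : V) = γ x) (q : F[X]) (x : U) :
    (aeval g q x : V) = aeval γ q (x : V) := by
  induction q using Polynomial.induction_on' generalizing x with
  | add p q hp hq => simp [hp, hq]
  | monomial n c =>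
    have h1 : ∀ (n : ℕ) (x : U), ((g ^ n) x : V) = (γ ^ n) (x : V) := by
      intro n
      induction n with
      | zero => simp
      | succ n ih => intro x; rw [pow_succ, pow_succ, Module.End.mul_apply, ih, hg]; rfl
    rw [← C_mul_X_pow_eq_monomial]
    simp [h1]

/-- A vector whose annihilator is generated by a polynomial. -/
structure IsCyclicFor (γ : Module.End F V) (χ : F[X]) (v : V) : Prop where
  monic : χ.Monic
  natDegree_eq : χ.natDegree = Module.finrank F V
  root : aeval γ χ = 0
  eq_zero : ∀ q : F[X], q.degree < Module.finrank F V → aeval γ q v = 0 → q = 0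

variable {χ : F[X]} {v : V}

theorem IsCyclicFor.dvd (h : IsCyclicFor γ χ v) {q : F[X]} (hq : aeval γ q v = 0) : χ ∣ q := by
  rw [← modByMonic_eq_zero_iff_dvd h.monic]
  refine h.eq_zero _ ?_ ?_
  · rw [← h.natDegree_eq, ← degree_eq_natDegree h.monic.ne_zero]
    exact degree_modByMonic_lt _ h.monic
  · have h1 := congrArg (fun r => aeval γ r v) (modByMonic_add_div q χ)
    simpa [h.root, hq] using h1

theorem IsCyclicFor.exists_eq [FiniteDimensional F V] (h : IsCyclicFor γ χ v) (x : V) :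
    ∃ q : F[X], aeval γ q v = x := by
  obtain ⟨q, hq⟩ := (evalLT_bijective h.eq_zero).2 x
  exact ⟨q, hq⟩

/-- The kernel of a factor is again cyclic: it is generated by the complementary factor applied to
the cyclic vector. -/
theorem IsCyclicFor.exists_mem_ker [FiniteDimensional F V] (h : IsCyclicFor γ χ v) {P s : F[X]}
    (hP : P ≠ 0) (hχ : χ = P * s) {x : V} (hx : x ∈ LinearMap.ker (aeval γ P)) :
    ∃ r : F[X], aeval γ r (aeval γ s v) = x := by
  obtain ⟨q, rfl⟩ := h.exists_eq x
  have h1 : χ ∣ P * q := h.dvd (by rw [map_mul]; exact hx)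
  rw [hχ, mul_dvd_mul_iff_left hP] at h1
  obtain ⟨r, rfl⟩ := h1
  exact ⟨r, by rw [mul_comm s, map_mul]; rfl⟩

/-- The lattices on the kernel of a factor. -/
theorem hasBlocks_ker [FiniteDimensional F V] (hs : B.IsSymm) (hB : NondegOn B ⊤)
    (hskew : ∀ x y, B (γ x) y = -B x (γ y)) (h : IsCyclicFor γ χ v) (hsq : Squarefree χ)
    {p : O[X]} (hp : IsSingleSlope p) (hm : 0 < ordConst p) {s : F[X]}
    (hχ : χ = p.map (algebraMap O F) * s) (hco : IsCoprime (p.map (algebraMap O F)) s)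
    (hco' : IsCoprime ((p.map (algebraMap O F)).comp (-X)) s) :
    IsGood B γ (LinearMap.ker (aeval γ (p.map (algebraMap O F)))) ∧
      HasBlocks B γ (LinearMap.ker (aeval γ (p.map (algebraMap O F)))) p := by
  set P := p.map (algebraMap O F) with hP
  have hPm : P.Monic := hp.1.map _
  have hPd : P.natDegree = p.natDegree := hp.1.natDegree_map _
  have hP0 : P.coeff 0 ≠ 0 := by
    rw [coeff_map, Ne, map_eq_zero_iff _ (IsFractionRing.injective O F)]
    exact hp.2.2.1
  have hsm : s.Monic := hPm.of_mul_monic_left (hχ ▸ h.monic)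
  set U := LinearMap.ker (aeval γ P) with hU
  have htop : U ⊔ LinearMap.ker (aeval γ s) = ⊤ := by
    rw [sup_ker_aeval_eq_ker_aeval_mul_of_coprime γ hco, ← hχ, h.root]
    exact LinearMap.ker_zero
  have horth : Orth B U (LinearMap.ker (aeval γ s)) := orth_ker hskew hco'
  have hgood : IsGood B γ U := by
    refine ⟨fun x hx hxU => hB x trivial fun y _ => ?_, ker_stable P⟩
    obtain ⟨y₁, hy₁, y₂, hy₂, rfl⟩ := Submodule.mem_sup.1 (htop.ge (Submodule.mem_top (x := y)))
    rw [map_add, hxU y₁ hy₁, horth x hx y₂ hy₂, add_zero]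
  refine ⟨hgood, ?_⟩
  let g : Module.End F U := γ.restrict hgood.stable
  have hg : ∀ x : U, (g x : V) = γ x := fun x => rfl
  have hgu : IsUnit g := by
    rw [LinearMap.isUnit_iff_ker_eq_bot, LinearMap.ker_eq_bot]
    intro x y hxy
    refine Subtype.ext (injOn_ker hP0 x.2 y.2 ?_)
    rw [← hg, hxy, hg]
  obtain ⟨u, hu⟩ := hgu
  have hu' : ∀ x : U, ((u : Module.End F U) x : V) = γ x := by rw [hu]; exact hg
  let w : U := ⟨aeval γ s v, by
    rw [hU, LinearMap.mem_ker, ← Module.End.mul_apply, ← map_mul, ← hχ, h.root]; rfl⟩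
  have hcyc : ∀ x : U, ∃ q : F[X], aeval (u : Module.End F U) q w = x := by
    intro x
    obtain ⟨r, hr⟩ := h.exists_mem_ker hPm.ne_zero hχ x.2
    exact ⟨r, Subtype.ext (by rw [coe_aeval_restrict hu']; exact hr)⟩
  have hroot : aeval (u : Module.End F U) P = 0 := by
    ext x
    rw [coe_aeval_restrict hu']
    exact x.2
  have hrank : Module.finrank F U = p.natDegree := by
    -- A relation of degree below that of `p` for `w = s(γ) v` would give one for `v` of degree
    -- below the dimension after multiplication by `s`.
    have hbij : Function.Bijective (evalLT (u : Module.End F U) p.natDegree w) := by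
      constructor
      · rw [← LinearMap.ker_eq_bot, LinearMap.ker_eq_bot']
        rintro ⟨q, hq⟩ h0
        rw [evalLT_apply] at h0
        have h1 := congrArg Subtype.val h0
        rw [coe_aeval_restrict hu'] at h1
        change aeval γ q (aeval γ s v) = 0 at h1
        rw [← Module.End.mul_apply, ← map_mul] at h1
        have h2 := h.eq_zero _ (by
          rw [← h.natDegree_eq, hχ, hPm.natDegree_mul hsm, hPd, degree_mul, Nat.cast_add,
            ← degree_eq_natDegree hsm.ne_zero]
          exact WithBot.add_lt_add_right (degree_ne_bot.2 hsm.ne_zero) (mem_degreeLT.1 hq)) h1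
        exact Subtype.ext ((mul_eq_zero.1 h2).resolve_right hsm.ne_zero)
      · intro x
        obtain ⟨q, rfl⟩ := hcyc x
        refine ⟨⟨q %ₘ P, mem_degreeLT.2 ?_⟩, ?_⟩
        · rw [← hPd, ← degree_eq_natDegree hPm.ne_zero]
          exact degree_modByMonic_lt _ hPm
        · rw [evalLT_apply]
          conv_rhs => rw [← modByMonic_add_div q P]
          simp [hroot]
    rw [← (LinearEquiv.ofBijective _ hbij).finrank_eq, finrank_degreeLT]
  have hblock : IsBlock (B.restrict U) u p := {
    symm := restrict_isSymm hs U
    nondeg := fun x _ hx => Subtype.ext (hgood.nondeg x x.2 fun y hy => hx ⟨y, hy⟩ trivial)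
    skew := fun x y => by
      change B ((u : Module.End F U) x : V) y = -B x ((u : Module.End F U) y : V)
      rw [hu', hu', hskew]
    slope := hp
    ord_pos := hm
    finrank := hrank
    root := hroot }
  exact (hblock.hasBlocks hcyc (hsq.squarefree_of_dvd ⟨s, hχ⟩)).emb hu'

theorem isCoprime_prod {P : F[X]} {L : List O[X]}
    (h : ∀ q ∈ L, IsCoprime P (q.map (algebraMap O F))) :
    IsCoprime P (L.prod.map (algebraMap O F)) := by
  induction L with
  | nil => simpa using isCoprime_one_right
  | cons q L ih =>
    rw [List.prod_cons, Polynomial.map_mul]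
    exact (h q List.mem_cons_self).mul_right (ih fun r hr => h r (List.mem_cons_of_mem _ hr))

theorem sumSub_eq_ker {L : List O[X]} (hL : ∀ p ∈ L, IsSingleSlope p)
    (hsl : L.Pairwise fun p q => q.natDegree * ordConst p < p.natDegree * ordConst q) :
    sumSub (fun p => LinearMap.ker (aeval γ (p.map (algebraMap O F)))) L =
      LinearMap.ker (aeval γ (L.prod.map (algebraMap O F))) := by
  induction L with
  | nil => simp [sumSub, Module.End.one_eq_id]
  | cons p L ih =>
    rw [sumSub, ih (fun q hq => hL q (List.mem_cons_of_mem _ hq)) hsl.of_cons,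
      sup_ker_aeval_eq_ker_aeval_mul_of_coprime, List.prod_cons, Polynomial.map_mul]
    exact isCoprime_prod fun q hq => (hL p List.mem_cons_self).isCoprime F
      (hL q (List.mem_cons_of_mem _ hq)) ((List.pairwise_cons.1 hsl).1 q hq).ne'

theorem coeff_zero_prod_ne_zero {L : List O[X]} (hL : ∀ p ∈ L, IsSingleSlope p) :
    (L.prod.map (algebraMap O F)).coeff 0 ≠ 0 := by
  rw [coeff_map, Ne, map_eq_zero_iff _ (IsFractionRing.injective O F), coeff_zero_eq_eval_zero,
    eval_list_prod, List.prod_eq_zero_iff]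
  intro h
  obtain ⟨p, hp, h0⟩ := List.mem_map.1 h
  rw [← coeff_zero_eq_eval_zero] at h0
  exact (hL p hp).2.2.1 h0

/-- The self-dual lattice for `γ` whose characteristic polynomial is `X ∏ f`. -/
theorem exists_isClosedLat [FiniteDimensional F V] (hs : B.IsSymm) (hB : NondegOn B ⊤)
    (hskew : ∀ x y, B (γ x) y = -B x (γ y)) {L : List O[X]}
    {sq : O[X] → Prop} (hsqr : ∀ p ∈ L, p.natDegree % ordConst p = 0 →
      Even (p.natDegree / ordConst p) → sq p → squareOwn p)
    (h : IsCyclicFor γ (X * L.prod.map (algebraMap O F)) v)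
    (hsq : Squarefree (X * L.prod.map (algebraMap O F))) (hL : ∀ p ∈ L, IsSingleSlope p)
    (hsl : L.Pairwise fun p q => q.natDegree * ordConst p < p.natDegree * ordConst q)
    (hord : ∀ p ∈ L, 0 < ordConst p) {Λ₀ : Submodule O V} (hΛ₀ : IsLat (⊤ : Submodule F V) Λ₀)
    (hΛ₀' : dualIn B ⊤ Λ₀ = Λ₀) :
    ∃ Λ, IsClosedLat B γ ⊤ (if Even (sumOrd L) then modify sq false L + {1}
      else modify sq false L) Λ := by
  set Q := L.prod.map (algebraMap O F) with hQ
  have hQ0 : Q.coeff 0 ≠ 0 := coeff_zero_prod_ne_zero hL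
  have hQm : Q.Monic := (monic_X (R := F)).of_mul_monic_left h.monic
  have hQn : Q.comp (-X) ≠ 0 ∧ (Q.comp (-X)).coeff 0 ≠ 0 := by
    have : (Q.comp (-X)).coeff 0 ≠ 0 := by rw [coeff_comp_neg_X]; simpa using hQ0
    exact ⟨by rintro h0; rw [h0] at this; simp at this, this⟩
  have hsum := sumSub_eq_ker (γ := γ) (F := F) hL hsl
  set U : O[X] → Submodule F V := fun p => LinearMap.ker (aeval γ (p.map (algebraMap O F))) with hU
  have hfac : ∀ p ∈ L, IsGood B γ (U p) ∧ HasBlocks B γ (U p) p := by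
    intro p hp
    obtain ⟨L₁, L₂, rfl⟩ := List.append_of_mem hp
    have hother : ∀ q ∈ L₁ ++ L₂, IsSingleSlope q ∧
        p.natDegree * ordConst q ≠ q.natDegree * ordConst p := by
      intro q hq
      rw [List.pairwise_append] at hsl
      rcases List.mem_append.1 hq with hq | hq
      · exact ⟨hL q (by simp [hq]), (hsl.2.2 q hq p List.mem_cons_self).ne⟩
      · exact ⟨hL q (by simp [hq]), ((List.pairwise_cons.1 hsl.2.1).1 q hq).ne'⟩
    have hps := hL p hp
    have hp0 : (p.map (algebraMap O F)).coeff 0 ≠ 0 := by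
      rw [coeff_map, Ne, map_eq_zero_iff _ (IsFractionRing.injective O F)]
      exact hps.2.2.1
    refine hasBlocks_ker hs hB hskew h hsq hps (hord p hp)
      (s := X * (L₁ ++ L₂).prod.map (algebraMap O F)) ?_ ?_ ?_
    · rw [hQ, List.prod_append, List.prod_cons, List.prod_append, Polynomial.map_mul,
        Polynomial.map_mul, Polynomial.map_mul]
      ring
    · exact (isCoprime_X hp0).mul_right (isCoprime_prod fun q hq =>
        hps.isCoprime F (hother q hq).1 (hother q hq).2)
    · refine (isCoprime_X ?_).mul_right (isCoprime_prod fun q hq =>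
        hps.isCoprime_neg F (hother q hq).1 (hother q hq).2)
      rw [coeff_comp_neg_X]
      simpa using hp0
  have hlist : IsBlockList B γ U L := {
    good := fun p hp => (hfac p hp).1
    blocks := fun p hp => (hfac p hp).2
    slope := hsl
    orth := hsl.imp_of_mem fun {p q} hp hq hpq =>
      orth_ker hskew ((hL p hp).isCoprime_neg F (hL q hq) hpq.ne') }
  set w := aeval γ Q v with hw
  have hγw : γ w = 0 := by
    have h1 : aeval γ (X * Q) v = 0 := by rw [h.root]; rfl
    rwa [map_mul, aeval_X, Module.End.mul_apply] at h1
  have hw0 : w ≠ 0 := by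
    intro h0
    refine hQm.ne_zero (h.eq_zero Q ?_ h0)
    rw [← h.natDegree_eq, natDegree_X_mul hQm.ne_zero, degree_eq_natDegree hQm.ne_zero]
    exact_mod_cast Nat.lt_succ_self _
  have hker : LinearMap.ker (aeval γ (X : F[X])) = Submodule.span F {w} := by
    apply le_antisymm
    · intro x hx
      obtain ⟨r, rfl⟩ := h.exists_mem_ker X_ne_zero rfl hx
      rw [← hw, aeval_of_apply_eq_zero hγw]
      exact Submodule.smul_mem _ _ (Submodule.mem_span_singleton_self w)
    · rw [Submodule.span_singleton_le_iff_mem, LinearMap.mem_ker, aeval_X, hγw]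
  refine exists_isClosedLat_top hsqr hs hB hΛ₀ hΛ₀' hlist ?_ hγw hw0 ?_ ?_
  · rw [hsum]; exact injOn_ker hQ0
  · rw [hsum, ← hker]
    exact orth_ker hskew (isCoprime_X hQn.2)
  · rw [hsum, ← hker, sup_ker_aeval_eq_ker_aeval_mul_of_coprime γ (isCoprime_X hQ0), mul_comm,
      h.root]
    exact LinearMap.ker_zero

end Decomposition

/-! ### Initial forms for the weights `k` of `t` and `1` of `λ`. -/

section InitialForm

/-- With weight `k` for `t` and `1` for `λ`, the initial form of `q` is `c t^M λ^M'`. -/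
def HasInit (k : ℕ) (q : O[X]) (M M' : ℕ) (c : ℂ) : Prop :=
  ∀ i j, k * i + j ≤ k * M + M' →
    PowerSeries.coeff i (q.coeff j) = if i = M ∧ j = M' then c else 0

/-- If `p` has no terms of weight below `w`, then up to the weight `k M + M' + w` a product with `p`
sees only the initial monomial of `q`: every other term of `q` in this range meets a vanishing
coefficient of `p`. -/
theorem HasInit.coeff_mul {k : ℕ} {q p : O[X]} {M M' w : ℕ} {c : ℂ} (hq : HasInit k q M M' c)
    (hp : ∀ i j, k * i + j < w → PowerSeries.coeff i (p.coeff j) = 0) {i j : ℕ}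
    (hij : k * i + j ≤ k * M + M' + w) :
    PowerSeries.coeff i ((q * p).coeff j) =
      if M ≤ i ∧ M' ≤ j then c * PowerSeries.coeff (i - M) (p.coeff (j - M')) else 0 := by
  have h1 : ∀ x ∈ Finset.HasAntidiagonal.antidiagonal j, ∀ y ∈ Finset.HasAntidiagonal.antidiagonal i,
      PowerSeries.coeff y.1 (q.coeff x.1) * PowerSeries.coeff y.2 (p.coeff x.2) =
        if y.1 = M ∧ x.1 = M' then c * PowerSeries.coeff y.2 (p.coeff x.2) else 0 := by
    intro x hx y hy
    rw [Finset.HasAntidiagonal.mem_antidiagonal] at hx hy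
    by_cases hle : k * y.1 + x.1 ≤ k * M + M'
    · rw [hq _ _ hle]
      split_ifs <;> simp
    · rw [hp y.2 x.2, mul_zero, if_neg]
      · rintro ⟨h1, h2⟩
        rw [h1, h2] at hle
        exact hle le_rfl
      · rw [← hx, ← hy, mul_add] at hij
        omega
  rw [Polynomial.coeff_mul, map_sum]
  simp_rw [PowerSeries.coeff_mul]
  rw [Finset.sum_congr rfl fun x hx => Finset.sum_congr rfl fun y hy => h1 x hx y hy]
  split_ifs with h
  · rw [Finset.sum_eq_single (M', j - M'), Finset.sum_eq_single (M, i - M)]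
    · simp
    · intro y hy hne
      refine if_neg fun h2 => hne ?_
      rw [Finset.HasAntidiagonal.mem_antidiagonal] at hy
      exact Prod.ext h2.1 (by simp; omega)
    · intro h2
      exact absurd (Finset.HasAntidiagonal.mem_antidiagonal.2 (by simp; omega)) h2
    · intro x hx hne
      refine Finset.sum_eq_zero fun y _ => if_neg fun h2 => hne ?_
      rw [Finset.HasAntidiagonal.mem_antidiagonal] at hx
      exact Prod.ext h2.2 (by simp; omega)
    · intro h2
      exact absurd (Finset.HasAntidiagonal.mem_antidiagonal.2 (by simp; omega)) h2
  · refine Finset.sum_eq_zero fun x hx => Finset.sum_eq_zero fun y hy => if_neg fun h2 => h ?_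
    rw [Finset.HasAntidiagonal.mem_antidiagonal] at hx hy
    omega

theorem HasInit.mul {k : ℕ} {q p : O[X]} {M M' N N' : ℕ} {c d : ℂ} (hq : HasInit k q M M' c)
    (hp : HasInit k p N N' d) : HasInit k (q * p) (M + N) (M' + N') (c * d) := by
  intro i j hij
  have hk : k * (M + N) = k * M + k * N := mul_add _ _ _
  rw [hq.coeff_mul (w := k * N + N') _ (by omega)]
  · by_cases h : M ≤ i ∧ M' ≤ j
    · have hi : k * i = k * M + k * (i - M) := by rw [← mul_add]; congr 1; omega
      rw [if_pos h, hp _ _ (by omega)]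
      have h1 : (i - M = N ∧ j - M' = N') ↔ (i = M + N ∧ j = M' + N') := by omega
      simp only [h1]
      split_ifs <;> simp
    · rw [if_neg h, if_neg]
      omega
  · intro i' j' h'
    rw [hp _ _ h'.le, if_neg]
    rintro ⟨rfl, rfl⟩
    exact lt_irrefl _ h'

theorem hasInit_one {k : ℕ} (hk : 0 < k) : HasInit k 1 0 0 1 := by
  intro i j hij
  have h1 : k * i = 0 ∧ j = 0 := by omega
  have h2 : i = 0 := (Nat.mul_eq_zero.1 h1.1).resolve_left hk.ne'
  simp [h1.2, h2]

theorem hasInit_prod {k : ℕ} (hk : 0 < k) {L : List O[X]} {a b : O[X] → ℕ}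
    (h : ∀ q ∈ L, ∃ c : ℂ, c ≠ 0 ∧ HasInit k q (a q) (b q) c) :
    ∃ c : ℂ, c ≠ 0 ∧ HasInit k L.prod (L.map a).sum (L.map b).sum c := by
  induction L with
  | nil => exact ⟨1, one_ne_zero, by simpa using hasInit_one hk⟩
  | cons q L ih =>
    obtain ⟨c, hc, hcq⟩ := h q List.mem_cons_self
    obtain ⟨d, hd, hdL⟩ := ih fun r hr => h r (List.mem_cons_of_mem _ hr)
    exact ⟨c * d, mul_ne_zero hc hd, by simpa using hcq.mul hdL⟩

theorem IsSingleSlope.coeff_eq_zero {q : O[X]} (hq : IsSingleSlope q) {i j : ℕ}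
    (h : q.natDegree * i + ordConst q * j < q.natDegree * ordConst q) :
    PowerSeries.coeff i (q.coeff j) = 0 := by
  by_cases hj : j ≤ q.natDegree
  · have h1 := hq.2.2.2 (q.natDegree - j) (Nat.sub_le _ _)
    rw [Nat.sub_sub_self hj] at h1
    refine PowerSeries.coeff_of_lt_order i ?_
    by_contra hlt
    rw [not_lt] at hlt
    have h2 : (((q.natDegree - j) * ordConst q : ℕ) : ℕ∞) ≤ (q.natDegree * i : ℕ) := by
      refine h1.trans ?_
      rw [Nat.cast_mul]
      exact mul_le_mul_right hlt _
    have h3 := Nat.cast_le.1 h2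
    have h4 : (q.natDegree - j) * ordConst q + ordConst q * j = q.natDegree * ordConst q := by
      rw [mul_comm (ordConst q) j, ← add_mul, Nat.sub_add_cancel hj]
    omega
  · rw [coeff_eq_zero_of_natDegree_lt (not_le.1 hj), map_zero]

/-- For `N / m > k` the weight `k` favours the end of the Newton segment at the constant term; all
other terms have larger weight. -/
theorem IsSingleSlope.hasInit_before {q : O[X]} (hq : IsSingleSlope q) {k : ℕ} (hk : 0 < k)
    (h : k * ordConst q < q.natDegree) :
    ∃ c : ℂ, c ≠ 0 ∧ HasInit k q (ordConst q) 0 c := by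
  refine ⟨PowerSeries.coeff (ordConst q) (q.coeff 0), PowerSeries.coeff_order hq.2.2.1, ?_⟩
  intro i j hij
  split_ifs with hc
  · rw [hc.1, hc.2]
  · refine hq.coeff_eq_zero ?_
    generalize q.natDegree = N, ordConst q = m at *
    rcases lt_or_ge i m with hi | hi
    · obtain ⟨e, rfl⟩ : ∃ e, m = i + (e + 1) := ⟨m - i - 1, by omega⟩
      have h1 : j ≤ k * (e + 1) := by
        have : k * (i + (e + 1)) = k * i + k * (e + 1) := mul_add _ _ _
        omega
      have h2 : (i + (e + 1)) * j ≤ (i + (e + 1)) * (k * (e + 1)) := Nat.mul_le_mul_left _ h1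
      have h3 : (k * (i + (e + 1))) * (e + 1) < N * (e + 1) := Nat.mul_lt_mul_of_pos_right h (by omega)
      nlinarith
    · have h1 : k * m ≤ k * i := Nat.mul_le_mul_left _ hi
      have h2 : i = m := Nat.eq_of_mul_eq_mul_left hk (by omega)
      exact absurd ⟨h2, by rw [h2] at hij; omega⟩ hc

/-- For `N / m < k` the leading term is the unique term of least weight. -/
theorem IsSingleSlope.hasInit_after {q : O[X]} (hq : IsSingleSlope q) {k : ℕ}
    (h : q.natDegree < k * ordConst q) :
    ∃ c : ℂ, c ≠ 0 ∧ HasInit k q 0 q.natDegree c := by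
  refine ⟨1, one_ne_zero, ?_⟩
  intro i j hij
  have hm : 0 < ordConst q := Nat.pos_of_ne_zero fun h0 => by rw [h0] at h; omega
  split_ifs with hc
  · rw [hc.1, hc.2, hq.1.coeff_natDegree]; simp
  · refine hq.coeff_eq_zero ?_
    generalize q.natDegree = N, ordConst q = m at *
    have h1 : m * (k * i + j) ≤ m * N := Nat.mul_le_mul_left _ (by omega)
    rcases Nat.eq_zero_or_pos i with rfl | hi
    · have h2 : j < N := by omega
      nlinarith
    · have h2 : N * i < k * m * i := Nat.mul_lt_mul_of_pos_right h hi
      nlinarith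

end InitialForm

/-! ### Comparing the graded polynomials of the product and of one factor. -/

section Graded

theorem balanced_card {N m : ℕ} (hm : 0 < m) : (balanced N m).card = m := by
  have := Nat.mod_lt N hm
  simp [balanced]; omega

theorem balanced_sum {N m : ℕ} (hm : 0 < m) : (balanced N m).sum = N := by
  have h1 := (Nat.mod_lt N hm).le
  simp only [balanced, Multiset.sum_add, Multiset.sum_replicate, smul_eq_mul]
  zify [h1]
  have h2 : (m : ℤ) * (N / m : ℕ) + (N % m : ℕ) = N := by exact_mod_cast Nat.div_add_mod N m
  push_cast at h2
  linear_combination h2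

theorem le_of_mem_balanced {N m k x : ℕ} (hm : 0 < m) (h : k * m ≤ N) (hx : x ∈ balanced N m) :
    k ≤ x := by
  have := (Nat.le_div_iff_mul_le hm).2 h
  rcases Multiset.mem_add.1 hx with hx | hx <;> have := Multiset.eq_of_mem_replicate hx <;> omega

theorem le_of_mem_balanced' {N m k x : ℕ} (hm : 0 < m) (h : N < k * m) (hx : x ∈ balanced N m) :
    x ≤ k := by
  have := (Nat.div_lt_iff_lt_mul hm).2 h
  rcases Multiset.mem_add.1 hx with hx | hx <;> have := Multiset.eq_of_mem_replicate hx <;> omega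

theorem card_filter_add_count {b : Multiset ℕ} {k : ℕ} (h : ∀ x ∈ b, k ≤ x) :
    (b.filter (k < ·)).card + b.count k = b.card ∧
      (b.filter (k < ·)).sum + k * b.count k = b.sum := by
  induction b using Multiset.induction_on with
  | empty => simp
  | cons x b ih =>
    obtain ⟨h1, h2⟩ := ih fun y hy => h y (Multiset.mem_cons_of_mem hy)
    rcases (h x (Multiset.mem_cons_self x b)).eq_or_lt with rfl | hlt
    · simp [mul_add]; omega
    · simp [hlt, Multiset.count_cons_of_ne hlt.ne]; omega

theorem mul_count_le_sum (b : Multiset ℕ) (k : ℕ) : k * b.count k ≤ b.sum := by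
  induction b using Multiset.induction_on with
  | empty => simp
  | cons x b ih =>
    by_cases hx : k = x
    · subst hx; simp [mul_add]; omega
    · simp [Multiset.count_cons_of_ne hx]; omega

theorem natDegree_list_prod_of_monic {L : List O[X]} (h : ∀ q ∈ L, q.Monic) :
    L.prod.natDegree = (L.map natDegree).sum := by
  have h1 := natDegree_multiset_prod_of_monic (L : Multiset O[X]) h
  simpa using h1

/-- The order of vanishing of a square at zero is even, so the power of `X` is itself a square and
can be cancelled; constants have square roots. -/
theorem isSquare_of_C_mul_X_pow_mul {g : ℂ[X]} {c : ℂ} (hc : c ≠ 0) {n : ℕ} (h0 : g.coeff 0 ≠ 0)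
    (h : IsSquare (C c * X ^ n * g)) : IsSquare g := by
  obtain ⟨r, hr⟩ := h
  have hg : g ≠ 0 := by rintro rfl; simp at h0
  have hr0 : r ≠ 0 := by
    rintro rfl
    rw [mul_zero] at hr
    exact mul_ne_zero (mul_ne_zero (C_ne_zero.2 hc) (pow_ne_zero _ X_ne_zero)) hg hr
  obtain ⟨e, r', hX, rfl⟩ : ∃ (e : ℕ) (r' : ℂ[X]), ¬ X ∣ r' ∧ r = X ^ e * r' := by
    obtain ⟨e, r', h1, h2⟩ := WfDvdMonoid.max_power_factor hr0 (irreducible_X (R := ℂ))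
    exact ⟨e, r', h1, h2⟩
  have hXg : ¬ X ∣ C c * g := by
    rw [X_dvd_iff, coeff_C_mul]
    exact mul_ne_zero hc h0
  have hXr : ¬ X ∣ r' * r' := fun hd => (prime_X.dvd_or_dvd hd).elim hX hX
  have h1 : X ^ n * (C c * g) = X ^ (2 * e) * (r' * r') := by
    linear_combination hr
  have h2 : n = 2 * e := by
    rcases lt_trichotomy n (2 * e) with hlt | heq | hlt
    · obtain ⟨d, hd⟩ := Nat.exists_eq_add_of_lt hlt
      rw [hd, add_assoc, pow_add, mul_assoc] at h1
      have h3 := mul_left_cancel₀ (pow_ne_zero n X_ne_zero) h1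
      exact absurd ⟨X ^ d * (r' * r'), by rw [h3]; ring⟩ hXg
    · exact heq
    · obtain ⟨d, hd⟩ := Nat.exists_eq_add_of_lt hlt
      rw [hd, add_assoc, pow_add, mul_assoc] at h1
      have h3 := mul_left_cancel₀ (pow_ne_zero (2 * e) X_ne_zero) h1
      exact absurd ⟨X ^ d * (C c * g), by rw [← h3]; ring⟩ hXr
  rw [h2] at h1
  have h3 := mul_left_cancel₀ (pow_ne_zero (2 * e) X_ne_zero) h1
  obtain ⟨z, hz⟩ := IsAlgClosed.exists_pow_nat_eq c⁻¹ (n := 2) (by norm_num)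
  refine ⟨C z * r', ?_⟩
  have h4 : C c⁻¹ * C c = (1 : ℂ[X]) := by rw [← C_mul, inv_mul_cancel₀ hc, C_1]
  have h5 : (C z * C z : ℂ[X]) = C c⁻¹ := by rw [← C_mul, ← hz, sq]
  linear_combination C c⁻¹ * h3 - g * h4 - r' * r' * h5

/-- If the graded polynomial of the product is a square then so is that of the factor. -/
theorem squareOwn_of_squareWhole {L : List O[X]} (hL : ∀ p ∈ L, IsSingleSlope p)
    (hsl : L.Pairwise fun p q => q.natDegree * ordConst p < p.natDegree * ordConst q)
    (hord : ∀ p ∈ L, 0 < ordConst p) {p : O[X]} (hp : p ∈ L)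
    (hmod : p.natDegree % ordConst p = 0) (heven : Even (p.natDegree / ordConst p))
    (h : squareWhole L p) : squareOwn p := by
  obtain ⟨L₁, L₂, rfl⟩ := List.append_of_mem hp
  have hps := hL p hp
  have hm := hord p hp
  obtain ⟨k, hk⟩ := Nat.dvd_of_mod_eq_zero hmod
  have hkd : p.natDegree / ordConst p = k := by rw [hk, Nat.mul_div_cancel_left _ hm]
  have hk0 : 0 < k := Nat.pos_of_ne_zero fun h0 => by
    have := hps.2.1
    rw [hk, h0] at this
    omega
  -- Here evenness of `k` enters: the additional part `1` of the collection is smaller than `k` and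
  -- does not affect the graded polynomial.
  have hk2 : 1 < k := by
    rw [hkd] at heven
    obtain ⟨r, hr⟩ := heven
    omega
  rw [squareWhole, hkd] at h
  rw [squareOwn, gr_balanced hm hk]
  rw [List.pairwise_append] at hsl
  have hbef : ∀ q ∈ L₁, k * ordConst q < q.natDegree := by
    intro q hq
    have h1 := hsl.2.2 q hq p List.mem_cons_self
    rw [hk, mul_assoc, mul_comm q.natDegree] at h1
    exact lt_of_mul_lt_mul_left h1 (Nat.zero_le _)
  have haft : ∀ q ∈ L₂, q.natDegree < k * ordConst q := by
    intro q hq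
    have h1 := (List.pairwise_cons.1 hsl.2.1).1 q hq
    rw [hk, mul_assoc, mul_comm q.natDegree] at h1
    exact lt_of_mul_lt_mul_left h1 (Nat.zero_le _)
  have hL₁ : ∀ q ∈ L₁, IsSingleSlope q ∧ 0 < ordConst q := fun q hq =>
    ⟨hL q (by simp [hq]), hord q (by simp [hq])⟩
  have hL₂ : ∀ q ∈ L₂, IsSingleSlope q ∧ 0 < ordConst q := fun q hq =>
    ⟨hL q (by simp [hq]), hord q (by simp [hq])⟩
  obtain ⟨c₁, hc₁, hi₁⟩ := hasInit_prod (a := ordConst) (b := fun _ => 0) hk0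
    fun q hq => (hL₁ q hq).1.hasInit_before hk0 (hbef q hq)
  obtain ⟨c₂, hc₂, hi₂⟩ := hasInit_prod (a := fun _ => 0) (b := natDegree) hk0
    fun q hq => (hL₂ q hq).1.hasInit_after (haft q hq)
  have hinit := hi₁.mul hi₂
  simp only [List.map_const', List.sum_replicate, smul_zero, add_zero, zero_add] at hinit
  set M := (L₁.map ordConst).sum with hM
  set M' := (L₂.map natDegree).sum with hM'
  set S := (L₁.map natDegree).sum with hS
  have hdeg : (L₁ ++ p :: L₂).prod.natDegree = S + (p.natDegree + M') := by
    rw [natDegree_list_prod_of_monic fun q hq => (hL q hq).1]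
    simp [hS, hM']
  let bal : List O[X] → Multiset ℕ := fun L => (L.map fun q => balanced q.natDegree (ordConst q)).sum
  have hbal : ∀ (L : List O[X]), (∀ q ∈ L, 0 < ordConst q) →
      (bal L).card = (L.map ordConst).sum ∧ (bal L).sum = (L.map natDegree).sum := by
    intro L
    induction L with
    | nil => intro _; simp [bal]
    | cons q L ih =>
      intro h
      obtain ⟨h1, h2⟩ := ih fun r hr => h r (List.mem_cons_of_mem _ hr)
      simp only [bal, List.map_cons, List.sum_cons, Multiset.card_add, Multiset.sum_add] at h1 h2 ⊢
      rw [h1, h2, balanced_card (h q List.mem_cons_self), balanced_sum (h q List.mem_cons_self)]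
      exact ⟨rfl, rfl⟩
  have hmem : ∀ (L : List O[X]) (x : ℕ), x ∈ bal L →
      ∃ q ∈ L, x ∈ balanced q.natDegree (ordConst q) := by
    intro L x
    induction L with
    | nil => intro h; simp [bal] at h
    | cons q L ih =>
      intro h
      simp only [bal, List.map_cons, List.sum_cons, Multiset.mem_add] at h ih
      rcases h with h | h
      · exact ⟨q, List.mem_cons_self, h⟩
      · obtain ⟨r, hr, hxr⟩ := ih h
        exact ⟨r, List.mem_cons_of_mem _ hr, hxr⟩
  have hrep : balanced p.natDegree (ordConst p) = Multiset.replicate (ordConst p) k := by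
    rw [balanced, hkd, hmod]; simp
  have hdA : dA (L₁ ++ p :: L₂) = bal L₁ + Multiset.replicate (ordConst p) k + bal L₂ + {1} := by
    simp [dA, bal, hrep, add_assoc]
  obtain ⟨hb₁, hb₁'⟩ := hbal L₁ fun q hq => (hL₁ q hq).2
  obtain ⟨hb₂, hb₂'⟩ := hbal L₂ fun q hq => (hL₂ q hq).2
  obtain ⟨hf₁, hf₁'⟩ := card_filter_add_count (b := bal L₁) (k := k) fun x hx => by
    obtain ⟨q, hq, hxq⟩ := hmem L₁ x hx
    exact le_of_mem_balanced (hL₁ q hq).2 (hbef q hq).le hxq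
  have hf₂ : (bal L₂).filter (k < ·) = 0 := by
    rw [Multiset.filter_eq_nil]
    intro x hx
    obtain ⟨q, hq, hxq⟩ := hmem L₂ x hx
    exact (le_of_mem_balanced' (hL₂ q hq).2 (haft q hq) hxq).not_gt
  have hf₂' := mul_count_le_sum (bal L₂) k
  rw [hb₂', ← hM'] at hf₂'
  rw [hb₁, ← hM] at hf₁
  rw [hb₁', ← hS] at hf₁'
  set C₁ := (bal L₁).count k
  set C₂ := (bal L₂).count k
  set p₀ := ((bal L₁).filter (k < ·)).card
  set s₀ := ((bal L₁).filter (k < ·)).sum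
  have hfr : (Multiset.replicate (ordConst p) k).filter (k < ·) = 0 :=
    Multiset.filter_eq_nil.2 fun x hx => by
      rw [Multiset.eq_of_mem_replicate hx]; exact lt_irrefl _
  have hfil : (dA (L₁ ++ p :: L₂)).filter (k < ·) = (bal L₁).filter (k < ·) := by
    rw [hdA, Multiset.filter_add, Multiset.filter_add, Multiset.filter_add, hf₂,
      hfr, Multiset.filter_singleton, if_neg hk2.not_gt]
    simp
  have hcount : (dA (L₁ ++ p :: L₂)).count k = C₁ + ordConst p + C₂ := by
    rw [hdA, Multiset.count_add, Multiset.count_add, Multiset.count_add,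
      Multiset.count_replicate_self, Multiset.count_singleton, if_neg hk2.ne']
    rfl
  have hprod : (L₁ ++ p :: L₂).prod = L₁.prod * L₂.prod * p := by
    rw [List.prod_append, List.prod_cons]; ring
  -- The earlier factors have initial form a multiple of a power of `t`, the later ones a power of
  -- `λ`, so in the relevant weight only `p` varies. Parts `k` contributed by neighbouring factors,
  -- `C₁` and `C₂` in number, shift the range of `α` and produce the factor `X^C₂`.
  have hgr : gr (dA (L₁ ++ p :: L₂)) k (L₁ ++ p :: L₂).prod =
      C (c₁ * c₂) * X ^ C₂ * grSlope k p := by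
    rw [gr, hfil, hcount, hdeg, hprod, grSlope, Finset.mul_sum]
    change ∑ α ∈ Finset.range (C₁ + ordConst p + C₂ + 1), C (PowerSeries.coeff (p₀ + α)
      ((L₁.prod * L₂.prod * p).coeff (S + (p.natDegree + M') - (s₀ + α * k)))) *
        X ^ (C₁ + ordConst p + C₂ - α) = _
    set m := ordConst p
    have hcoef : ∀ α ≤ C₁ + m + C₂, PowerSeries.coeff (p₀ + α)
        ((L₁.prod * L₂.prod * p).coeff (S + (p.natDegree + M') - (s₀ + α * k))) =
        if C₁ ≤ α ∧ α ≤ C₁ + m then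
          c₁ * c₂ * PowerSeries.coeff (α - C₁) (p.coeff (p.natDegree - (α - C₁) * k)) else 0 := by
      intro α hα
      have e1 : α * k ≤ k * C₁ + p.natDegree + k * C₂ := by
        rw [hk]; nlinarith
      have e2 : k * (p₀ + α) = k * p₀ + α * k := by ring
      have e3 : k * M = k * p₀ + k * C₁ := by rw [← hf₁]; ring
      rw [hinit.coeff_mul (w := p.natDegree) (fun i j hij => hps.coeff_eq_zero ?_) (by omega)]
      · rcases lt_or_ge α C₁ with h1 | h1
        · rw [if_neg (by omega), if_neg (by omega)]
        · have e4 : α * k = k * C₁ + (α - C₁) * k := by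
            rw [mul_comm k, ← add_mul]; congr 1; omega
          rcases le_or_gt α (C₁ + m) with h2 | h2
          · have e5 : (α - C₁) * k ≤ p.natDegree := by
              rw [hk]; exact Nat.mul_le_mul_right _ (by omega)
            rw [if_pos (by omega), if_pos ⟨h1, h2⟩]
            congr 3
            · omega
            · omega
          · have e5 : p.natDegree < (α - C₁) * k := by
              rw [hk]; exact Nat.mul_lt_mul_of_pos_right (by omega) hk0
            rw [if_neg (by omega), if_neg (by omega)]
      · rw [hk] at hij ⊢
        change ordConst p * k * i + ordConst p * j < _ * ordConst p
        rw [mul_assoc, ← mul_add, mul_comm _ (ordConst p)]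
        exact Nat.mul_lt_mul_of_pos_left hij hm
    rw [Finset.sum_congr rfl fun α hα => by
      rw [hcoef α (Nat.lt_succ_iff.1 (Finset.mem_range.1 hα))]]
    symm
    refine Finset.sum_of_injOn (fun β => C₁ + β) (fun a _ b _ hab => Nat.add_left_cancel hab)
      ?_ ?_ ?_
    · intro β hβ
      simp only [Finset.coe_range, Set.mem_Iio] at hβ ⊢
      omega
    · intro α hα hn
      rw [if_neg, C_0, zero_mul]
      rintro ⟨h1, h2⟩
      refine hn ⟨α - C₁, ?_, ?_⟩
      · simp only [Finset.coe_range, Set.mem_Iio]; omega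
      · change C₁ + (α - C₁) = α; omega
    · intro β hβ
      have hβ' : β ≤ m := Nat.lt_succ_iff.1 (Finset.mem_range.1 hβ)
      rw [if_pos ⟨Nat.le_add_right _ _, by omega⟩, Nat.add_sub_cancel_left,
        show C₁ + m + C₂ - (C₁ + β) = C₂ + (m - β) by omega, C_mul (b := PowerSeries.coeff _ _), pow_add]
      ring
  rw [hgr] at h
  exact isSquare_of_C_mul_X_pow_mul (mul_ne_zero hc₁ hc₂) (grSlope_coeff_zero hps.2.2.1 hk) h

end Graded

/-! ### Topological nilpotence makes all the orders positive. -/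

section Nilpotent

variable {F : Type*} [Field F] [Algebra O F] [IsFractionRing O F]
variable {V : Type*} [AddCommGroup V] [Module F V] [Module O V] [IsScalarTower O F V]

/-- Krull's intersection theorem for the finitely generated module `A`. -/
theorem eq_zero_of_forall_mem_tS_pow {A : Submodule O V} (hA : A.FG) {u : V}
    (hu : ∀ e, u ∈ act (tEnd F V ^ e) A) : u = 0 := by
  have hfin : Module.Finite O A := Module.Finite.iff_fg.2 hA
  have huA : u ∈ A := tS_pow_le A 0 (hu 0)
  have h1 : (⟨u, huA⟩ : A) ∈ (⨅ e : ℕ, IsLocalRing.maximalIdeal O ^ e • (⊤ : Submodule O A)) := by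
    refine Submodule.mem_iInf _ |>.2 fun e => ?_
    obtain ⟨z, hz, hzu⟩ := hu e
    have h2 : (⟨u, huA⟩ : A) = (PowerSeries.X : O) ^ e • ⟨z, hz⟩ := by
      refine Subtype.ext ?_
      change u = (PowerSeries.X : O) ^ e • z
      rw [← hzu]
      change (tEnd F V ^ e) z = _
      rw [tEnd_pow_apply, τ, ← map_pow, algebraMap_smul]
    rw [h2]
    refine Submodule.smul_mem_smul (Ideal.pow_mem_pow ?_ e) trivial
    rw [IsLocalRing.mem_maximalIdeal, mem_nonunits_iff]
    exact PowerSeries.X_irreducible.not_isUnit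
  rw [Ideal.iInf_pow_smul_eq_bot_of_isLocalRing _ Ideal.IsPrime.ne_top'] at h1
  exact congrArg Subtype.val ((Submodule.mem_bot O).1 h1)

/-- A polynomial that kills a non-zero vector of a topologically nilpotent endomorphism has a
constant term in the maximal ideal. -/
theorem not_isUnit_coeff_zero {γ : Module.End F V} {A : Submodule O V}
    (hA : IsLat (⊤ : Submodule F V) A)
    (hγ : ∀ e, ∃ k, act (γ ^ k) A ≤ act (tEnd F V ^ e) A) {p : O[X]} (hp : p.Monic) {w : V}
    (hw : w ≠ 0) (h0 : aeval γ (p.map (algebraMap O F)) w = 0) : ¬ IsUnit (p.coeff 0) := by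
  rintro ⟨u, hu⟩
  let ev : O[X] →ₗ[O] V :=
    { toFun := fun q => aeval γ (q.map (algebraMap O F)) w
      map_add' := fun q r => by simp
      map_smul' := fun a q => by
        simp only [Polynomial.map_smul, RingHom.id_apply]
        rw [map_smul, LinearMap.smul_apply, algebraMap_smul] }
  have hev : ∀ q, ev q = aeval γ (q.map (algebraMap O F)) w := fun q => rfl
  have hmul : ∀ q r, ev (q * r) = aeval γ (q.map (algebraMap O F)) (ev r) := fun q r => by
    rw [hev, hev, Polynomial.map_mul, map_mul, Module.End.mul_apply]
  have hevp : ∀ q, ev (p * q) = 0 := fun q => by rw [mul_comm, hmul, hev, h0, map_zero]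
  set W := (degreeLT O p.natDegree).map ev with hW
  have hWfg : W.FG := by
    refine Submodule.FG.map ev ?_
    classical
    rw [degreeLT_eq_span_X_pow]
    exact Submodule.fg_span (Finset.finite_toSet _)
  have hmem : ∀ q, ev q ∈ W := by
    intro q
    refine ⟨q %ₘ p, mem_degreeLT.2 ?_, ?_⟩
    · rw [← degree_eq_natDegree hp.ne_zero]
      exact degree_modByMonic_lt _ hp
    · conv_rhs => rw [← modByMonic_add_div q p, map_add, hevp, add_zero]
  obtain ⟨c, hc⟩ := hA.exists_tS_pow_le hWfg (fun x _ => trivial)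
  -- If `p(0)` is a unit, `b` is an inverse of `X` modulo `p`, so `w = γ^k b(γ)^k w` for all `k`.
  -- The vectors `b(γ)^k w` stay in one finitely generated module while `γ^k` tends to zero, so a
  -- multiple `t^c w` is infinitely divisible by `t`.
  let b : O[X] := C (-(↑u⁻¹ : O)) * divX p
  have hb : ∀ q, ev q = ev (X * b * q) := by
    intro q
    have h1 : X * b * q = q - p * (C (↑u⁻¹ : O) * q) := by
      have h2 := divX_mul_X_add p
      rw [← hu] at h2
      have h3 : C (↑u⁻¹ : O) * C (↑u : O) = 1 := by rw [← C_mul, u.inv_mul, C_1]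
      rw [← h2]
      simp only [b, C_neg]
      linear_combination q * h3
    rw [h1, map_sub, hevp, sub_zero]
  have hpow : ∀ k q, ev q = (γ ^ k) (ev (b ^ k * q)) := by
    intro k
    induction k with
    | zero => intro q; simp
    | succ k ih =>
      intro q
      rw [ih q, hb (b ^ k * q), show X * b * (b ^ k * q) = X * (b ^ (k + 1) * q) by ring, hmul X,
        map_X, aeval_X, pow_succ γ, Module.End.mul_apply]
  have hw1 : ev 1 = w := by simp [hev]
  have h2 : (tEnd F V ^ c) w = 0 := by
    refine eq_zero_of_forall_mem_tS_pow (F := F) hA.fg fun e => ?_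
    obtain ⟨k, hk⟩ := hγ e
    refine hk ?_
    rw [← hw1, hpow k, ← Module.End.mul_apply, ((commute_tEnd (F := F) (γ ^ k)).pow_left c).eq,
      Module.End.mul_apply]
    exact mem_act_of_mem (φ := γ ^ k) (hc (mem_act_of_mem (φ := tEnd F V ^ c) (hmem _)))
  exact hw (tEnd_pow_injective c (h2.trans (map_zero _).symm))

theorem IsSingleSlope.not_isUnit_coeff_zero_iff {p : O[X]} (hp : IsSingleSlope p) :
    ¬ IsUnit (p.coeff 0) ↔ 0 < ordConst p := by
  rw [ordConst, Nat.pos_iff_ne_zero, Ne, ENat.toNat_eq_zero, not_or]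
  have h1 : (p.coeff 0).order ≠ ⊤ := fun h => hp.2.2.1 (PowerSeries.order_eq_top.1 h)
  rw [PowerSeries.isUnit_iff_constantCoeff, isUnit_iff_ne_zero, not_not]
  constructor
  · intro h
    exact ⟨PowerSeries.order_ne_zero_iff_constCoeff_eq_zero.2 h, h1⟩
  · intro h
    exact PowerSeries.order_ne_zero_iff_constCoeff_eq_zero.1 h.1

theorem ordConst_prod {L : List O[X]} (hL : ∀ p ∈ L, IsSingleSlope p) :
    ordConst L.prod = sumOrd L := by
  induction L with
  | nil => simp [ordConst, sumOrd]
  | cons p L ih =>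
    have h0 : (L.prod.coeff 0).order ≠ ⊤ := fun h => by
      have h1 := coeff_zero_prod_ne_zero (F := K) (L := L) fun q hq => hL q (List.mem_cons_of_mem _ hq)
      rw [coeff_map, PowerSeries.order_eq_top.1 h, map_zero] at h1
      exact h1 rfl
    have h1 : (p.coeff 0).order ≠ ⊤ :=
      fun h => (hL p List.mem_cons_self).2.2.1 (PowerSeries.order_eq_top.1 h)
    rw [sumOrd_cons, ← ih fun q hq => hL q (List.mem_cons_of_mem _ hq), List.prod_cons, ordConst,
      mul_coeff_zero, PowerSeries.order_mul, ENat.toNat_add h1 h0]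
    rfl

end Nilpotent

/-! ### Jordan types from the ranks of powers. -/

section Jordan

/-- The powers are listed in reverse so that multiplication by `X` lowers the index, as the chain
convention demands. -/
theorem exists_basis_quotient_X_pow (k : ℕ) :
    ∃ c : Module.Basis (Fin k) ℂ (ℂ[X] ⧸ (Submodule.span ℂ[X] {(X : ℂ[X]) ^ k})),
      ∀ i : Fin k, c i = Submodule.Quotient.mk (X ^ (k - 1 - i)) := by
  have hm : ((X : ℂ[X]) ^ k).Monic := monic_X_pow k
  let e : Fin ((X : ℂ[X]) ^ k).natDegree ≃ Fin k := finCongr (natDegree_X_pow k)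
  let c₀ : Module.Basis (Fin ((X : ℂ[X]) ^ k).natDegree) ℂ (AdjoinRoot ((X : ℂ[X]) ^ k)) :=
    (AdjoinRoot.powerBasis' hm).basis
  have hc₀ : ∀ i, c₀ i = AdjoinRoot.mk _ (X ^ (i : ℕ)) := by
    intro i
    rw [map_pow, AdjoinRoot.mk_X]
    exact (AdjoinRoot.powerBasis' hm).basis_eq_pow i
  refine ⟨(c₀.reindex e).reindex Fin.revPerm, fun i => ?_⟩
  have h1 : ((e.symm (Fin.revPerm.symm i) : Fin _) : ℕ) = k - 1 - i := by
    simp [e, Fin.val_rev]; omega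
  have h2 : (c₀.reindex e).reindex Fin.revPerm i = AdjoinRoot.mk _ (X ^ (k - 1 - i : ℕ)) := by
    rw [Module.Basis.reindex_apply, Module.Basis.reindex_apply, hc₀, h1]
  exact h2

variable {W : Type*} [AddCommGroup W] [Module ℂ W]

/-- A basis made of chains for a nilpotent endomorphism. -/
structure IsChainBasis (φ : Module.End ℂ W) {r : ℕ} {s : Fin r → ℕ}
    (b : Module.Basis (Σ i : Fin r, Fin (s i)) ℂ W) : Prop where
  zero : ∀ (i : Fin r) (h : 0 < s i), φ (b ⟨i, ⟨0, h⟩⟩) = 0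
  succ : ∀ (i : Fin r) (j : ℕ) (h : j + 1 < s i),
    φ (b ⟨i, ⟨j + 1, h⟩⟩) = b ⟨i, ⟨j, Nat.lt_of_succ_lt h⟩⟩

/-- The structure theorem for torsion modules over `ℂ[X]`, applied to the module on which `X` acts
as `φ`; nilpotence makes every summand a quotient by a power of `X`. -/
theorem exists_chainBasis [FiniteDimensional ℂ W] {φ : Module.End ℂ W} (hφ : IsNilpotent φ) :
    ∃ (r : ℕ) (s : Fin r → ℕ) (b : Module.Basis (Σ i : Fin r, Fin (s i)) ℂ W),
      IsChainBasis φ b := by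
  obtain ⟨n, hn⟩ := hφ
  have htor : Module.IsTorsion' (Module.AEval' φ) (Submonoid.powers (X : ℂ[X])) := by
    intro x
    refine ⟨⟨X ^ n, n, rfl⟩, ?_⟩
    obtain ⟨y, rfl⟩ := (Module.AEval'.of φ).surjective x
    change (X ^ n : ℂ[X]) • Module.AEval'.of φ y = 0
    rw [Module.AEval'.X_pow_smul_of, hn, zero_smul, map_zero]
  obtain ⟨r, s, ⟨e⟩⟩ := Module.torsion_by_prime_power_decomposition (irreducible_X (R := ℂ)) htor
  choose c hc using fun i => exists_basis_quotient_X_pow (s i)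
  let E := e.trans (DirectSum.linearEquivFunOnFintype ℂ[X] (Fin r) _)
  let E' := (Module.AEval'.of φ).trans (E.restrictScalars ℂ)
  have hE : ∀ i (z : ℂ[X] ⧸ (Submodule.span ℂ[X] {(X : ℂ[X]) ^ s i})),
      φ (E'.symm (Pi.single i z)) = E'.symm (Pi.single i ((X : ℂ[X]) • z)) := by
    intro i z
    rw [LinearEquiv.eq_symm_apply, Pi.single_smul]
    change E (Module.AEval'.of φ (φ (E'.symm (Pi.single i z)))) = _
    rw [← Module.AEval'.X_smul_of, map_smul]
    congr 1
    exact E'.apply_symm_apply _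
  refine ⟨r, s, (Pi.basis c).map E'.symm, ⟨fun i h => ?_, fun i j h => ?_⟩⟩
  · rw [Module.Basis.map_apply, Pi.basis_apply, hE, hc, ← Submodule.Quotient.mk_smul, smul_eq_mul,
      ← pow_succ', (Submodule.Quotient.mk_eq_zero _).2, Pi.single_zero, map_zero]
    have : s i - 1 - ((⟨0, h⟩ : Fin (s i)) : ℕ) + 1 = s i := by simp; omega
    rw [this]
    exact Submodule.mem_span_singleton_self _
  · rw [Module.Basis.map_apply, Module.Basis.map_apply, Pi.basis_apply, Pi.basis_apply, hE, hc, hc,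
      ← Submodule.Quotient.mk_smul, smul_eq_mul, ← pow_succ']
    have : s i - 1 - ((⟨j + 1, h⟩ : Fin (s i)) : ℕ) + 1 =
      s i - 1 - ((⟨j, Nat.lt_of_succ_lt h⟩ : Fin (s i)) : ℕ) := by simp; omega
    rw [this]

variable {φ : Module.End ℂ W} {r : ℕ} {s : Fin r → ℕ}
  {b : Module.Basis (Σ i : Fin r, Fin (s i)) ℂ W}

theorem IsChainBasis.pow_add (h : IsChainBasis φ b) (i : Fin r) (j a : ℕ) (ha : a + j < s i) :
    (φ ^ j) (b ⟨i, ⟨a + j, ha⟩⟩) = b ⟨i, ⟨a, by omega⟩⟩ := by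
  induction j with
  | zero => rfl
  | succ j ih =>
    rw [pow_succ, Module.End.mul_apply]
    exact (congrArg (φ ^ j) (h.succ i (a + j) ha)).trans (ih _)

theorem IsChainBasis.pow_of_lt (h : IsChainBasis φ b) (i : Fin r) (j a : ℕ) (ha : a < s i)
    (hj : a < j) : (φ ^ j) (b ⟨i, ⟨a, ha⟩⟩) = 0 := by
  obtain ⟨e, rfl⟩ := Nat.exists_eq_add_of_lt hj
  have h1 := h.pow_add i a 0 (by omega)
  simp only [zero_add] at h1
  rw [show a + e + 1 = (e + 1) + a by omega, _root_.pow_add, Module.End.mul_apply, h1, pow_succ,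
    Module.End.mul_apply, h.zero, map_zero]

theorem IsChainBasis.finrank_range_pow (h : IsChainBasis φ b) (j : ℕ) :
    Module.finrank ℂ (LinearMap.range (φ ^ j)) = ∑ i, (s i - j) := by
  let u : (Σ i : Fin r, Fin (s i - j)) → W := fun x => b ⟨x.1, ⟨x.2, by omega⟩⟩
  have hu : LinearIndependent ℂ u := by
    refine b.linearIndependent.comp
      (fun x : (Σ i : Fin r, Fin (s i - j)) => ⟨x.1, ⟨x.2, by omega⟩⟩) ?_
    rintro ⟨i, a⟩ ⟨i', a'⟩ hx
    obtain ⟨rfl, h2⟩ := Sigma.mk.inj_iff.1 hx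
    simp only [heq_eq_eq, Fin.mk.injEq] at h2
    rw [Fin.ext h2]
  have hr : LinearMap.range (φ ^ j) = Submodule.span ℂ (Set.range u) := by
    rw [LinearMap.range_eq_map, ← b.span_eq, Submodule.map_span, ← Set.range_comp]
    apply le_antisymm
    · rw [Submodule.span_le]
      rintro _ ⟨⟨i, ⟨a, ha⟩⟩, rfl⟩
      rcases lt_or_ge a j with hj | hj
      · rw [Function.comp_apply, h.pow_of_lt i j a ha hj]
        exact Submodule.zero_mem _
      · obtain ⟨a, rfl⟩ := Nat.exists_eq_add_of_le' hj
        rw [Function.comp_apply, h.pow_add i j a ha]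
        exact Submodule.subset_span ⟨⟨i, ⟨a, by omega⟩⟩, rfl⟩
    · rw [Submodule.span_le]
      rintro _ ⟨⟨i, a⟩, rfl⟩
      have ha : (a : ℕ) + j < s i := by omega
      exact Submodule.subset_span ⟨⟨i, ⟨a + j, ha⟩⟩, h.pow_add i j a ha⟩
  rw [hr, finrank_span_eq_card hu]
  simp

/-- The blocks of length zero may be removed. -/
theorem IsChainBasis.exists_pos (h : IsChainBasis φ b) :
    ∃ (r' : ℕ) (s' : Fin r' → ℕ) (b' : Module.Basis (Σ i : Fin r', Fin (s' i)) ℂ W),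
      IsChainBasis φ b' ∧ ∀ i, 0 < s' i := by
  let ε := (Fintype.equivFin {i : Fin r // 0 < s i}).symm
  let g : (Σ i, Fin (s (ε i))) → Σ i : Fin r, Fin (s i) := fun x => ⟨ε x.1, x.2⟩
  have hg : Function.Bijective g := by
    constructor
    · rintro ⟨i, a⟩ ⟨i', a'⟩ hx
      obtain ⟨h1, h2⟩ := Sigma.mk.inj_iff.1 hx
      obtain rfl := ε.injective (Subtype.ext h1)
      obtain rfl : a = a' := eq_of_heq h2
      rfl
    · rintro ⟨i, a⟩
      obtain ⟨i', hi'⟩ := ε.surjective ⟨i, a.pos⟩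
      have h1 : ((ε i' : {i : Fin r // 0 < s i}) : Fin r) = i := by rw [hi']
      subst h1
      exact ⟨⟨i', a⟩, rfl⟩
  have hb : ∀ x, b.reindex (Equiv.ofBijective g hg).symm x = b (g x) := fun x => by
    rw [Module.Basis.reindex_apply, Equiv.symm_symm]; rfl
  refine ⟨_, fun i => s (ε i), b.reindex (Equiv.ofBijective g hg).symm, ⟨fun i hi => ?_,
    fun i j hj => ?_⟩, fun i => (ε i).2⟩
  · rw [hb]; exact h.zero _ hi
  · rw [hb, hb]; exact h.succ _ j hj

/-- Multiplicities of parts are second differences of the column sums, so ranks of powers determine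
the partition up to parts equal to zero. -/
theorem partSum_second_difference (d : Multiset ℕ) (j : ℕ) :
    partSum d j + partSum d (j + 2) = 2 * partSum d (j + 1) + d.count (j + 1) := by
  induction d using Multiset.induction_on with
  | empty => rfl
  | cons x d ih =>
    rw [← Multiset.singleton_add, partSum_add, partSum_add, partSum_add, partSum_singleton,
      partSum_singleton, partSum_singleton, Multiset.count_add, Multiset.count_singleton]
    split_ifs <;> omega

/-- The ranks of the powers determine the Jordan type. -/
theorem hasJordanType_of_finrank {N : ℕ} {A : Matrix (Fin N) (Fin N) ℂ} {d : Multiset ℕ}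
    (h : ∀ j, Module.finrank ℂ (LinearMap.range (Matrix.toLin' A ^ j)) = partSum d j) :
    HasJordanType A (d.filter (0 < ·)) := by
  have hnil : IsNilpotent (Matrix.toLin' A) := by
    refine ⟨d.sum, ?_⟩
    have h1 := h d.sum
    have h2 : partSum d d.sum = 0 := by
      rw [partSum, Multiset.sum_eq_zero_iff]
      intro x hx
      obtain ⟨y, hy, rfl⟩ := Multiset.mem_map.1 hx
      exact Nat.sub_eq_zero_of_le (Multiset.single_le_sum (fun _ _ => Nat.zero_le _) y hy)
    rw [h2, Submodule.finrank_eq_zero, LinearMap.range_eq_bot] at h1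
    exact h1
  obtain ⟨_, _, _, hb₀⟩ := exists_chainBasis hnil
  obtain ⟨r, s, b, hb, hs⟩ := hb₀.exists_pos
  refine ⟨r, s, b, hs, ?_, fun i hi => ?_, fun i j hj => ?_⟩
  · have hsum : ∀ j, partSum d j = partSum (Finset.univ.val.map s) j := by
      intro j
      rw [← h, hb.finrank_range_pow, partSum, Multiset.map_map]
      rfl
    ext a
    rcases Nat.eq_zero_or_pos a with rfl | ha
    · rw [Multiset.count_eq_zero_of_notMem, Multiset.count_eq_zero_of_notMem]
      · intro h0
        obtain ⟨i, -, hi⟩ := Multiset.mem_map.1 h0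
        exact (hs i).ne' hi
      · simp
    · obtain ⟨j, rfl⟩ := Nat.exists_eq_add_of_lt ha
      rw [zero_add, Multiset.count_filter_of_pos (show 0 < j + 1 by omega)]
      have h1 := partSum_second_difference d j
      have h2 := partSum_second_difference (Finset.univ.val.map s) j
      rw [← hsum, ← hsum, ← hsum] at h2
      omega
  · rw [← Matrix.toLin'_apply]; exact hb.zero i hi
  · rw [← Matrix.toLin'_apply]; exact hb.succ i j hj

end Jordan

/-! ### Unimodular symmetric matrices, and reduction modulo `t` of lattices. -/

section Matrices

variable {N : ℕ}

theorem transpose_aeval {R n : Type*} [CommRing R] [Fintype n] [DecidableEq n] (G : Matrix n n R)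
    (p : R[X]) : (aeval G p).transpose = aeval G.transpose p := by
  simp [aeval_eq_sum_range, Matrix.transpose_sum, Matrix.transpose_smul, Matrix.transpose_pow]

/-- A symmetric unimodular matrix over `𝒪` is equivalent to the identity. -/
theorem exists_transpose_mul_self {G : Matrix (Fin N) (Fin N) O} (hs : G.IsSymm)
    (hG : IsUnit G.det) : ∃ w : Matrix (Fin N) (Fin N) O, w.transpose * w = G := by
  have hm := G.charpoly_monic
  have : Module.Finite O (AdjoinRoot G.charpoly) := hm.finite_adjoinRoot
  have : Module.Free O (AdjoinRoot G.charpoly) := hm.free_adjoinRoot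
  have h0 : IsUnit (G.charpoly.coeff 0) := by
    rw [Matrix.det_eq_sign_charpoly_coeff] at hG
    exact isUnit_of_mul_isUnit_right hG
  -- The constant term of the characteristic polynomial is the determinant up to sign, so the class
  -- of `X` is a unit. Its square root yields a polynomial `h` with `h(G)² = G`, and `h(G)` is
  -- symmetric with `G`.
  have hu : IsUnit (AdjoinRoot.root G.charpoly) := by
    have h1 := congrArg (AdjoinRoot.mk G.charpoly) (divX_mul_X_add G.charpoly)
    rw [AdjoinRoot.mk_self, map_add, map_mul, AdjoinRoot.mk_X, AdjoinRoot.mk_C] at h1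
    have h2 := h0.map (AdjoinRoot.of G.charpoly)
    rw [← neg_eq_of_add_eq_zero_right h1, IsUnit.neg_iff] at h2
    exact isUnit_of_mul_isUnit_right h2
  obtain ⟨s, hs'⟩ := isSquare_of_isUnit hu
  obtain ⟨h, rfl⟩ := AdjoinRoot.mk_surjective s
  rw [← AdjoinRoot.mk_X, ← map_mul, AdjoinRoot.mk_eq_mk] at hs'
  obtain ⟨r, hr⟩ := hs'
  have h3 := congrArg (aeval G) hr
  rw [map_sub, map_mul, map_mul, aeval_X, Matrix.aeval_self_charpoly, zero_mul, sub_eq_zero] at h3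
  exact ⟨aeval G h, by rw [transpose_aeval, hs.eq, ← h3]⟩

variable {F : Type*} [Field F] [Algebra O F] [IsFractionRing O F]

variable (F) in
/-- Extension of scalars from `𝒪` to a fraction field. -/
def extend (A : Matrix (Fin N) (Fin N) O) : Matrix (Fin N) (Fin N) F := A.map (algebraMap O F)

theorem extend_mul (A D : Matrix (Fin N) (Fin N) O) : extend F (A * D) = extend F A * extend F D := Matrix.map_mul

theorem extend_one : extend F (1 : Matrix (Fin N) (Fin N) O) = 1 :=
  Matrix.map_one (algebraMap O F) (map_zero _) (map_one _)

theorem extend_neg (A : Matrix (Fin N) (Fin N) O) : extend F (-A) = -extend F A := by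
  ext i j; simp [extend]

theorem extend_transpose (A : Matrix (Fin N) (Fin N) O) : extend F A.transpose = (extend F A).transpose := rfl

theorem extend_injective : Function.Injective (extend F : Matrix (Fin N) (Fin N) O → _) :=
  Matrix.map_injective (IsFractionRing.injective O F)

theorem extend_det (A : Matrix (Fin N) (Fin N) O) : (extend F A).det = algebraMap O F A.det :=
  ((algebraMap O F).map_det A).symm

theorem extend_mulVec (A : Matrix (Fin N) (Fin N) O) (y : Fin N → O) :
    (extend F A).mulVec (algebraMap O F ∘ y) = algebraMap O F ∘ (A.mulVec y) :=
  funext fun i => (RingHom.map_mulVec (algebraMap O F) A y i).symm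

theorem exists_extend {M : Matrix (Fin N) (Fin N) F} (h : ∀ i j, M i j ∈ (1 : Submodule O F)) :
    ∃ A, extend F A = M := by
  choose A hA using fun i j => Submodule.mem_one.1 (h i j)
  exact ⟨Matrix.of A, Matrix.ext hA⟩

/-- The length of the image of an endomorphism in a quotient is the rank of its reduction. -/
theorem relLen_range_sup_ker [Algebra O ℂ] (hC : Function.Surjective (algebraMap O ℂ))
    {M W : Type*} [AddCommGroup M] [Module O M] [AddCommGroup W] [Module ℂ W] [Module O W]
    [IsScalarTower O ℂ W] [FiniteDimensional ℂ W] (α : M →ₗ[O] M) {π : M →ₗ[O] W}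
    (hπ : Function.Surjective π) {β : Module.End ℂ W} (h : ∀ x, π (α x) = β (π x)) :
    relLen (LinearMap.ker π) (LinearMap.range α ⊔ LinearMap.ker π) =
      Module.finrank ℂ (LinearMap.range β) := by
  rw [relLen_sup, relLen]
  have h1 : (LinearMap.range α ⊓ LinearMap.ker π).submoduleOf (LinearMap.range α) =
      LinearMap.ker (π.domRestrict (LinearMap.range α)) := by
    ext x
    simp [Submodule.submoduleOf]
  have h2 : LinearMap.range (π.domRestrict (LinearMap.range α)) =
      (LinearMap.range β).restrictScalars O := by
    ext y
    constructor
    · rintro ⟨⟨_, x, rfl⟩, rfl⟩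
      exact ⟨π x, (h x).symm⟩
    · rintro ⟨w, rfl⟩
      obtain ⟨x, rfl⟩ := hπ w
      exact ⟨⟨α x, x, rfl⟩, h x⟩
  rw [h1, (LinearMap.quotKerEquivRange _).length_eq, h2]
  have h3 := Module.length_eq_of_surjective (R := ℂ) (S := O) (M := LinearMap.range β) hC
  exact h3.trans (Module.length_eq_finrank _ _)

/-- The columns of a matrix map `𝒪^N` to a lattice. -/
def columnMap (g : Matrix (Fin N) (Fin N) F) : (Fin N → O) →ₗ[O] (Fin N → F) :=
  (Matrix.toLin' g).restrictScalars O ∘ₗ (Algebra.linearMap O F).compLeft (Fin N)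

theorem columnMap_apply (g : Matrix (Fin N) (Fin N) F) (y : Fin N → O) :
    columnMap g y = g.mulVec (algebraMap O F ∘ y) := rfl

theorem columnMap_injective {g : Matrix (Fin N) (Fin N) F} (hg : IsUnit g) :
    Function.Injective (columnMap g) := by
  intro x y h
  have h1 := Matrix.mulVec_injective_iff_isUnit.2 hg h
  funext i
  exact IsFractionRing.injective O F (congrFun h1 i)

theorem columnMap_mul (g : Matrix (Fin N) (Fin N) F) (P : Matrix (Fin N) (Fin N) O)
    (y : Fin N → O) : columnMap (g * extend F P) y = columnMap g (P.mulVec y) := by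
  rw [columnMap_apply, columnMap_apply, ← Matrix.mulVec_mulVec, extend_mulVec]

theorem columnMap_conj {γ g : Matrix (Fin N) (Fin N) F} {A : Matrix (Fin N) (Fin N) O}
    (h : γ * g = g * extend F A) (y : Fin N → O) :
    Matrix.toLin' γ (columnMap g y) = columnMap g (A.mulVec y) := by
  rw [← columnMap_mul, ← h, Matrix.toLin'_apply, columnMap_apply, columnMap_apply,
    Matrix.mulVec_mulVec]

/-- The ranks of the powers of the reduction, in terms of lengths of lattices. -/
theorem finrank_range_pow_modT {γ g : Matrix (Fin N) (Fin N) F} (hg : IsUnit g)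
    {A : Matrix (Fin N) (Fin N) O} (h : γ * g = g * extend F A) {Λ : Submodule O (Fin N → F)}
    (hΛ : Λ = LinearMap.range (columnMap g)) (j : ℕ) :
    rankLen (F := F) (Matrix.toLin' γ) Λ Λ j =
      Module.finrank ℂ (LinearMap.range (Matrix.toLin' (modT A) ^ j)) := by
  let _ : Algebra O ℂ := (PowerSeries.constantCoeff (R := ℂ)).toAlgebra
  have hC : ∀ a : O, algebraMap O ℂ a = PowerSeries.constantCoeff a := fun _ => rfl
  have hCs : Function.Surjective (algebraMap O ℂ) := fun c => ⟨PowerSeries.C c, by simp [hC]⟩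
  let π : (Fin N → O) →ₗ[O] (Fin N → ℂ) := (Algebra.linearMap O ℂ).compLeft (Fin N)
  have hπa : ∀ y, π y = algebraMap O ℂ ∘ y := fun _ => rfl
  have hπ : Function.Surjective π := by
    intro z
    choose y hy using fun i => hCs (z i)
    exact ⟨y, funext hy⟩
  have hpow : ∀ (j : ℕ) (y : Fin N → O), (Matrix.toLin' γ ^ j) (columnMap g y) =
      columnMap g ((Matrix.toLin' A ^ j) y) := by
    intro j
    induction j with
    | zero => intro y; rfl
    | succ j ih =>
      intro y
      rw [pow_succ, pow_succ, Module.End.mul_apply, Module.End.mul_apply, columnMap_conj h, ih]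
      rfl
  have hred : ∀ (j : ℕ) (y : Fin N → O), π ((Matrix.toLin' A ^ j) y) =
      (Matrix.toLin' (modT A) ^ j) (π y) := by
    intro j
    induction j with
    | zero => intro y; rfl
    | succ j ih =>
      intro y
      rw [pow_succ, pow_succ, Module.End.mul_apply, Module.End.mul_apply, ih]
      congr 1
      rw [Matrix.toLin'_apply, Matrix.toLin'_apply, hπa, hπa]
      exact funext (RingHom.map_mulVec (algebraMap O ℂ) A y)
  rw [← relLen_range_sup_ker hCs (Matrix.toLin' A ^ j) hπ (hred j), rankLen]
  have hΛ' : Λ = (⊤ : Submodule O (Fin N → O)).map (columnMap g) := by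
    rw [hΛ, LinearMap.range_eq_map]
  have h1 : tS F Λ = (LinearMap.ker π).map (columnMap g) := by
    rw [hΛ]
    ext x
    constructor
    · rintro ⟨_, ⟨y, rfl⟩, rfl⟩
      refine ⟨(PowerSeries.X : O) • y, ?_, ?_⟩
      · change π _ = 0
        rw [hπa]
        ext i
        simp [hC]
      · rw [map_smul]
        change _ = tEnd F _ (columnMap g y)
        rw [tEnd_apply, τ_smul]
    · rintro ⟨y, hy, rfl⟩
      have h2 : ∀ i, ∃ z : O, y i = PowerSeries.X * z := fun i =>
        PowerSeries.X_dvd_iff.2 (congrFun (show π y = 0 from hy) i)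
      choose z hz using h2
      refine ⟨columnMap g z, ⟨z, rfl⟩, ?_⟩
      change tEnd F _ (columnMap g z) = _
      rw [tEnd_apply, τ_smul, ← map_smul]
      congr 1
      funext i
      exact (hz i).symm
  have h2 : act (Matrix.toLin' γ ^ j) Λ =
      (LinearMap.range (Matrix.toLin' A ^ j)).map (columnMap g) := by
    rw [hΛ]
    ext x
    constructor
    · rintro ⟨_, ⟨y, rfl⟩, rfl⟩
      exact ⟨(Matrix.toLin' A ^ j) y, ⟨y, rfl⟩, (hpow j y).symm⟩
    · rintro ⟨_, ⟨y, rfl⟩, rfl⟩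
      exact ⟨columnMap g y, ⟨y, rfl⟩, hpow j y⟩
  rw [h1, h2, ← Submodule.map_sup, relLen_map _ (columnMap_injective hg).injOn le_sup_right]

end Matrices

/-! ### From self-dual lattices to group elements. -/

section Reduction

variable {F : Type*} [Field F] [Algebra O F] [IsFractionRing O F] {N : ℕ}

theorem columnMap_of (c : Fin N → Fin N → F) (y : Fin N → O) :
    columnMap (Matrix.of fun i j => c j i) y = ∑ i, y i • c i := by
  rw [columnMap_apply]
  ext i
  rw [Matrix.mulVec, dotProduct, Finset.sum_apply]
  refine Finset.sum_congr rfl fun j _ => ?_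
  rw [Pi.smul_apply, Algebra.smul_def, mul_comm]
  rfl

theorem IsLat.exists_basis_top {V : Type*} [AddCommGroup V] [Module F V] [Module O V]
    [IsScalarTower O F V] {Λ : Submodule O V} (h : IsLat (⊤ : Submodule F V) Λ) :
    ∃ (N : ℕ) (c : Module.Basis (Fin N) F V), Λ = Submodule.span O (Set.range c) := by
  obtain ⟨N, b, hb⟩ := h.exists_basis
  refine ⟨N, b.map Submodule.topEquiv, ?_⟩
  rw [hb, Submodule.map_span, ← Set.range_comp]
  rfl

theorem IsLat.exists_columnMap {Λ : Submodule O (Fin N → F)}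
    (h : IsLat (⊤ : Submodule F (Fin N → F)) Λ) :
    ∃ g : Matrix (Fin N) (Fin N) F, IsUnit g ∧ Λ = LinearMap.range (columnMap g) := by
  obtain ⟨N', c, hc⟩ := h.exists_basis_top
  have hN : N' = N := by
    have h1 := Module.finrank_eq_card_basis c
    rw [Module.finrank_fin_fun, Fintype.card_fin] at h1
    exact h1.symm
  subst hN
  refine ⟨Matrix.of fun i j => c j i,
    Matrix.linearIndependent_cols_iff_isUnit.1 c.linearIndependent, ?_⟩
  rw [hc]
  ext x
  rw [Submodule.mem_span_range_iff_exists_fun, LinearMap.mem_range]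
  exact exists_congr fun y => by rw [columnMap_of]

theorem mulVec_single_mem {g : Matrix (Fin N) (Fin N) F} (j : Fin N) :
    g.mulVec (Pi.single j 1) ∈ LinearMap.range (columnMap g) := by
  refine ⟨Pi.single j 1, ?_⟩
  rw [columnMap_apply]
  congr 1
  ext i
  by_cases hi : i = j
  · subst hi; simp
  · simp [hi]

/-- A matrix whose columns lie in the lattice of `g` is `g` times an integral matrix. -/
theorem exists_mul_extend {g D : Matrix (Fin N) (Fin N) F}
    (h : ∀ j, D.mulVec (Pi.single j 1) ∈ LinearMap.range (columnMap g)) :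
    ∃ A : Matrix (Fin N) (Fin N) O, D = g * extend F A := by
  choose y hy using h
  refine ⟨Matrix.of fun i j => y j i, ?_⟩
  ext i j
  have h1 := congrFun (hy j) i
  rw [Matrix.mulVec_single_one] at h1
  exact h1.symm

theorem det_eq_one_or {J : Matrix (Fin N) (Fin N) F} (hJ : J.det ≠ 0) {g : Matrix (Fin N) (Fin N) F}
    (h : g.transpose * J * g = J) : g.det = 1 ∨ g.det = -1 := by
  have h1 := congrArg Matrix.det h
  rw [Matrix.det_mul, Matrix.det_mul, Matrix.det_transpose] at h1
  have h2 : g.det * g.det = 1 := mul_right_cancel₀ hJ (by linear_combination h1)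
  exact mul_self_eq_one_iff.1 h2

/-- A self-dual stable lattice gives a reduction. -/
theorem exists_reduction {n : ℕ} {J : Matrix (Fin (2 * n + 1)) (Fin (2 * n + 1)) O}
    (hJ : J.IsSymm) (hJu : IsUnit J.det) {γ : Matrix (Fin (2 * n + 1)) (Fin (2 * n + 1)) F}
    (hγ : γ.transpose * extend F J = -(extend F J * γ)) {d : Multiset ℕ}
    {Λ : Submodule O (Fin (2 * n + 1) → F)}
    (hΛ : IsClosedLat (Matrix.toBilin' (extend F J)) (Matrix.toLin' γ) ⊤ d Λ) :
    ∃ g : Matrix (Fin (2 * n + 1)) (Fin (2 * n + 1)) F,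
      g.transpose * extend F J * g = extend F J ∧ g.det = 1 ∧
      ∃ A : Matrix (Fin (2 * n + 1)) (Fin (2 * n + 1)) O,
        A.transpose * J = -(J * A) ∧ g⁻¹ * γ * g = extend F A ∧
        HasJordanType (modT A) (d.filter (0 < ·)) := by
  obtain ⟨h, hh, hΛh⟩ := hΛ.lat.exists_columnMap
  have hJK : (extend F J).det ≠ 0 := by
    rw [extend_det]; exact (hJu.map (algebraMap O F)).ne_zero
  have hform : ∀ x y, Matrix.toBilin' (extend F J) x y = dotProduct x ((extend F J).mulVec y) :=
    fun x y => Matrix.toBilin'_apply' _ _ _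
  have hent : ∀ (M : Matrix (Fin (2 * n + 1)) (Fin (2 * n + 1)) F) (x y : Fin (2 * n + 1) → F),
      Matrix.toBilin' (extend F J) (h.mulVec x) (M.mulVec y) =
        dotProduct x ((h.transpose * extend F J * M).mulVec y) := by
    intro M x y
    rw [hform, ← Matrix.mulVec_mulVec, ← Matrix.mulVec_mulVec,
      Matrix.dotProduct_mulVec x h.transpose, Matrix.vecMul_transpose]
  have hunit : IsUnit h.det := (Matrix.isUnit_iff_isUnit_det h).1 hh
  set G := h.transpose * extend F J * h with hGdef
  clear_value G
  obtain ⟨G₀, hG₀⟩ : ∃ G₀, extend F G₀ = G := by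
    refine exists_extend fun i j => ?_
    have h1 : h.mulVec (Pi.single i 1) ∈ dualIn (Matrix.toBilin' (extend F J)) ⊤ Λ := by
      rw [hΛ.dual, hΛh]; exact mulVec_single_mem i
    have h2 := (mem_dualIn.1 h1).1 (h.mulVec (Pi.single j 1)) (by
      rw [hΛh]; exact mulVec_single_mem j)
    rw [hent, ← hGdef] at h2
    simpa using h2
  have hGdet : IsUnit G.det := by
    rw [hGdef, Matrix.det_mul, Matrix.det_mul, Matrix.det_transpose]
    exact (hunit.mul (isUnit_iff_ne_zero.2 hJK)).mul hunit
  have hG₀s : G₀.IsSymm := by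
    refine extend_injective (F := F) ?_
    rw [extend_transpose, hG₀, hGdef, Matrix.transpose_mul, Matrix.transpose_mul,
      Matrix.transpose_transpose, ← extend_transpose, hJ.eq, mul_assoc]
  have hcomm : ∀ x y, Matrix.toBilin' (extend F J) x y = Matrix.toBilin' (extend F J) y x := by
    intro x y
    rw [hform, hform, Matrix.dotProduct_mulVec, ← Matrix.mulVec_transpose,
      ← extend_transpose, hJ.eq, dotProduct_comm]
  -- The columns of `h G⁻¹` form the dual basis. Self-duality puts them in `Λ`, so the inverse of
  -- the Gram matrix is integral and the Gram matrix is unimodular.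
  obtain ⟨H, hH⟩ : ∃ H : Matrix (Fin (2 * n + 1)) (Fin (2 * n + 1)) O,
      h * G⁻¹ = h * extend F H := by
    refine exists_mul_extend fun j => ?_
    rw [← hΛh, ← hΛ.dual]
    refine mem_dualIn.2 ⟨fun x hx => ?_, trivial⟩
    rw [hΛh] at hx
    obtain ⟨y, rfl⟩ := hx
    rw [hcomm, columnMap_apply, hent, ← mul_assoc, ← hGdef,
      Matrix.mul_nonsing_inv _ hGdet, Matrix.one_mulVec, dotProduct_single, mul_one]
    exact algebraMap_mem_one _
  have hG₀u : IsUnit G₀.det := by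
    have h1 : G⁻¹ = extend F H := by
      have := congrArg (h⁻¹ * ·) hH
      simpa only [Matrix.nonsing_inv_mul_cancel_left _ _ hunit] using this
    have h2 : G₀ * H = 1 := by
      refine extend_injective (F := F) ?_
      rw [extend_mul, hG₀, ← h1, extend_one, Matrix.mul_nonsing_inv _ hGdet]
    exact Matrix.isUnit_det_of_right_inverse h2
  obtain ⟨A₀, hA₀⟩ : ∃ A₀, γ * h = h * extend F A₀ := by
    refine exists_mul_extend fun j => ?_
    rw [← hΛh, ← Matrix.mulVec_mulVec]
    refine hΛ.stable (mem_act_of_mem (φ := Matrix.toLin' γ) ?_)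
    rw [hΛh]
    exact mulVec_single_mem j
  obtain ⟨w, hw⟩ := exists_transpose_mul_self hG₀s hG₀u
  obtain ⟨u, hu⟩ := exists_transpose_mul_self hJ hJu
  have hwu : IsUnit w.det := by
    rw [← hw, Matrix.det_mul] at hG₀u
    exact isUnit_of_mul_isUnit_right hG₀u
  have huu : IsUnit u.det := by
    rw [← hu, Matrix.det_mul] at hJu
    exact isUnit_of_mul_isUnit_right hJu
  obtain ⟨P, hPu, hP, hPdet⟩ : ∃ P : Matrix (Fin (2 * n + 1)) (Fin (2 * n + 1)) O,
      IsUnit P.det ∧ P.transpose * G₀ * P = J ∧ (h * extend F P).det = 1 := by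
    -- Both Gram matrices are equivalent to the identity, through `w` and `u`; their quotient is the
    -- change of basis from one to the other.
    obtain ⟨Q, hwQ⟩ : ∃ Q, w * Q = u := ⟨w⁻¹ * u, Matrix.mul_nonsing_inv_cancel_left _ _ hwu⟩
    have hQ : Q.transpose * G₀ * Q = J := by
      rw [← hu, ← hwQ, ← hw, Matrix.transpose_mul]
      simp only [mul_assoc]
    have hQu : IsUnit Q.det := by
      rw [← hwQ, Matrix.det_mul] at huu
      exact isUnit_of_mul_isUnit_right huu
    have hdet : (h * extend F Q).det = 1 ∨ (h * extend F Q).det = -1 := by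
      refine det_eq_one_or hJK ?_
      have h1 := congrArg (extend F) hQ
      rw [extend_mul, extend_mul, hG₀, hGdef, extend_transpose] at h1
      conv_rhs => rw [← h1]
      rw [Matrix.transpose_mul]
      simp only [mul_assoc]
    rcases hdet with hdet | hdet
    · exact ⟨Q, hQu, hQ, hdet⟩
    -- In odd dimension `-1` is orthogonal of determinant `-1` and preserves every lattice.
    · have hodd : ((-1) ^ (2 * n + 1) : O) = -1 := by rw [pow_succ, pow_mul]; simp
      have hodd' : ((-1) ^ (2 * n + 1) : F) = -1 := by rw [pow_succ, pow_mul]; simp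
      refine ⟨-Q, ?_, ?_, ?_⟩
      · rw [Matrix.det_neg, Fintype.card_fin, hodd]; simpa using hQu
      · rw [Matrix.transpose_neg, neg_mul, neg_mul_neg]; exact hQ
      · rw [extend_neg, mul_neg, Matrix.det_neg, Fintype.card_fin, hodd', hdet]; ring
  set g := h * extend F P with hg
  clear_value g
  have hgJ : g.transpose * extend F J * g = extend F J := by
    have h1 := congrArg (extend F) hP
    rw [extend_mul, extend_mul, hG₀, hGdef, extend_transpose] at h1
    conv_rhs => rw [← h1]
    rw [hg, Matrix.transpose_mul]
    simp only [mul_assoc]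
  have hgu : IsUnit g := by rw [Matrix.isUnit_iff_isUnit_det, hPdet]; exact isUnit_one
  have hgu' : IsUnit g.det := by rw [hPdet]; exact isUnit_one
  let A := P⁻¹ * A₀ * P
  have hA : γ * g = g * extend F A := by
    have h1 : P * A = A₀ * P := by
      change P * (P⁻¹ * A₀ * P) = _
      rw [mul_assoc, Matrix.mul_nonsing_inv_cancel_left _ _ hPu]
    rw [hg, ← mul_assoc, hA₀, mul_assoc, mul_assoc, ← extend_mul, ← extend_mul, h1]
  have hΛg : Λ = LinearMap.range (columnMap g) := by
    rw [hΛh]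
    apply le_antisymm
    · rintro _ ⟨y, rfl⟩
      refine ⟨P⁻¹.mulVec y, ?_⟩
      rw [hg, columnMap_mul, Matrix.mulVec_mulVec, Matrix.mul_nonsing_inv _ hPu, Matrix.one_mulVec]
    · rintro _ ⟨y, rfl⟩
      exact ⟨P.mulVec y, by rw [hg, columnMap_mul]⟩
  refine ⟨g, hgJ, hPdet, A, ?_, ?_, ?_⟩
  · refine extend_injective (F := F) ?_
    rw [extend_neg, extend_mul, extend_mul, extend_transpose]
    calc (extend F A).transpose * extend F J
        = (g * extend F A).transpose * extend F J * g := by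
          conv_lhs => rw [← hgJ]
          rw [Matrix.transpose_mul]; simp only [mul_assoc]
      _ = g.transpose * (γ.transpose * extend F J) * g := by
          rw [← hA, Matrix.transpose_mul]; simp only [mul_assoc]
      _ = -(g.transpose * extend F J * (γ * g)) := by
          rw [hγ]; simp only [mul_assoc, neg_mul, mul_neg]
      _ = -(extend F J * extend F A) := by rw [hA, ← mul_assoc, hgJ]
  · rw [mul_assoc, hA, Matrix.nonsing_inv_mul_cancel_left _ _ hgu']
  · refine hasJordanType_of_finrank fun j => ?_
    have h1 := finrank_range_pow_modT hgu hA hΛg j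
    rw [hΛ.rank j] at h1
    exact_mod_cast h1.symm

end Reduction

/-! ### The reductions for matrices with given characteristic polynomial. -/

section Main

variable {F : Type*} [Field F] [Algebra O F] [IsFractionRing O F] {N : ℕ}

theorem mem_range_columnMap_one {x : Fin N → F} :
    x ∈ LinearMap.range (columnMap (1 : Matrix (Fin N) (Fin N) F)) ↔
      ∃ y : Fin N → O, x = algebraMap O F ∘ y := by
  refine exists_congr fun y => ?_
  rw [columnMap_apply, Matrix.one_mulVec, eq_comm]

theorem isLat_range_columnMap_one :
    IsLat (⊤ : Submodule F (Fin N → F))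
      (LinearMap.range (columnMap (1 : Matrix (Fin N) (Fin N) F))) where
  fg := by
    rw [LinearMap.range_eq_map]
    exact Module.Finite.fg_top.map _
  span_eq := by
    rw [eq_top_iff, ← (Pi.basisFun F (Fin N)).span_eq, Submodule.span_le]
    rintro _ ⟨j, rfl⟩
    refine Submodule.subset_span ?_
    have h1 := mulVec_single_mem (g := (1 : Matrix (Fin N) (Fin N) F)) j
    rw [Pi.basisFun_apply]
    rwa [Matrix.one_mulVec] at h1

theorem dualIn_range_columnMap_one {J : Matrix (Fin N) (Fin N) O} (hJ : J.IsSymm)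
    (hJu : IsUnit J.det) :
    dualIn (Matrix.toBilin' (extend F J)) ⊤
      (LinearMap.range (columnMap (1 : Matrix (Fin N) (Fin N) F))) =
      LinearMap.range (columnMap (1 : Matrix (Fin N) (Fin N) F)) := by
  ext x
  rw [mem_dualIn]
  constructor
  · rintro ⟨h, -⟩
    have h1 : ∀ j, ∃ a : O, algebraMap O F a = (extend F J).mulVec x j := by
      intro j
      have h2 := h _ (mulVec_single_mem j)
      rw [Matrix.one_mulVec, Matrix.toBilin'_apply', Matrix.dotProduct_mulVec,
        dotProduct_single_one, ← Matrix.mulVec_transpose, ← extend_transpose, hJ.eq] at h2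
      exact Submodule.mem_one.1 h2
    choose y hy using h1
    refine mem_range_columnMap_one.2 ⟨J⁻¹.mulVec y, ?_⟩
    rw [← extend_mulVec, show algebraMap O F ∘ y = (extend F J).mulVec x from funext hy,
      Matrix.mulVec_mulVec, ← extend_mul, Matrix.nonsing_inv_mul _ hJu, extend_one,
      Matrix.one_mulVec]
  · intro hx
    refine ⟨fun z hz => ?_, trivial⟩
    obtain ⟨x, rfl⟩ := mem_range_columnMap_one.1 hx
    obtain ⟨z, rfl⟩ := mem_range_columnMap_one.1 hz
    rw [Matrix.toBilin'_apply', extend_mulVec, ← RingHom.map_dotProduct]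
    exact algebraMap_mem_one _

/-- The reductions, over any fraction field of `𝒪`. -/
theorem exists_reduction_of_charpoly {n : ℕ} {J : Matrix (Fin (2 * n + 1)) (Fin (2 * n + 1)) O}
    (hJ : J.IsSymm) (hJu : IsUnit J.det) {γ : Matrix (Fin (2 * n + 1)) (Fin (2 * n + 1)) F}
    (hγ : γ.transpose * extend F J = -(extend F J * γ))
    (hnil : ∀ e : ℕ, ∃ k, ∃ A, γ ^ k = extend F ((PowerSeries.X ^ e : O) • A))
    (hsep : γ.charpoly.Separable) {L : List O[X]}
    (hχ : γ.charpoly = X * L.prod.map (algebraMap O F)) (hL : ∀ p ∈ L, IsSingleSlope p)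
    (hsl : L.Pairwise fun p q => q.natDegree * ordConst p < p.natDegree * ordConst q)
    {sq : O[X] → Prop} (hsqr : (∀ p ∈ L, 0 < ordConst p) → ∀ p ∈ L, p.natDegree % ordConst p = 0 →
      Even (p.natDegree / ordConst p) → sq p → squareOwn p) :
    ∃ g : Matrix (Fin (2 * n + 1)) (Fin (2 * n + 1)) F,
      g.transpose * extend F J * g = extend F J ∧ g.det = 1 ∧
      ∃ A : Matrix (Fin (2 * n + 1)) (Fin (2 * n + 1)) O,
        A.transpose * J = -(J * A) ∧ g⁻¹ * γ * g = extend F A ∧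
        HasJordanType (modT A) (dB sq L) := by
  have hinf : Infinite F := by
    have := charZero_of_fraction F
    infer_instance
  have hJK : IsUnit (extend F J).det := by rw [extend_det]; exact hJu.map (algebraMap O F)
  set φ := Matrix.toLin' γ with hφ
  set B := Matrix.toBilin' (extend F J) with hBdef
  have hform : ∀ x y, B x y = dotProduct x ((extend F J).mulVec y) :=
    fun x y => Matrix.toBilin'_apply' _ _ _
  have hs : B.IsSymm := by
    refine ⟨fun x y => ?_⟩
    rw [hform, hform, Matrix.dotProduct_mulVec, ← Matrix.mulVec_transpose, ← extend_transpose,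
      hJ.eq, dotProduct_comm]
  have hB : NondegOn B ⊤ := by
    intro x _ hx
    have h1 : (extend F J).mulVec x = 0 := by
      funext j
      have h2 := hx (Pi.single j 1) trivial
      rwa [hform, Matrix.dotProduct_mulVec, dotProduct_single_one, ← Matrix.mulVec_transpose,
        ← extend_transpose, hJ.eq] at h2
    exact Matrix.eq_zero_of_mulVec_eq_zero hJK.ne_zero h1
  have hskew : ∀ x y, B (φ x) y = -B x (φ y) := by
    intro x y
    rw [hform, hform, hφ, Matrix.toLin'_apply, Matrix.toLin'_apply, ← Matrix.vecMul_transpose,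
      ← Matrix.dotProduct_mulVec, Matrix.mulVec_mulVec, Matrix.mulVec_mulVec, hγ,
      Matrix.neg_mulVec, dotProduct_neg]
  have haev : ∀ q : F[X], aeval φ q = Matrix.toLin' (aeval γ q) := fun q =>
    aeval_algHom_apply (Matrix.toLinAlgEquiv' (R := F) (n := Fin (2 * n + 1))).toAlgHom γ q
  have hdeg : γ.charpoly.natDegree = Module.finrank F (Fin (2 * n + 1) → F) := by
    rw [Matrix.charpoly_natDegree_eq_dim, Module.finrank_fin_fun, Fintype.card_fin]
  have hroot : aeval φ γ.charpoly = 0 := by rw [haev, Matrix.aeval_self_charpoly, map_zero]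
  obtain ⟨v, hv⟩ := exists_cyclic γ.charpoly_monic hdeg hroot fun q hq => by
    rw [haev, LinearEquiv.map_eq_zero_iff] at hq
    exact charpoly_dvd_of_aeval_eq_zero hsep hq
  have hcyc : IsCyclicFor φ γ.charpoly v := ⟨γ.charpoly_monic, hdeg, hroot, hv⟩
  have hsq := hsep.squarefree
  set Λ₀ := LinearMap.range (columnMap (1 : Matrix (Fin (2 * n + 1)) (Fin (2 * n + 1)) F)) with hΛ₀
  have hpow : ∀ k, φ ^ k = Matrix.toLin' (γ ^ k) := fun k => by rw [hφ, Matrix.toLin'_pow]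
  have hnil' : ∀ e, ∃ k, act (φ ^ k) Λ₀ ≤ act (tEnd F _ ^ e) Λ₀ := by
    intro e
    obtain ⟨k, A, hA⟩ := hnil e
    refine ⟨k, ?_⟩
    rw [act_le]
    intro x hx
    obtain ⟨y, rfl⟩ := mem_range_columnMap_one.1 hx
    refine ⟨algebraMap O F ∘ A.mulVec y, mem_range_columnMap_one.2 ⟨_, rfl⟩, ?_⟩
    change (tEnd F _ ^ e) _ = (φ ^ k) _
    rw [tEnd_pow_apply, hpow, Matrix.toLin'_apply, hA, extend_mulVec, Matrix.smul_mulVec]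
    funext i
    simp [τ]
  -- The complementary factor applied to the cyclic vector is non-zero and killed by `p(γ)`, so
  -- topological nilpotence forces `p(0)` into the maximal ideal.
  have hord : ∀ p ∈ L, 0 < ordConst p := by
    intro p hp
    obtain ⟨L₁, L₂, rfl⟩ := List.append_of_mem hp
    have hps := hL p hp
    set s := X * (L₁ ++ L₂).prod.map (algebraMap O F) with hsdef
    have hfac : γ.charpoly = p.map (algebraMap O F) * s := by
      rw [hχ, hsdef, List.prod_append, List.prod_cons, List.prod_append, Polynomial.map_mul,
        Polynomial.map_mul, Polynomial.map_mul]
      ring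
    have hpm : (p.map (algebraMap O F)).Monic := hps.1.map _
    have hsm : s.Monic := hpm.of_mul_monic_left (hfac ▸ γ.charpoly_monic)
    rw [← hps.not_isUnit_coeff_zero_iff]
    refine not_isUnit_coeff_zero isLat_range_columnMap_one hnil' hps.1 (w := aeval φ s v) ?_ ?_
    · intro h0
      refine hsm.ne_zero (hv s ?_ h0)
      rw [← hdeg, hfac, hpm.natDegree_mul hsm, hps.1.natDegree_map, degree_eq_natDegree hsm.ne_zero]
      exact_mod_cast Nat.lt_add_of_pos_left hps.2.1
    · rw [← Module.End.mul_apply, ← map_mul, ← hfac, hroot]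
      rfl
  rw [hχ] at hcyc hsq
  obtain ⟨Λ, hΛ⟩ := exists_isClosedLat hs hB hskew (hsqr hord) hcyc hsq hL hsl hord
    isLat_range_columnMap_one (dualIn_range_columnMap_one hJ hJu)
  rw [dB, ordConst_prod hL]
  exact exists_reduction hJ hJu hγ hΛ

/-- The test `sq` is arbitrary, subject only to implying that the factor's own graded polynomial is
a square: failure of the test leads to the exceptional partition, which is always realized. This
treats both versions of the rule at once. -/
theorem hasReduction_dB {n : ℕ} {J : Matrix (Fin (2 * n + 1)) (Fin (2 * n + 1)) O}
    (hJ : IsPerfectSymm J) {γ : Matrix (Fin (2 * n + 1)) (Fin (2 * n + 1)) K} (hγ : γ ∈ LHeart J)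
    {L : List O[X]} (hL : IsSlopeFactorization γ L) {sq : O[X] → Prop}
    (hsqr : (∀ p ∈ L, 0 < ordConst p) → ∀ p ∈ L, p.natDegree % ordConst p = 0 →
      Even (p.natDegree / ordConst p) → sq p → squareOwn p) :
    HasReduction J γ (dB sq L) := by
  have hskew : γ.transpose * extend K J = -(extend K J * γ) := by
    have h1 := hγ.1
    rw [mem_skewAdjointMatricesLieSubalgebra, mem_skewAdjointMatricesSubmodule] at h1
    have h2 : γ.transpose * toK J = toK J * (-γ) := h1
    rw [Matrix.mul_neg] at h2
    exact h2
  obtain ⟨g, hg, hdet, A, hA, hgA, hJd⟩ := exists_reduction_of_charpoly hJ.1 hJ.2 hskew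
    (fun e => (hγ.2.1 e).imp fun k hk => hk k le_rfl) hγ.2.2 hL.1 hL.2.1 hL.2.2 hsqr
  refine ⟨g, ⟨hg, hdet⟩, A, ?_, hgA, hJd⟩
  rw [mem_skewAdjointMatricesLieSubalgebra, mem_skewAdjointMatricesSubmodule]
  have h1 : A.transpose * J = J * (-A) := by rw [hA, Matrix.mul_neg]
  exact h1

end Main

end SOOdd

end

theorem mainTheorem5 (n : ℕ)
    (J : Matrix (Fin (2 * n + 1)) (Fin (2 * n + 1)) SOOdd.O) (hJ : SOOdd.IsPerfectSymm J)
    (γ : Matrix (Fin (2 * n + 1)) (Fin (2 * n + 1)) SOOdd.K) (hγ : γ ∈ SOOdd.LHeart J)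
    (f : List (Polynomial SOOdd.O)) (hf : SOOdd.IsSlopeFactorization γ f) :
    SOOdd.HasReduction J γ (SOOdd.dB (SOOdd.squareWhole f) f) ∧
      SOOdd.HasReduction J γ (SOOdd.dB SOOdd.squareOwn f) :=
  -- For the test on the whole collection the required implication is the comparison of graded
  -- polynomials; for the test on the factor it is trivial.
  ⟨SOOdd.hasReduction_dB hJ hγ hf fun hord _ hp hmod heven h =>
      SOOdd.squareOwn_of_squareWhole hf.2.1 hf.2.2 hord hp hmod heven h,
    SOOdd.hasReduction_dB hJ hγ hf fun _ _ _ _ _ h => h⟩
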